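/- Let $d\in\{3,4\}$, let $p\cdot q$ be the Minkowski product of signature $(+,-,\dots,-)$ on $\mathbb R^d$, let $\mathcal L_+^\uparrow$ be the proper orthochronous Lorentz group, $\mathcal L_+^\downarrow$ the set of Lorentz transformations of determinant $1$ that reverse the time direction, and $j_0\in\mathcal L_+^\downarrow$ the reflection that inverts the signs of $x^0$ and $x^1$. Let $m\ge 0$, $H_m^+=\{p: p\cdot p=m^2,\ p_0>0\}$ with its Lorentz invariant measure $d\mu$, let $\bar p\in H_m^+$ with $-j_0\bar p=\bar p$, and let $G=\{\Lambda\in\mathcal L_+^\uparrow:\Lambda\bar p=\bar p\}$ be the little group. Let $V$ be a strongly continuous irreducible unitary representation of $G$ on a Hilbert space $\mathfrak h$; if $m=0$ and $d=4$, assume that $V$ is faithful. Let $\Gamma=\{q\in H_0^+: q\cdot\bar p=1\}$, let $\nu_\Gamma$ be the measure that the Lorentz invariant measure $\nu$ of $H_0^+$ induces on $\Gamma$ (that is, $d\nu=t^{d-3}\,dt\,d\nu_\Gamma$ in the coordinates $(t,q)\mapsto tq$, $t>0$, $q\in\Gamma$), and let $\mathcal H=L^2(\Gamma,d\nu_\Gamma)$.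 For $\operatorname{Re}\alpha=-(d-2)/2$ identify functions on $\Gamma$ with functions on $H_0^+$ that are homogeneous of degree $\alpha$, and let $U^\alpha$ be given on $\mathcal H$ by $$(U^\alpha(\Lambda)\psi)(q)=\psi(\Lambda^{-1}q),\ \Lambda\in\mathcal L_+^\uparrow,\qquad (U^\alpha(j)\psi)(q)=\overline{\psi(-j^{-1}q)},\ j\in\mathcal L_+^\downarrow ,$$ where $U^\alpha(j)$ maps functions of degree $\alpha$ to functions of degree $\bar\alpha$. The restriction of $U^\alpha$ to $G$ and $j_0$ does not depend on $\alpha$. i) There are a linear map $T$ from a dense subspace $\operatorname{dom}T$ of $\mathcal H$ onto a dense subspace of $\mathfrak h$ and an anti-unitary operator $V(j_0)$ on $\mathfrak h$, both independent of $\alpha$, such that for all $\alpha$ with $\operatorname{Re}\alpha=-(d-2)/2$: * $\operatorname{dom}T$ is invariant under $U^\alpha(\Lambda)$, $\Lambda\in G$, and under $U^\alpha(j_0)$, and on $\operatorname{dom}T$ one has $V(\Lambda)\,T=T\,U^\alpha(\Lambda)$ for $\Lambda\in G$, and $V(j_0)\,T=T\,U^\alpha(j_0)$. * $V(j_0)^2=1$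 and $V(j_0)V(\Lambda)V(j_0)=V(j_0\Lambda j_0)$ for $\Lambda\in G$. * If $m>0$, then $V$ is a subrepresentation of $U^\alpha|_G$: $\operatorname{dom}T=\mathcal H$, and $T=\iota^*$ for an isometry $\iota:\mathfrak h\to\mathcal H$ with $\iota V(\Lambda)=U^\alpha(\Lambda)\iota$ for $\Lambda\in G$. * If $m=0$, then $V$ occurs in a direct integral decomposition of $U^\alpha|_G$: let $K=\mathbb R$ for $d=3$ and $K=(0,\infty)$ for $d=4$, with Lebesgue measure. There are irreducible strongly continuous unitary representations $V_k$, $k\in K$, of $G$ on $\mathfrak h$, with $k\mapsto V_k(\Lambda)x$ continuous for all $\Lambda\in G$ and $x\in\mathfrak h$, a $\kappa\in K$ with $V_\kappa=V$, and a unitary $W:\mathcal H\to L^2(K,dk;\mathfrak h)$ with $(WU^\alpha(\Lambda)\psi)(k)=V_k(\Lambda)(W\psi)(k)$ for all $\Lambda\in G$, $\psi\in\mathcal H$ and almost every $k$, such that for every $\psi\in\operatorname{dom}T$ the class $W\psi$ has a representative that is continuous at $\kappa$ and has the value $T\psi$ there. ii) Let $p\mapsto A_p$ be any Borel map from $H_m^+$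 to $\mathcal L_+^\uparrow$ with $A_p\bar p=p$ and $j_0A_pj_0=A_{-j_0p}$, and let $R(\Lambda,p)=A_p^{-1}\Lambda A_{\Lambda^{-1}p}\in G$. On $L^2(H_m^+,d\mu)\otimes\mathfrak h=L^2(H_m^+,d\mu;\mathfrak h)$ let $$(U(a,\Lambda)\psi)(p)=e^{ia\cdot p}\,V(R(\Lambda,p))\,\psi(\Lambda^{-1}p),\qquad (U(j_0)\psi)(p)=V(j_0)\,\psi(-j_0p),$$ and $U(j)=U(j_0)U(0,j_0j)$ for $j\in\mathcal L_+^\downarrow$. On $L^2(H_m^+,d\mu)$ let $(U_0(a,\Lambda)\phi)(p)=e^{ia\cdot p}\phi(\Lambda^{-1}p)$ and $(U_0(j)\phi)(p)=\overline{\phi(-j^{-1}p)}$. For $\operatorname{Re}\alpha=-(d-2)/2$ let $R^\alpha$ be the operator from $L^2(H_m^+,d\mu)\otimes\mathcal H=L^2(H_m^+,d\mu;\mathcal H)$ to $L^2(H_m^+,d\mu;\mathfrak h)$ given by $(R^\alpha\Phi)(p)=T\,U^\alpha(A_p^{-1})\,\Phi(p)$, so that $$\big(R^\alpha(\phi\otimes\varphi)\big)(p)=\phi(p)\,T\,U^\alpha(A_p^{-1})\varphi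 ,$$ with domain the set of all $\Phi$ for which the right-hand side is defined for almost every $p$ and belongs to $L^2(H_m^+,d\mu;\mathfrak h)$. Then the elementary tensors in $\operatorname{dom}R^\alpha$ span a dense subspace, and on $\operatorname{dom}R^\alpha$ (including that the operators on the right map $\operatorname{dom}R^\alpha$ to $\operatorname{dom}R^\alpha$ and to $\operatorname{dom}R^{\bar\alpha}$, respectively) $$U(a,\Lambda)\,R^\alpha=R^\alpha\,\big(U_0(a,\Lambda)\otimes U^\alpha(\Lambda)\big),\quad (a,\Lambda)\in\mathbb R^d\rtimes\mathcal L_+^\uparrow,\qquad U(j)\,R^\alpha=R^{\bar\alpha}\,\big(U_0(j)\otimes U^\alpha(j)\big),\quad j\in\mathcal L_+^\downarrow .$$ -/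

import Mathlib

open MeasureTheory Matrix ENNReal
open scoped ComplexConjugate

noncomputable section
namespace Wigner

/-- Minkowski space in spacetime dimension `d = n + 2`; coordinate `0` is the time coordinate.
Throughout, `n = d - 2` is the dimension of the cycles on the light cone. -/
abbrev Mink (n : ℕ) : Type := Fin (n + 2) → ℝ

/-- The Minkowski product with signature `(+,-,...,-)`. -/
def mdot {n : ℕ} (x y : Mink n) : ℝ :=
  x 0 * y 0 - ∑ i : Fin (n + 1), x i.succ * y i.succ

/-- The orthochronous Lorentz group (determinant `±1`): the linear maps that preserve the
Minkowski product and map the forward causal vectors to forward causal vectors. -/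
def orthochronous (n : ℕ) : Subgroup (GL (Fin (n + 2)) ℝ) where
  carrier := {g | (∀ x y : Mink n, mdot (g.1 *ᵥ x) (g.1 *ᵥ y) = mdot x y) ∧
    ∀ x : Mink n, 0 ≤ mdot x x → 0 < x 0 → 0 < (g.1 *ᵥ x) 0}
  one_mem' := by simp
  mul_mem' := by
    rintro a b ⟨ha, ha'⟩ ⟨hb, hb'⟩
    refine ⟨fun x y => ?_, fun x hx hx0 => ?_⟩
    · simp only [Units.val_mul, ← Matrix.mulVec_mulVec, ha, hb]
    · simp only [Units.val_mul, ← Matrix.mulVec_mulVec]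
      exact ha' _ (by rwa [hb]) (hb' x hx hx0)
  inv_mem' := by
    rintro a ⟨ha, ha'⟩
    have key : ∀ x : Mink n, a.1 *ᵥ (a⁻¹.1 *ᵥ x) = x := fun x => by
      rw [Matrix.mulVec_mulVec, ← Units.val_mul, mul_inv_cancel, Units.val_one, Matrix.one_mulVec]
    have hinv : ∀ x y : Mink n, mdot (a⁻¹.1 *ᵥ x) (a⁻¹.1 *ᵥ y) = mdot x y := fun x y => by
      rw [← ha, key, key]
    refine ⟨hinv, fun x hx hx0 => ?_⟩
    by_contra hneg
    have hneg := not_lt.mp hneg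
    set y := a⁻¹.1 *ᵥ x with hy
    have hyy : 0 ≤ mdot y y := by rw [hinv]; exact hx
    rcases hneg.lt_or_eq with h | h
    · have h1 := ha' (-y) (by simpa [mdot] using hyy) (by simpa using h)
      rw [Matrix.mulVec_neg, key] at h1
      simp at h1
      linarith
    · have h2 : ∑ i : Fin (n + 1), y i.succ * y i.succ ≤ 0 := by
        simp only [mdot, h] at hyy; linarith
      have h3 : ∀ i : Fin (n + 1), y i.succ = 0 := by
        intro i
        have := (Finset.sum_eq_zero_iff_of_nonneg (fun i _ => mul_self_nonneg (y i.succ))).1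
          (le_antisymm h2 (Finset.sum_nonneg fun i _ => mul_self_nonneg (y (Fin.succ i)))) i
          (Finset.mem_univ i)
        simpa using this
      have h4 : y = 0 := by
        funext i
        refine Fin.cases h h3 i
      have := key x
      rw [← hy, h4, Matrix.mulVec_zero] at this
      rw [← this] at hx0
      simp at hx0

/-- The mass hyperboloid `{p : p · p = m², p⁰ > 0}`; for `m = 0` the mantle of the forward
light cone. -/
abbrev MassShell (n : ℕ) (m : ℝ) : Type := {p : Mink n // mdot p p = m ^ 2 ∧ 0 < p 0}

/-- The energy `√(m² + |k|²)` of the spatial momentum `k`. -/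
def energy {n : ℕ} (m : ℝ) (k : Fin (n + 1) → ℝ) : ℝ := √(m ^ 2 + ∑ i, k i ^ 2)

/-- The point `(√(m² + |k|²), k)` of the mass shell with spatial momentum `k`. -/
def onShell {n : ℕ} (m : ℝ) (k : Fin (n + 1) → ℝ) : Mink n := Fin.cons (energy m k) k

/-- The Lorentz invariant measure `d^{d-1}k / p⁰` on the mass shell, as a measure on Minkowski
space. -/
def invMeasure (n : ℕ) (m : ℝ) : Measure (Mink n) :=
  ((volume : Measure (Fin (n + 1) → ℝ)).withDensity
    fun k => ENNReal.ofReal (energy m k)⁻¹).map (onShell m)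

lemma measurable_energy {n : ℕ} (m : ℝ) : Measurable (energy (n := n) m) := by
  unfold energy; fun_prop

lemma measurable_onShell {n : ℕ} (m : ℝ) : Measurable (onShell (n := n) m) := by
  refine measurable_pi_iff.2 fun i => ?_
  refine Fin.cases ?_ (fun j => ?_) i
  · simpa [onShell] using measurable_energy m
  · simpa [onShell] using measurable_pi_apply j

lemma lintegral_invMeasure {n : ℕ} (m : ℝ) {f : Mink n → ℝ≥0∞} (hf : Measurable f) :
    ∫⁻ p, f p ∂invMeasure n m =
      ∫⁻ k, ENNReal.ofReal (energy m k)⁻¹ * f (onShell m k) := by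
  rw [invMeasure, lintegral_map hf (measurable_onShell m)]
  exact lintegral_withDensity_eq_lintegral_mul _ (measurable_energy m).inv.ennreal_ofReal
      (hf.comp (measurable_onShell m))

lemma onShell_tail {n : ℕ} {m : ℝ} {p : Mink n} (h : mdot p p = m ^ 2) (h0 : 0 ≤ p 0) :
    onShell m (Fin.tail p) = p := by
  have : energy m (Fin.tail p) = p 0 := by
    rw [energy, Real.sqrt_eq_iff_eq_sq (by positivity) h0, ← h, mdot]
    simp only [Fin.tail, pow_two]; ring
  rw [onShell, this, Fin.cons_self_tail]

lemma mdot_onShell {n : ℕ} (m : ℝ) (k : Fin (n + 1) → ℝ) :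
    mdot (onShell m k) (onShell m k) = m ^ 2 := by
  simp only [mdot, onShell, Fin.cons_zero, Fin.cons_succ, energy]
  rw [Real.mul_self_sqrt (by positivity)]
  simp [pow_two]


/-- The diagonal of the Minkowski metric. -/
def signature (n : ℕ) : Fin (n + 2) → ℝ := Fin.cons 1 fun _ => -1

lemma mdot_eq_sum {n : ℕ} (x y : Mink n) : mdot x y = ∑ i, x i * (signature n i * y i) := by
  rw [Fin.sum_univ_succ]
  simp [mdot, signature, Finset.sum_neg_distrib, sub_eq_add_neg]

lemma transpose_mul_signature_mul {n : ℕ} {g : GL (Fin (n + 2)) ℝ} (hg : g ∈ orthochronous n) :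
    (g.1)ᵀ * (diagonal (signature n) * g.1) = diagonal (signature n) := by
  have hd : ∀ M : Matrix (Fin (n + 2)) (Fin (n + 2)) ℝ, ∀ i j,
      (M.transpose * (diagonal (signature n) * M)) i j =
        mdot (M *ᵥ (Pi.single i 1 : Mink n)) (M *ᵥ (Pi.single j 1 : Mink n)) := by
    intro M i j
    rw [Matrix.mul_apply]
    simp only [Matrix.diagonal_mul, Matrix.transpose_apply]
    simp [mdot_eq_sum]
  ext i j
  rw [hd, hg.1]
  have := hd 1 i j
  rw [Matrix.one_mulVec, Matrix.one_mulVec] at this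
  rw [Matrix.transpose_one, Matrix.one_mul, Matrix.mul_one] at this
  exact this.symm

lemma abs_det_eq_one {n : ℕ} {g : GL (Fin (n + 2)) ℝ} (hg : g ∈ orthochronous n) :
    |g.1.det| = 1 := by
  have h := congrArg Matrix.det (transpose_mul_signature_mul hg)
  rw [det_mul, det_mul, det_transpose] at h
  have h0 : (diagonal (signature n)).det ≠ 0 := by
    rw [det_diagonal, Finset.prod_ne_zero_iff]
    intro i _
    refine Fin.cases ?_ (fun j => ?_) i <;> simp [signature]
  have h1 : g.1.det ^ 2 = 1 := by
    refine mul_right_cancel₀ h0 ?_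
    linear_combination h
  rcases sq_eq_one_iff.1 h1 with h | h <;> simp [h]

lemma abs_det_minor {n : ℕ} {g : GL (Fin (n + 2)) ℝ} (hg : g ∈ orthochronous n)
    (u : Fin (n + 1) → ℝ) :
    |(Matrix.of fun i j : Fin (n + 1) => g.1 i.succ 0 * u j + g.1 i.succ j.succ).det| =
      |(g.1 *ᵥ (Fin.cons 1 u : Mink n)) 0| := by
  let N : (Fin (n + 1) → ℝ) → Matrix (Fin (n + 2)) (Fin (n + 2)) ℝ := fun u =>
    Matrix.of (Fin.cons (Fin.cons 1 u : Mink n) fun i => (Pi.single i.succ 1 : Mink n))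
  have hN : ∀ u, (N u).det = 1 := fun u => by
    rw [Matrix.det_of_isUpperTriangular]
    · rw [Fin.prod_univ_succ]; simp [N]
    · intro i j hij
      induction i using Fin.cases with
      | zero => exact absurd hij (Fin.not_lt_zero _)
      | succ i =>
        have : j ≠ i.succ := ne_of_lt hij
        simp [N, this]
  have hNN : N u * N (-u) = 1 := by
    ext i j
    induction i using Fin.cases with
    | zero =>
      induction j using Fin.cases with
      | zero => simp [N, Matrix.mul_apply, Fin.sum_univ_succ]
      | succ j =>
        simp [N, Matrix.mul_apply, Fin.sum_univ_succ, Pi.single_apply,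
          (Fin.succ_ne_zero j).symm]
    | succ i =>
      simp [N, Matrix.mul_apply, Pi.single_apply, Matrix.one_apply, eq_comm]
  have hadjN : (N u).adjugate = N (-u) := by
    have := congrArg (· * N (-u)) (adjugate_mul (N u))
    simpa [hN, Matrix.mul_assoc, hNN] using this
  have hadjg : g.1.adjugate = g.1.det •
      (diagonal (signature n) * ((g.1)ᵀ * diagonal (signature n))) := by
    have h1 : (diagonal (signature n) * ((g.1)ᵀ * diagonal (signature n))) * g.1 = 1 := by
      rw [Matrix.mul_assoc, Matrix.mul_assoc, transpose_mul_signature_mul hg, diagonal_mul_diagonal,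
        ← diagonal_one]
      congr 1
      funext i
      refine Fin.cases ?_ (fun j => ?_) i <;> simp [signature]
    have h2 := mul_eq_one_comm.1 h1
    have := congrArg (· * (diagonal (signature n) * ((g.1)ᵀ * diagonal (signature n))))
      (adjugate_mul g.1)
    simpa only [Matrix.mul_assoc, h2, Matrix.mul_one, Matrix.smul_mul, Matrix.one_mul] using this
  have hM : (Matrix.of fun i j : Fin (n + 1) => g.1 i.succ 0 * u j + g.1 i.succ j.succ) =
      (g.1 * N u).submatrix (Fin.succAbove 0) (Fin.succAbove 0) := by
    ext i j
    simp [N, Matrix.mul_apply, Fin.sum_univ_succ, Pi.single_apply]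
  have h := adjugate_fin_succ_eq_det_submatrix (g.1 * N u) 0 0
  rw [← hM, adjugate_mul_distrib, hadjN, hadjg] at h
  have h' := h.symm
  simp only [Fin.val_zero, add_zero, pow_zero, one_mul] at h'
  rw [h', Matrix.mul_smul, Matrix.smul_apply, smul_eq_mul, abs_mul, abs_det_eq_one hg, one_mul]
  congr 1
  rw [Matrix.mul_apply]
  simp only [diagonal_mul, Matrix.mul_diagonal, mulVec, dotProduct, transpose_apply]
  rw [Fin.sum_univ_succ, Fin.sum_univ_succ (n := n + 1)]
  simp [N, signature, mul_comm]

lemma energy_sq {n : ℕ} (m : ℝ) (k : Fin (n + 1) → ℝ) :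
    energy m k ^ 2 = m ^ 2 + ∑ i, k i ^ 2 := Real.sq_sqrt (by positivity)

/-- The measure `d^{d-1}k / p⁰` is Lorentz invariant. -/
lemma lintegral_invMeasure_mulVec {n : ℕ} {m : ℝ} {g : GL (Fin (n + 2)) ℝ}
    (hg : g ∈ orthochronous n) {f : Mink n → ℝ≥0∞} (hf : Measurable f) :
    ∫⁻ p, f (g.1 *ᵥ p) ∂invMeasure n m = ∫⁻ p, f p ∂invMeasure n m := by
  have hlin : Measurable fun p : Mink n => g.1 *ᵥ p :=
    (Continuous.matrix_mulVec continuous_const continuous_id).measurable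
  have hcomp := lintegral_invMeasure m (hf.comp hlin)
  simp only [Function.comp_def] at hcomp
  rw [lintegral_invMeasure m hf, hcomp]
  set S : Set (Fin (n + 1) → ℝ) := {k | 0 < energy m k} with hS
  have hSm : MeasurableSet S := measurableSet_lt measurable_const (measurable_energy m)
  have hsupp : ∀ F : Mink n → ℝ≥0∞,
      ∫⁻ k, ENNReal.ofReal (energy m k)⁻¹ * F (onShell m k) =
        ∫⁻ k in S, ENNReal.ofReal (energy m k)⁻¹ * F (onShell m k) := by
    intro F
    refine (setLIntegral_eq_of_support_subset ?_).symm
    intro k hk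
    by_contra hkS
    have : energy m k = 0 := le_antisymm (not_lt.1 hkS) (Real.sqrt_nonneg _)
    simp [this] at hk
  let φ : GL (Fin (n + 2)) ℝ → (Fin (n + 1) → ℝ) → (Fin (n + 1) → ℝ) :=
    fun g k => Fin.tail (g.1 *ᵥ onShell m k)
  have hφ : ∀ g ∈ orthochronous n, ∀ k ∈ S,
      onShell m (φ g k) = g.1 *ᵥ onShell m k ∧ φ g k ∈ S := by
    intro g hg k hk
    have h0 : 0 < (g.1 *ᵥ onShell m k) 0 :=
      hg.2 _ (by rw [mdot_onShell]; positivity) hk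
    have h1 : onShell m (φ g k) = g.1 *ᵥ onShell m k :=
      onShell_tail (by rw [hg.1, mdot_onShell]) h0.le
    refine ⟨h1, ?_⟩
    have := congrFun h1 0
    simp only [onShell, Fin.cons_zero] at this
    change 0 < energy m _
    rw [this]; exact h0
  have hφφ : ∀ g ∈ orthochronous n, ∀ k ∈ S, φ g⁻¹ (φ g k) = k := by
    intro g hg k hk
    simp only [φ] at *
    rw [(hφ g hg k hk).1, mulVec_mulVec, ← Units.val_mul, inv_mul_cancel, Units.val_one,
      one_mulVec]
    simp [onShell]
  have hinj : Set.InjOn (φ g) S := fun a ha b hb hab => by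
    rw [← hφφ g hg a ha, ← hφφ g hg b hb, hab]
  have himg : φ g '' S = S := by
    refine Set.Subset.antisymm (fun _ => ?_) fun k hk => ?_
    · rintro ⟨k, hk, rfl⟩
      exact (hφ g hg k hk).2
    · have hg' := inv_mem hg
      refine ⟨φ g⁻¹ k, (hφ _ hg' k hk).2, ?_⟩
      have := hφφ _ hg' k hk
      rwa [inv_inv] at this
  let M : (Fin (n + 1) → ℝ) → Matrix (Fin (n + 1)) (Fin (n + 1)) ℝ := fun k =>
    Matrix.of fun i j => g.1 i.succ 0 * (k j / energy m k) + g.1 i.succ j.succ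
  have hder : ∀ k ∈ S, HasFDerivWithinAt (φ g)
      (LinearMap.toContinuousLinearMap (Matrix.toLin' (M k))) S k := by
    intro k hk
    refine HasFDerivAt.hasFDerivWithinAt ?_
    have hpos : m ^ 2 + ∑ i, k i ^ 2 ≠ 0 := by
      rw [← energy_sq]; exact pow_ne_zero _ (ne_of_gt hk)
    have hen : HasFDerivAt (energy (n := n) m)
        ((1 / (2 * √(m ^ 2 + ∑ i, k i ^ 2))) •
          ∑ i, (2 * k i) • (ContinuousLinearMap.proj (R := ℝ) (φ := fun _ : Fin (n + 1) => ℝ) i)) k := by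
      refine HasFDerivAt.sqrt ?_ hpos
      refine HasFDerivAt.const_add _ ?_
      refine HasFDerivAt.fun_sum fun i _ => ?_
      have := (hasFDerivAt_apply (𝕜 := ℝ) i k).pow 2
      simpa using this
    rw [hasFDerivAt_pi']
    intro i
    have h1 : HasFDerivAt (fun k : Fin (n + 1) → ℝ => g.1 i.succ 0 * energy m k +
        ∑ j, g.1 i.succ j.succ * k j) _ k :=
      (hen.const_mul _).add (HasFDerivAt.fun_sum fun j _ =>
        (hasFDerivAt_apply (𝕜 := ℝ) j k).const_mul (g.1 i.succ j.succ))
    have h2 : (fun x => φ g x i) = fun k : Fin (n + 1) → ℝ => g.1 i.succ 0 * energy m k +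
        ∑ j, g.1 i.succ j.succ * k j := by
      funext k
      simp [φ, Fin.tail, mulVec, dotProduct, Fin.sum_univ_succ, onShell]
    rw [h2]
    refine h1.congr_fderiv ?_
    ext v
    have h3 : energy m k = √(m ^ 2 + ∑ i, k i ^ 2) := rfl
    rw [← h3]
    have h4 : energy m k ≠ 0 := ne_of_gt hk
    simp [M, mulVec, dotProduct, add_mul, Finset.sum_add_distrib, Finset.mul_sum]
    refine Finset.sum_congr rfl fun j _ => ?_
    field_simp
  rw [hsupp f, hsupp (fun p => f (g.1 *ᵥ p))]
  conv_rhs => rw [← himg]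
  rw [lintegral_image_eq_lintegral_abs_det_fderiv_mul _ hSm hder hinj]
  refine setLIntegral_congr_fun hSm fun k hk => ?_
  have hpos : 0 < energy m k := hk
  have hpos' : 0 < energy m (φ g k) := (hφ g hg k hk).2
  have hdet : |(LinearMap.toContinuousLinearMap (Matrix.toLin' (M k))).det| =
      energy m (φ g k) / energy m k := by
    have e1 : (LinearMap.toContinuousLinearMap (Matrix.toLin' (M k))).det = (M k).det := by
      rw [ContinuousLinearMap.det]; simp
    rw [e1]
    have e2 := abs_det_minor hg fun j => k j / energy m k
    rw [show (M k).det = _ from rfl, e2]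
    have e3 : (Fin.cons 1 fun j => k j / energy m k : Mink n) = (energy m k)⁻¹ • onShell m k := by
      funext i
      refine Fin.cases ?_ (fun j => ?_) i
      · simp [onShell, hpos.ne']
      · simp [onShell, div_eq_inv_mul]
    rw [e3, mulVec_smul, ← (hφ g hg k hk).1]
    simp only [Pi.smul_apply, onShell, Fin.cons_zero, smul_eq_mul]
    rw [abs_of_pos (by positivity), div_eq_inv_mul]
  simp only [hdet]
  rw [(hφ g hg k hk).1, ← mul_assoc, ← ENNReal.ofReal_mul (by positivity)]
  congr 2
  field_simp

lemma measurable_mulVec {n : ℕ} (g : Matrix (Fin (n + 2)) (Fin (n + 2)) ℝ) :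
    Measurable fun p : Mink n => g *ᵥ p :=
  (Continuous.matrix_mulVec continuous_const continuous_id).measurable

lemma measurable_mdot {n : ℕ} (v : Mink n) : Measurable (mdot v) := by
  unfold mdot; fun_prop

lemma mdot_smul {n : ℕ} (v q : Mink n) (t : ℝ) : mdot v (t • q) = t * mdot v q := by
  simp only [mdot, Pi.smul_apply, smul_eq_mul, mul_sub, Finset.mul_sum]
  congr 1
  · ring
  · exact Finset.sum_congr rfl fun i _ => by ring

/-- The point `q / (v · q)` of the cycle `{q ∈ H₀⁺ : v · q = 1}` on the ray of `q`. -/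
def toCycle {n : ℕ} (v q : Mink n) : Mink n := (mdot v q)⁻¹ • q

lemma measurable_toCycle {n : ℕ} (v : Mink n) : Measurable (toCycle v) :=
  (measurable_mdot v).inv.smul measurable_id

/-- The restriction of the invariant measure `ν` of the light cone to the cycle
`Γ_v = {q ∈ H₀⁺ : v · q = 1}`, i.e. the measure `dν_Γ` with `dν = t^{n-1} dt dν_Γ` in the polar
coordinates `(t, q) ↦ t q`; explicitly `ν_Γ(B) = n ν({t q : q ∈ B, 0 < t ≤ 1})`. -/
def cycleMeasure {n : ℕ} (v : Mink n) : Measure (Mink n) :=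
  (n : ℝ≥0∞) • ((invMeasure n 0).restrict {q | 0 < mdot v q ∧ mdot v q ≤ 1}).map (toCycle v)

instance {n : ℕ} (m : ℝ) : SFinite (invMeasure n m) := by
  unfold invMeasure; infer_instance

lemma lintegral_invMeasure_smul {n : ℕ} {t : ℝ} (ht : 0 < t) {f : Mink n → ℝ≥0∞}
    (hf : Measurable f) :
    ∫⁻ p, f p ∂invMeasure n 0 = ENNReal.ofReal (t ^ n) * ∫⁻ p, f (t • p) ∂invMeasure n 0 := by
  have hf' : Measurable fun p : Mink n => f (t • p) := hf.comp (measurable_const_smul t)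
  rw [lintegral_invMeasure 0 hf, lintegral_invMeasure 0 hf']
  have he : ∀ k : Fin (n + 1) → ℝ, energy 0 (t • k) = t * energy 0 k := fun k => by
    simp only [energy, Pi.smul_apply, smul_eq_mul, mul_pow, ← Finset.mul_sum, ne_eq,
      OfNat.ofNat_ne_zero, not_false_eq_true, zero_pow, zero_add]
    rw [Real.sqrt_mul (by positivity), Real.sqrt_sq ht.le]
  have ho : ∀ k : Fin (n + 1) → ℝ, onShell 0 (t • k) = t • onShell 0 k := fun k => by
    funext i
    refine Fin.cases ?_ (fun j => ?_) i
    · simp [onShell, he]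
    · simp [onShell]
  set F : (Fin (n + 1) → ℝ) → ℝ≥0∞ := fun k => ENNReal.ofReal (energy 0 k)⁻¹ * f (onShell 0 k)
  have hF : Measurable F :=
    (measurable_energy 0).inv.ennreal_ofReal.mul (hf.comp (measurable_onShell 0))
  have hvol : ∫⁻ k, F k = ENNReal.ofReal (t ^ (n + 1)) * ∫⁻ k, F (t • k) := by
    have h1 := Measure.map_addHaar_smul (volume : Measure (Fin (n + 1) → ℝ)) ht.ne'
    have h2 : ∫⁻ k, F (t • k) =
        ∫⁻ k, F k ∂(Measure.map (t • ·) (volume : Measure (Fin (n + 1) → ℝ))) :=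
      (lintegral_map hF (measurable_const_smul t)).symm
    rw [h2, h1, lintegral_smul_measure, smul_eq_mul, ← mul_assoc, ← ENNReal.ofReal_mul
      (by positivity), Module.finrank_fin_fun, abs_of_pos (by positivity),
      mul_inv_cancel₀ (by positivity), ENNReal.ofReal_one, one_mul]
  rw [hvol, ← lintegral_const_mul' _ _ ENNReal.ofReal_ne_top,
    ← lintegral_const_mul' _ _ ENNReal.ofReal_ne_top]
  refine lintegral_congr fun k => ?_
  simp only [F, he, ho]
  rw [← mul_assoc, ← mul_assoc, ← ENNReal.ofReal_mul (by positivity),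
    ← ENNReal.ofReal_mul (by positivity)]
  congr 2
  field_simp
  rw [pow_succ']

/-- Nonzero vectors in the closed forward light cone. -/
def ForwardCausal {n : ℕ} (v : Mink n) : Prop := 0 ≤ mdot v v ∧ 0 < v 0

lemma ForwardCausal.mulVec {n : ℕ} {v : Mink n} (hv : ForwardCausal v) {g : GL (Fin (n + 2)) ℝ}
    (hg : g ∈ orthochronous n) : ForwardCausal (g.1 *ᵥ v) :=
  ⟨by rw [hg.1]; exact hv.1, hg.2 v hv.1 hv.2⟩

lemma ae_mdot_pos {n : ℕ} [NeZero n] {v : Mink n} (hv : ForwardCausal v) :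
    ∀ᵐ q ∂invMeasure n 0, 0 < mdot v q := by
  obtain ⟨hvv, hv0⟩ := hv
  have hms : MeasurableSet {q : Mink n | 0 < mdot v q} :=
    measurableSet_lt measurable_const (measurable_mdot v)
  rw [invMeasure, ae_map_iff (measurable_onShell 0).aemeasurable hms]
  refine (withDensity_absolutelyContinuous _ _).ae_le ?_
  set s : Submodule ℝ (Fin (n + 1) → ℝ) := Submodule.span ℝ {Fin.tail v}
  have hs : s ≠ ⊤ := by
    intro h
    have h1 : Module.finrank ℝ s ≤ 1 := by
      have h2 := finrank_span_finset_le_card (R := ℝ) {(Fin.tail v : Fin (n + 1) → ℝ)}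
      rw [Finset.coe_singleton, Finset.card_singleton] at h2
      exact h2
    rw [h, finrank_top, Module.finrank_fin_fun] at h1
    have := NeZero.ne n
    omega
  have hnull := Measure.addHaar_submodule (volume : Measure (Fin (n + 1) → ℝ)) s hs
  filter_upwards [measure_eq_zero_iff_ae_notMem.1 hnull] with k hk
  by_contra hneg
  apply hk
  have h0 : v 0 * energy 0 k ≤ ∑ i : Fin (n + 1), v i.succ * k i := by
    simpa [mdot, onShell] using hneg
  have hE : energy 0 k ^ 2 = ∑ i, k i ^ 2 := by rw [energy_sq]; simp
  have hE0 : 0 ≤ energy 0 k := Real.sqrt_nonneg _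
  have hV : ∑ i : Fin (n + 1), v i.succ ^ 2 ≤ v 0 ^ 2 := by
    simp only [mdot, ← pow_two] at hvv; linarith
  have hsum : ∑ i : Fin (n + 1), (v 0 * k i - energy 0 k * v i.succ) ^ 2 ≤ 0 := by
    have : ∑ i : Fin (n + 1), (v 0 * k i - energy 0 k * v i.succ) ^ 2 =
        v 0 ^ 2 * ∑ i, k i ^ 2 + energy 0 k ^ 2 * ∑ i : Fin (n + 1), v i.succ ^ 2
          - 2 * (v 0 * energy 0 k) * ∑ i : Fin (n + 1), v i.succ * k i := by
      simp only [Finset.mul_sum, ← Finset.sum_add_distrib, ← Finset.sum_sub_distrib]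
      exact Finset.sum_congr rfl fun i _ => by ring
    rw [this, ← hE]
    nlinarith [mul_le_mul_of_nonneg_left h0 (mul_nonneg hv0.le hE0),
      mul_le_mul_of_nonneg_left hV (sq_nonneg (energy 0 k))]
  have hz : ∀ i : Fin (n + 1), v 0 * k i - energy 0 k * v i.succ = 0 := fun i => by
    have := (Finset.sum_eq_zero_iff_of_nonneg (fun i _ => sq_nonneg _)).1
      (le_antisymm hsum (Finset.sum_nonneg fun i _ => sq_nonneg _)) i (Finset.mem_univ i)
    exact pow_eq_zero_iff two_ne_zero |>.1 this
  refine Submodule.mem_span_singleton.2 ⟨energy 0 k / v 0, ?_⟩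
  funext i
  have := hz i
  simp only [Pi.smul_apply, Fin.tail, smul_eq_mul]
  field_simp
  linarith

lemma lintegral_cycleMeasure {n : ℕ} (v : Mink n) {f : Mink n → ℝ≥0∞} (hf : Measurable f) :
    ∫⁻ q, f q ∂cycleMeasure v =
      n * ∫⁻ q in {q | 0 < mdot v q ∧ mdot v q ≤ 1}, f (toCycle v q) ∂invMeasure n 0 := by
  rw [cycleMeasure, lintegral_smul_measure, lintegral_map hf (measurable_toCycle v), smul_eq_mul]

/-- The profile `exp(n t)` for `t ≤ 0` and `0` for `t > 0`. -/
def cutoff (n : ℕ) (t : ℝ) : ℝ≥0∞ := (Set.Iic 0).indicator (fun t => ENNReal.ofReal (Real.exp (n * t))) t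

lemma measurable_cutoff (n : ℕ) : Measurable (cutoff n) :=
  Measurable.indicator (by fun_prop) measurableSet_Iic

lemma lintegral_cutoff_ne (n : ℕ) [NeZero n] :
    ∫⁻ t, cutoff n t ≠ 0 ∧ ∫⁻ t, cutoff n t ≠ ⊤ := by
  have hn : (0 : ℝ) < n := by exact_mod_cast Nat.pos_of_ne_zero (NeZero.ne n)
  constructor
  · rw [Ne, lintegral_eq_zero_iff (measurable_cutoff n)]
    intro h
    have : volume (Set.Iic (0 : ℝ)) = 0 := by
      refine measure_mono_null ?_ h
      intro t ht
      simp [cutoff, Set.mem_Iic.1 ht, Real.exp_pos]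
    simp at this
  · simp only [cutoff]
    rw [lintegral_indicator measurableSet_Iic]
    have := (integrableOn_exp_mul_Iic hn 0)
    exact (IntegrableOn.setLIntegral_lt_top this).ne

/-- The weight `(v · q)^n` on `0 < v · q ≤ 1`, and `0` elsewhere. -/
def kern {n : ℕ} (v q : Mink n) : ℝ≥0∞ :=
  {q | 0 < mdot v q}.indicator (fun q => cutoff n (Real.log (mdot v q))) q

lemma measurable_kern {n : ℕ} (v : Mink n) : Measurable (kern v) :=
  Measurable.indicator ((measurable_cutoff n).comp (measurable_mdot v).log)
    (measurableSet_lt measurable_const (measurable_mdot v))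

lemma kern_smul {n : ℕ} {v q : Mink n} (h : 0 < mdot v q) (t : ℝ) :
    kern v (Real.exp t • q) = cutoff n (t + Real.log (mdot v q)) := by
  have h' : 0 < mdot v (Real.exp t • q) := by rw [mdot_smul]; positivity
  rw [kern, Set.indicator_of_mem (by exact h'), mdot_smul, Real.log_mul (Real.exp_ne_zero _) h.ne',
    Real.log_exp]

lemma kern_eq {n : ℕ} {v q : Mink n} (h : 0 < mdot v q) :
    kern v q = {q | 0 < mdot v q ∧ mdot v q ≤ 1}.indicator
      (fun q => ENNReal.ofReal (mdot v q ^ n)) q := by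
  rw [kern, Set.indicator_of_mem (by exact h), cutoff]
  by_cases h1 : mdot v q ≤ 1
  · have h2 : q ∈ {q : Mink n | 0 < mdot v q ∧ mdot v q ≤ 1} := ⟨h, h1⟩
    rw [Set.indicator_of_mem (by exact Real.log_nonpos h.le h1), Set.indicator_of_mem h2,
      Real.exp_nat_mul, Real.exp_log h]
  · rw [Set.indicator_of_notMem, Set.indicator_of_notMem (fun h2 => h1 h2.2)]
    exact not_le.2 (Real.log_pos (not_le.1 h1))

/-- The integral over a cycle of a function that is homogeneous of degree `-n` does not depend
on the cycle. -/
lemma lintegral_kern_comm {n : ℕ} [NeZero n] {v w : Mink n} (hv : ForwardCausal v)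
    (hw : ForwardCausal w) {H : Mink n → ℝ≥0∞} (hH : Measurable H)
    (hhom : ∀ t : ℝ, ∀ q, ENNReal.ofReal (Real.exp t ^ n) * H (Real.exp t • q) = H q) :
    ∫⁻ q, H q * kern v q ∂invMeasure n 0 = ∫⁻ q, H q * kern w q ∂invMeasure n 0 := by
  set I := ∫⁻ t, cutoff n t with hI
  obtain ⟨hI0, hIt⟩ := lintegral_cutoff_ne n
  have hsm : Measurable fun x : Mink n × ℝ => Real.exp x.2 • x.1 := by fun_prop
  have hsm' : Measurable fun x : Mink n × ℝ => Real.exp (-x.2) • x.1 := by fun_prop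
  have h1 : (∫⁻ q, H q * kern v q ∂invMeasure n 0) * I =
      ∫⁻ q, ∫⁻ t, H q * kern v q * kern w (Real.exp t • q) ∂volume ∂invMeasure n 0 := by
    rw [← lintegral_mul_const' _ _ hIt]
    refine lintegral_congr_ae ?_
    filter_upwards [ae_mdot_pos hw] with q hq
    have hmk : Measurable fun t : ℝ => kern w (Real.exp t • q) :=
      (measurable_kern w).comp (by fun_prop)
    rw [lintegral_const_mul _ hmk]
    simp only [kern_smul hq]
    rw [lintegral_add_right_eq_self (cutoff n)]
  have h2 : (∫⁻ q, H q * kern w q ∂invMeasure n 0) * I =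
      ∫⁻ q, ∫⁻ t, H q * kern w q * kern v (Real.exp (-t) • q) ∂volume ∂invMeasure n 0 := by
    rw [← lintegral_mul_const' _ _ hIt]
    refine lintegral_congr_ae ?_
    filter_upwards [ae_mdot_pos hv] with q hq
    have hmk : Measurable fun t : ℝ => kern v (Real.exp (-t) • q) :=
      (measurable_kern v).comp (by fun_prop)
    rw [lintegral_const_mul _ hmk]
    simp only [kern_smul hq]
    congr 1
    have := lintegral_sub_left_eq_self (cutoff n) (Real.log (mdot v q)) (μ := volume)
    rw [← this]
    exact lintegral_congr fun t => by rw [sub_eq_neg_add]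
  have h3 : (∫⁻ q, H q * kern v q ∂invMeasure n 0) * I =
      (∫⁻ q, H q * kern w q ∂invMeasure n 0) * I := by
    rw [h1, h2, lintegral_lintegral_swap, lintegral_lintegral_swap (μ := invMeasure n 0)]
    · refine lintegral_congr fun t => ?_
      have hm : Measurable fun q => H q * kern w q * kern v (Real.exp (-t) • q) :=
        (hH.mul (measurable_kern w)).mul ((measurable_kern v).comp (by fun_prop))
      rw [lintegral_invMeasure_smul (Real.exp_pos t) hm,
        ← lintegral_const_mul' _ _ ENNReal.ofReal_ne_top]
      refine lintegral_congr fun q => ?_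
      rw [smul_smul, ← Real.exp_add, neg_add_cancel, Real.exp_zero, one_smul, ← mul_assoc,
        ← mul_assoc, hhom]
      ring
    · exact (((hH.mul (measurable_kern w)).comp measurable_fst).mul
        ((measurable_kern v).comp hsm')).aemeasurable
    · exact (((hH.mul (measurable_kern v)).comp measurable_fst).mul
        ((measurable_kern w).comp hsm)).aemeasurable
  exact (ENNReal.mul_left_inj hI0 hIt).1 h3

lemma lintegral_cycleMeasure_hom {n : ℕ} [NeZero n] {v : Mink n} (hv : ForwardCausal v)
    {H : Mink n → ℝ≥0∞} (hH : Measurable H)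
    (hhom : ∀ t : ℝ, ∀ q, ENNReal.ofReal (Real.exp t ^ n) * H (Real.exp t • q) = H q) :
    ∫⁻ q, H q ∂cycleMeasure v = n * ∫⁻ q, H q * kern v q ∂invMeasure n 0 := by
  have hms : MeasurableSet {q : Mink n | 0 < mdot v q ∧ mdot v q ≤ 1} :=
    (measurableSet_lt measurable_const (measurable_mdot v)).inter
      (measurableSet_le (measurable_mdot v) measurable_const)
  rw [lintegral_cycleMeasure v hH, ← lintegral_indicator hms]
  congr 1
  refine lintegral_congr_ae ?_
  filter_upwards [ae_mdot_pos hv] with q hq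
  rw [kern_eq hq]
  by_cases h : q ∈ {q : Mink n | 0 < mdot v q ∧ mdot v q ≤ 1}
  · rw [Set.indicator_of_mem h, Set.indicator_of_mem h]
    have := hhom (-Real.log (mdot v q)) q
    rw [Real.exp_neg, Real.exp_log hq] at this
    rw [← this, toCycle, mul_right_comm, ← ENNReal.ofReal_mul (by positivity), ← mul_pow,
      inv_mul_cancel₀ hq.ne']
    simp
  · rw [Set.indicator_of_notMem h, Set.indicator_of_notMem h, mul_zero]

lemma ae_cycleMeasure {n : ℕ} [NeZero n] {v w : Mink n} (hw : ForwardCausal w) :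
    ∀ᵐ q ∂cycleMeasure v, 0 < mdot w q := by
  unfold cycleMeasure
  have hms : MeasurableSet {q : Mink n | 0 < mdot w q} :=
    measurableSet_lt measurable_const (measurable_mdot w)
  have hms' : MeasurableSet {q : Mink n | 0 < mdot v q ∧ mdot v q ≤ 1} :=
    (measurableSet_lt measurable_const (measurable_mdot v)).inter
      (measurableSet_le (measurable_mdot v) measurable_const)
  refine Measure.ae_smul_measure ?_ _
  rw [ae_map_iff (measurable_toCycle v).aemeasurable hms, ae_restrict_iff' hms']
  filter_upwards [ae_mdot_pos hw] with q hq hq'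
  rw [toCycle, mdot_smul]
  exact mul_pos (inv_pos.2 hq'.1) hq

lemma ae_cycleMeasure_eq_one {n : ℕ} {v : Mink n} :
    ∀ᵐ q ∂cycleMeasure v, mdot v q = 1 := by
  unfold cycleMeasure
  have hms : MeasurableSet {q : Mink n | mdot v q = 1} :=
    measurableSet_eq_fun (measurable_mdot v) measurable_const
  have hms' : MeasurableSet {q : Mink n | 0 < mdot v q ∧ mdot v q ≤ 1} :=
    (measurableSet_lt measurable_const (measurable_mdot v)).inter
      (measurableSet_le (measurable_mdot v) measurable_const)
  refine Measure.ae_smul_measure ?_ _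
  rw [ae_map_iff (measurable_toCycle v).aemeasurable hms, ae_restrict_iff' hms']
  refine Filter.Eventually.of_forall fun q hq => ?_
  rw [toCycle, mdot_smul, inv_mul_cancel₀ hq.1.ne']

lemma mdot_inv_mulVec {n : ℕ} {g : GL (Fin (n + 2)) ℝ} (hg : g ∈ orthochronous n)
    (v q : Mink n) : mdot v (g⁻¹.1 *ᵥ q) = mdot (g.1 *ᵥ v) q := by
  rw [← hg.1, mulVec_mulVec, ← Units.val_mul, mul_inv_cancel, Units.val_one, one_mulVec]

lemma toCycle_smul {n : ℕ} (v q : Mink n) {t : ℝ} (ht : t ≠ 0) :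
    toCycle v (t • q) = toCycle v q := by
  rw [toCycle, toCycle, mdot_smul, smul_smul, mul_inv, mul_right_comm, inv_mul_cancel₀ ht, one_mul]

/-- The change of variables on the cycle that is induced by a Lorentz transformation. -/
lemma lintegral_cycle_comp {n : ℕ} [NeZero n] {v : Mink n} (hv : ForwardCausal v)
    {g : GL (Fin (n + 2)) ℝ} (hg : g ∈ orthochronous n) {f : Mink n → ℝ≥0∞} (hf : Measurable f) :
    ∫⁻ q, ENNReal.ofReal ((mdot v (g⁻¹.1 *ᵥ q))⁻¹ ^ n) * f (toCycle v (g⁻¹.1 *ᵥ q))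
      ∂cycleMeasure v = ∫⁻ q, f q ∂cycleMeasure v := by
  set H : Mink n → ℝ≥0∞ := {q | 0 < mdot v q}.indicator
    fun q => ENNReal.ofReal ((mdot v q)⁻¹ ^ n) * f (toCycle v q) with hHdef
  have hHm : Measurable H :=
    Measurable.indicator (((measurable_mdot v).inv.pow_const n).ennreal_ofReal.mul
      (hf.comp (measurable_toCycle v))) (measurableSet_lt measurable_const (measurable_mdot v))
  have hhom : ∀ t : ℝ, ∀ q, ENNReal.ofReal (Real.exp t ^ n) * H (Real.exp t • q) = H q := by
    intro t q
    by_cases h : 0 < mdot v q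
    · have h' : 0 < mdot v (Real.exp t • q) := by rw [mdot_smul]; positivity
      rw [hHdef, Set.indicator_of_mem (a := q) (by exact h),
        Set.indicator_of_mem (a := Real.exp t • q) (by exact h'), toCycle_smul _ _ (Real.exp_ne_zero t), ← mul_assoc, ← ENNReal.ofReal_mul (by positivity),
        mdot_smul, ← mul_pow, mul_inv, mul_inv_cancel_left₀ (Real.exp_ne_zero t)]
    · have h' : ¬ 0 < mdot v (Real.exp t • q) := by
        rw [mdot_smul]
        exact fun h2 => h (pos_of_mul_pos_right h2 (Real.exp_pos t).le)
      rw [hHdef, Set.indicator_of_notMem (a := q) (by exact h),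
        Set.indicator_of_notMem (a := Real.exp t • q) (by exact h'), mul_zero]
  have hgv : ForwardCausal (g.1 *ᵥ v) := hv.mulVec hg
  have hginv := inv_mem hg
  have e1 : ∫⁻ q, ENNReal.ofReal ((mdot v (g⁻¹.1 *ᵥ q))⁻¹ ^ n) * f (toCycle v (g⁻¹.1 *ᵥ q))
      ∂cycleMeasure v = ∫⁻ q, H (g⁻¹.1 *ᵥ q) ∂cycleMeasure v := by
    refine lintegral_congr_ae ?_
    filter_upwards [ae_cycleMeasure (v := v) hgv] with q hq
    rw [← mdot_inv_mulVec hg] at hq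
    rw [hHdef, Set.indicator_of_mem (by exact hq)]
  have e2 : ∫⁻ q, f q ∂cycleMeasure v = ∫⁻ q, H q ∂cycleMeasure v := by
    refine lintegral_congr_ae ?_
    filter_upwards [ae_cycleMeasure_eq_one (v := v)] with q hq
    rw [hHdef, Set.indicator_of_mem (by simp [hq])]
    simp [toCycle, hq]
  have hH' : Measurable fun q => H (g⁻¹.1 *ᵥ q) := hHm.comp (measurable_mulVec _)
  have hhom' : ∀ t : ℝ, ∀ q : Mink n, ENNReal.ofReal (Real.exp t ^ n) *
      H (g⁻¹.1 *ᵥ (Real.exp t • q)) = H (g⁻¹.1 *ᵥ q) := fun t q => by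
    rw [mulVec_smul, hhom]
  have hinv := lintegral_invMeasure_mulVec (m := 0) hginv
    (hHm.mul (measurable_kern (g⁻¹.1 *ᵥ v)) : Measurable fun q => H q * kern (g⁻¹.1 *ᵥ v) q)
  simp only [Pi.mul_apply] at hinv
  have hginvv : ForwardCausal (g⁻¹.1 *ᵥ v) := hv.mulVec hginv
  rw [e1, e2, lintegral_cycleMeasure_hom hv hH' hhom', lintegral_cycleMeasure_hom hv hHm hhom,
    lintegral_kern_comm hv hginvv hHm hhom, ← hinv]
  congr 1
  refine lintegral_congr fun q => ?_
  congr 1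
  have : mdot (g⁻¹.1 *ᵥ v) (g⁻¹.1 *ᵥ q) = mdot v q := hginv.1 _ _
  simp only [kern, Set.indicator, Set.mem_ofPred_eq, this]

lemma quasiMeasurePreserving_cycle {n : ℕ} [NeZero n] {v : Mink n} (hv : ForwardCausal v)
    {g : GL (Fin (n + 2)) ℝ} (hg : g ∈ orthochronous n) :
    Measure.QuasiMeasurePreserving (fun q => toCycle v (g⁻¹.1 *ᵥ q))
      (cycleMeasure v) (cycleMeasure v) := by
  have hmeas : Measurable fun q => toCycle v (g⁻¹.1 *ᵥ q) :=
    (measurable_toCycle v).comp (measurable_mulVec _)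
  refine ⟨hmeas, Measure.AbsolutelyContinuous.mk fun N hN hN0 => ?_⟩
  rw [Measure.map_apply hmeas hN]
  have h := lintegral_cycle_comp hv hg (measurable_one.indicator hN : Measurable (N.indicator 1))
  rw [lintegral_indicator_one hN, hN0, lintegral_eq_zero_iff] at h
  · rw [measure_eq_zero_iff_ae_notMem]
    filter_upwards [h, ae_cycleMeasure (v := v) (hv.mulVec hg)] with q hq hq' hqN
    rw [← mdot_inv_mulVec hg] at hq'
    have hmem : toCycle v (g⁻¹.1 *ᵥ q) ∈ N := hqN
    rw [Set.indicator_of_mem hmem] at hq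
    simp only [Pi.one_apply, mul_one, Pi.zero_apply, ENNReal.ofReal_eq_zero] at hq
    exact absurd hq (not_le.2 (by positivity))
  · exact (((measurable_mdot v).comp (measurable_mulVec _)).inv.pow_const n).ennreal_ofReal.mul
      ((measurable_one.indicator hN).comp hmeas)

/-- The admissible parameters: complex numbers with real part `-(d-2)/2`. -/
abbrev PrincipalParam (n : ℕ) : Type := {α : ℂ // α.re = -(n : ℝ) / 2}

/-- The complex conjugate parameter. -/
def PrincipalParam.conj {n : ℕ} (α : PrincipalParam n) : PrincipalParam n :=
  ⟨starRingEnd ℂ α.1, by rw [Complex.conj_re]; exact α.2⟩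

/-- The extension of a function on the cycle `Γ_v` to a function on the light cone that is
homogeneous of degree `α`. -/
def homExt {n : ℕ} (v : Mink n) (α : ℂ) (ψ : Mink n → ℂ) (q : Mink n) : ℂ :=
  ((mdot v q : ℝ) : ℂ) ^ α * ψ (toCycle v q)

lemma MassShell.forwardCausal {n : ℕ} {m : ℝ} (p : MassShell n m) : ForwardCausal p.1 :=
  ⟨by rw [p.2.1]; positivity, p.2.2⟩

/-- The representation space of the principal series representations: `L²(Γ, ν_Γ)` for the
cycle `Γ = {q ∈ H₀⁺ : q · pbar = 1}`. Its elements are identified with functions on the light cone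
that are homogeneous of degree `α` by means of `homExt`. -/
abbrev HLor {n : ℕ} {m : ℝ} (pbar : MassShell n m) : Type := Lp ℂ 2 (cycleMeasure pbar.1)

lemma measurable_homExt {n : ℕ} (v : Mink n) (α : ℂ) {ψ : Mink n → ℂ} (hψ : Measurable ψ) :
    Measurable (homExt v α ψ) :=
  (Complex.measurable_ofReal.comp (measurable_mdot v)).pow_const α |>.mul
    (hψ.comp (measurable_toCycle v))

lemma eLpNorm_homExt {n : ℕ} [NeZero n] {v : Mink n} (hv : ForwardCausal v)
    (α : PrincipalParam n) {g : GL (Fin (n + 2)) ℝ} (hg : g ∈ orthochronous n)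
    {ψ : Mink n → ℂ} (hψ : Measurable ψ) :
    eLpNorm (fun q => homExt v α.1 ψ (g⁻¹.1 *ᵥ q)) 2 (cycleMeasure v) =
      eLpNorm ψ 2 (cycleMeasure v) := by
  rw [eLpNorm_eq_lintegral_rpow_enorm_toReal two_ne_zero ENNReal.ofNat_ne_top,
    eLpNorm_eq_lintegral_rpow_enorm_toReal two_ne_zero ENNReal.ofNat_ne_top]
  congr 1
  have hf : Measurable fun q => ‖ψ q‖ₑ ^ (2 : ℝ≥0∞).toReal := hψ.enorm.pow_const _
  rw [← lintegral_cycle_comp hv hg hf]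
  refine lintegral_congr_ae ?_
  filter_upwards [ae_cycleMeasure (v := v) (hv.mulVec hg)] with q hq
  rw [← mdot_inv_mulVec hg] at hq
  rw [homExt, enorm_mul, ENNReal.mul_rpow_of_nonneg _ _ ENNReal.toReal_nonneg]
  congr 1
  rw [← ofReal_norm, Complex.norm_cpow_eq_rpow_re_of_pos hq, α.2,
    ENNReal.ofReal_rpow_of_nonneg (by positivity) ENNReal.toReal_nonneg, ← Real.rpow_mul hq.le]
  congr 1
  rw [ENNReal.toReal_ofNat, inv_pow, ← Real.rpow_natCast, ← Real.rpow_neg hq.le]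
  congr 1
  ring

lemma memLp_homExt {n : ℕ} [NeZero n] {m : ℝ} {pbar : MassShell n m} (α : PrincipalParam n)
    (g : orthochronous n) (ψ : HLor pbar) :
    MemLp (fun q => homExt pbar.1 α.1 ψ ((g⁻¹).1.1 *ᵥ q)) 2 (cycleMeasure pbar.1) := by
  have hψ : Measurable ψ := (Lp.stronglyMeasurable ψ).measurable
  refine ⟨((measurable_homExt _ _ hψ).comp (measurable_mulVec _)).aestronglyMeasurable, ?_⟩
  have := eLpNorm_homExt pbar.forwardCausal α g.2 hψ
  exact this.trans_lt (Lp.eLpNorm_lt_top ψ)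

lemma homExt_congr {n : ℕ} [NeZero n] {m : ℝ} {pbar : MassShell n m} (α : ℂ)
    (g : orthochronous n) {ψ ψ' : Mink n → ℂ} (h : ψ =ᵐ[cycleMeasure pbar.1] ψ') :
    (fun q => homExt pbar.1 α ψ ((g⁻¹).1.1 *ᵥ q)) =ᵐ[cycleMeasure pbar.1]
      fun q => homExt pbar.1 α ψ' ((g⁻¹).1.1 *ᵥ q) := by
  filter_upwards [(quasiMeasurePreserving_cycle pbar.forwardCausal g.2).ae_eq_comp h] with q hq
  simp only [Function.comp_apply] at hq
  exact congrArg _ hq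

/-- For an orthochronous `g`, the map `ψ ↦ ψ ∘ g⁻¹` on homogeneous functions of degree `α`, as an
operator on `L²(Γ, ν_Γ)`. -/
def pullback {n : ℕ} [NeZero n] {m : ℝ} {pbar : MassShell n m} (α : PrincipalParam n)
    (g : orthochronous n) : HLor pbar →ₗᵢ[ℂ] HLor pbar where
  toFun ψ := (memLp_homExt α g ψ).toLp _
  map_add' ψ ψ' := by
    rw [← MemLp.toLp_add]
    refine MemLp.toLp_congr _ _ ((homExt_congr α.1 g (Lp.coeFn_add ψ ψ')).trans ?_)
    exact Filter.Eventually.of_forall fun q => by simp [homExt, mul_add]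
  map_smul' c ψ := by
    rw [RingHom.id_apply, ← MemLp.toLp_const_smul]
    refine MemLp.toLp_congr _ _ ((homExt_congr α.1 g (Lp.coeFn_smul c ψ)).trans ?_)
    exact Filter.Eventually.of_forall fun q => by simp [homExt, mul_left_comm]
  norm_map' ψ := by
    change ‖(memLp_homExt α g ψ).toLp _‖ = ‖ψ‖
    rw [Lp.norm_toLp, Lp.norm_def]
    congr 1
    exact eLpNorm_homExt pbar.forwardCausal α g.2 (Lp.stronglyMeasurable ψ).measurable

/-- Complex conjugation. -/
def conjLp {n : ℕ} {m : ℝ} {pbar : MassShell n m} : HLor pbar →ₗᵢ⋆[ℂ] HLor pbar where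
  toFun ψ := star ψ
  map_add' ψ ψ' := by
    ext1
    filter_upwards [Lp.coeFn_star (ψ + ψ'), Lp.coeFn_star ψ, Lp.coeFn_star ψ',
      Lp.coeFn_add ψ ψ', Lp.coeFn_add (star ψ) (star ψ')] with q h1 h2 h3 h4 h5
    rw [h1, h5]
    simp only [Pi.star_apply, Pi.add_apply, h2, h3]
    rw [h4, Pi.add_apply, star_add]
  map_smul' c ψ := by
    ext1
    filter_upwards [Lp.coeFn_star (c • ψ), Lp.coeFn_star ψ,
      Lp.coeFn_smul c ψ, Lp.coeFn_smul (starRingEnd ℂ c) (star ψ)] with q h1 h2 h3 h4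
    rw [h1, h4]
    simp only [Pi.star_apply, Pi.smul_apply, h2]
    rw [h3, Pi.smul_apply, star_smul]
    rfl
  norm_map' ψ := by
    refine le_antisymm (Lp.norm_le_norm_of_ae_le ?_) (Lp.norm_le_norm_of_ae_le ?_) <;>
    filter_upwards [Lp.coeFn_star ψ] with q h1 <;>
    simp [h1]

/-- The proper orthochronous Lorentz group. -/
def restrictedLorentz (n : ℕ) : Subgroup (orthochronous n) where
  carrier := {g | g.1.1.det = 1}
  one_mem' := by simp
  mul_mem' := by
    intro a b ha hb
    simp only [Set.mem_ofPred_eq] at *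
    simp [ha, hb]
  inv_mem' := by
    intro a ha
    have h : (a * a⁻¹).1.1.det = 1 := by simp
    simp only [Set.mem_ofPred_eq] at *
    simpa only [Subgroup.coe_mul, Units.val_mul, det_mul, ha, one_mul] using h

/-- The action of the Lorentz group on the mass shell. -/
instance {n : ℕ} {m : ℝ} : MulAction (orthochronous n) (MassShell n m) where
  smul g p := ⟨g.1.1 *ᵥ p.1, by rw [g.2.1]; exact p.2.1,
    g.2.2 _ p.forwardCausal.1 p.forwardCausal.2⟩
  one_smul p := Subtype.ext (one_mulVec p.1)
  mul_smul g h p := Subtype.ext (by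
    change (g.1.1 * h.1.1) *ᵥ p.1 = g.1.1 *ᵥ (h.1.1 *ᵥ p.1)
    rw [mulVec_mulVec])

lemma coe_smul {n : ℕ} {m : ℝ} (g : orthochronous n) (p : MassShell n m) :
    (g • p).1 = g.1.1 *ᵥ p.1 := rfl

/-- The invariant measure on the mass shell. -/
def shellMeasure (n : ℕ) (m : ℝ) : Measure (MassShell n m) :=
  (invMeasure n m).comap Subtype.val

lemma measurableSet_shell (n : ℕ) (m : ℝ) :
    MeasurableSet {p : Mink n | mdot p p = m ^ 2 ∧ 0 < p 0} := by
  refine MeasurableSet.inter (measurableSet_eq_fun ?_ measurable_const)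
    (measurableSet_lt measurable_const (measurable_pi_apply 0))
  unfold mdot; fun_prop

lemma measurableEmbedding_val (n : ℕ) (m : ℝ) :
    MeasurableEmbedding (Subtype.val : MassShell n m → Mink n) :=
  MeasurableEmbedding.subtype_coe (measurableSet_shell n m)

lemma measurable_smul_shell {n : ℕ} {m : ℝ} (g : orthochronous n) :
    Measurable fun p : MassShell n m => g • p :=
  Measurable.subtype_mk ((measurable_mulVec _).comp measurable_subtype_coe)

lemma measurePreserving_smul {n : ℕ} {m : ℝ} (g : orthochronous n) :
    MeasurePreserving (fun p : MassShell n m => g • p) (shellMeasure n m) (shellMeasure n m) := by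
  refine ⟨measurable_smul_shell g, Measure.ext fun s hs => ?_⟩
  have hB := (measurableEmbedding_val n m).measurableSet_image.2 hs
  rw [Measure.map_apply (measurable_smul_shell g) hs, shellMeasure,
    (measurableEmbedding_val n m).comap_apply, (measurableEmbedding_val n m).comap_apply]
  have himg : Subtype.val '' ((fun p : MassShell n m => g • p) ⁻¹' s) =
      (fun p : Mink n => g.1.1 *ᵥ p) ⁻¹' (Subtype.val '' s) := by
    ext p
    constructor
    · rintro ⟨q, hq, rfl⟩
      exact ⟨g • q, hq, rfl⟩
    · rintro ⟨q, hq, hqp⟩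
      refine ⟨g⁻¹ • q, by simpa using hq, ?_⟩
      rw [coe_smul, hqp, mulVec_mulVec, ← Units.val_mul, ← Subgroup.coe_mul, inv_mul_cancel]
      simp
  rw [himg, ← lintegral_indicator_one hB, ← lintegral_invMeasure_mulVec g.2
    (measurable_one.indicator hB), ← lintegral_indicator_one ((measurable_mulVec _) hB)]
  rfl

/-- The matrix of the reflection at the edge of the standard wedge `{|x⁰| < x¹}`. -/
def j0Matrix (n : ℕ) : Matrix (Fin (n + 2)) (Fin (n + 2)) ℝ :=
  diagonal fun i => if i = 0 ∨ i = 1 then -1 else 1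

lemma j0Matrix_mul_self (n : ℕ) : j0Matrix n * j0Matrix n = 1 := by
  rw [j0Matrix, diagonal_mul_diagonal, ← diagonal_one]
  congr 1
  funext i
  split_ifs <;> norm_num

/-- The reflection `j₀` at the edge of the standard wedge: it inverts the sign of `x⁰` and `x¹`. -/
def j0 (n : ℕ) : GL (Fin (n + 2)) ℝ :=
  ⟨j0Matrix n, j0Matrix n, j0Matrix_mul_self n, j0Matrix_mul_self n⟩

lemma neg_j0_mem (n : ℕ) : -j0 n ∈ orthochronous n := by
  have h : ∀ (x : Mink n) (i), ((-j0 n).1 *ᵥ x) i = (if i = 0 ∨ i = 1 then 1 else -1) * x i := by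
    intro x i
    rw [Units.val_neg, neg_mulVec, Pi.neg_apply]
    change -((diagonal _) *ᵥ x) i = _
    rw [mulVec_diagonal]
    split_ifs <;> simp
  refine ⟨fun x y => ?_, fun x _ hx => ?_⟩
  · simp only [mdot, h]
    congr 1
    · simp
    · refine Finset.sum_congr rfl fun i _ => ?_
      split_ifs <;> ring
  · rw [h]; simpa using hx

lemma det_j0 (n : ℕ) : (j0 n).1.det = 1 := by
  change (diagonal _).det = 1
  rw [det_diagonal, Fin.prod_univ_succ, Fin.prod_univ_succ]
  have : ∀ i : Fin n, ¬ (i.succ.succ = 0 ∨ i.succ.succ = (1 : Fin (n + 2))) := by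
    intro i
    simp [Fin.ext_iff]
  simp only [this, if_false, Finset.prod_const_one]
  simp

/-- The antichronous component of the proper Lorentz group (determinant one, time reversing). -/
def LorentzDown (n : ℕ) : Type := {j : GL (Fin (n + 2)) ℝ // j.1.det = 1 ∧ -j ∈ orthochronous n}

/-- The orthochronous transformation `-j`. -/
def LorentzDown.neg {n : ℕ} (j : LorentzDown n) : orthochronous n := ⟨-j.1, j.2.2⟩

/-- The reflection `j₀` as a proper antichronous Lorentz transformation. -/
def j0Down (n : ℕ) : LorentzDown n := ⟨j0 n, det_j0 n, neg_j0_mem n⟩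

/-- The proper orthochronous transformation `j₀ j`. -/
def LorentzDown.j0Mul {n : ℕ} (j : LorentzDown n) : restrictedLorentz n :=
  ⟨⟨j0 n * j.1, by
    have := mul_mem (neg_j0_mem n) j.2.2
    rwa [neg_mul_neg] at this⟩, by
    change (j0 n * j.1).1.det = 1
    rw [Units.val_mul, det_mul, det_j0, j.2.1, one_mul]⟩

/-- The adjoint action `Λ ↦ j₀ Λ j₀`. -/
def conjJ0 {n : ℕ} (L : restrictedLorentz n) : restrictedLorentz n :=
  ⟨⟨j0 n * L.1.1 * j0 n, by
    have := mul_mem (mul_mem (neg_j0_mem n) L.1.2) (neg_j0_mem n)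
    rwa [neg_mul, neg_mul_neg] at this⟩, by
    change (j0 n * L.1.1 * j0 n).1.det = 1
    have h : L.1.1.1.det = 1 := L.2
    rw [Units.val_mul, Units.val_mul, det_mul, det_mul, det_j0, h, one_mul, one_mul]⟩

/-- The little group: the stabilizer of the base point in the proper orthochronous Lorentz
group. -/
abbrev LittleGroup {n : ℕ} {m : ℝ} (pbar : MassShell n m) : Subgroup (restrictedLorentz n) :=
  MulAction.stabilizer (restrictedLorentz n) pbar

/-- If `-j₀ pbar = pbar`, then `Λ ↦ j₀ Λ j₀` maps the little group to itself. -/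
def conjJ0Little {n : ℕ} {m : ℝ} {pbar : MassShell n m} (hp : (j0Down n).neg • pbar = pbar)
    (L : LittleGroup pbar) : LittleGroup pbar :=
  ⟨conjJ0 L.1, by
    rw [MulAction.mem_stabilizer_iff]
    have h1 : (conjJ0 L.1).1 = (j0Down n).neg * L.1.1 * (j0Down n).neg := by
      apply Subtype.ext
      change j0 n * L.1.1.1 * j0 n = -j0 n * L.1.1.1 * -j0 n
      rw [neg_mul, neg_mul_neg]
    have h2 : L.1.1 • pbar = pbar := L.2
    change (conjJ0 L.1).1 • pbar = pbar
    rw [h1, mul_smul, mul_smul, hp, h2, hp]⟩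

/-- Strongly continuous unitary representations. -/
structure UnitaryRep (G : Type*) [Group G] [TopologicalSpace G] (V : Type*)
    [NormedAddCommGroup V] [InnerProductSpace ℂ V] where
  toHom : G →* (V ≃ₗᵢ[ℂ] V)
  continuous_apply : ∀ x : V, Continuous fun g => toHom g x

namespace UnitaryRep

variable {G : Type*} [Group G] [TopologicalSpace G] {V : Type*}
    [NormedAddCommGroup V] [InnerProductSpace ℂ V]

/-- The representation space is nonzero and has no nontrivial closed invariant subspace. -/
def Irreducible (D : UnitaryRep G V) : Prop :=
  Nontrivial V ∧ ∀ K : Submodule ℂ V, IsClosed (K : Set V) →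
    (∀ g, ∀ x ∈ K, D.toHom g x ∈ K) → K = ⊥ ∨ K = ⊤

/-- Different group elements are represented by different operators. -/
def Faithful (D : UnitaryRep G V) : Prop := Function.Injective D.toHom

lemma continuous_uncurry (D : UnitaryRep G V) : Continuous fun x : G × V => D.toHom x.1 x.2 := by
  rw [continuous_iff_continuousAt]
  rintro ⟨g, x⟩
  have h1 : ContinuousAt (fun y : G × V => D.toHom y.1 x) (g, x) :=
    ((D.continuous_apply x).comp continuous_fst).continuousAt
  have h2 : Filter.Tendsto (fun y : G × V => D.toHom y.1 (y.2 - x)) (nhds (g, x)) (nhds 0) := by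
    rw [tendsto_zero_iff_norm_tendsto_zero]
    simp only [LinearIsometryEquiv.norm_map]
    have : Continuous fun y : G × V => ‖y.2 - x‖ := by fun_prop
    simpa using this.tendsto (g, x)
  have h3 := h1.tendsto.add h2
  simp only [add_zero] at h3
  refine h3.congr fun y => ?_
  rw [← map_add, add_sub_cancel]

end UnitaryRep

/-- A Borel section `p ↦ A_p` of the bundle `Λ ↦ Λ pbar` with `A_p pbar = p` and
`j₀ A_p j₀ = A_{-j₀ p}`. -/
structure BoostSection {n : ℕ} {m : ℝ} (pbar : MassShell n m) where
  toFun : MassShell n m → restrictedLorentz n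
  stronglyMeasurable : StronglyMeasurable toFun
  map_base : ∀ p, toFun p • pbar = p
  conj_reflection : ∀ p, conjJ0 (toFun p) = toFun ((j0Down n).neg • p)

/-- The Wigner rotation `R(Λ, p) = A_p⁻¹ Λ A_{Λ⁻¹ p}`. -/
def wignerRotation {n : ℕ} {m : ℝ} {pbar : MassShell n m} (A : BoostSection pbar)
    (L : restrictedLorentz n) (p : MassShell n m) : LittleGroup pbar :=
  ⟨(A.toFun p)⁻¹ * L * A.toFun (L⁻¹ • p), by
    rw [MulAction.mem_stabilizer_iff, mul_smul, mul_smul, A.map_base, smul_inv_smul,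
      inv_smul_eq_iff, A.map_base]⟩

instance (n : ℕ) : TopologicalSpace.PseudoMetrizableSpace (GL (Fin (n + 2)) ℝ) :=
  have : TopologicalSpace.PseudoMetrizableSpace (Matrix (Fin (n + 2)) (Fin (n + 2)) ℝ) :=
    inferInstanceAs (TopologicalSpace.PseudoMetrizableSpace (Fin (n + 2) → Fin (n + 2) → ℝ))
  have : TopologicalSpace.PseudoMetrizableSpace (Matrix (Fin (n + 2)) (Fin (n + 2)) ℝ)ᵐᵒᵖ :=
    MulOpposite.opHomeomorph.symm.isInducing.pseudoMetrizableSpace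
  (Units.isEmbedding_embedProduct (M := Matrix (Fin (n + 2)) (Fin (n + 2)) ℝ)
    ).isInducing.pseudoMetrizableSpace

lemma stronglyMeasurable_wignerRotation {n : ℕ} {m : ℝ} {pbar : MassShell n m}
    (A : BoostSection pbar) (L : restrictedLorentz n) :
    StronglyMeasurable (wignerRotation A L) := by
  have : TopologicalSpace.PseudoMetrizableSpace (orthochronous n) :=
    Topology.IsInducing.subtypeVal.pseudoMetrizableSpace
  have : TopologicalSpace.PseudoMetrizableSpace (restrictedLorentz n) :=
    Topology.IsInducing.subtypeVal.pseudoMetrizableSpace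
  have : TopologicalSpace.PseudoMetrizableSpace (LittleGroup pbar) :=
    Topology.IsInducing.subtypeVal.pseudoMetrizableSpace
  rw [← Embedding.comp_stronglyMeasurable_iff (Topology.IsEmbedding.subtypeVal)]
  have h : StronglyMeasurable fun p => A.toFun (L⁻¹ • p) :=
    A.stronglyMeasurable.comp_measurable (measurable_smul_shell (L⁻¹).1)
  exact (A.stronglyMeasurable.inv.mul stronglyMeasurable_const).mul h

/-- `L²(H_m⁺, dμ; H) = L²(H_m⁺, dμ) ⊗ H`. -/
abbrev L2Shell (n : ℕ) (m : ℝ) (V : Type*) [NormedAddCommGroup V] : Type _ :=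
  Lp V 2 (shellMeasure n m)

/-- The plane wave `p ↦ exp(i a · p)`. -/
def plane {n : ℕ} {m : ℝ} (a : Mink n) (p : MassShell n m) : ℂ := Complex.exp (Complex.I * (mdot a p.1 : ℝ))

lemma measurable_plane {n : ℕ} {m : ℝ} (a : Mink n) : Measurable (plane (m := m) a) :=
  Complex.measurable_exp.comp ((Complex.measurable_ofReal.comp
    ((measurable_mdot a).comp measurable_subtype_coe)).const_mul _)

lemma norm_plane {n : ℕ} {m : ℝ} (a : Mink n) (p : MassShell n m) : ‖plane a p‖ = 1 := by
  rw [plane, mul_comm]; exact Complex.norm_exp_ofReal_mul_I _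

lemma memLp_translate {n : ℕ} {m : ℝ} {H : Type*} [NormedAddCommGroup H] (g : orthochronous n) (Φ : L2Shell n m H) :
    MemLp (fun p => Φ (g⁻¹ • p)) 2 (shellMeasure n m) :=
  (Lp.memLp Φ).comp_measurePreserving (measurePreserving_smul g⁻¹)

section Representations

variable {n : ℕ} [NeZero n] {m : ℝ} {pbar : MassShell n m}

/-- The principal series representation `U^α(Λ)`: `(U^α(Λ) ψ)(q) = ψ(Λ⁻¹ q)` on homogeneous
functions of degree `α`. -/
def ULor (α : PrincipalParam n) (L : restrictedLorentz n) : HLor pbar →ₗᵢ[ℂ] HLor pbar :=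
  pullback α L.1

/-- The anti-unitary operator `(U^α(j) ψ)(q) = conj (ψ(-j⁻¹ q))` for antichronous `j`; it maps
functions of degree `α` to functions of degree `conj α`. -/
def ULorDown (α : PrincipalParam n) (j : LorentzDown n) : HLor pbar →ₗᵢ⋆[ℂ] HLor pbar :=
  conjLp.comp (pullback α j.neg)

variable {V : Type*} [NormedAddCommGroup V] [InnerProductSpace ℂ V]

/-- The induced representation:
`(U(a, Λ) ψ)(p) = exp(i a · p) D(R(Λ, p)) ψ(Λ⁻¹ p)`. -/
def Uirr (D : UnitaryRep (LittleGroup pbar) V) (A : BoostSection pbar) (a : Mink n)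
    (L : restrictedLorentz n) (ψ : L2Shell n m V) : L2Shell n m V :=
  MemLp.toLp (fun p => plane a p • D.toHom (wignerRotation A L p) (ψ (L⁻¹ • p)))
    ((memLp_translate L.1 ψ).congr_norm
      ((measurable_plane a).aestronglyMeasurable.smul
        (D.continuous_uncurry.comp_aestronglyMeasurable
          ((stronglyMeasurable_wignerRotation A L).aestronglyMeasurable.prodMk
            (memLp_translate L.1 ψ).1)))
      (Filter.Eventually.of_forall fun p => by
        rw [norm_smul, norm_plane, one_mul, LinearIsometryEquiv.norm_map]; rfl))

/-- The extension of the induced representation to antichronous `j`: `U(j) = U(j₀) U(0, j₀ j)`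
with `(U(j₀) ψ)(p) = J ψ(-j₀ p)`, i.e. `(U(j) ψ)(p) = J D(R(j₀ j, -j₀ p)) ψ(-j⁻¹ p)`. Here `J` is the
representer of `j₀` on the space of the inducing representation. -/
def UirrDown (D : UnitaryRep (LittleGroup pbar) V) (J : V ≃ₗᵢ⋆[ℂ] V) (A : BoostSection pbar)
    (j : LorentzDown n) (ψ : L2Shell n m V) : L2Shell n m V :=
  MemLp.toLp (fun p => J (D.toHom (wignerRotation A j.j0Mul ((j0Down n).neg • p))
      (ψ (j.neg⁻¹ • p))))
    ((memLp_translate j.neg ψ).congr_norm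
      (J.continuous.comp_aestronglyMeasurable
        (D.continuous_uncurry.comp_aestronglyMeasurable
          (((stronglyMeasurable_wignerRotation A j.j0Mul).comp_measurable
            (measurable_smul_shell _)).aestronglyMeasurable.prodMk
            (memLp_translate j.neg ψ).1)))
      (Filter.Eventually.of_forall fun p => by
        rw [LinearIsometryEquiv.norm_map, LinearIsometryEquiv.norm_map]))

/-- `U₀(a, Λ) ⊗ U^α(Λ)` on `L²(H_m⁺, dμ) ⊗ L²(Γ, ν_Γ)`, where `U₀` is the scalar representation
`(U₀(a, Λ) φ)(p) = exp(i a · p) φ(Λ⁻¹ p)`. -/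
def U0tensor (α : PrincipalParam n) (a : Mink n) (L : restrictedLorentz n)
    (Φ : L2Shell n m (HLor pbar)) : L2Shell n m (HLor pbar) :=
  MemLp.toLp (fun p => plane a p • ULor α L (Φ (L⁻¹ • p)))
    ((memLp_translate L.1 Φ).congr_norm
      ((measurable_plane a).aestronglyMeasurable.smul
        ((ULor α L).continuous.comp_aestronglyMeasurable (memLp_translate L.1 Φ).1))
      (Filter.Eventually.of_forall fun p => by
        rw [norm_smul, norm_plane, one_mul, LinearIsometry.norm_map]; rfl))

/-- `U₀(j) ⊗ U^α(j)` for antichronous `j`, where `(U₀(j) φ)(p) = conj (φ(-j⁻¹ p))`. -/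
def U0tensorDown (α : PrincipalParam n) (j : LorentzDown n)
    (Φ : L2Shell n m (HLor pbar)) : L2Shell n m (HLor pbar) :=
  MemLp.toLp (fun p => ULorDown α j (Φ (j.neg⁻¹ • p)))
    ((memLp_translate j.neg Φ).congr_norm
      ((ULorDown α j).continuous.comp_aestronglyMeasurable (memLp_translate j.neg Φ).1)
      (Filter.Eventually.of_forall fun p => by rw [LinearIsometry.norm_map]))

/-- The elementary tensor `φ ⊗ ϕ`, i.e. the function `p ↦ φ(p) ϕ`. -/
def tensor (φ : L2Shell n m ℂ) (ϕ : V) : L2Shell n m V :=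
  MemLp.toLp (fun p => φ p • ϕ) (((ContinuousLinearMap.toSpanSingleton ℂ ϕ).comp_memLp' (Lp.memLp φ)))

lemma coeFn_tensor (φ : L2Shell n m ℂ) (ϕ : V) :
    tensor φ ϕ =ᵐ[shellMeasure n m] fun p => φ p • ϕ := MemLp.coeFn_toLp _

/-- The natural domain of `(R Φ)(p) = T U^α(A_p⁻¹) Φ(p)`: all `Φ` for which the right hand side is
defined for almost every `p` and is square integrable. -/
def intertwinerDomain (T : HLor pbar →ₗ.[ℂ] V) (α : PrincipalParam n) (A : BoostSection pbar) :
    Submodule ℂ (L2Shell n m (HLor pbar)) where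
  carrier := {Φ | ∃ Ψ : L2Shell n m V, ∀ᵐ p ∂shellMeasure n m,
    (ULor α (A.toFun p)⁻¹ (Φ p), Ψ p) ∈ T.graph}
  zero_mem' := ⟨0, by
    filter_upwards [Lp.coeFn_zero (HLor pbar) 2 (shellMeasure n m),
      Lp.coeFn_zero V 2 (shellMeasure n m)] with p h1 h2
    rw [h1, h2]
    simp⟩
  add_mem' := by
    rintro Φ Φ' ⟨Ψ, h⟩ ⟨Ψ', h'⟩
    refine ⟨Ψ + Ψ', ?_⟩
    filter_upwards [h, h', Lp.coeFn_add Φ Φ', Lp.coeFn_add Ψ Ψ'] with p h1 h2 h3 h4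
    rw [h3, h4, Pi.add_apply, Pi.add_apply, map_add]
    exact T.graph.add_mem h1 h2
  smul_mem' := by
    rintro c Φ ⟨Ψ, h⟩
    refine ⟨c • Ψ, ?_⟩
    filter_upwards [h, Lp.coeFn_smul c Φ, Lp.coeFn_smul c Ψ] with p h1 h3 h4
    rw [h3, h4, Pi.smul_apply, Pi.smul_apply, map_smul]
    exact T.graph.smul_mem c h1

lemma intertwiner_unique {T : HLor pbar →ₗ.[ℂ] V} {α : PrincipalParam n} {A : BoostSection pbar}
    {Φ : L2Shell n m (HLor pbar)} {Ψ Ψ' : L2Shell n m V}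
    (h : ∀ᵐ p ∂shellMeasure n m, (ULor α (A.toFun p)⁻¹ (Φ p), Ψ p) ∈ T.graph)
    (h' : ∀ᵐ p ∂shellMeasure n m, (ULor α (A.toFun p)⁻¹ (Φ p), Ψ' p) ∈ T.graph) : Ψ = Ψ' := by
  ext1
  filter_upwards [h, h'] with p h1 h2
  exact T.mem_graph_snd_inj h1 h2 rfl

/-- The operator `R^α`, `(R Φ)(p) = T U^α(A_p⁻¹) Φ(p)`, on its natural domain; in particular
`(R (φ ⊗ ϕ))(p) = φ(p) T U^α(A_p⁻¹) ϕ`. -/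
def intertwiner (T : HLor pbar →ₗ.[ℂ] V) (α : PrincipalParam n) (A : BoostSection pbar) :
    L2Shell n m (HLor pbar) →ₗ.[ℂ] L2Shell n m V where
  domain := intertwinerDomain T α A
  toFun :=
    { toFun := fun Φ => Classical.choose Φ.2
      map_add' := fun Φ Φ' => intertwiner_unique (Classical.choose_spec (Φ + Φ').2) (by
        filter_upwards [Classical.choose_spec Φ.2, Classical.choose_spec Φ'.2,
          Lp.coeFn_add Φ.1 Φ'.1, Lp.coeFn_add (Classical.choose Φ.2) (Classical.choose Φ'.2)]
          with p h1 h2 h3 h4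
        rw [Submodule.coe_add, h3, h4, Pi.add_apply, Pi.add_apply, map_add]
        exact T.graph.add_mem h1 h2)
      map_smul' := fun c Φ => intertwiner_unique (Classical.choose_spec (c • Φ).2) (by
        filter_upwards [Classical.choose_spec Φ.2,
          Lp.coeFn_smul c Φ.1, Lp.coeFn_smul c (Classical.choose Φ.2)] with p h1 h3 h4
        rw [RingHom.id_apply, Submodule.coe_smul, h3, h4, Pi.smul_apply, Pi.smul_apply, map_smul]
        exact T.graph.smul_mem c h1) }

lemma intertwiner_spec (T : HLor pbar →ₗ.[ℂ] V) (α : PrincipalParam n) (A : BoostSection pbar)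
    (Φ : (intertwiner T α A).domain) : ∀ᵐ p ∂shellMeasure n m,
      ∃ h : ULor α (A.toFun p)⁻¹ (Φ.1 p) ∈ T.domain,
        intertwiner T α A Φ p = T ⟨ULor α (A.toFun p)⁻¹ (Φ.1 p), h⟩ := by
  have h : ∀ᵐ p ∂shellMeasure n m,
      (ULor α (A.toFun p)⁻¹ (Φ.1 p), intertwiner T α A Φ p) ∈ T.graph := Classical.choose_spec Φ.2
  filter_upwards [h] with p hp
  obtain ⟨y, h1, h2⟩ := (LinearPMap.mem_graph_iff T).1 hp
  have h1 : (y : HLor pbar) = ULor α (A.toFun p)⁻¹ (Φ.1 p) := h1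
  refine ⟨by rw [← h1]; exact y.2, ?_⟩
  have h2 : T y = intertwiner T α A Φ p := h2
  rw [← h2]
  congr 1
  exact Subtype.ext h1

lemma intertwiner_tensor (T : HLor pbar →ₗ.[ℂ] V) (α : PrincipalParam n) (A : BoostSection pbar)
    (φ : L2Shell n m ℂ) (ϕ : HLor pbar) (h : tensor φ ϕ ∈ (intertwiner T α A).domain) :
    ∀ᵐ p ∂shellMeasure n m, φ p ≠ 0 → ∃ h' : ULor α (A.toFun p)⁻¹ ϕ ∈ T.domain,
      intertwiner T α A ⟨tensor φ ϕ, h⟩ p = φ p • T ⟨ULor α (A.toFun p)⁻¹ ϕ, h'⟩ := by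
  filter_upwards [intertwiner_spec T α A ⟨tensor φ ϕ, h⟩, coeFn_tensor φ ϕ] with p hp h2 h0
  obtain ⟨h1, e⟩ := hp
  have h3 : ULor α (A.toFun p)⁻¹ (tensor φ ϕ p) = φ p • ULor α (A.toFun p)⁻¹ ϕ := by
    rw [h2, map_smul]
  have h4 : ULor α (A.toFun p)⁻¹ ϕ ∈ T.domain := by
    have h5 : φ p • ULor α (A.toFun p)⁻¹ ϕ ∈ T.domain := by rw [← h3]; exact h1
    exact (Submodule.smul_mem_iff _ h0).1 h5
  refine ⟨h4, ?_⟩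
  rw [e, ← T.map_smul]
  congr 1
  exact Subtype.ext h3


/-- The labels `κ` of the direct integral decomposition for `m = 0`: the real line in `d = 3`, the
positive half-line in `d = 4`. -/
def labels (n : ℕ) : Set ℝ := if n = 1 then Set.univ else Set.Ioi 0

/-- There is a decomposition `W` of the restriction of `U^α` to the little group into a direct
integral, with respect to Lebesgue measure on the set of labels, of a strongly continuous field
`k ↦ E k` of irreducible representations, `D` is the fibre at a label `κ`, and `T` is the evaluation
`ψ ↦ (W ψ)(κ)` on vectors `ψ` for which `W ψ` is continuous at `κ`. -/
def IsDirectIntegralFibre (D : UnitaryRep (LittleGroup pbar) V) (T : HLor pbar →ₗ.[ℂ] V) : Prop :=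
  ∃ (κ : ℝ) (E : ℝ → UnitaryRep (LittleGroup pbar) V)
    (W : HLor pbar ≃ₗᵢ[ℂ] Lp V 2 (volume.restrict (labels n))),
    κ ∈ labels n ∧ E κ = D ∧
    (∀ k ∈ labels n, (E k).Irreducible) ∧
    (∀ g x, ContinuousOn (fun k => (E k).toHom g x) (labels n)) ∧
    (∀ (α : PrincipalParam n) (g : LittleGroup pbar) (ψ : HLor pbar),
      ∀ᵐ k ∂volume.restrict (labels n), W (ULor α g.1 ψ) k = (E k).toHom g (W ψ k)) ∧
    ∀ ψ : T.domain, ∃ f : ℝ → V,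
      f =ᵐ[volume.restrict (labels n)] W ψ.1 ∧ ContinuousAt f κ ∧ f κ = T ψ

/-- `D` is a subrepresentation of the restriction of `U^α` to the little group, by means of an
isometric embedding `ι`, and `T` is the everywhere defined partial isometry `ι*`. -/
def IsSubrepProjection (D : UnitaryRep (LittleGroup pbar) V) (T : HLor pbar →ₗ.[ℂ] V) : Prop :=
  T.domain = ⊤ ∧ ∃ ι : V →ₗᵢ[ℂ] HLor pbar,
    (∀ (α : PrincipalParam n) (g : LittleGroup pbar) (x : V),
      ι (D.toHom g x) = ULor α g.1 (ι x)) ∧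
    ∀ (x : V) (ψ : T.domain), inner ℂ x (T ψ) = inner ℂ (ι x) ψ.1

end Representations

end Wigner

end

open Wigner

/-!
The construction rests on a nonzero vector `ξ` of the representation space that is invariant under
the stabilizer, in the little group, of one point `origin pbar` of the cycle
`{q ∈ H₀⁺ : pbar · q = 1}`. The little group acts transitively on the cycle, so `D(g) ξ` is a
function of `q = g • origin pbar` (`orbitVec`). Since the measure of the cycle is invariant, the
operator `T ψ = ∫ ψ(q) D(g_q) ξ dq`, defined on those square integrable functions that are also
integrable, satisfies `D(g) T = T U^α(g)`. The degree `α` plays no role for transformations that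
fix `pbar`.

*The anti-unitary operator.* The element `j₀ g j₀` differs from `g⁻¹` only by factors from the
stabilizer of `origin pbar`, so `⟪ξ, D(j₀ g j₀) ξ⟫` is the complex conjugate of `⟪ξ, D(g) ξ⟫`. Hence
`D(g) ξ ↦ D(j₀ g j₀) ξ` extends to an antilinear isometry `V(j₀)`
(`FixedVector.exists_conjugation`), and `V(j₀) T = T U^α(j₀)` is immediate.

*Existence of `ξ`* (`exists_fixedVector`). In three dimensions the stabilizer is trivial. In four
dimensions it consists of the rotations in the transverse plane. For `m > 0` the little group is a
compact group of rotations of space which is transitive on directions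
(`exists_invariant_of_rotations`). Some average of an orbit of the representation, weighted by a
product of matrix entries, is not zero; for a product with the smallest number of factors,
polarization allows one to take all entries from the same row, and such an average is invariant
under the rotations about an axis. For `m = 0` the little group is the Euclidean motion group of the
plane. There the rotation averages of the translations are operators between the weight spaces of
the rotations; Schur's lemma shows that the products of such an operator with its adjoint are
scalars, and connects a given weight space to that of weight zero (`MotionGroup.exists_frequency`).
This also computes the Gram function of `ξ` on the translations: it is the average of a character
over a circle.

*Positive mass.* For a suitable multiple of `ξ` the adjoint of `T` is an isometry, by Schur's lemma
applied to `T T*`; `T` is bounded because the cycle has finite measure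
(`FixedVector.isSubrepProjection`).

*Zero mass.* The null rotations act simply transitively on the cycle, which they identify with the
Euclidean transverse space `ℝ^{d-2}`, and the measure of the cycle becomes a multiple of Lebesgue
measure. In these coordinates the representations of the little group that belong to different radii
`k` differ by a dilation (if `d = 4`; if `d = 3`, they are the characters), and `T` for the radius
`k` is the Fourier transform evaluated on the sphere of radius `k` (at the point `k` if `d = 3`).
Plancherel's theorem in polar coordinates then gives an isometry from `L²` of the cycle to the
direct integral. Its image contains the sections `h(k) D_k(g) ξ` with test functions `h`, up to a
nonvanishing density, and is therefore everything, because the orbit of `ξ` is total in every fibre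
(`SphericalField.isDirectIntegralFibre`, with the fields provided by
`exists_isDirectIntegralFibre_one` and `exists_isDirectIntegralFibre_two`).

*The intertwiner `R^α`.* Its intertwining relations follow pointwise from those of `T` and from the
definition of the Wigner rotation (`intertwiner_U0tensor`, `intertwiner_U0tensorDown`). For the
density of the elementary tensors (`dense_tensor_intertwiner`) one uses functions on the cycle of
bounded energy, supported away from the direction of `p`: for `m = 0` the operator `U^α(A_p⁻¹)` is
singular there and may lead out of the integrable functions.
-/

noncomputable section
namespace Wigner

/-! ### Unitary representations and Schur's lemma -/

namespace UnitaryRep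

variable {G : Type*} [Group G] [TopologicalSpace G] {V : Type*}
    [NormedAddCommGroup V] [InnerProductSpace ℂ V]

/-- The operator `D(g)` as a bounded operator. -/
def op (D : UnitaryRep G V) (g : G) : V →L[ℂ] V :=
  (D.toHom g).toContinuousLinearEquiv.toContinuousLinearMap

@[simp] lemma op_apply (D : UnitaryRep G V) (g : G) (x : V) : D.op g x = D.toHom g x := rfl

lemma toHom_mul_apply (D : UnitaryRep G V) (g h : G) (x : V) :
    D.toHom (g * h) x = D.toHom g (D.toHom h x) := by rw [map_mul]; rfl

@[simp] lemma toHom_one_apply (D : UnitaryRep G V) (x : V) : D.toHom 1 x = x := by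
  rw [map_one]; rfl

@[simp] lemma toHom_apply_inv_apply (D : UnitaryRep G V) (g : G) (x : V) :
    D.toHom g (D.toHom g⁻¹ x) = x := by
  rw [← toHom_mul_apply, mul_inv_cancel, toHom_one_apply]

lemma inner_toHom_left (D : UnitaryRep G V) (g : G) (x y : V) :
    inner ℂ (D.toHom g x) y = inner ℂ x (D.toHom g⁻¹ y) := by
  conv_lhs => rw [← D.toHom_apply_inv_apply g y, LinearIsometryEquiv.inner_map_map]

lemma inner_toHom_toHom (D : UnitaryRep G V) (g h : G) (x y : V) :
    inner ℂ (D.toHom g x) (D.toHom h y) = inner ℂ x (D.toHom (g⁻¹ * h) y) := by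
  rw [inner_toHom_left, toHom_mul_apply]

/-- A closed invariant subspace that contains a nonzero vector is everything. -/
lemma Irreducible.eq_top {D : UnitaryRep G V} (hD : D.Irreducible) {K : Submodule ℂ V}
    (hK : IsClosed (K : Set V)) (hinv : ∀ g, ∀ x ∈ K, D.toHom g x ∈ K) {x : V} (hx : x ∈ K)
    (hx0 : x ≠ 0) : K = ⊤ := by
  refine (hD.2 K hK hinv).resolve_left fun h => hx0 ?_
  rwa [h, Submodule.mem_bot] at hx

/-- The orbit of a nonzero vector under an irreducible representation is total. -/
lemma Irreducible.span_orbit {D : UnitaryRep G V} (hD : D.Irreducible) {x : V} (hx0 : x ≠ 0) :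
    (Submodule.span ℂ (Set.range fun g => D.toHom g x)).topologicalClosure = ⊤ := by
  refine hD.eq_top (Submodule.isClosed_topologicalClosure _) (fun g y hy => ?_)
    (Submodule.le_topologicalClosure _ (Submodule.subset_span ⟨1, D.toHom_one_apply x⟩)) hx0
  refine map_mem_closure (D.toHom g).continuous hy fun z hz => ?_
  induction hz using Submodule.span_induction with
  | mem z hz =>
    obtain ⟨h, rfl⟩ := hz
    exact Submodule.subset_span ⟨g * h, D.toHom_mul_apply g h x⟩
  | zero => rw [map_zero]; exact Submodule.zero_mem _
  | add a b _ _ ha hb => rw [map_add]; exact Submodule.add_mem _ ha hb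
  | smul c a _ ha => rw [map_smul]; exact Submodule.smul_mem _ c ha

/-- A vector orthogonal to the orbit of a nonzero vector vanishes. -/
lemma Irreducible.eq_zero_of_inner_orbit {D : UnitaryRep G V} (hD : D.Irreducible) {x : V}
    (hx0 : x ≠ 0) {y : V} (hy : ∀ g, inner ℂ (D.toHom g x) y = 0) : y = 0 := by
  have h : y ∈ ((Submodule.span ℂ (Set.range fun g => D.toHom g x)).topologicalClosure)ᗮ := by
    rw [Submodule.orthogonal_closure, Submodule.mem_orthogonal]
    intro u hu
    induction hu using Submodule.span_induction with
    | mem z hz => obtain ⟨g, rfl⟩ := hz; exact hy g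
    | zero => exact inner_zero_left _
    | add a b _ _ ha hb => rw [inner_add_left, ha, hb, add_zero]
    | smul c a _ ha => rw [inner_smul_left, ha, mul_zero]
  rwa [hD.span_orbit hx0, Submodule.top_orthogonal_eq_bot, Submodule.mem_bot] at h

/-- Schur's lemma for a normal operator: if its spectrum had two points, two continuous functions
with disjoint supports would produce a proper closed invariant subspace. -/
theorem Irreducible.exists_eq_smul_one [CompleteSpace V] {D : UnitaryRep G V} (hD : D.Irreducible)
    (S : V →L[ℂ] V) (hn : IsStarNormal S) (hS : ∀ g x, S (D.toHom g x) = D.toHom g (S x)) :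
    ∃ c : ℂ, S = c • 1 := by
  have : Nontrivial V := hD.1
  obtain ⟨a, ha⟩ := spectrum.nonempty S
  by_cases h1 : ∀ b ∈ spectrum ℂ S, b = a
  · refine ⟨a, ?_⟩
    calc S = cfc (id : ℂ → ℂ) S := (cfc_id ℂ S hn).symm
      _ = cfc (fun _ : ℂ => a) S := cfc_congr fun b hb => h1 b hb
      _ = a • 1 := by rw [cfc_const a S hn, Algebra.algebraMap_eq_smul_one]
  exfalso
  push Not at h1
  obtain ⟨b, hb, hab⟩ := h1
  have hr : 0 < ‖b - a‖ := norm_pos_iff.2 (sub_ne_zero.2 hab)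
  let f : ℂ → ℂ → ℂ := fun p z => ((max 0 (‖b - a‖ / 2 - ‖z - p‖) : ℝ) : ℂ)
  have hf : ∀ p, Continuous (f p) := fun p => by fun_prop
  have hcomm : ∀ p g, Commute (cfc (f p) S) (D.op g) := fun p g => by
    have e1 : ∀ g, Commute S (D.op g) := fun g => ContinuousLinearMap.ext fun x => hS g x
    have e2 : star (D.op g⁻¹) = D.op g := by
      refine (ContinuousLinearMap.eq_adjoint_iff _ _).2 (fun x y => ?_) |>.symm
      simp only [op_apply]
      rw [inner_toHom_left]
    refine Commute.cfc (e1 g) ?_ _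
    rw [← e2]
    exact (e1 g⁻¹).star_star
  have hne : ∀ p ∈ spectrum ℂ S, cfc (f p) S ≠ 0 := fun p hp h0 => by
    have h2 : f p p ∈ spectrum ℂ (cfc (f p) S) := by
      rw [cfc_map_spectrum (f p) S hn (hf p).continuousOn]
      exact ⟨p, hp, rfl⟩
    rw [h0, spectrum.zero_eq] at h2
    have h3 : f p p = 0 := h2
    simp only [f, sub_self, norm_zero, sub_zero, Complex.ofReal_eq_zero] at h3
    rw [max_eq_right (by positivity)] at h3
    linarith
  have hmul : cfc (f a) S * cfc (f b) S = 0 := by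
    rw [← cfc_mul _ _ S (hf a).continuousOn (hf b).continuousOn]
    have : (fun x => f a x * f b x) = fun _ => 0 := by
      funext z
      simp only [f, ← Complex.ofReal_mul, Complex.ofReal_eq_zero, mul_eq_zero]
      have := norm_sub_le (z - a) (z - b)
      rw [_root_.sub_sub_sub_cancel_left] at this
      by_cases h : ‖b - a‖ / 2 ≤ ‖z - a‖
      · left; exact max_eq_left (by linarith)
      · right; exact max_eq_left (by linarith)
    rw [this]; exact cfc_const_zero ℂ S
  rcases hD.2 ((cfc (f a) S).ker) (cfc (f a) S).isClosed_ker
    (fun g x hx => by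
      rw [LinearMap.mem_ker] at hx ⊢
      have := congrArg (fun A : V →L[ℂ] V => A x) (hcomm a g)
      simp only [mul_apply_eq_comp, op_apply] at this
      change cfc (f a) S x = 0 at hx
      change cfc (f a) S (D.toHom g x) = 0
      rw [this, hx, map_zero]) with h | h
  · refine hne b hb (ContinuousLinearMap.ext fun x => ?_)
    have h2 : cfc (f b) S x ∈ (cfc (f a) S).ker :=
      congrArg (fun A : V →L[ℂ] V => A x) hmul
    rw [h, Submodule.mem_bot] at h2
    exact h2
  · refine hne a ha (ContinuousLinearMap.ext fun x => ?_)
    have : x ∈ (cfc (f a) S).ker := h ▸ Submodule.mem_top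
    exact this

end UnitaryRep

/-- Two families with complex conjugate Gram matrices and total linear spans are exchanged by an
antilinear isometry. -/
lemma exists_antilinear_of_gram {ι V : Type*} [NormedAddCommGroup V] [InnerProductSpace ℂ V]
    [CompleteSpace V] (v w : ι → V)
    (hv : (Submodule.span ℂ (Set.range v)).topologicalClosure = ⊤)
    (h : ∀ i j, inner ℂ (w i) (w j) = conj (inner ℂ (v i) (v j))) :
    ∃ J : V →SL[starRingEnd ℂ] V, (∀ i, J (v i) = w i) ∧ ∀ x, ‖J x‖ = ‖x‖ := by
  let e : (ι →₀ ℂ) →ₗ[ℂ] V := Finsupp.linearCombination ℂ v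
  let f : (ι →₀ ℂ) →ₛₗ[starRingEnd ℂ] V :=
    { toFun := fun c => c.sum fun i z => conj z • w i
      map_add' := fun c c' => Finsupp.sum_add_index' (by simp) (by simp [add_smul])
      map_smul' := fun z c => by
        rw [Finsupp.sum_smul_index' (by simp), Finsupp.smul_sum]
        simp [mul_smul] }
  have hd : DenseRange e := by
    have h1 : (LinearMap.range e : Submodule ℂ V) = Submodule.span ℂ (Set.range v) :=
      Finsupp.range_linearCombination _
    have h2 : Set.range e = ((LinearMap.range e : Submodule ℂ V) : Set V) := rfl
    rw [DenseRange, h2, h1]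
    exact Submodule.dense_iff_topologicalClosure_eq_top.2 hv
  have hnorm : ∀ c, ‖f c‖ = ‖e c‖ := fun c => by
    have h1 : inner ℂ (f c) (f c) = conj (inner ℂ (e c) (e c)) := by
      change inner ℂ (c.sum fun i z => conj z • w i) (c.sum fun i z => conj z • w i) =
        conj (inner ℂ (c.sum fun i z => z • v i) (c.sum fun i z => z • v i))
      simp only [Finsupp.sum, sum_inner, inner_sum, inner_smul_left, inner_smul_right, h, map_sum,
        map_mul, Complex.conj_conj]
    rw [inner_self_eq_norm_sq_to_K, inner_self_eq_norm_sq_to_K] at h1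
    have h2 : ‖f c‖ ^ 2 = ‖e c‖ ^ 2 := by
      have : ((‖f c‖ ^ 2 : ℝ) : ℂ) = ((‖e c‖ ^ 2 : ℝ) : ℂ) := by simpa using h1
      exact_mod_cast this
    exact (sq_eq_sq₀ (norm_nonneg _) (norm_nonneg _)).1 h2
  have hJ : ∀ c, f.extendOfNorm e (e c) = f c :=
    fun c => LinearMap.extendOfNorm_eq hd ⟨1, fun x => by rw [hnorm, one_mul]⟩ c
  refine ⟨f.extendOfNorm e, fun i => ?_, fun x => ?_⟩
  · have h1 : e (Finsupp.single i 1) = v i := by simp [e]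
    have h2 : f (Finsupp.single i 1) = w i := by simp [f]
    rw [← h1, hJ, h2]
  · refine hd.induction_on (p := fun x => ‖f.extendOfNorm e x‖ = ‖x‖) x
      (isClosed_eq (by fun_prop) (by fun_prop)) fun c => ?_
    rw [hJ, hnorm]

/-! ### Minkowski geometry -/

section Mdot
variable {n : ℕ} (x y z : Mink n) (t : ℝ)

lemma mdot_comm : mdot x y = mdot y x := by
  simp only [mdot, mul_comm]

lemma mdot_add_right : mdot x (y + z) = mdot x y + mdot x z := by
  simp only [mdot, Pi.add_apply, mul_add, Finset.sum_add_distrib]; ring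

lemma mdot_add_left : mdot (x + y) z = mdot x z + mdot y z := by
  rw [mdot_comm, mdot_add_right, mdot_comm z, mdot_comm z]

lemma mdot_smul_left : mdot (t • x) y = t * mdot x y := by
  rw [mdot_comm, mdot_smul, mdot_comm]

lemma mdot_neg_right : mdot x (-y) = -mdot x y := by
  rw [← neg_one_smul ℝ y, mdot_smul]; ring

lemma mdot_sub_right : mdot x (y - z) = mdot x y - mdot x z := by
  rw [sub_eq_add_neg, mdot_add_right, mdot_neg_right]; ring

lemma mdot_sub_left : mdot (x - y) z = mdot x z - mdot y z := by
  rw [mdot_comm, mdot_sub_right, mdot_comm z, mdot_comm z]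

lemma mdot_eq : mdot x y = x 0 * y 0 - x 1 * y 1 - ∑ i : Fin n, x i.succ.succ * y i.succ.succ := by
  rw [mdot, Fin.sum_univ_succ]
  simp only [Fin.succ_zero_eq_one]
  ring

lemma continuous_mdot : Continuous fun p : Mink n × Mink n => mdot p.1 p.2 := by
  unfold mdot; fun_prop

lemma dotProduct_signature : (fun i => signature n i * x i) ⬝ᵥ y = mdot x y := by
  rw [mdot_eq_sum, dotProduct]
  exact Finset.sum_congr rfl fun i _ => by ring

end Mdot

lemma mdot_nonneg {n : ℕ} {v z : Mink n} (hv : 0 ≤ mdot v v) (hv0 : 0 ≤ v 0) (hz : 0 ≤ mdot z z)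
    (hz0 : 0 ≤ z 0) : 0 ≤ mdot v z := by
  simp only [mdot, ← pow_two] at hv hz ⊢
  have h := Finset.sum_mul_sq_le_sq_mul_sq Finset.univ (fun i : Fin (n + 1) => v i.succ)
    fun i => z i.succ
  have h2 : (∑ i : Fin (n + 1), v i.succ * z i.succ) ^ 2 ≤ (v 0 * z 0) ^ 2 := by
    refine h.trans ?_
    rw [mul_pow]
    exact mul_le_mul (by linarith) (by linarith) (Finset.sum_nonneg fun i _ => sq_nonneg _)
      (sq_nonneg _)
  have := abs_le_of_sq_le_sq h2 (by positivity)
  linarith [le_abs_self (∑ i : Fin (n + 1), v i.succ * z i.succ)]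

/-- Two forward causal vectors are orthogonal only if they are parallel. -/
lemma eq_smul_of_mdot_nonpos {n : ℕ} {v x : Mink n} (hv : ForwardCausal v) (hx : ForwardCausal x)
    (h : mdot v x ≤ 0) : x = (x 0 / v 0) • v := by
  obtain ⟨hvv, hv0⟩ := hv
  obtain ⟨hxx, hx0⟩ := hx
  simp only [mdot, ← pow_two] at hvv hxx h
  have hsum : ∑ i : Fin (n + 1), (v 0 * x i.succ - x 0 * v i.succ) ^ 2 ≤ 0 := by
    have : ∑ i : Fin (n + 1), (v 0 * x i.succ - x 0 * v i.succ) ^ 2 =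
        v 0 ^ 2 * ∑ i : Fin (n + 1), x i.succ ^ 2 + x 0 ^ 2 * ∑ i : Fin (n + 1), v i.succ ^ 2
          - 2 * (v 0 * x 0) * ∑ i : Fin (n + 1), v i.succ * x i.succ := by
      simp only [Finset.mul_sum, ← Finset.sum_add_distrib, ← Finset.sum_sub_distrib]
      exact Finset.sum_congr rfl fun i _ => by ring
    rw [this]
    nlinarith [mul_le_mul_of_nonneg_left (sub_nonpos.1 h) (mul_nonneg hv0.le hx0.le),
      mul_le_mul_of_nonneg_left (sub_nonneg.1 hvv) (sq_nonneg (x 0)),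
      mul_le_mul_of_nonneg_left (sub_nonneg.1 hxx) (sq_nonneg (v 0))]
  have hz : ∀ i : Fin (n + 1), v 0 * x i.succ - x 0 * v i.succ = 0 := fun i => by
    have := (Finset.sum_eq_zero_iff_of_nonneg (fun i _ => sq_nonneg _)).1
      (le_antisymm hsum (Finset.sum_nonneg fun i _ => sq_nonneg _)) i (Finset.mem_univ i)
    exact pow_eq_zero_iff two_ne_zero |>.1 this
  funext i
  refine Fin.cases ?_ (fun i => ?_) i
  · simp only [Pi.smul_apply, smul_eq_mul]; field_simp
  · have := hz i
    simp only [Pi.smul_apply, smul_eq_mul]; field_simp; linarith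

section Matrices
variable {n : ℕ}

lemma transpose_mul_signature_mul_of {M : Matrix (Fin (n + 2)) (Fin (n + 2)) ℝ}
    (h : ∀ x y : Mink n, mdot (M *ᵥ x) (M *ᵥ y) = mdot x y) :
    Mᵀ * (diagonal (signature n) * M) = diagonal (signature n) := by
  have hd : ∀ M : Matrix (Fin (n + 2)) (Fin (n + 2)) ℝ, ∀ i j,
      (M.transpose * (diagonal (signature n) * M)) i j =
        mdot (M *ᵥ (Pi.single i 1 : Mink n)) (M *ᵥ (Pi.single j 1 : Mink n)) := by
    intro M i j
    rw [Matrix.mul_apply]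
    simp only [Matrix.diagonal_mul, Matrix.transpose_apply]
    simp [mdot_eq_sum]
  ext i j
  rw [hd, h]
  have := hd 1 i j
  rw [Matrix.one_mulVec, Matrix.one_mulVec] at this
  rw [Matrix.transpose_one, Matrix.one_mul, Matrix.mul_one] at this
  exact this.symm

lemma signature_mul_self (n : ℕ) : diagonal (signature n) * diagonal (signature n) = 1 := by
  rw [diagonal_mul_diagonal, ← diagonal_one]
  congr 1
  funext i
  refine Fin.cases ?_ (fun j => ?_) i <;> simp [signature]

/-- A matrix that preserves the Minkowski product, as an invertible matrix. -/
def lorentzGL (M : Matrix (Fin (n + 2)) (Fin (n + 2)) ℝ)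
    (h : ∀ x y : Mink n, mdot (M *ᵥ x) (M *ᵥ y) = mdot x y) : GL (Fin (n + 2)) ℝ :=
  have h1 : diagonal (signature n) * (Mᵀ * diagonal (signature n)) * M = 1 := by
    rw [Matrix.mul_assoc, Matrix.mul_assoc, transpose_mul_signature_mul_of h, signature_mul_self]
  ⟨M, diagonal (signature n) * (Mᵀ * diagonal (signature n)), mul_eq_one_comm.1 h1, h1⟩

lemma inv_eq_of_mem_orthochronous {g : GL (Fin (n + 2)) ℝ} (hg : g ∈ orthochronous n) :
    (g⁻¹).1 = diagonal (signature n) * ((g.1)ᵀ * diagonal (signature n)) := by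
  have h : g = lorentzGL g.1 hg.1 := Units.ext rfl
  conv_lhs => rw [h]
  rfl

/-- A Lorentz transformation that fixes a forward causal vector preserves the time direction. -/
lemma mem_orthochronous_of_fix {v : Mink n} (hv : ForwardCausal v) {g : GL (Fin (n + 2)) ℝ}
    (h : ∀ x y : Mink n, mdot (g.1 *ᵥ x) (g.1 *ᵥ y) = mdot x y) (hgv : g.1 *ᵥ v = v) :
    g ∈ orthochronous n := by
  refine ⟨h, fun x hx hx0 => ?_⟩
  by_contra hneg
  have hneg := not_lt.1 hneg
  have h1 : 0 ≤ mdot v (-(g.1 *ᵥ x)) := by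
    refine mdot_nonneg hv.1 hv.2.le ?_ (by simpa using hneg)
    rw [mdot_neg_right, mdot_comm, mdot_neg_right, neg_neg, h]
    exact hx
  rw [mdot_neg_right] at h1
  nth_rewrite 1 [← hgv] at h1
  rw [h] at h1
  have h2 := eq_smul_of_mdot_nonpos hv ⟨hx, hx0⟩ (by linarith)
  rw [h2, mulVec_smul, hgv, ← h2] at hneg
  linarith

lemma isInducing_orthochronous : Topology.IsInducing fun g : orthochronous n => g.1.1 := by
  have key : ∀ t : TopologicalSpace (orthochronous n),
      (@Continuous _ _ t _ fun g : orthochronous n => g.1.1) →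
      @Continuous _ _ t instTopologicalSpaceSubtype (id : orthochronous n → orthochronous n) := by
    intro t ht
    refine continuous_induced_rng.2 (Units.continuous_iff.2 ⟨ht, ?_⟩)
    have : (fun g : orthochronous n => ((g.1)⁻¹).1) = fun g : orthochronous n =>
        diagonal (signature n) * ((g.1.1)ᵀ * diagonal (signature n)) :=
      funext fun g => inv_eq_of_mem_orthochronous g.2
    change Continuous fun g : orthochronous n => ((g.1)⁻¹).1
    rw [this]
    exact continuous_const.matrix_mul (ht.matrix_transpose.matrix_mul continuous_const)
  refine ⟨le_antisymm ?_ ?_⟩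
  · exact continuous_iff_le_induced.1 (Units.continuous_val.comp continuous_subtype_val)
  · exact continuous_id_iff_le.1 (key _ continuous_induced_dom)

end Matrices

section Little
variable {n : ℕ} {m : ℝ} {pbar : MassShell n m}

/-- The matrix of an element of the little group. -/
def lmat (g : LittleGroup pbar) : Matrix (Fin (n + 2)) (Fin (n + 2)) ℝ := g.1.1.1.1

lemma isInducing_lmat :
    Topology.IsInducing (lmat : LittleGroup pbar → _) :=
  isInducing_orthochronous.comp
    (Topology.IsInducing.subtypeVal.comp Topology.IsInducing.subtypeVal)

lemma continuous_lmat : Continuous (lmat : LittleGroup pbar → _) :=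
  isInducing_lmat.continuous

lemma lmat_ext {g h : LittleGroup pbar} (H : lmat g = lmat h) : g = h :=
  Subtype.ext (Subtype.ext (Subtype.ext (Units.ext H)))

@[simp] lemma lmat_mul (g h : LittleGroup pbar) : lmat (g * h) = lmat g * lmat h := rfl

@[simp] lemma lmat_one : lmat (1 : LittleGroup pbar) = 1 := rfl

lemma lmat_inv_mul (g : LittleGroup pbar) : lmat g⁻¹ * lmat g = 1 := by
  rw [← lmat_mul, inv_mul_cancel, lmat_one]

lemma lmat_mul_inv (g : LittleGroup pbar) : lmat g * lmat g⁻¹ = 1 := by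
  rw [← lmat_mul, mul_inv_cancel, lmat_one]

@[simp] lemma lmat_inv_mulVec_mulVec (g : LittleGroup pbar) (x : Mink n) :
    lmat g⁻¹ *ᵥ (lmat g *ᵥ x) = x := by
  rw [mulVec_mulVec, lmat_inv_mul, one_mulVec]

@[simp] lemma lmat_mulVec_inv_mulVec (g : LittleGroup pbar) (x : Mink n) :
    lmat g *ᵥ (lmat g⁻¹ *ᵥ x) = x := by
  rw [mulVec_mulVec, lmat_mul_inv, one_mulVec]

lemma lmat_mulVec_base (g : LittleGroup pbar) : lmat g *ᵥ pbar.1 = pbar.1 :=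
  congrArg Subtype.val (g.2 : g.1 • pbar = pbar)

lemma mdot_lmat (g : LittleGroup pbar) (x y : Mink n) :
    mdot (lmat g *ᵥ x) (lmat g *ᵥ y) = mdot x y := g.1.1.2.1 x y

lemma det_lmat (g : LittleGroup pbar) : (lmat g).det = 1 := g.1.2

/-- The element of the little group with a given matrix. -/
def LittleGroup.ofMat (M : Matrix (Fin (n + 2)) (Fin (n + 2)) ℝ)
    (h : ∀ x y : Mink n, mdot (M *ᵥ x) (M *ᵥ y) = mdot x y) (hdet : M.det = 1)
    (hfix : M *ᵥ pbar.1 = pbar.1) : LittleGroup pbar :=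
  ⟨⟨⟨lorentzGL M h, mem_orthochronous_of_fix pbar.forwardCausal h hfix⟩, hdet⟩,
    MulAction.mem_stabilizer_iff.2 (Subtype.ext hfix)⟩

/-- The cycle `{q ∈ H₀⁺ : pbar · q = 1}`. -/
def cycle (pbar : MassShell n m) : Set (Mink n) :=
  {q | mdot q q = 0 ∧ 0 < q 0 ∧ mdot pbar.1 q = 1}

lemma cycle.forwardCausal {q : Mink n} (hq : q ∈ cycle pbar) : ForwardCausal q :=
  ⟨hq.1.ge, hq.2.1⟩

lemma lmat_mulVec_mem_cycle (g : LittleGroup pbar) {q : Mink n} (hq : q ∈ cycle pbar) :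
    lmat g *ᵥ q ∈ cycle pbar := by
  refine ⟨by rw [mdot_lmat, hq.1], g.1.1.2.2 q hq.1.ge hq.2.1, ?_⟩
  nth_rewrite 1 [← lmat_mulVec_base g]
  rw [mdot_lmat, hq.2.2]

lemma neg_j0_mulVec (x : Mink n) (i) :
    ((j0Down n).neg.1.1 *ᵥ x) i = (if i = 0 ∨ i = 1 then 1 else -1) * x i := by
  change ((-(j0 n)).1 *ᵥ x) i = _
  rw [Units.val_neg, neg_mulVec, Pi.neg_apply]
  change -((diagonal _) *ᵥ x) i = _
  rw [mulVec_diagonal]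
  split_ifs <;> simp

lemma base_apply (hp : (j0Down n).neg • pbar = pbar) (i : Fin (n + 2)) (h0 : i ≠ 0)
    (h1 : i ≠ 1) : pbar.1 i = 0 := by
  have h := congrFun (congrArg Subtype.val hp) i
  rw [coe_smul, neg_j0_mulVec, if_neg (by tauto)] at h
  linarith

/-- The sign of the first spatial component of the base point. -/
def baseSign (pbar : MassShell n m) : ℝ := if 0 ≤ pbar.1 1 then 1 else -1

/-- The normalisation `(pbar⁰ + |pbar¹|)⁻¹`. -/
def baseNorm (pbar : MassShell n m) : ℝ := (pbar.1 0 + |pbar.1 1|)⁻¹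

/-- The point of the cycle in the plane of `x⁰` and `x¹` that is farthest from the direction of
`pbar`; it is fixed by `-j₀`. -/
def origin (pbar : MassShell n m) : Mink n :=
  fun i => if i = 0 then baseNorm pbar else if i = 1 then -(baseSign pbar * baseNorm pbar) else 0

lemma baseSign_mul_self (pbar : MassShell n m) : baseSign pbar * baseSign pbar = 1 := by
  unfold baseSign; split_ifs <;> norm_num

lemma baseSign_mul (pbar : MassShell n m) : pbar.1 1 * baseSign pbar = |pbar.1 1| := by
  unfold baseSign
  split_ifs with h
  · rw [abs_of_nonneg h, mul_one]
  · rw [abs_of_neg (not_le.1 h)]; ring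

lemma baseNorm_pos (pbar : MassShell n m) : 0 < baseNorm pbar :=
  inv_pos.2 (add_pos_of_pos_of_nonneg pbar.2.2 (abs_nonneg _))

lemma baseNorm_mul (pbar : MassShell n m) : baseNorm pbar * (pbar.1 0 + |pbar.1 1|) = 1 :=
  inv_mul_cancel₀ (add_pos_of_pos_of_nonneg pbar.2.2 (abs_nonneg _)).ne'

@[simp] lemma origin_zero (pbar : MassShell n m) : origin pbar 0 = baseNorm pbar := if_pos rfl

@[simp] lemma origin_one (pbar : MassShell n m) :
    origin pbar 1 = -(baseSign pbar * baseNorm pbar) := by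
  rw [origin, if_neg (by simp), if_pos rfl]

lemma origin_apply (i : Fin (n + 2)) (h0 : i ≠ 0) (h1 : i ≠ 1) : origin pbar i = 0 := by
  rw [origin, if_neg h0, if_neg h1]

lemma mdot_origin (x : Mink n) :
    mdot x (origin pbar) = baseNorm pbar * (x 0 + baseSign pbar * x 1) := by
  rw [mdot_eq, Finset.sum_eq_zero fun i _ => by
    rw [origin_apply _ (Fin.succ_ne_zero _) (by simp [Fin.ext_iff]), mul_zero]]
  simp only [origin_zero, origin_one]
  ring

lemma origin_mem_cycle (pbar : MassShell n m) : origin pbar ∈ cycle pbar := by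
  refine ⟨?_, by simpa using baseNorm_pos pbar, ?_⟩
  · rw [mdot_origin, origin_zero, origin_one]
    linear_combination -baseNorm pbar ^ 2 * baseSign_mul_self pbar
  · rw [mdot_origin, mul_comm (baseSign pbar), baseSign_mul, baseNorm_mul]

lemma base_mul_self (hp : (j0Down n).neg • pbar = pbar) :
    pbar.1 0 ^ 2 - pbar.1 1 ^ 2 = m ^ 2 := by
  have h := pbar.2.1
  rw [mdot_eq, Finset.sum_eq_zero fun i _ => by
    rw [base_apply hp _ (Fin.succ_ne_zero _) (by simp [Fin.ext_iff]), mul_zero]] at h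
  linarith

/-- A linear map that fixes `pbar` and `origin pbar` fixes the plane of `x⁰` and `x¹`. -/
lemma mulVec_single_of_fix (hp : (j0Down n).neg • pbar = pbar)
    {M : Matrix (Fin (n + 2)) (Fin (n + 2)) ℝ} (h1 : M *ᵥ pbar.1 = pbar.1)
    (h2 : M *ᵥ origin pbar = origin pbar) :
    M *ᵥ Pi.single 0 1 = Pi.single 0 1 ∧ M *ᵥ Pi.single 1 1 = Pi.single 1 1 := by
  have e0 : (Pi.single 0 1 : Mink n) = baseNorm pbar • pbar.1 + |pbar.1 1| • origin pbar := by
    funext i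
    simp only [Pi.add_apply, Pi.smul_apply, smul_eq_mul]
    by_cases hi0 : i = 0
    · subst hi0; rw [Pi.single_eq_same, origin_zero, ← baseNorm_mul pbar]; ring
    by_cases hi1 : i = 1
    · subst hi1
      rw [Pi.single_eq_of_ne (by simp), origin_one, ← baseSign_mul]
      linear_combination baseNorm pbar * pbar.1 1 * baseSign_mul_self pbar
    · rw [Pi.single_eq_of_ne hi0, base_apply hp i hi0 hi1, origin_apply i hi0 hi1]; ring
  have e1 : (Pi.single 1 1 : Mink n) = (baseSign pbar * baseNorm pbar) • pbar.1 -
      (baseSign pbar * pbar.1 0) • origin pbar := by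
    funext i
    simp only [Pi.sub_apply, Pi.smul_apply, smul_eq_mul]
    by_cases hi0 : i = 0
    · subst hi0; rw [Pi.single_eq_of_ne (by simp), origin_zero]; ring
    by_cases hi1 : i = 1
    · subst hi1
      rw [Pi.single_eq_same, origin_one]
      have h3 := baseNorm_mul pbar
      rw [← baseSign_mul] at h3
      linear_combination -h3 - baseNorm pbar * pbar.1 0 * baseSign_mul_self pbar
    · rw [Pi.single_eq_of_ne hi1, base_apply hp i hi0 hi1, origin_apply i hi0 hi1]; ring
  constructor
  · rw [e0, mulVec_add, mulVec_smul, mulVec_smul, h1, h2]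
  · rw [e1, mulVec_sub, mulVec_smul, mulVec_smul, h1, h2]

lemma eq_origin_of_mdot {q : Mink n} (hq : q ∈ cycle pbar) (h : mdot (origin pbar) q = 0) :
    q = origin pbar := by
  have h1 := eq_smul_of_mdot_nonpos (cycle.forwardCausal (origin_mem_cycle pbar))
    (cycle.forwardCausal hq) h.le
  have h2 := hq.2.2
  rw [h1, mdot_smul, (origin_mem_cycle pbar).2.2, mul_one] at h2
  rw [h1, h2, one_smul]

/-- The reflection of the last coordinate. -/
def flipMat (n : ℕ) : Matrix (Fin (n + 2)) (Fin (n + 2)) ℝ :=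
  diagonal fun i => if i = Fin.last _ then -1 else 1

lemma flipMat_mulVec (x : Mink n) (i) :
    (flipMat n *ᵥ x) i = (if i = Fin.last _ then -1 else 1) * x i := mulVec_diagonal _ _ _

lemma flipMat_mul_self : flipMat n * flipMat n = 1 := by
  rw [flipMat, diagonal_mul_diagonal, ← diagonal_one]
  congr 1
  funext i
  split_ifs <;> norm_num

lemma flipMat_mdot (x y : Mink n) : mdot (flipMat n *ᵥ x) (flipMat n *ᵥ y) = mdot x y := by
  simp only [mdot_eq_sum, flipMat_mulVec]
  refine Finset.sum_congr rfl fun i _ => ?_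
  split_ifs <;> ring

lemma det_flipMat : (flipMat n).det = -1 := by
  rw [flipMat, det_diagonal, Finset.prod_ite_eq' Finset.univ (Fin.last (n + 1)) fun _ => (-1 : ℝ)]
  simp

lemma flipMat_fix [NeZero n] {x : Mink n} (hx : ∀ i, i ≠ 0 → i ≠ 1 → x i = 0) :
    flipMat n *ᵥ x = x := by
  funext i
  rw [flipMat_mulVec]
  split_ifs with h
  · have hn := NeZero.ne n
    rw [hx i (by rw [h]; simp [Fin.ext_iff]) (by rw [h]; simpa [Fin.ext_iff] using hn)]; ring
  · ring

/-- The Lorentz reflection along `d = q - origin pbar`, which exchanges two points of the cycle. -/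
def reflMat (pbar : MassShell n m) (q : Mink n) : Matrix (Fin (n + 2)) (Fin (n + 2)) ℝ :=
  1 + vecMulVec ((mdot (origin pbar) q)⁻¹ • (q - origin pbar))
    (fun i => signature n i * (q - origin pbar) i)

lemma reflMat_mulVec (q x : Mink n) : reflMat pbar q *ᵥ x =
    x + (mdot (q - origin pbar) x * (mdot (origin pbar) q)⁻¹) • (q - origin pbar) := by
  rw [reflMat, add_mulVec, one_mulVec, vecMulVec_mulVec, dotProduct_signature]
  simp [smul_smul]

section Refl
variable {q : Mink n}

lemma mdot_sub_origin_self (hq : q ∈ cycle pbar) : mdot (q - origin pbar) (q - origin pbar) =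
    -(2 * mdot (origin pbar) q) := by
  rw [mdot_sub_left, mdot_sub_right, mdot_sub_right, hq.1, (origin_mem_cycle pbar).1,
    mdot_comm q]
  ring

lemma reflMat_mdot (hq : q ∈ cycle pbar) (h : mdot (origin pbar) q ≠ 0) (x y : Mink n) :
    mdot (reflMat pbar q *ᵥ x) (reflMat pbar q *ᵥ y) = mdot x y := by
  rw [reflMat_mulVec, reflMat_mulVec]
  simp only [mdot_add_left, mdot_add_right, mdot_smul, mdot_smul_left, mdot_sub_origin_self hq]
  rw [mdot_comm x (q - origin pbar)]
  field_simp
  ring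

lemma det_reflMat (hq : q ∈ cycle pbar) (h : mdot (origin pbar) q ≠ 0) :
    (reflMat pbar q).det = -1 := by
  rw [reflMat, vecMulVec_eq Unit, det_one_add_replicateCol_mul_replicateRow, dotProduct_signature,
    mdot_smul, mdot_sub_origin_self hq]
  field_simp
  norm_num

lemma reflMat_base (hq : q ∈ cycle pbar) : reflMat pbar q *ᵥ pbar.1 = pbar.1 := by
  rw [reflMat_mulVec, mdot_comm, mdot_sub_right, hq.2.2, (origin_mem_cycle pbar).2.2]
  simp

lemma reflMat_origin (h : mdot (origin pbar) q ≠ 0) : reflMat pbar q *ᵥ origin pbar = q := by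
  rw [reflMat_mulVec, mdot_sub_left, (origin_mem_cycle pbar).1, mdot_comm q, sub_zero,
    mul_inv_cancel₀ h, one_smul, add_sub_cancel]

lemma reflMat_self (hq : q ∈ cycle pbar) (h : mdot (origin pbar) q ≠ 0) :
    reflMat pbar q *ᵥ q = origin pbar := by
  rw [reflMat_mulVec, mdot_sub_left, hq.1, zero_sub, neg_mul,
    mul_inv_cancel₀ h, neg_smul, one_smul]
  abel

end Refl
end Little

/-! ### The orbit of the little group on the cycle -/

section Section
variable {n : ℕ} [NeZero n] {m : ℝ} {pbar : MassShell n m}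

open Classical in
/-- A section of the map `g ↦ g • origin pbar` from the little group onto the cycle: the product of
the reflection that exchanges `origin pbar` and `q` with the reflection of the last coordinate.
It is the identity at `origin pbar` and off the cycle. -/
def sec (hp : (j0Down n).neg • pbar = pbar) (q : Mink n) : LittleGroup pbar :=
  if h : q ∈ cycle pbar ∧ q ≠ origin pbar then
    have h0 : mdot (origin pbar) q ≠ 0 := fun h0 => h.2 (eq_origin_of_mdot h.1 h0)
    LittleGroup.ofMat (reflMat pbar q * flipMat n)
      (fun x y => by
        rw [← mulVec_mulVec, ← mulVec_mulVec, reflMat_mdot h.1 h0, flipMat_mdot])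
      (by rw [det_mul, det_reflMat h.1 h0, det_flipMat]; norm_num)
      (by rw [← mulVec_mulVec, flipMat_fix (base_apply hp), reflMat_base h.1])
  else 1

variable (hp : (j0Down n).neg • pbar = pbar)

lemma lmat_sec {q : Mink n} (h : q ∈ cycle pbar ∧ q ≠ origin pbar) :
    lmat (sec hp q) = reflMat pbar q * flipMat n := by
  rw [sec, dif_pos h]; rfl

lemma sec_mulVec_origin {q : Mink n} (hq : q ∈ cycle pbar) :
    lmat (sec hp q) *ᵥ origin pbar = q := by
  by_cases h : q = origin pbar
  · rw [sec, dif_neg (by tauto), lmat_one, one_mulVec, h]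
  · rw [lmat_sec hp ⟨hq, h⟩, ← mulVec_mulVec, flipMat_fix (fun i => origin_apply i),
      reflMat_origin fun h0 => h (eq_origin_of_mdot hq h0)]

lemma sec_inv_mulVec_origin {q : Mink n} (hq : q ∈ cycle pbar) :
    lmat (sec hp q)⁻¹ *ᵥ origin pbar = flipMat n *ᵥ q := by
  by_cases h : q = origin pbar
  · rw [sec, dif_neg (by tauto), inv_one, lmat_one, one_mulVec, h,
      flipMat_fix (fun i => origin_apply i)]
  · have h1 : lmat (sec hp q) *ᵥ (flipMat n *ᵥ q) = origin pbar := by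
      rw [lmat_sec hp ⟨hq, h⟩, mulVec_mulVec, Matrix.mul_assoc, flipMat_mul_self, Matrix.mul_one,
        reflMat_self hq fun h0 => h (eq_origin_of_mdot hq h0)]
    rw [← h1, lmat_inv_mulVec_mulVec]

lemma measurableSet_cycle (pbar : MassShell n m) : MeasurableSet (cycle pbar) := by
  have h1 : MeasurableSet {q : Mink n | mdot q q = 0} :=
    measurableSet_eq_fun (by unfold mdot; fun_prop) measurable_const
  have h2 : MeasurableSet {q : Mink n | 0 < q 0} :=
    measurableSet_lt measurable_const (measurable_pi_apply 0)
  have h3 : MeasurableSet {q : Mink n | mdot pbar.1 q = 1} :=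
    measurableSet_eq_fun (measurable_mdot _) measurable_const
  exact h1.inter (h2.inter h3)

lemma continuousOn_sec : ContinuousOn (sec hp) {q | q ∈ cycle pbar ∧ q ≠ origin pbar} := by
  rw [isInducing_lmat.continuousOn_iff]
  refine ContinuousOn.congr (f := fun q => reflMat pbar q * flipMat n) ?_
    fun q hq => lmat_sec hp hq
  refine ContinuousOn.mul ?_ continuousOn_const
  refine continuousOn_pi.2 fun i => continuousOn_pi.2 fun j => ?_
  simp only [reflMat, Matrix.add_apply, vecMulVec_apply, Pi.smul_apply, smul_eq_mul]
  have h1 : Continuous fun q : Mink n => mdot (origin pbar) q :=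
    continuous_mdot.comp (by fun_prop : Continuous fun q : Mink n => (origin pbar, q))
  refine continuousOn_const.add (((h1.continuousOn.inv₀ fun q hq h0 =>
    hq.2 (eq_origin_of_mdot hq.1 h0)).mul ?_).mul ?_) <;> fun_prop

lemma lmat_conjJ0Little (g : LittleGroup pbar) (x : Mink n) :
    lmat (conjJ0Little hp g) *ᵥ x =
      (j0Down n).neg.1.1 *ᵥ (lmat g *ᵥ ((j0Down n).neg.1.1 *ᵥ x)) := by
  rw [mulVec_mulVec, mulVec_mulVec]
  congr 1
  change j0Matrix n * lmat g * j0Matrix n = -j0Matrix n * lmat g * -j0Matrix n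
  rw [neg_mul, neg_mul_neg]

lemma neg_j0_mulVec_origin : (j0Down n).neg.1.1 *ᵥ origin pbar = origin pbar := by
  funext i
  rw [neg_j0_mulVec]
  split_ifs with h
  · rw [one_mul]
  · rw [origin_apply i (by tauto) (by tauto)]; ring

end Section

/-! ### The stabilizer of a point of the cycle -/

section Rotations
variable {m : ℝ}

/-- The rotation of the last two coordinates by the complex number `u`. -/
def rotMat (u : ℂ) : Matrix (Fin (2 + 2)) (Fin (2 + 2)) ℝ :=
  !![1, 0, 0, 0; 0, 1, 0, 0; 0, 0, u.re, -u.im; 0, 0, u.im, u.re]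

lemma rotMat_mulVec (u : ℂ) (x : Mink 2) :
    rotMat u *ᵥ x = ![x 0, x 1, u.re * x 2 - u.im * x 3, u.im * x 2 + u.re * x 3] := by
  funext i
  fin_cases i <;> simp [rotMat, mulVec, dotProduct, Fin.sum_univ_succ] <;> ring

lemma mdot_two (x y : Mink 2) :
    mdot x y = x 0 * y 0 - x 1 * y 1 - x 2 * y 2 - x 3 * y 3 := by
  rw [mdot_eq, Fin.sum_univ_two]
  have h2 : (Fin.succ (Fin.succ (0 : Fin 2)) : Fin 4) = 2 := rfl
  have h3 : (Fin.succ (Fin.succ (1 : Fin 2)) : Fin 4) = 3 := rfl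
  rw [h2, h3]; ring

lemma normSq_circle (u : Circle) : (u : ℂ).re ^ 2 + (u : ℂ).im ^ 2 = 1 := by
  have := Circle.normSq_coe u
  rw [Complex.normSq_apply] at this
  linarith

/-- The rotations of the last two coordinates, as elements of the little group. -/
def rot {pbar : MassShell 2 m} (hp : (j0Down 2).neg • pbar = pbar) (u : Circle) :
    LittleGroup pbar :=
  LittleGroup.ofMat (rotMat u)
    (fun x y => by
      rw [rotMat_mulVec, rotMat_mulVec, mdot_two, mdot_two]
      simp only [cons_val]
      linear_combination (-(x 2 * y 2) - x 3 * y 3) * normSq_circle u)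
    (by
      rw [rotMat, det_succ_row_zero]
      simp [det_fin_three, Fin.sum_univ_succ]
      linear_combination normSq_circle u)
    (by
      rw [rotMat_mulVec]
      have h2 : pbar.1 2 = 0 := base_apply hp 2 (by decide) (by decide)
      have h3 : pbar.1 3 = 0 := base_apply hp 3 (by decide) (by decide)
      funext i
      fin_cases i <;> simp [h2, h3])

variable {pbar : MassShell 2 m} (hp : (j0Down 2).neg • pbar = pbar)

lemma rot_mulVec (u : Circle) (x : Mink 2) : lmat (rot hp u) *ᵥ x =
    ![x 0, x 1, (u : ℂ).re * x 2 - (u : ℂ).im * x 3, (u : ℂ).im * x 2 + (u : ℂ).re * x 3] :=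
  rotMat_mulVec u x

lemma rot_mulVec_origin (u : Circle) : lmat (rot hp u) *ᵥ origin pbar = origin pbar := by
  rw [rot_mulVec]
  have h2 : origin pbar 2 = 0 := origin_apply 2 (by decide) (by decide)
  have h3 : origin pbar 3 = 0 := origin_apply 3 (by decide) (by decide)
  funext i
  fin_cases i <;> simp [h2, h3]

lemma lmat_injective_mulVec {n : ℕ} {m : ℝ} {pbar : MassShell n m} {g h : LittleGroup pbar}
    (H : ∀ x, lmat g *ᵥ x = lmat h *ᵥ x) : g = h :=
  lmat_ext (Matrix.ext_of_mulVec_single fun _ => H _)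

lemma rot_mul (u v : Circle) : rot hp (u * v) = rot hp u * rot hp v := by
  refine lmat_injective_mulVec fun x => ?_
  rw [lmat_mul, ← mulVec_mulVec, rot_mulVec, rot_mulVec, rot_mulVec]
  funext i
  fin_cases i <;> simp <;> ring

lemma continuous_rot : Continuous (rot hp) := by
  rw [isInducing_lmat.continuous_iff]
  refine continuous_pi fun i => continuous_pi fun j => ?_
  change Continuous fun u : Circle => rotMat u i j
  fin_cases i <;> fin_cases j <;> simp [rotMat] <;> fun_prop

/-- In four spacetime dimensions, the stabilizer of `origin pbar` consists of the rotations of the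
last two coordinates. -/
lemma exists_eq_rot {k : LittleGroup pbar} (hk : lmat k *ᵥ origin pbar = origin pbar) :
    ∃ u, k = rot hp u := by
  obtain ⟨h0, h1⟩ := mulVec_single_of_fix hp (lmat_mulVec_base k) hk
  set M := lmat k with hM
  have hc : ∀ i j, M i j = (M *ᵥ Pi.single j 1) i := fun i j => by simp
  have c0 : ∀ i, M i 0 = (Pi.single 0 1 : Mink 2) i := fun i => by rw [hc, h0]
  have c1 : ∀ i, M i 1 = (Pi.single 1 1 : Mink 2) i := fun i => by rw [hc, h1]
  have hinner : ∀ i j, mdot (fun l => M l i) (fun l => M l j) =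
      mdot (Pi.single i 1 : Mink 2) (Pi.single j 1) := fun i j =>
    (congrArg₂ mdot (funext fun l => hc l i) (funext fun l => hc l j)).trans (mdot_lmat k _ _)
  have r02 : M 0 2 = 0 := by simpa [mdot_two, c0] using hinner 0 2
  have r03 : M 0 3 = 0 := by simpa [mdot_two, c0] using hinner 0 3
  have r12 : M 1 2 = 0 := by simpa [mdot_two, c1] using hinner 1 2
  have r13 : M 1 3 = 0 := by simpa [mdot_two, c1] using hinner 1 3
  have n22 : M 2 2 * M 2 2 + M 3 2 * M 3 2 = 1 := by
    have := hinner 2 2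
    simp [mdot_two, r02, r12] at this; linarith
  have n33 : M 2 3 * M 2 3 + M 3 3 * M 3 3 = 1 := by
    have := hinner 3 3
    simp [mdot_two, r03, r13] at this; linarith
  have hdet : M 2 2 * M 3 3 - M 2 3 * M 3 2 = 1 := by
    have := det_lmat k
    rw [← hM, det_succ_row_zero] at this
    simp [Fin.sum_univ_succ, c0, r02, r03] at this
    rw [det_fin_three] at this
    simp at this
    simp [c1, r12, r13] at this
    linarith
  have hs : (M 3 3 - M 2 2) ^ 2 + (M 2 3 + M 3 2) ^ 2 = 0 := by
    linear_combination n22 + n33 - 2 * hdet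
  have e33 : M 3 3 = M 2 2 := by nlinarith [sq_nonneg (M 3 3 - M 2 2), sq_nonneg (M 2 3 + M 3 2)]
  have e23 : M 2 3 = -M 3 2 := by nlinarith [sq_nonneg (M 3 3 - M 2 2), sq_nonneg (M 2 3 + M 3 2)]
  have hu : (⟨M 2 2, M 3 2⟩ : ℂ) ∈ Submonoid.unitSphere ℂ := by
    rw [Submonoid.unitSphere, Submonoid.mem_mk]
    change _ ∈ Metric.sphere (0 : ℂ) 1
    rw [mem_sphere_zero_iff_norm, ← sq_eq_sq₀ (norm_nonneg _) zero_le_one, Complex.sq_norm,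
      Complex.normSq_mk]
    linarith
  refine ⟨⟨_, hu⟩, lmat_ext ?_⟩
  change M = rotMat ⟨M 2 2, M 3 2⟩
  ext i j
  fin_cases i <;> fin_cases j <;> simp [rotMat, c0, c1, r02, r03, r12, r13, e33, e23]

end Rotations

/-- In three spacetime dimensions, the stabilizer of `origin pbar` is trivial. -/
lemma eq_one_of_fix {m : ℝ} {pbar : MassShell 1 m} (hp : (j0Down 1).neg • pbar = pbar)
    {k : LittleGroup pbar} (hk : lmat k *ᵥ origin pbar = origin pbar) : k = 1 := by
  obtain ⟨h0, h1⟩ := mulVec_single_of_fix hp (lmat_mulVec_base k) hk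
  set M := lmat k with hM
  have hmd : ∀ x y : Mink 1, mdot x y = x 0 * y 0 - x 1 * y 1 - x 2 * y 2 := fun x y => by
    rw [mdot_eq, Fin.sum_univ_one]; rfl
  have hc : ∀ i j, M i j = (M *ᵥ Pi.single j 1) i := fun i j => by simp
  have c0 : ∀ i, M i 0 = (Pi.single 0 1 : Mink 1) i := fun i => by rw [hc, h0]
  have c1 : ∀ i, M i 1 = (Pi.single 1 1 : Mink 1) i := fun i => by rw [hc, h1]
  have hinner : ∀ i j, mdot (fun l => M l i) (fun l => M l j) =
      mdot (Pi.single i 1 : Mink 1) (Pi.single j 1) := fun i j =>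
    (congrArg₂ mdot (funext fun l => hc l i) (funext fun l => hc l j)).trans (mdot_lmat k _ _)
  have r02 : M 0 2 = 0 := by simpa [hmd, c0] using hinner 0 2
  have r12 : M 1 2 = 0 := by simpa [hmd, c1] using hinner 1 2
  have hdet : M 2 2 = 1 := by
    have := det_lmat k
    rw [← hM] at this
    erw [det_fin_three] at this
    simpa [c0, c1, r02, r12] using this
  refine lmat_ext ?_
  change M = 1
  ext i j
  fin_cases i <;> fin_cases j <;> simp [c0, c1, r02, r12, hdet]

section Conj
variable {n : ℕ} [NeZero n] {m : ℝ} {pbar : MassShell n m}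

/-- The reflections `-j₀` and that of the last coordinate agree up to the stabilizer of
`origin pbar`. -/
lemma exists_fix_flipMat (hn : n = 1 ∨ n = 2) (hp : (j0Down n).neg • pbar = pbar) (q : Mink n) :
    ∃ k : LittleGroup pbar, lmat k *ᵥ origin pbar = origin pbar ∧
      lmat k *ᵥ (flipMat n *ᵥ q) = (j0Down n).neg.1.1 *ᵥ q := by
  rcases hn with rfl | rfl
  · refine ⟨1, by rw [lmat_one, one_mulVec], ?_⟩
    rw [lmat_one, one_mulVec]
    funext i
    rw [neg_j0_mulVec, flipMat_mulVec]
    fin_cases i <;> simp [Fin.ext_iff]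
  · have key : ∃ u : Circle, (u : ℂ) * (⟨q 2, -q 3⟩ : ℂ) = ⟨-q 2, -q 3⟩ := by
      by_cases hz : (⟨q 2, -q 3⟩ : ℂ) = 0
      · refine ⟨1, ?_⟩
        rw [Complex.ext_iff] at hz
        simp at hz
        simp [hz.1, hz.2]
      · have hz' : (⟨q 2, -q 3⟩ : ℂ).re ^ 2 + (⟨q 2, -q 3⟩ : ℂ).im ^ 2 ≠ 0 := by
          intro h
          apply hz
          rw [Complex.ext_iff]
          constructor <;> simp at h ⊢ <;> nlinarith [sq_nonneg (q 2), sq_nonneg (q 3)]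
        have hu : (⟨-q 2, -q 3⟩ : ℂ) / ⟨q 2, -q 3⟩ ∈ Submonoid.unitSphere ℂ := by
          change _ ∈ Metric.sphere (0 : ℂ) 1
          rw [mem_sphere_zero_iff_norm, norm_div, div_eq_one_iff_eq (norm_ne_zero_iff.2 hz),
            ← sq_eq_sq₀ (norm_nonneg _) (norm_nonneg _), Complex.sq_norm, Complex.sq_norm,
            Complex.normSq_mk, Complex.normSq_mk]
          ring
        exact ⟨⟨_, hu⟩, div_mul_cancel₀ _ hz⟩
    obtain ⟨u, hu⟩ := key
    refine ⟨rot hp u, rot_mulVec_origin hp u, ?_⟩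
    rw [Complex.ext_iff] at hu
    simp only [Complex.mul_re, Complex.mul_im] at hu
    rw [rot_mulVec]
    funext i
    rw [neg_j0_mulVec]
    have f0 : (flipMat 2 *ᵥ q) 0 = q 0 := by rw [flipMat_mulVec]; simp [Fin.ext_iff]
    have f1 : (flipMat 2 *ᵥ q) 1 = q 1 := by rw [flipMat_mulVec]; simp [Fin.ext_iff]
    have f2 : (flipMat 2 *ᵥ q) 2 = q 2 := by rw [flipMat_mulVec]; simp [Fin.ext_iff]
    have f3 : (flipMat 2 *ᵥ q) 3 = -q 3 := by rw [flipMat_mulVec]; simp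
    rw [f0, f1, f2, f3]
    fin_cases i
    · simp
    · simp
    · simpa using hu.1
    · simpa [add_comm] using hu.2

/-- `j₀ g j₀` lies in the double coset of `g⁻¹` with respect to the stabilizer of
`origin pbar`. -/
lemma exists_fix_conjJ0 (hn : n = 1 ∨ n = 2) (hp : (j0Down n).neg • pbar = pbar)
    (g : LittleGroup pbar) : ∃ k : LittleGroup pbar, lmat k *ᵥ origin pbar = origin pbar ∧
      lmat (k * g⁻¹) *ᵥ origin pbar = lmat (conjJ0Little hp g) *ᵥ origin pbar := by
  have hq := lmat_mulVec_mem_cycle g (origin_mem_cycle pbar)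
  set q := lmat g *ᵥ origin pbar with hqdef
  obtain ⟨k, hk, hkq⟩ := exists_fix_flipMat hn hp q
  have h1 : lmat ((sec hp q)⁻¹ * g) *ᵥ origin pbar = origin pbar := by
    rw [lmat_mul, ← mulVec_mulVec, ← hqdef]
    nth_rewrite 2 [← sec_mulVec_origin hp hq]
    rw [lmat_inv_mulVec_mulVec]
  refine ⟨k * ((sec hp q)⁻¹ * g), by rw [lmat_mul, ← mulVec_mulVec, h1, hk], ?_⟩
  rw [mul_assoc, mul_inv_cancel_right, lmat_mul, ← mulVec_mulVec, sec_inv_mulVec_origin hp hq,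
    hkq, lmat_conjJ0Little, neg_j0_mulVec_origin]

end Conj

/-! ### The measure on the cycle -/

section CycleMeasure
variable {n : ℕ} [NeZero n]

lemma norm_le_energy (k : Fin (n + 1) → ℝ) : ‖k‖ ≤ energy 0 k := by
  refine (pi_norm_le_iff_of_nonneg (Real.sqrt_nonneg _)).2 fun i => ?_
  refine Real.le_sqrt_of_sq_le ?_
  rw [Real.norm_eq_abs, sq_abs]
  have := Finset.single_le_sum (fun j _ => sq_nonneg (k j)) (Finset.mem_univ i)
  simpa using this

/-- The density `1 / |k|` is locally integrable because space has dimension at least two. -/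
lemma invMeasure_energy_le_lt_top (R : ℝ) : invMeasure n 0 {q | q 0 ≤ R} < ⊤ := by
  have hms : MeasurableSet {q : Mink n | q 0 ≤ R} :=
    measurableSet_le (measurable_pi_apply 0) measurable_const
  have hloc : LocallyIntegrable (fun k : Fin (n + 1) → ℝ => (energy 0 k)⁻¹) volume := by
    refine locallyIntegrable_of_norm_le_rpow (C := 1) (α := 1) ?_ ?_ ?_
      (measurable_energy 0).inv.aestronglyMeasurable
    · rw [Module.finrank_fin_fun]; omega
    · rw [Module.finrank_fin_fun]
      have := Nat.pos_of_ne_zero (NeZero.ne n)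
      push_cast
      have h : (0 : ℝ) < n := by exact_mod_cast this
      linarith
    · refine Filter.Eventually.of_forall fun k => ?_
      rw [one_mul, Real.rpow_neg_one, norm_inv,
        Real.norm_of_nonneg (r := energy 0 k) (Real.sqrt_nonneg _)]
      by_cases hk : k = 0
      · simp [hk, energy]
      · exact inv_anti₀ (norm_pos_iff.2 hk) (norm_le_energy k)
  have hint := (hloc.integrableOn_isCompact (isCompact_closedBall 0 R)).setLIntegral_lt_top
  rw [← lintegral_indicator_one hms, lintegral_invMeasure 0 (measurable_one.indicator hms)]
  refine lt_of_le_of_lt ?_ hint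
  rw [← lintegral_indicator Metric.isClosed_closedBall.measurableSet]
  refine lintegral_mono fun k => ?_
  by_cases hk : onShell 0 k ∈ {q : Mink n | q 0 ≤ R}
  · have h1 : k ∈ Metric.closedBall 0 R := by
      rw [mem_closedBall_zero_iff]
      exact (norm_le_energy k).trans hk
    rw [Set.indicator_of_mem hk, Set.indicator_of_mem h1]
    simp
  · rw [Set.indicator_of_notMem hk, mul_zero]
    exact zero_le

/-- The part of the cone below the cycle that is projected to points of energy at most `R` has
itself energy at most `max R 0`. -/
lemma cycleMeasure_bounded_lt_top (v : Mink n) (R : ℝ) : cycleMeasure v {q | q 0 ≤ R} < ⊤ := by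
  have hms : MeasurableSet {q : Mink n | q 0 ≤ R} :=
    measurableSet_le (measurable_pi_apply 0) measurable_const
  rw [cycleMeasure, Measure.smul_apply, Measure.map_apply (measurable_toCycle v) hms,
    Measure.restrict_apply ((measurable_toCycle v) hms), smul_eq_mul]
  refine ENNReal.mul_lt_top (ENNReal.natCast_lt_top n)
    (lt_of_le_of_lt (measure_mono ?_) (invMeasure_energy_le_lt_top (n := n) (max R 0)))
  rintro q ⟨hq, h0, h1⟩
  have h2 : (mdot v q)⁻¹ * q 0 ≤ R := hq
  change q 0 ≤ max R 0
  rw [inv_mul_le_iff₀ h0] at h2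
  refine h2.trans ?_
  calc mdot v q * R ≤ mdot v q * max R 0 := mul_le_mul_of_nonneg_left (le_max_left _ _) h0.le
    _ ≤ 1 * max R 0 := mul_le_mul_of_nonneg_right h1 (le_max_right _ _)
    _ = max R 0 := one_mul _

instance (v : Mink n) : SigmaFinite (cycleMeasure v) :=
  ⟨⟨{ set := fun N => {q | q 0 ≤ N}
      set_mem := fun _ => trivial
      finite := fun N => cycleMeasure_bounded_lt_top v N
      spanning := Set.eq_univ_of_forall fun q => Set.mem_iUnion.2 (exists_nat_ge (q 0)) }⟩⟩

lemma invMeasure_ne_zero : invMeasure n 0 ≠ 0 := by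
  intro h
  have h1 := lintegral_invMeasure (n := n) 0 (measurable_const (a := (1 : ℝ≥0∞)))
  rw [h, lintegral_zero_measure] at h1
  simp only [mul_one] at h1
  have h2 := (lintegral_eq_zero_iff (measurable_energy 0).inv.ennreal_ofReal).1 h1.symm
  have h3 : ∀ᵐ k : Fin (n + 1) → ℝ, k = 0 := by
    filter_upwards [h2] with k hk
    have h4 : (energy 0 k)⁻¹ ≤ 0 := ENNReal.ofReal_eq_zero.1 hk
    have h5 : energy 0 k ≤ 0 := inv_nonpos.1 h4
    exact norm_le_zero_iff.1 ((norm_le_energy k).trans h5)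
  have h6 : (volume : Measure (Fin (n + 1) → ℝ)) Set.univ = 0 := by
    refine le_antisymm ((measure_mono_ae (t := {0}) ?_).trans (measure_singleton _).le) zero_le
    filter_upwards [h3] with k hk _ using hk
  exact (NeZero.ne (volume : Measure (Fin (n + 1) → ℝ))) (Measure.measure_univ_eq_zero.1 h6)

/-- If the measure of the cycle vanished, so would the invariant measure of the part of the cone
below the cycle, and, by dilation, of the whole cone. -/
lemma cycleMeasure_ne_zero {v : Mink n} (hv : ForwardCausal v) : cycleMeasure v ≠ 0 := by
  intro h
  apply invMeasure_ne_zero (n := n)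
  set S : ℝ → Set (Mink n) := fun t => {q | 0 < mdot v q ∧ mdot v q ≤ t} with hS
  have hSm : ∀ t, MeasurableSet (S t) := fun t =>
    (measurableSet_lt measurable_const (measurable_mdot v)).inter
      (measurableSet_le (measurable_mdot v) measurable_const)
  have h1 : invMeasure n 0 (S 1) = 0 := by
    have h2 : cycleMeasure v Set.univ = 0 := by rw [h]; rfl
    rw [cycleMeasure, Measure.smul_apply,
      Measure.map_apply (measurable_toCycle v) MeasurableSet.univ,
      Set.preimage_univ, Measure.restrict_apply MeasurableSet.univ, Set.univ_inter, smul_eq_mul,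
      mul_eq_zero] at h2
    exact h2.resolve_left (by exact_mod_cast NeZero.ne n)
  have h3 : ∀ N : ℕ, invMeasure n 0 (S (N + 1)) = 0 := fun N => by
    have hN : (0 : ℝ) < N + 1 := by positivity
    rw [← lintegral_indicator_one (hSm _), lintegral_invMeasure_smul hN
      (measurable_one.indicator (hSm _))]
    have h4 : (fun p : Mink n => (S (N + 1)).indicator (1 : Mink n → ℝ≥0∞) (((N : ℝ) + 1) • p)) =
        (S 1).indicator 1 := by
      funext p
      have : ((N : ℝ) + 1) • p ∈ S (N + 1) ↔ p ∈ S 1 := by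
        simp only [hS, Set.mem_ofPred_eq, mdot_smul, mul_pos_iff_of_pos_left hN]
        rw [mul_le_iff_le_one_right hN]
      by_cases hp : p ∈ S 1
      · rw [Set.indicator_of_mem hp, Set.indicator_of_mem (this.2 hp)]; rfl
      · rw [Set.indicator_of_notMem hp, Set.indicator_of_notMem (fun h => hp (this.1 h))]
    rw [h4, lintegral_indicator_one (hSm _), h1, mul_zero]
  rw [← Measure.measure_univ_eq_zero]
  refine le_antisymm ((measure_mono_ae (t := ⋃ N : ℕ, S (N + 1)) ?_).trans
    (measure_iUnion_null h3).le) zero_le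
  filter_upwards [ae_mdot_pos hv] with q hq _
  obtain ⟨N, hN⟩ := exists_nat_ge (mdot v q)
  exact Set.mem_iUnion.2 ⟨N, hq, by linarith⟩

lemma ae_mem_cycle {m : ℝ} (pbar : MassShell n m) :
    ∀ᵐ q ∂cycleMeasure pbar.1, q ∈ cycle pbar := by
  have hnull : ∀ᵐ q ∂invMeasure n 0, mdot q q = 0 ∧ 0 ≤ q 0 := by
    have hms : MeasurableSet {q : Mink n | mdot q q = 0 ∧ 0 ≤ q 0} :=
      (measurableSet_eq_fun (by unfold mdot; fun_prop) measurable_const).inter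
        (measurableSet_le measurable_const (measurable_pi_apply 0))
    rw [invMeasure, ae_map_iff (measurable_onShell 0).aemeasurable hms]
    refine Filter.Eventually.of_forall fun k => ⟨by rw [mdot_onShell]; ring, Real.sqrt_nonneg _⟩
  have hms' : MeasurableSet {q : Mink n | 0 < mdot pbar.1 q ∧ mdot pbar.1 q ≤ 1} :=
    (measurableSet_lt measurable_const (measurable_mdot _)).inter
      (measurableSet_le (measurable_mdot _) measurable_const)
  unfold cycleMeasure
  refine Measure.ae_smul_measure ?_ _
  refine (ae_map_iff (p := fun q => q ∈ cycle pbar) (measurable_toCycle _).aemeasurable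
    (measurableSet_cycle pbar)).2 ((ae_restrict_iff' hms').2 ?_)
  filter_upwards [hnull] with q hq hq'
  have h0 : 0 < q 0 := by
    refine hq.2.lt_of_ne fun h => hq'.1.ne' ?_
    have h1 : ∑ i : Fin (n + 1), q i.succ * q i.succ = 0 := by
      have := hq.1
      rw [mdot, ← h] at this
      linarith
    have h2 := fun i => (Finset.sum_eq_zero_iff_of_nonneg
      (fun i _ => mul_self_nonneg (q (Fin.succ i)))).1 h1 i (Finset.mem_univ i)
    have h3 : q = 0 := by
      funext i
      refine Fin.cases h.symm (fun i => mul_self_eq_zero.1 (h2 i)) i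
    rw [h3]; simp [mdot]
  refine ⟨?_, ?_, ?_⟩
  · rw [toCycle, mdot_smul, mdot_smul_left, hq.1]; ring
  · exact mul_pos (inv_pos.2 hq'.1) h0
  · rw [toCycle, mdot_smul, inv_mul_cancel₀ hq'.1.ne']

/-- Lorentz transformations that fix `v` preserve the measure of the cycle of `v`. -/
lemma measurePreserving_cycleMeasure {v : Mink n} (hv : ForwardCausal v) (g : orthochronous n)
    (hg : g.1.1 *ᵥ v = v) :
    MeasurePreserving (fun q : Mink n => g.1.1 *ᵥ q) (cycleMeasure v) (cycleMeasure v) := by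
  refine ⟨measurable_mulVec _, Measure.ext fun s hs => ?_⟩
  rw [Measure.map_apply (measurable_mulVec _) hs, ← lintegral_indicator_one hs,
    ← lintegral_indicator_one (measurable_mulVec _ hs),
    ← lintegral_cycle_comp hv (inv_mem g.2) (measurable_one.indicator hs)]
  refine lintegral_congr_ae ?_
  filter_upwards [ae_cycleMeasure_eq_one (v := v)] with q hq
  have h1 : mdot v (g.1.1 *ᵥ q) = 1 := by
    nth_rewrite 1 [← hg]
    rw [g.2.1, hq]
  rw [inv_inv, h1, toCycle, h1]
  simp only [inv_one, one_pow, ENNReal.ofReal_one, one_mul, one_smul]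
  rfl

lemma measurePreserving_lmat {m : ℝ} {pbar : MassShell n m} (g : LittleGroup pbar) :
    MeasurePreserving (fun q : Mink n => lmat g *ᵥ q) (cycleMeasure pbar.1)
      (cycleMeasure pbar.1) :=
  measurePreserving_cycleMeasure pbar.forwardCausal g.1.1 (lmat_mulVec_base g)

lemma integral_comp_of_measurePreserving {X Y E : Type*} [MeasurableSpace X] [MeasurableSpace Y]
    [NormedAddCommGroup E] [NormedSpace ℝ E] {μ : Measure X} {ν : Measure Y} {f : X → Y}
    (hf : MeasurePreserving f μ ν) {F : Y → E} (hF : AEStronglyMeasurable F ν) :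
    ∫ x, F (f x) ∂μ = ∫ y, F y ∂ν := by
  conv_rhs => rw [← hf.map_eq]
  rw [integral_map hf.measurable.aemeasurable (by rwa [hf.map_eq])]

end CycleMeasure

/-! ### The principal series -/

section Pullback
variable {n : ℕ} [NeZero n] {m : ℝ} {pbar : MassShell n m}

lemma coeFn_pullback (α : PrincipalParam n) (g : orthochronous n) (ψ : HLor pbar) :
    pullback α g ψ =ᵐ[cycleMeasure pbar.1]
      fun q => homExt pbar.1 α.1 ψ ((g⁻¹).1.1 *ᵥ q) :=
  MemLp.coeFn_toLp (memLp_homExt α g ψ)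

lemma homExt_of_mdot_eq_one {v q : Mink n} (h : mdot v q = 1) (α : ℂ) (ψ : Mink n → ℂ) :
    homExt v α ψ q = ψ q := by
  rw [homExt, toCycle, h]; simp

lemma homExt_smul {v q : Mink n} (hq : 0 < mdot v q) {t : ℝ} (ht : 0 < t) (α : ℂ)
    (ψ : Mink n → ℂ) : homExt v α ψ (t • q) = (t : ℂ) ^ α * homExt v α ψ q := by
  rw [homExt, homExt, toCycle_smul v q ht.ne', mdot_smul, ← mul_assoc, Complex.ofReal_mul,
    Complex.mul_cpow_ofReal_nonneg ht.le hq.le]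

lemma ae_mdot_inv_pos (g : orthochronous n) :
    ∀ᵐ q ∂cycleMeasure pbar.1, 0 < mdot pbar.1 ((g⁻¹).1.1 *ᵥ q) := by
  filter_upwards [ae_cycleMeasure (v := pbar.1) (pbar.forwardCausal.mulVec g.2)] with q hq
  rwa [← mdot_inv_mulVec g.2] at hq

lemma pullback_mul (α : PrincipalParam n) (g h : orthochronous n) (ψ : HLor pbar) :
    pullback α (g * h) ψ = pullback α g (pullback α h ψ) := by
  ext1
  have h1 := (quasiMeasurePreserving_cycle pbar.forwardCausal g.2).ae (coeFn_pullback α h ψ)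
  filter_upwards [coeFn_pullback α (g * h) ψ, coeFn_pullback α g (pullback α h ψ), h1,
    ae_mdot_inv_pos g, ae_mdot_inv_pos (g * h)] with q h2 h3 h4 h5 h6
  have e1 : ((g * h)⁻¹).1.1 *ᵥ q = (h⁻¹).1.1 *ᵥ ((g⁻¹).1.1 *ᵥ q) := by
    rw [mulVec_mulVec, _root_.mul_inv_rev]; rfl
  rw [e1] at h6
  rw [h2, h3]
  have h7 : (pullback α h ψ) (toCycle pbar.1 ((g⁻¹).1.1 *ᵥ q)) =
      homExt pbar.1 α.1 ψ ((h⁻¹).1.1 *ᵥ toCycle pbar.1 ((g⁻¹).1.1 *ᵥ q)) := h4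
  rw [homExt.eq_1 pbar.1 α.1 (pullback α h ψ), h7, toCycle, mulVec_smul,
    homExt_smul h6 (inv_pos.2 h5), ← mul_assoc, e1,
    ← Complex.mul_cpow_ofReal_nonneg h5.le (inv_pos.2 h5).le, ← Complex.ofReal_mul,
    mul_inv_cancel₀ h5.ne', Complex.ofReal_one, Complex.one_cpow, one_mul]

lemma coeFn_pullback_of_fix (α : PrincipalParam n) (g : orthochronous n)
    (hg : g.1.1 *ᵥ pbar.1 = pbar.1) (ψ : HLor pbar) :
    pullback α g ψ =ᵐ[cycleMeasure pbar.1] fun q => ψ ((g⁻¹).1.1 *ᵥ q) := by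
  filter_upwards [coeFn_pullback α g ψ, ae_cycleMeasure_eq_one (v := pbar.1)] with q h1 h2
  rw [h1, homExt_of_mdot_eq_one]
  have := mdot_inv_mulVec g.2 pbar.1 q
  rw [hg, h2] at this
  exact this

lemma coeFn_ULor (α : PrincipalParam n) (g : LittleGroup pbar) (ψ : HLor pbar) :
    ULor α g.1 ψ =ᵐ[cycleMeasure pbar.1] fun q => ψ (lmat g⁻¹ *ᵥ q) :=
  coeFn_pullback_of_fix α g.1.1 (lmat_mulVec_base g) ψ

lemma ULor_mul (α : PrincipalParam n) (L L' : restrictedLorentz n) (ψ : HLor pbar) :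
    ULor α (L * L') ψ = ULor α L (ULor α L' ψ) := pullback_mul α L.1 L'.1 ψ

lemma neg_j0_inv : ((j0Down n).neg)⁻¹ = (j0Down n).neg := by
  rw [inv_eq_iff_mul_eq_one]
  refine Subtype.ext ?_
  change -j0 n * -j0 n = 1
  rw [neg_mul_neg]
  exact Units.ext (j0Matrix_mul_self n)

lemma coeFn_ULorDown_j0 (hp : (j0Down n).neg • pbar = pbar) (α : PrincipalParam n)
    (ψ : HLor pbar) : ULorDown α (j0Down n) ψ =ᵐ[cycleMeasure pbar.1]
      fun q => conj (ψ ((j0Down n).neg.1.1 *ᵥ q)) := by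
  have h1 := coeFn_pullback_of_fix α (j0Down n).neg (congrArg Subtype.val hp) ψ
  filter_upwards [h1, Lp.coeFn_star (pullback α (j0Down n).neg ψ)] with q h2 h3
  change (star (pullback α (j0Down n).neg ψ) : HLor pbar) q = _
  rw [h3, Pi.star_apply, h2, neg_j0_inv]
  rfl

lemma conjLp_pullback (α : PrincipalParam n) (g : orthochronous n) (ψ : HLor pbar) :
    conjLp (pullback α g ψ) = pullback α.conj g (conjLp ψ) := by
  ext1
  have h0 := (quasiMeasurePreserving_cycle pbar.forwardCausal g.2).ae (Lp.coeFn_star ψ)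
  filter_upwards [coeFn_pullback α g ψ, coeFn_pullback α.conj g (conjLp ψ),
    Lp.coeFn_star (pullback α g ψ), h0, ae_mdot_inv_pos g] with q h1 h2 h3 h4 h5
  change (star (pullback α g ψ) : HLor pbar) q = _
  rw [h3, Pi.star_apply, h1, h2, homExt, homExt, star_mul', PrincipalParam.conj]
  congr 1
  · rw [Complex.cpow_conj _ _ (by
      rw [Complex.arg_ofReal_of_nonneg h5.le]; exact Real.pi_pos.ne), Complex.conj_ofReal]
    rfl
  · exact h4.symm

end Pullback

/-! ### The operators `T` and `J` that belong to an invariant vector -/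

section OrbitVec
variable {n : ℕ} [NeZero n] {m : ℝ} {pbar : MassShell n m}
  (hp : (j0Down n).neg • pbar = pbar)
  {H : Type*} [NormedAddCommGroup H] [InnerProductSpace ℂ H]
  (D : UnitaryRep (LittleGroup pbar) H) (ξ : H)

/-- The vector `ξ` is invariant under the stabilizer of `origin pbar`. -/
def FixedVector (D : UnitaryRep (LittleGroup pbar) H) (ξ : H) : Prop :=
  ∀ k : LittleGroup pbar, lmat k *ᵥ origin pbar = origin pbar → D.toHom k ξ = ξ

/-- For an invariant vector `ξ`, the vector `D(g) ξ` as a function of `q = g • origin pbar`. -/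
def orbitVec (q : Mink n) : H := D.toHom (sec hp q) ξ

lemma norm_orbitVec (q : Mink n) : ‖orbitVec hp D ξ q‖ = ‖ξ‖ := LinearIsometryEquiv.norm_map _ _

lemma aestronglyMeasurable_orbitVec (μ : Measure (Mink n)) :
    AEStronglyMeasurable (orbitVec hp D ξ) μ := by
  set U : Set (Mink n) := {q | q ∈ cycle pbar ∧ q ≠ origin pbar} with hU
  have hUm : MeasurableSet U :=
    (measurableSet_cycle pbar).inter (measurableSet_singleton (origin pbar)).compl
  have h1 : AEStronglyMeasurable (U.indicator (orbitVec hp D ξ)) μ :=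
    (aestronglyMeasurable_indicator_iff hUm).2
      (ContinuousOn.aestronglyMeasurable
        ((D.continuous_apply ξ).comp_continuousOn (continuousOn_sec hp)) hUm)
  have h2 : AEStronglyMeasurable (Uᶜ.indicator fun _ => ξ) μ :=
    (stronglyMeasurable_const.indicator hUm.compl).aestronglyMeasurable
  refine (h1.add h2).congr (Filter.Eventually.of_forall fun q => ?_)
  by_cases hq : q ∈ U
  · simp [hq]
  · have h3 : orbitVec hp D ξ q = ξ := by
      rw [orbitVec, sec, dif_neg (by exact hq), D.toHom_one_apply]
    simp [hq, h3]

variable {D ξ}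

lemma FixedVector.toHom_eq (hK : FixedVector D ξ) (g : LittleGroup pbar) :
    D.toHom g ξ = orbitVec hp D ξ (lmat g *ᵥ origin pbar) := by
  have hq := lmat_mulVec_mem_cycle g (origin_mem_cycle pbar)
  have h1 : lmat ((sec hp (lmat g *ᵥ origin pbar))⁻¹ * g) *ᵥ origin pbar = origin pbar := by
    rw [lmat_mul, ← mulVec_mulVec]
    nth_rewrite 2 [← sec_mulVec_origin hp hq]
    rw [lmat_inv_mulVec_mulVec]
  rw [orbitVec]
  nth_rewrite 2 [← hK _ h1]
  rw [← D.toHom_mul_apply, mul_inv_cancel_left]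

lemma FixedVector.toHom_orbitVec (hK : FixedVector D ξ) (g : LittleGroup pbar) {q : Mink n}
    (hq : q ∈ cycle pbar) :
    D.toHom g (orbitVec hp D ξ q) = orbitVec hp D ξ (lmat g *ᵥ q) := by
  rw [orbitVec, ← D.toHom_mul_apply, hK.toHom_eq hp, lmat_mul, ← mulVec_mulVec,
    sec_mulVec_origin hp hq]

lemma FixedVector.smul (hK : FixedVector D ξ) (c : ℂ) : FixedVector D (c • ξ) := fun k hk => by
  rw [map_smul, hK k hk]

lemma orbitVec_smul (c : ℂ) (q : Mink n) :
    orbitVec hp D (c • ξ) q = c • orbitVec hp D ξ q := map_smul _ _ _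

lemma integrable_smul_orbitVec (D : UnitaryRep (LittleGroup pbar) H) (ξ : H)
    {μ : Measure (Mink n)} {ψ : Mink n → ℂ} (hψ : Integrable ψ μ) :
    Integrable (fun q => ψ q • orbitVec hp D ξ q) μ := by
  refine (hψ.norm.mul_const ‖ξ‖).mono' (hψ.1.smul (aestronglyMeasurable_orbitVec hp D ξ μ))
    (Filter.Eventually.of_forall fun q => ?_)
  rw [norm_smul, norm_orbitVec]

/-- The square integrable functions on the cycle that are also integrable. -/
def integrableDomain (pbar : MassShell n m) : Submodule ℂ (HLor pbar) where
  carrier := {ψ | Integrable ψ (cycleMeasure pbar.1)}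
  zero_mem' := (integrable_zero _ _ _).congr (Lp.coeFn_zero ℂ 2 (cycleMeasure pbar.1)).symm
  add_mem' := fun {ψ ψ'} h h' =>
    (Integrable.add (f := ψ) (g := ψ') h h').congr (Lp.coeFn_add ψ ψ').symm
  smul_mem' := fun c ψ h => (Integrable.smul (f := ψ) c h).congr (Lp.coeFn_smul c ψ).symm

variable (D ξ)

/-- The operator `T ψ = ∫ ψ(q) D(g_q) ξ dν(q)`, `g_q • origin pbar = q`, defined on the integrable
functions in `L²(Γ, ν_Γ)`. -/
def orbitT : HLor pbar →ₗ.[ℂ] H where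
  domain := integrableDomain pbar
  toFun :=
    { toFun := fun ψ => ∫ q, ψ.1 q • orbitVec hp D ξ q ∂cycleMeasure pbar.1
      map_add' := fun ψ ψ' => by
        rw [← integral_add (integrable_smul_orbitVec hp D ξ ψ.2)
          (integrable_smul_orbitVec hp D ξ ψ'.2)]
        refine integral_congr_ae ?_
        filter_upwards [Lp.coeFn_add ψ.1 ψ'.1] with q h
        rw [Submodule.coe_add, h, Pi.add_apply, add_smul]
      map_smul' := fun c ψ => by
        rw [RingHom.id_apply, ← integral_smul]
        refine integral_congr_ae ?_
        filter_upwards [Lp.coeFn_smul c ψ.1] with q h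
        rw [Submodule.coe_smul, h, Pi.smul_apply, smul_assoc] }

lemma orbitT_apply (ψ : (orbitT hp D ξ).domain) :
    orbitT hp D ξ ψ = ∫ q, ψ.1 q • orbitVec hp D ξ q ∂cycleMeasure pbar.1 := rfl

lemma dense_integrableDomain : Dense (integrableDomain pbar : Set (HLor pbar)) := by
  refine (Lp.simpleFunc.dense (E := ℂ) (μ := cycleMeasure pbar.1) (p := 2) (by simp)).mono
    fun ψ hψ => ?_
  have h1 := Lp.simpleFunc.memLp (⟨ψ, hψ⟩ : Lp.simpleFunc ℂ 2 (cycleMeasure pbar.1))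
  rw [SimpleFunc.memLp_iff_integrable (by simp) (by simp)] at h1
  exact h1.congr (Lp.simpleFunc.toSimpleFunc_eq_toFun
    (⟨ψ, hψ⟩ : Lp.simpleFunc ℂ 2 (cycleMeasure pbar.1)))

variable {D ξ}

/-- `T` intertwines the principal series with `D`. -/
lemma FixedVector.orbitT_ULor (hK : FixedVector D ξ) (α : PrincipalParam n) (g : LittleGroup pbar)
    (ψ : (orbitT hp D ξ).domain) : ∃ h : ULor α g.1 ψ.1 ∈ (orbitT hp D ξ).domain,
      D.toHom g (orbitT hp D ξ ψ) = orbitT hp D ξ ⟨ULor α g.1 ψ.1, h⟩ := by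
  have hi : Integrable (fun q => ψ.1 (lmat g⁻¹ *ᵥ q)) (cycleMeasure pbar.1) :=
    (measurePreserving_lmat g⁻¹).integrable_comp_of_integrable ψ.2
  have hU := coeFn_ULor α g ψ.1
  refine ⟨hi.congr hU.symm, ?_⟩
  rw [orbitT_apply, orbitT_apply]
  have h1 : D.toHom g (∫ q, ψ.1 q • orbitVec hp D ξ q ∂cycleMeasure pbar.1) =
      ∫ q, D.toHom g (ψ.1 q • orbitVec hp D ξ q) ∂cycleMeasure pbar.1 :=
    ((D.toHom g).toContinuousLinearEquiv.integral_comp_comm _).symm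
  have hmeas : AEStronglyMeasurable (fun q => (ULor α g.1 ψ.1) q • orbitVec hp D ξ q)
      (cycleMeasure pbar.1) :=
    (Lp.aestronglyMeasurable _).smul (aestronglyMeasurable_orbitVec hp D ξ _)
  rw [h1]
  refine Eq.trans ?_ (integral_comp_of_measurePreserving (measurePreserving_lmat g) hmeas)
  refine integral_congr_ae ?_
  filter_upwards [(measurePreserving_lmat g).quasiMeasurePreserving.ae hU, ae_mem_cycle pbar]
    with q h2 h3
  rw [h2, map_smul, hK.toHom_orbitVec hp g h3, lmat_inv_mulVec_mulVec]

/-- `J D(g) ξ = D(j₀ g j₀) ξ` defines an antiunitary involution: the Gram matrix of the vectors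
`D(g) ξ` is determined by the spherical function `g ↦ ⟨ξ, D(g) ξ⟩`, and `j₀ g j₀` lies in the double
coset of `g⁻¹`. -/
theorem FixedVector.exists_conjugation [CompleteSpace H] (hn : n = 1 ∨ n = 2)
    (hK : FixedVector D ξ) (hirr : D.Irreducible) (hξ : ξ ≠ 0) :
    ∃ J : H ≃ₗᵢ⋆[ℂ] H, (∀ x, J (J x) = x) ∧
      (∀ (g : LittleGroup pbar) (x : H), J (D.toHom g (J x)) = D.toHom (conjJ0Little hp g) x) ∧
      ∀ q ∈ cycle pbar, J (orbitVec hp D ξ q) = orbitVec hp D ξ ((j0Down n).neg.1.1 *ᵥ q) := by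
  have hjj : ∀ x : Mink n, (j0Down n).neg.1.1 *ᵥ ((j0Down n).neg.1.1 *ᵥ x) = x := fun x => by
    funext i
    rw [neg_j0_mulVec, neg_j0_mulVec]
    split_ifs <;> ring
  have cmul : ∀ g h : LittleGroup pbar,
      conjJ0Little hp (g * h) = conjJ0Little hp g * conjJ0Little hp h := fun g h =>
    lmat_injective_mulVec fun x => by
      rw [lmat_mul, ← mulVec_mulVec, lmat_conjJ0Little, lmat_conjJ0Little, lmat_conjJ0Little, hjj,
        lmat_mul, ← mulVec_mulVec]
  have cone : conjJ0Little hp (1 : LittleGroup pbar) = 1 := lmat_injective_mulVec fun x => by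
    rw [lmat_conjJ0Little, lmat_one, one_mulVec, hjj, one_mulVec]
  have cinv : ∀ g : LittleGroup pbar, conjJ0Little hp g⁻¹ = (conjJ0Little hp g)⁻¹ := fun g =>
    eq_inv_of_mul_eq_one_left (by rw [← cmul, inv_mul_cancel, cone])
  have cc : ∀ g : LittleGroup pbar, conjJ0Little hp (conjJ0Little hp g) = g := fun g =>
    lmat_injective_mulVec fun x => by
      rw [lmat_conjJ0Little, lmat_conjJ0Little, hjj, hjj]
  have hsph : ∀ g : LittleGroup pbar, inner ℂ ξ (D.toHom (conjJ0Little hp g) ξ) =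
      conj (inner ℂ ξ (D.toHom g ξ)) := fun g => by
    obtain ⟨k, hk, hkg⟩ := exists_fix_conjJ0 hn hp g
    rw [hK.toHom_eq hp (conjJ0Little hp g), ← hkg, ← hK.toHom_eq hp, D.toHom_mul_apply,
      inner_conj_symm]
    conv_lhs => rw [← hK k hk]
    rw [LinearIsometryEquiv.inner_map_map, D.inner_toHom_left, hK k hk]
  obtain ⟨J, hJ, hJn⟩ := exists_antilinear_of_gram (fun g => D.toHom g ξ)
    (fun g => D.toHom (conjJ0Little hp g) ξ) (hirr.span_orbit hξ) fun g h => by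
      rw [D.inner_toHom_toHom, D.inner_toHom_toHom, ← cinv, ← cmul, hsph]
  have hdense : Dense ((Submodule.span ℂ (Set.range fun g => D.toHom g ξ)) : Set H) :=
    Submodule.dense_iff_topologicalClosure_eq_top.2 (hirr.span_orbit hξ)
  have hJJ : ∀ x, J (J x) = x := fun x => by
    refine hdense.induction (P := fun x => J (J x) = x) (fun y hy => ?_)
      (isClosed_eq (by fun_prop) continuous_id) x
    induction hy using Submodule.span_induction with
    | mem z hz => obtain ⟨g, rfl⟩ := hz; simp only; rw [hJ, hJ, cc]
    | zero => simp
    | add a b _ _ ha hb => rw [map_add, map_add, ha, hb]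
    | smul c a _ ha => rw [map_smulₛₗ, map_smulₛₗ, ha, Complex.conj_conj]
  let J' : H ≃ₗᵢ⋆[ℂ] H :=
    { LinearEquiv.ofInvolutive (J : H →ₛₗ[starRingEnd ℂ] H) hJJ with norm_map' := hJn }
  have hJ' : ∀ x, J' x = J x := fun x => rfl
  refine ⟨J', hJJ, fun g x => ?_, fun q hq => ?_⟩
  · refine hdense.induction (P := fun x => J (D.toHom g (J x)) = D.toHom (conjJ0Little hp g) x)
      (fun y hy => ?_) (isClosed_eq (by fun_prop) (by fun_prop)) x
    induction hy using Submodule.span_induction with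
    | mem z hz =>
      obtain ⟨h, rfl⟩ := hz
      simp only
      rw [hJ, ← D.toHom_mul_apply, hJ, cmul, cc, D.toHom_mul_apply]
    | zero => simp
    | add a b _ _ ha hb => simp only [map_add, ha, hb]
    | smul c a _ ha => simp only [map_smulₛₗ, ha, Complex.conj_conj, RingHom.id_apply]
  · rw [hJ', orbitVec, hJ, hK.toHom_eq hp, lmat_conjJ0Little, neg_j0_mulVec_origin,
      sec_mulVec_origin hp hq]

/-- `T` intertwines `U^α(j₀)` with `J`. -/
lemma orbitT_ULorDown [CompleteSpace H] {J : H ≃ₗᵢ⋆[ℂ] H}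
    (hJ : ∀ q ∈ cycle pbar, J (orbitVec hp D ξ q) = orbitVec hp D ξ ((j0Down n).neg.1.1 *ᵥ q))
    (α : PrincipalParam n) (ψ : (orbitT hp D ξ).domain) :
    ∃ h : ULorDown α (j0Down n) ψ.1 ∈ (orbitT hp D ξ).domain,
      J (orbitT hp D ξ ψ) = orbitT hp D ξ ⟨ULorDown α (j0Down n) ψ.1, h⟩ := by
  have hmp := measurePreserving_cycleMeasure pbar.forwardCausal (j0Down n).neg
    (congrArg Subtype.val hp)
  have hU := coeFn_ULorDown_j0 hp α ψ.1
  have hi : Integrable (fun q => conj (ψ.1 ((j0Down n).neg.1.1 *ᵥ q))) (cycleMeasure pbar.1) := by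
    have h1 : Integrable (fun q => ψ.1 ((j0Down n).neg.1.1 *ᵥ q)) (cycleMeasure pbar.1) :=
      hmp.integrable_comp_of_integrable ψ.2
    exact (LinearIsometryEquiv.integrable_comp_iff Complex.conjLIE).2 h1
  refine ⟨hi.congr hU.symm, ?_⟩
  rw [orbitT_apply, orbitT_apply]
  let Jr : H ≃L[ℝ] H := ((J.toLinearEquiv.toAddEquiv.toRealLinearEquiv J.continuous
    J.symm.continuous))
  have h1 : J (∫ q, ψ.1 q • orbitVec hp D ξ q ∂cycleMeasure pbar.1) =
      ∫ q, J (ψ.1 q • orbitVec hp D ξ q) ∂cycleMeasure pbar.1 :=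
    (Jr.integral_comp_comm _).symm
  have hmeas : AEStronglyMeasurable (fun q => (ULorDown α (j0Down n) ψ.1) q • orbitVec hp D ξ q)
      (cycleMeasure pbar.1) :=
    (Lp.aestronglyMeasurable _).smul (aestronglyMeasurable_orbitVec hp D ξ _)
  rw [h1]
  refine Eq.trans ?_ (integral_comp_of_measurePreserving hmp hmeas)
  refine integral_congr_ae ?_
  filter_upwards [hmp.quasiMeasurePreserving.ae hU, ae_mem_cycle pbar] with q h2 h3
  have hjj : (j0Down n).neg.1.1 *ᵥ ((j0Down n).neg.1.1 *ᵥ q) = q := by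
    funext i
    rw [neg_j0_mulVec, neg_j0_mulVec]
    split_ifs <;> ring
  rw [h2, map_smulₛₗ, hJ q h3, hjj]

/-- The range of `T` is dense, because its closure is an invariant subspace. -/
theorem FixedVector.denseRange_orbitT [CompleteSpace H] (hK : FixedVector D ξ)
    (hirr : D.Irreducible) (hξ : ξ ≠ 0) : DenseRange (orbitT hp D ξ) := by
  have hne : ∃ ψ : (orbitT hp D ξ).domain, orbitT hp D ξ ψ ≠ 0 := by
    by_contra! h
    have h0 : orbitVec hp D ξ =ᵐ[cycleMeasure pbar.1] 0 := by
      refine ae_eq_zero_of_forall_setIntegral_eq_of_sigmaFinite (fun s hs hfin => ?_)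
        fun s hs hfin => ?_
      · exact Measure.integrableOn_of_bounded hfin.ne (aestronglyMeasurable_orbitVec hp D ξ _)
          (Filter.Eventually.of_forall fun q => (norm_orbitVec hp D ξ q).le)
      · have h1 := h ⟨indicatorConstLp 2 hs hfin.ne 1, by
          refine Integrable.congr ?_ indicatorConstLp_coeFn.symm
          exact (integrable_indicator_iff hs).2 (integrableOn_const hfin.ne)⟩
        rw [orbitT_apply] at h1
        rw [← h1, ← integral_indicator hs]
        refine integral_congr_ae ?_
        filter_upwards [indicatorConstLp_coeFn (p := 2) (hs := hs) (hμs := hfin.ne) (c := (1 : ℂ))]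
          with q hq
        rw [hq]
        by_cases hqs : q ∈ s <;> simp [hqs]
    have h2 : ∀ᵐ q ∂cycleMeasure pbar.1, False := by
      filter_upwards [h0] with q hq
      have := norm_orbitVec hp D ξ q
      rw [hq, Pi.zero_apply, norm_zero] at this
      exact hξ (norm_eq_zero.1 this.symm)
    exact cycleMeasure_ne_zero pbar.forwardCausal
      (Measure.measure_univ_eq_zero.1 (by simpa [ae_iff] using h2))
  obtain ⟨ψ₀, hψ₀⟩ := hne
  have htop := hirr.eq_top (K := (LinearMap.range (orbitT hp D ξ).toFun).topologicalClosure)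
    (Submodule.isClosed_topologicalClosure _) (fun g y hy => by
      refine map_mem_closure (D.toHom g).continuous hy fun z hz => ?_
      obtain ⟨ψ, rfl⟩ := hz
      obtain ⟨h, hh⟩ := hK.orbitT_ULor hp ⟨-(n : ℂ) / 2, by
        rw [← Complex.ofReal_natCast, ← Complex.ofReal_neg]
        simp⟩ g ψ
      exact ⟨_, hh.symm⟩)
    (Submodule.le_topologicalClosure _ ⟨ψ₀, rfl⟩) hψ₀
  have := Submodule.dense_iff_topologicalClosure_eq_top.2 htop
  exact this

end OrbitVec

/-! ### Positive mass: the subrepresentation of the principal series -/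

section Massive
variable {n : ℕ} [NeZero n] {m : ℝ} {pbar : MassShell n m}

/-- A forward timelike vector dominates the time component of forward causal vectors. -/
lemma exists_energy_le {v : Mink n} (hv : 0 < mdot v v) (hv0 : 0 < v 0) :
    ∃ C, 0 < C ∧ ∀ q : Mink n, ForwardCausal q → q 0 ≤ C * mdot v q := by
  set w := √(∑ i : Fin (n + 1), v i.succ ^ 2) with hw
  have hw2 : w ^ 2 = ∑ i : Fin (n + 1), v i.succ ^ 2 :=
    Real.sq_sqrt (Finset.sum_nonneg fun i _ => sq_nonneg _)
  have hw0 : 0 ≤ w := Real.sqrt_nonneg _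
  have hlt : w < v 0 := by
    refine lt_of_pow_lt_pow_left₀ 2 hv0.le ?_
    simp only [mdot, ← pow_two] at hv
    linarith
  refine ⟨(v 0 - w)⁻¹, inv_pos.2 (sub_pos.2 hlt), fun q hq => ?_⟩
  rw [le_inv_mul_iff₀ (sub_pos.2 hlt)]
  obtain ⟨hqq, hq0⟩ := hq
  simp only [mdot, ← pow_two] at hqq
  have h := Finset.sum_mul_sq_le_sq_mul_sq Finset.univ (fun i : Fin (n + 1) => v i.succ)
    fun i => q i.succ
  have h2 : (∑ i : Fin (n + 1), v i.succ * q i.succ) ^ 2 ≤ (w * q 0) ^ 2 := by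
    rw [mul_pow, hw2]
    exact h.trans (mul_le_mul_of_nonneg_left (by linarith)
      (Finset.sum_nonneg fun i _ => sq_nonneg _))
  have h3 := abs_le_of_sq_le_sq h2 (by positivity)
  have h4 := (le_abs_self _).trans h3
  rw [mdot]
  linarith

lemma cycleMeasure_univ_lt_top (hm : 0 < m) : cycleMeasure pbar.1 Set.univ < ⊤ := by
  obtain ⟨C, -, hC⟩ := exists_energy_le (v := pbar.1) (by rw [pbar.2.1]; positivity) pbar.2.2
  refine lt_of_le_of_lt (measure_mono_ae ?_) (cycleMeasure_bounded_lt_top pbar.1 C)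
  filter_upwards [ae_mem_cycle pbar] with q hq _
  have := hC q (cycle.forwardCausal hq)
  rwa [hq.2.2, mul_one] at this

variable (hp : (j0Down n).neg • pbar = pbar)
  {H : Type*} [NormedAddCommGroup H] [InnerProductSpace ℂ H]
  (D : UnitaryRep (LittleGroup pbar) H) (ξ : H)

lemma memLp_coefficient [IsFiniteMeasure (cycleMeasure pbar.1)] (x : H) :
    MemLp (fun q => inner ℂ (orbitVec hp D ξ q) x) 2 (cycleMeasure pbar.1) :=
  MemLp.of_bound ((aestronglyMeasurable_orbitVec hp D ξ _).inner aestronglyMeasurable_const)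
    (‖ξ‖ * ‖x‖) (Filter.Eventually.of_forall fun q =>
      (norm_inner_le_norm _ _).trans_eq (by rw [norm_orbitVec]))

/-- The matrix coefficients `(ι x)(q) = ⟨D(g_q) ξ, x⟩` as functions on a cycle of finite
measure. -/
def coefficient [IsFiniteMeasure (cycleMeasure pbar.1)] : H →L[ℂ] HLor pbar :=
  LinearMap.mkContinuous
    { toFun := fun x => (memLp_coefficient hp D ξ x).toLp _
      map_add' := fun x y => by
        rw [← MemLp.toLp_add]
        exact MemLp.toLp_congr _ _ (Filter.Eventually.of_forall fun q => inner_add_right _ _ _)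
      map_smul' := fun c x => by
        rw [RingHom.id_apply, ← MemLp.toLp_const_smul]
        exact MemLp.toLp_congr _ _ (Filter.Eventually.of_forall fun q => inner_smul_right _ _ _) }
    (measureUnivNNReal (cycleMeasure pbar.1) ^ (2 : ℝ≥0∞).toReal⁻¹ * ‖ξ‖) fun x => by
      rw [mul_assoc]
      refine Lp.norm_le_of_ae_bound (by positivity) ?_
      filter_upwards [(memLp_coefficient hp D ξ x).coeFn_toLp] with q hq
      change ‖((memLp_coefficient hp D ξ x).toLp _) q‖ ≤ _
      rw [hq]
      exact (norm_inner_le_norm _ _).trans_eq (by rw [norm_orbitVec])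

lemma coeFn_coefficient [IsFiniteMeasure (cycleMeasure pbar.1)] (x : H) :
    coefficient hp D ξ x =ᵐ[cycleMeasure pbar.1] fun q => inner ℂ (orbitVec hp D ξ q) x :=
  (memLp_coefficient hp D ξ x).coeFn_toLp

lemma inner_orbitT [CompleteSpace H] [IsFiniteMeasure (cycleMeasure pbar.1)] (x : H)
    (ψ : (orbitT hp D ξ).domain) :
    inner ℂ x (orbitT hp D ξ ψ) = inner ℂ (coefficient hp D ξ x) ψ.1 := by
  rw [orbitT_apply, L2.inner_def, ← integral_inner (integrable_smul_orbitVec hp D ξ ψ.2)]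
  refine integral_congr_ae ?_
  filter_upwards [coeFn_coefficient hp D ξ x] with q hq
  rw [hq, inner_smul_right, RCLike.inner_apply, inner_conj_symm]

variable {D ξ}

lemma FixedVector.coefficient_toHom [IsFiniteMeasure (cycleMeasure pbar.1)]
    (hK : FixedVector D ξ) (α : PrincipalParam n) (g : LittleGroup pbar) (x : H) :
    coefficient hp D ξ (D.toHom g x) = ULor α g.1 (coefficient hp D ξ x) := by
  ext1
  filter_upwards [coeFn_coefficient hp D ξ (D.toHom g x),
    coeFn_ULor α g (coefficient hp D ξ x), (measurePreserving_lmat g⁻¹).quasiMeasurePreserving.ae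
      (coeFn_coefficient hp D ξ x), ae_mem_cycle pbar] with q h1 h2 h3 h4
  rw [h1, h2, h3, ← hK.toHom_orbitVec hp g⁻¹ h4, D.inner_toHom_left, inv_inv]

/-- By Schur's lemma, the matrix coefficients form a multiple of an isometry. -/
lemma FixedVector.norm_coefficient [CompleteSpace H] [IsFiniteMeasure (cycleMeasure pbar.1)]
    (hK : FixedVector D ξ) (hirr : D.Irreducible) (hξ : ξ ≠ 0) :
    ∃ c : ℝ, 0 < c ∧ ∀ x, ‖coefficient hp D ξ x‖ ^ 2 = c * ‖x‖ ^ 2 := by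
  set ι := coefficient hp D ξ with hι
  let α : PrincipalParam n := ⟨-(n : ℂ) / 2, by
    rw [← Complex.ofReal_natCast, ← Complex.ofReal_neg]; simp⟩
  set S : H →L[ℂ] H := ι.adjoint ∘L ι with hS
  have hSi : ∀ x y, inner ℂ x (S y) = inner ℂ (ι x) (ι y) := fun x y => by
    rw [hS, ContinuousLinearMap.comp_apply, ContinuousLinearMap.adjoint_inner_right]
  have hself : IsSelfAdjoint S := by
    rw [ContinuousLinearMap.isSelfAdjoint_iff_isSymmetric]
    intro x y
    change inner ℂ (S x) y = inner ℂ x (S y)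
    rw [← inner_conj_symm, hSi, hSi, inner_conj_symm]
  obtain ⟨c, hc⟩ := hirr.exists_eq_smul_one S hself.isStarNormal fun g x => by
    refine ext_inner_left ℂ fun y => ?_
    rw [hSi, hι, hK.coefficient_toHom hp α, ← inv_inv g, ← D.inner_toHom_left, hSi, hι,
      hK.coefficient_toHom hp α, inv_inv, ← LinearIsometry.inner_map_map (ULor α g.1) (ULor _ _ _),
      ← ULor_mul]
    have : g.1 * (g⁻¹ : LittleGroup pbar).1 = 1 := by simp
    rw [this]
    have h1 : ULor α 1 (coefficient hp D ξ y) = coefficient hp D ξ y := by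
      have := hK.coefficient_toHom hp α 1 y
      rw [D.toHom_one_apply] at this
      exact this.symm
    rw [h1]
  have hnorm : ∀ x, ‖ι x‖ ^ 2 = c.re * ‖x‖ ^ 2 := fun x => by
    have h1 := hSi x x
    rw [hc, _root_.smul_apply, one_apply_eq_self, inner_smul_right,
      inner_self_eq_norm_sq_to_K, inner_self_eq_norm_sq_to_K] at h1
    have h2 := congrArg Complex.re h1
    rw [← RCLike.ofReal_pow, ← RCLike.ofReal_pow] at h2
    simp only [Complex.coe_algebraMap, Complex.re_mul_ofReal, Complex.ofReal_re] at h2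
    exact h2.symm
  refine ⟨c.re, ?_, hnorm⟩
  have hc0 : 0 ≤ c.re := by
    have h1 := hnorm ξ
    have h2 : 0 < ‖ξ‖ ^ 2 := by positivity
    by_contra hneg
    nlinarith [sq_nonneg ‖ι ξ‖]
  refine hc0.lt_of_ne fun h0 => ?_
  have hι0 : ∀ x, ι x = 0 := fun x => by
    have := hnorm x
    rw [← h0, zero_mul] at this
    exact norm_eq_zero.1 (pow_eq_zero_iff two_ne_zero |>.1 this)
  have hT : ∀ ψ, orbitT hp D ξ ψ = 0 := fun ψ => by
    refine ext_inner_left ℂ fun x => ?_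
    rw [inner_orbitT, ← hι, hι0, inner_zero_left, inner_zero_right]
  have hd := hK.denseRange_orbitT hp hirr hξ
  have hr : Set.range (orbitT hp D ξ) ⊆ {0} := by
    rintro _ ⟨ψ, rfl⟩
    exact hT ψ
  have h1 := hd.closure_eq
  have h2 := closure_mono hr
  rw [h1, closure_singleton] at h2
  exact hξ (h2 (Set.mem_univ ξ))

lemma coefficient_smul [IsFiniteMeasure (cycleMeasure pbar.1)] (c : ℝ) (x : H) :
    coefficient hp D ((c : ℂ) • ξ) x = (c : ℂ) • coefficient hp D ξ x := by
  ext1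
  filter_upwards [coeFn_coefficient hp D ((c : ℂ) • ξ) x, coeFn_coefficient hp D ξ x,
    Lp.coeFn_smul (c : ℂ) (coefficient hp D ξ x)] with q h1 h2 h3
  rw [h1, h3, Pi.smul_apply, h2, orbitVec_smul, inner_smul_left, Complex.conj_ofReal, smul_eq_mul]

/-- A suitable multiple of an invariant vector makes `T` the adjoint of an isometric embedding. -/
theorem FixedVector.isSubrepProjection [CompleteSpace H] (hm : 0 < m)
    (hK : FixedVector D ξ) (hirr : D.Irreducible) (hξ : ξ ≠ 0) :
    ∃ c : ℂ, c ≠ 0 ∧ IsSubrepProjection D (orbitT hp D (c • ξ)) := by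
  have : IsFiniteMeasure (cycleMeasure pbar.1) := ⟨cycleMeasure_univ_lt_top hm⟩
  obtain ⟨c, hc, hnorm⟩ := hK.norm_coefficient hp hirr hξ
  have hs : 0 < (√c)⁻¹ := inv_pos.2 (Real.sqrt_pos.2 hc)
  refine ⟨((√c)⁻¹ : ℝ), by exact_mod_cast hs.ne', ?_, ?_⟩
  · refine eq_top_iff.2 fun ψ _ => ?_
    exact (Lp.memLp ψ).integrable (by norm_num)
  · refine ⟨⟨(coefficient hp D ((((√c)⁻¹ : ℝ) : ℂ) • ξ)).toLinearMap, fun x => ?_⟩,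
      fun α g x => ?_, fun x ψ => ?_⟩
    · change ‖coefficient hp D ((((√c)⁻¹ : ℝ) : ℂ) • ξ) x‖ = ‖x‖
      rw [coefficient_smul, norm_smul, Complex.norm_real, Real.norm_of_nonneg hs.le,
        inv_mul_eq_iff_eq_mul₀ (Real.sqrt_pos.2 hc).ne',
        ← sq_eq_sq₀ (norm_nonneg _) (by positivity), hnorm, mul_pow, Real.sq_sqrt hc.le]
    · exact (hK.smul _).coefficient_toHom hp α g x
    · exact inner_orbitT hp D _ x ψ

end Massive

/-! ### Equivariance of the intertwiner `R^α` -/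

section Intertwiner
variable {n : ℕ} [NeZero n] {m : ℝ} {pbar : MassShell n m}
  {V : Type*} [NormedAddCommGroup V] [InnerProductSpace ℂ V]
  {T : HLor pbar →ₗ.[ℂ] V} {α : PrincipalParam n} {A : BoostSection pbar}

lemma intertwiner_eq_of_graph {Φ : L2Shell n m (HLor pbar)} {Ψ : L2Shell n m V}
    (h : ∀ᵐ p ∂shellMeasure n m, (ULor α (A.toFun p)⁻¹ (Φ p), Ψ p) ∈ T.graph) :
    ∃ h : Φ ∈ (intertwiner T α A).domain, Ψ = intertwiner T α A ⟨Φ, h⟩ :=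
  ⟨⟨Ψ, h⟩, intertwiner_unique h (Classical.choose_spec (⟨Ψ, h⟩ : Φ ∈ intertwinerDomain T α A))⟩

lemma intertwiner_mem_graph (Φ : (intertwiner T α A).domain) : ∀ᵐ p ∂shellMeasure n m,
    (ULor α (A.toFun p)⁻¹ (Φ.1 p), intertwiner T α A Φ p) ∈ T.graph :=
  Classical.choose_spec Φ.2

variable {D : UnitaryRep (LittleGroup pbar) V}

lemma intertwiner_U0tensor
    (hT : ∀ (α : PrincipalParam n) (g : LittleGroup pbar) (ψ : T.domain),
      ∃ h : ULor α g.1 ψ.1 ∈ T.domain, D.toHom g (T ψ) = T ⟨ULor α g.1 ψ.1, h⟩)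
    (a : Mink n) (L : restrictedLorentz n) (Φ : (intertwiner T α A).domain) :
    ∃ h : U0tensor α a L Φ.1 ∈ (intertwiner T α A).domain,
      Uirr D A a L (intertwiner T α A Φ) = intertwiner T α A ⟨U0tensor α a L Φ.1, h⟩ := by
  refine intertwiner_eq_of_graph ?_
  filter_upwards [(measurePreserving_smul (m := m) (L⁻¹).1).quasiMeasurePreserving.ae
    (intertwiner_mem_graph Φ), MemLp.coeFn_toLp (μ := shellMeasure n m) (p := 2)
      (f := fun p => plane a p • ULor α L (Φ.1 (L⁻¹ • p))) _,
    MemLp.coeFn_toLp (μ := shellMeasure n m) (p := 2)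
      (f := fun p => plane a p • D.toHom (wignerRotation A L p)
        (intertwiner T α A Φ (L⁻¹ • p))) _] with p h1 h2 h3
  rw [U0tensor, Uirr, h2, h3, map_smul]
  suffices h : (ULor α (A.toFun p)⁻¹ (ULor α L (Φ.1 (L⁻¹ • p))),
      D.toHom (wignerRotation A L p) (intertwiner T α A Φ (L⁻¹ • p))) ∈ T.graph from
    T.graph.smul_mem (plane a p) h
  obtain ⟨y, hy1, hy2⟩ := (LinearPMap.mem_graph_iff T).1 h1
  obtain ⟨h4, h5⟩ := hT α (wignerRotation A L p) y
  refine (LinearPMap.mem_graph_iff T).2 ⟨⟨_, h4⟩, ?_, ?_⟩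
  · simp only at hy1 ⊢
    rw [hy1, ← ULor_mul, ← ULor_mul]
    congr 2
    simp only [wignerRotation]
    change (A.toFun p)⁻¹ * L * A.toFun (L⁻¹ • p) * (A.toFun (L⁻¹ • p))⁻¹ = _
    rw [mul_inv_cancel_right]
  · simp only at hy2 ⊢
    rw [← h5, hy2]
    rfl

/-- With `p' = -j⁻¹ p` the relation reduces pointwise to `j₀ R(j₀ j, -j₀ p) A_{p'}⁻¹ = A_p⁻¹ j`,
which holds since `A` is compatible with `j₀`. -/
lemma intertwiner_U0tensorDown {J : V ≃ₗᵢ⋆[ℂ] V}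
    (hT : ∀ (α : PrincipalParam n) (g : LittleGroup pbar) (ψ : T.domain),
      ∃ h : ULor α g.1 ψ.1 ∈ T.domain, D.toHom g (T ψ) = T ⟨ULor α g.1 ψ.1, h⟩)
    (hJ : ∀ (α : PrincipalParam n) (ψ : T.domain),
      ∃ h : ULorDown α (j0Down n) ψ.1 ∈ T.domain,
        J (T ψ) = T ⟨ULorDown α (j0Down n) ψ.1, h⟩)
    (j : LorentzDown n) (Φ : (intertwiner T α A).domain) :
    ∃ h : U0tensorDown α j Φ.1 ∈ (intertwiner T α.conj A).domain,
      UirrDown D J A j (intertwiner T α A Φ) =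
        intertwiner T α.conj A ⟨U0tensorDown α j Φ.1, h⟩ := by
  refine intertwiner_eq_of_graph ?_
  filter_upwards [(measurePreserving_smul (m := m) (j.neg⁻¹)).quasiMeasurePreserving.ae
    (intertwiner_mem_graph Φ), MemLp.coeFn_toLp (μ := shellMeasure n m) (p := 2)
      (f := fun p => ULorDown α j (Φ.1 (j.neg⁻¹ • p))) _,
    MemLp.coeFn_toLp (μ := shellMeasure n m) (p := 2)
      (f := fun p => J (D.toHom (wignerRotation A j.j0Mul ((j0Down n).neg • p))
        (intertwiner T α A Φ (j.neg⁻¹ • p)))) _] with p h1 h2 h3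
  rw [U0tensorDown, UirrDown, h2, h3]
  obtain ⟨y, hy1, hy2⟩ := (LinearPMap.mem_graph_iff T).1 h1
  obtain ⟨h4, h5⟩ := hT α (wignerRotation A j.j0Mul ((j0Down n).neg • p)) y
  obtain ⟨h6, h7⟩ := hJ α ⟨_, h4⟩
  refine (LinearPMap.mem_graph_iff T).2 ⟨⟨_, h6⟩, ?_, ?_⟩
  · simp only at hy1 ⊢
    have hjj : (j0Down n).neg * (j0Down n).neg = 1 := by
      nth_rewrite 1 [← neg_j0_inv]
      exact inv_mul_cancel _
    have hj0 : (j.j0Mul).1 = (j0Down n).neg * j.neg := by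
      refine Subtype.ext ?_
      change j0 n * j.1 = -j0 n * -j.1
      rw [neg_mul_neg]
    have hq : (j.j0Mul)⁻¹ • ((j0Down n).neg • p) = j.neg⁻¹ • p := by
      change ((j.j0Mul).1)⁻¹ • ((j0Down n).neg • p) = j.neg⁻¹ • p
      rw [hj0, _root_.mul_inv_rev, neg_j0_inv, smul_smul, mul_assoc, hjj, mul_one]
    have hA : (A.toFun p).1 = (j0Down n).neg * (A.toFun ((j0Down n).neg • p)).1 *
        (j0Down n).neg := by
      have h8 := A.conj_reflection ((j0Down n).neg • p)
      rw [smul_smul, hjj, one_smul] at h8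
      rw [← h8]
      refine Subtype.ext ?_
      change j0 n * _ * j0 n = -j0 n * _ * -j0 n
      rw [neg_mul, neg_mul_neg]
    rw [hy1]
    change conjLp (pullback α (j0Down n).neg (pullback α _ (pullback α _ _))) =
      pullback α.conj _ (conjLp (pullback α j.neg _))
    rw [← conjLp_pullback, ← pullback_mul, ← pullback_mul, ← pullback_mul]
    congr 3
    have h9 : (wignerRotation A j.j0Mul ((j0Down n).neg • p)).1.1 =
        ((A.toFun ((j0Down n).neg • p)).1)⁻¹ * (j.j0Mul).1 *
          (A.toFun (j.neg⁻¹ • p)).1 := by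
      rw [← hq]; rfl
    rw [h9, hj0]
    rw [Subgroup.coe_inv, Subgroup.coe_inv, hA, _root_.mul_inv_rev, _root_.mul_inv_rev, neg_j0_inv]
    group
  · simp only at hy2 ⊢
    rw [← h7, ← h5, hy2]

end Intertwiner

/-! ### Density of the domain of the intertwiner `R^α` -/

section Density
variable {n : ℕ} [NeZero n] {m : ℝ} {pbar : MassShell n m}

lemma homExt_inv_inv (α : PrincipalParam n) (g : orthochronous n) (ψ : HLor pbar) :
    pullback α g⁻¹ ψ =ᵐ[cycleMeasure pbar.1] fun q => homExt pbar.1 α.1 ψ (g.1.1 *ᵥ q) := by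
  have := coeFn_pullback α g⁻¹ ψ
  rwa [inv_inv] at this

/-- The `L¹` norm on the cycle of `v` of a translated homogeneous function, as an integral of the
original function with a weight that is singular only in the direction of `g v`. -/
lemma lintegral_homExt_mulVec {v : Mink n} (hv : ForwardCausal v) (α : PrincipalParam n)
    (g : orthochronous n) {ϕ : Mink n → ℂ} (hϕ : Measurable ϕ) :
    ∫⁻ q, ‖homExt v α.1 ϕ (g.1.1 *ᵥ q)‖ₑ ∂cycleMeasure v =
      ∫⁻ q, ‖ϕ q‖ₑ * ENNReal.ofReal ((mdot (g.1.1 *ᵥ v) q) ^ (-(n : ℝ) / 2)) ∂cycleMeasure v := by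
  have hf : Measurable fun q => ‖ϕ q‖ₑ *
      ENNReal.ofReal ((mdot (g.1.1 *ᵥ v) q) ^ (-(n : ℝ) / 2)) :=
    hϕ.enorm.mul ((measurable_mdot _).pow_const _).ennreal_ofReal
  rw [← lintegral_cycle_comp hv (inv_mem g.2) hf]
  refine lintegral_congr_ae ?_
  filter_upwards [ae_cycleMeasure (v := v) (hv.mulVec (inv_mem g.2)),
    ae_cycleMeasure_eq_one (v := v)] with q hq hq1
  rw [← mdot_inv_mulVec (inv_mem g.2), inv_inv] at hq
  rw [inv_inv, homExt, enorm_mul, mul_left_comm, mul_comm]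
  congr 1
  have h1 : mdot (g.1.1 *ᵥ v) (toCycle v (g.1.1 *ᵥ q)) = (mdot v (g.1.1 *ᵥ q))⁻¹ := by
    rw [toCycle, mdot_smul, g.2.1, hq1, mul_one]
  rw [h1, ← ENNReal.ofReal_mul (by positivity), ← ofReal_norm,
    Complex.norm_cpow_eq_rpow_re_of_pos hq, α.2]
  congr 1
  rw [Real.inv_rpow hq.le, inv_pow, ← Real.rpow_natCast, ← Real.rpow_neg hq.le,
    ← Real.rpow_neg hq.le, ← Real.rpow_add hq]
  congr 1
  ring

/-- The transform of a square integrable function is integrable over the cycle if the function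
vanishes at large energies and near the direction where the Jacobian is singular. -/
lemma lintegral_homExt_mulVec_lt_top {v : Mink n} (hv : ForwardCausal v) (α : PrincipalParam n)
    (g : orthochronous n) {ϕ : Mink n → ℂ} (hϕ : Measurable ϕ) (hϕ2 : MemLp ϕ 2 (cycleMeasure v))
    {R δ : ℝ} (hδ : 0 < δ)
    (hS : ∀ᵐ q ∂cycleMeasure v, ϕ q ≠ 0 → q 0 ≤ R ∧ δ ≤ mdot (g.1.1 *ᵥ v) q) :
    ∫⁻ q, ‖homExt v α.1 ϕ (g.1.1 *ᵥ q)‖ₑ ∂cycleMeasure v < ⊤ := by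
  rw [lintegral_homExt_mulVec hv α g hϕ]
  set S : Set (Mink n) := {q | q 0 ≤ R} with hSdef
  have hSm : MeasurableSet S := measurableSet_le (measurable_pi_apply 0) measurable_const
  have : IsFiniteMeasure ((cycleMeasure v).restrict S) :=
    ⟨by rw [Measure.restrict_apply_univ]; exact cycleMeasure_bounded_lt_top v R⟩
  have hint : Integrable ϕ ((cycleMeasure v).restrict S) :=
    (hϕ2.restrict S).integrable (by norm_num)
  calc _ ≤ ∫⁻ q, S.indicator (fun q => ‖ϕ q‖ₑ * ENNReal.ofReal (δ ^ (-(n : ℝ) / 2))) q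
        ∂cycleMeasure v := by
        refine lintegral_mono_ae ?_
        filter_upwards [hS] with q hq
        by_cases h0 : ϕ q = 0
        · simp [h0]
        · obtain ⟨h1, h2⟩ := hq h0
          rw [Set.indicator_of_mem (by exact h1)]
          refine mul_le_mul_right (ENNReal.ofReal_le_ofReal ?_) _
          have h3 : -(n : ℝ) / 2 ≤ 0 := by
            have : (0 : ℝ) ≤ n := Nat.cast_nonneg n
            linarith
          exact Real.rpow_le_rpow_of_nonpos hδ h2 h3
    _ = (∫⁻ q in S, ‖ϕ q‖ₑ ∂cycleMeasure v) * ENNReal.ofReal (δ ^ (-(n : ℝ) / 2)) := by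
        rw [lintegral_indicator hSm, lintegral_mul_const _ hϕ.enorm]
    _ < ⊤ := ENNReal.mul_lt_top hint.2 ENNReal.ofReal_lt_top

lemma BoostSection.measurable_mulVec (A : BoostSection pbar) :
    Measurable fun x : MassShell n m × Mink n => (A.toFun x.1).1.1.1 *ᵥ x.2 := by
  have h1 : ∀ i j, Measurable fun p : MassShell n m => (A.toFun p).1.1.1 i j := fun i j => by
    have hc : Continuous fun L : restrictedLorentz n => L.1.1.1 i j :=
      (Continuous.matrix_elem (Units.continuous_val.comp
        (continuous_subtype_val.comp continuous_subtype_val)) i j)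
    exact (hc.comp_stronglyMeasurable A.stronglyMeasurable).measurable
  refine measurable_pi_iff.2 fun i => ?_
  simp only [mulVec, dotProduct]
  exact Finset.measurable_sum _ fun j _ => ((h1 i j).comp measurable_fst).mul
    ((measurable_pi_apply j).comp measurable_snd)

lemma measurable_homExt_boost (A : BoostSection pbar) (α : ℂ) {ϕ : Mink n → ℂ}
    (hϕ : Measurable ϕ) :
    Measurable fun x : MassShell n m × Mink n =>
      homExt pbar.1 α ϕ ((A.toFun x.1).1.1.1 *ᵥ x.2) :=
  (measurable_homExt _ _ hϕ).comp A.measurable_mulVec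

variable (hp : (j0Down n).neg • pbar = pbar)
  {H : Type*} [NormedAddCommGroup H] [InnerProductSpace ℂ H]
  (D : UnitaryRep (LittleGroup pbar) H) (ξ : H)

/-- The tensors `φ ⊗ ϕ` with `φ` supported where the translates of `ϕ` are bounded in `L¹` are in
the domain of `R^α`. -/
lemma tensor_mem_intertwiner (A : BoostSection pbar) (α : PrincipalParam n)
    (φ : L2Shell n m ℂ) (ϕ : HLor pbar) {C : ℝ}
    (h : ∀ᵐ p ∂shellMeasure n m, φ p ≠ 0 →
      ∫⁻ q, ‖homExt pbar.1 α.1 ϕ ((A.toFun p).1.1.1 *ᵥ q)‖ₑ ∂cycleMeasure pbar.1 ≤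
        ENNReal.ofReal C) :
    tensor φ ϕ ∈ (intertwiner (orbitT hp D ξ) α A).domain := by
  have hϕ : Measurable ϕ := (Lp.stronglyMeasurable ϕ).measurable
  have hov := aestronglyMeasurable_orbitVec hp D ξ (cycleMeasure pbar.1)
  set G : MassShell n m → Mink n → ℂ :=
    fun p q => homExt pbar.1 α.1 ϕ ((A.toFun p).1.1.1 *ᵥ q) with hG
  have hGm : Measurable (Function.uncurry G) := measurable_homExt_boost A α.1 hϕ
  set I : MassShell n m → H := fun p => ∫ q, G p q • hov.mk _ q ∂cycleMeasure pbar.1 with hI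
  have hIm : StronglyMeasurable I :=
    StronglyMeasurable.integral_prod_right (f := fun p q => G p q • hov.mk _ q)
      (hGm.stronglyMeasurable.smul (hov.stronglyMeasurable_mk.comp_measurable measurable_snd))
  have hmemd : ∀ p, ∫⁻ q, ‖G p q‖ₑ ∂cycleMeasure pbar.1 ≤ ENNReal.ofReal C →
      ∃ h : ULor α (A.toFun p)⁻¹ ϕ ∈ (orbitT hp D ξ).domain,
        orbitT hp D ξ ⟨_, h⟩ = I p ∧ ‖I p‖ ≤ max C 0 * ‖ξ‖ := by
    intro p hpC
    have hU : ULor α (A.toFun p)⁻¹ ϕ =ᵐ[cycleMeasure pbar.1] G p :=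
      homExt_inv_inv α (A.toFun p).1 ϕ
    have hGp : Integrable (G p) (cycleMeasure pbar.1) :=
      ⟨(hGm.comp measurable_prodMk_left).aestronglyMeasurable,
        hpC.trans_lt ENNReal.ofReal_lt_top⟩
    refine ⟨hGp.congr hU.symm, ?_, ?_⟩
    · rw [orbitT_apply]
      refine integral_congr_ae ?_
      filter_upwards [hU, hov.ae_eq_mk] with q h1 h2
      rw [h1, h2]
    · have h1 : ∫ q, ‖G p q‖ ∂cycleMeasure pbar.1 ≤ max C 0 := by
        rw [integral_norm_eq_lintegral_enorm hGp.1]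
        exact ENNReal.toReal_le_of_le_ofReal (le_max_right _ _)
          (hpC.trans (ENNReal.ofReal_le_ofReal (le_max_left _ _)))
      calc ‖I p‖ ≤ ∫ q, ‖G p q • hov.mk _ q‖ ∂cycleMeasure pbar.1 :=
            norm_integral_le_integral_norm _
        _ = ∫ q, ‖G p q‖ * ‖ξ‖ ∂cycleMeasure pbar.1 := by
            refine integral_congr_ae ?_
            filter_upwards [hov.ae_eq_mk] with q h2
            rw [norm_smul, ← h2, norm_orbitVec]
        _ ≤ max C 0 * ‖ξ‖ := by
            rw [integral_mul_const]
            exact mul_le_mul_of_nonneg_right h1 (norm_nonneg _)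
  have hmem : MemLp (fun p => φ p • I p) 2 (shellMeasure n m) := by
    refine MemLp.of_le ((Lp.memLp φ).norm.const_mul (max C 0 * ‖ξ‖))
      ((Lp.aestronglyMeasurable φ).smul hIm.aestronglyMeasurable) ?_
    filter_upwards [h] with p hpC
    by_cases h0 : φ p = 0
    · simp [h0]
    · obtain ⟨-, -, h3⟩ := hmemd p (hpC h0)
      rw [norm_smul, norm_mul, norm_norm, Real.norm_of_nonneg (by positivity), mul_comm]
      gcongr
  refine ⟨hmem.toLp _, ?_⟩
  filter_upwards [h, coeFn_tensor φ ϕ, hmem.coeFn_toLp] with p hpC h1 h2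
  rw [h1, h2, map_smul]
  by_cases h0 : φ p = 0
  · rw [h0, zero_smul, zero_smul]
    exact Submodule.zero_mem _
  · obtain ⟨h3, h4, -⟩ := hmemd p (hpC h0)
    have h5 : (ULor α (A.toFun p)⁻¹ ϕ, I p) ∈ (orbitT hp D ξ).graph :=
      (LinearPMap.mem_graph_iff _).2 ⟨⟨_, h3⟩, rfl, h4⟩
    exact Submodule.smul_mem _ (φ p) h5

/-- A vector orthogonal to all elementary tensors in the domain is, at almost every momentum `p`,
orthogonal to each function `ϕ` whose boost to `p` is integrable: it is orthogonal to the tensors of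
`ϕ` with functions of `p` supported where the norm of this boost is bounded. -/
lemma ae_inner_eq_zero_of_orthogonal (A : BoostSection pbar) (α : PrincipalParam n)
    (F : L2Shell n m (HLor pbar))
    (hF : ∀ (φ : L2Shell n m ℂ) (ϕ : HLor pbar),
      tensor φ ϕ ∈ (intertwiner (orbitT hp D ξ) α A).domain → inner ℂ (tensor φ ϕ) F = 0)
    (ϕ : HLor pbar) : ∀ᵐ p ∂shellMeasure n m,
      ∫⁻ q, ‖homExt pbar.1 α.1 ϕ ((A.toFun p).1.1.1 *ᵥ q)‖ₑ ∂cycleMeasure pbar.1 < ⊤ →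
        inner ℂ ϕ (F p) = 0 := by
  have hϕ : Measurable ϕ := (Lp.stronglyMeasurable ϕ).measurable
  set N : MassShell n m → ℝ≥0∞ := fun p =>
    ∫⁻ q, ‖homExt pbar.1 α.1 ϕ ((A.toFun p).1.1.1 *ᵥ q)‖ₑ ∂cycleMeasure pbar.1 with hN
  have hNm : Measurable N := (measurable_homExt_boost A α.1 hϕ).enorm.lintegral_prod_right'
  have key : ∀ C : ℕ, ∀ᵐ p ∂shellMeasure n m, N p ≤ ENNReal.ofReal C →
      inner ℂ ϕ (F p) = 0 := by
    intro C
    set S : Set (MassShell n m) := {p | N p ≤ ENNReal.ofReal C} with hS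
    have hSm : MeasurableSet S := measurableSet_le hNm measurable_const
    have h1 : MemLp (fun p => inner ℂ ϕ (F p)) 2 (shellMeasure n m) :=
      (Lp.memLp F).const_inner ϕ
    have h2 := h1.indicator hSm
    have hmem := tensor_mem_intertwiner hp D ξ A α (h2.toLp _) ϕ (C := C) (by
      filter_upwards [h2.coeFn_toLp] with p h3 h4
      rw [h3] at h4
      have h5 : p ∈ S := Set.mem_of_indicator_ne_zero h4
      exact h5)
    have h5 := hF _ _ hmem
    rw [L2.inner_def] at h5
    have h6 : ∫ p, ((‖S.indicator (fun p => inner ℂ ϕ (F p)) p‖ ^ 2 : ℝ) : ℂ)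
        ∂shellMeasure n m = 0 := by
      rw [← h5]
      refine integral_congr_ae ?_
      filter_upwards [coeFn_tensor (h2.toLp _) ϕ, h2.coeFn_toLp] with p h7 h8
      rw [h7, h8, inner_smul_left]
      by_cases hpS : p ∈ S
      · rw [Set.indicator_of_mem hpS, Complex.ofReal_pow]
        exact (Complex.conj_mul' _).symm
      · simp [hpS]
    rw [integral_complex_ofReal, Complex.ofReal_eq_zero, integral_eq_zero_iff_of_nonneg
      (fun p => by positivity) (by simpa using h2.integrable_norm_pow (p := 2) (by norm_num))] at h6
    filter_upwards [h6] with p h7 h8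
    have h9 : p ∈ S := h8
    simpa [h9] using h7
  rw [← ae_all_iff] at key
  filter_upwards [key] with p hk hlt
  obtain ⟨C, hC⟩ := exists_nat_ge (N p).toReal
  have hlt' : N p ≠ ⊤ := hlt.ne
  exact hk C ((ENNReal.ofReal_toReal hlt').symm.le.trans (ENNReal.ofReal_le_ofReal hC))

/-- The elementary tensors in the domain of `R^α` are total. It suffices to use the functions
`ϕ 1_S` where `ϕ` ranges over a countable dense set and `S` over countably many sets of bounded
energy that avoid a neighbourhood of the direction of some point `p'` of a countable dense subset of
the mass shell; such a tensor is in the domain if the momentum is restricted to a neighbourhood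
of `p'`. -/
theorem dense_tensor_intertwiner (A : BoostSection pbar) (α : PrincipalParam n) :
    Dense (Submodule.span ℂ {Φ : L2Shell n m (HLor pbar) |
      Φ ∈ (intertwiner (orbitT hp D ξ) α A).domain ∧
        ∃ (φ : L2Shell n m ℂ) (ϕ : HLor pbar), Φ = tensor φ ϕ} :
          Set (L2Shell n m (HLor pbar))) := by
  rw [Submodule.dense_iff_topologicalClosure_eq_top, Submodule.topologicalClosure_eq_top_iff,
    Submodule.eq_bot_iff]
  intro F hF
  have hF' : ∀ (φ : L2Shell n m ℂ) (ϕ : HLor pbar),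
      tensor φ ϕ ∈ (intertwiner (orbitT hp D ξ) α A).domain → inner ℂ (tensor φ ϕ) F = 0 :=
    fun φ ϕ h => (Submodule.mem_orthogonal _ _).1 hF _ (Submodule.subset_span ⟨h, φ, ϕ, rfl⟩)
  have : Nonempty (MassShell n m) := ⟨pbar⟩
  have : Fact ((2 : ℝ≥0∞) ≠ ⊤) := ⟨ENNReal.ofNat_ne_top⟩
  let P := TopologicalSpace.denseSeq (MassShell n m)
  let S : ℕ → ℕ → Set (Mink n) := fun j k => {q | q 0 ≤ k ∧ ((k : ℝ) + 1)⁻¹ ≤ mdot (P j).1 q}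
  have hSm : ∀ j k, MeasurableSet (S j k) := fun j k =>
    (measurableSet_le (measurable_pi_apply 0) measurable_const).inter
      (measurableSet_le measurable_const (measurable_mdot _))
  let ϕ : ℕ → HLor pbar := TopologicalSpace.denseSeq (HLor pbar)
  have hmem : ∀ i j k, MemLp ((S j k).indicator (ϕ i)) 2 (cycleMeasure pbar.1) := fun i j k =>
    (Lp.memLp (ϕ i)).indicator (hSm j k)
  have hae : ∀ᵐ p ∂shellMeasure n m, ∀ i j k,
      ∫⁻ q, ‖homExt pbar.1 α.1 ((hmem i j k).toLp _) ((A.toFun p).1.1.1 *ᵥ q)‖ₑ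
        ∂cycleMeasure pbar.1 < ⊤ → inner ℂ ((hmem i j k).toLp _) (F p) = 0 := by
    simp only [ae_all_iff]
    exact fun i j k => ae_inner_eq_zero_of_orthogonal hp D ξ A α F hF' _
  refine (Lp.eq_zero_iff_ae_eq_zero).2 ?_
  filter_upwards [hae] with p hpae
  rw [Pi.zero_apply, Lp.eq_zero_iff_ae_eq_zero]
  have hbase : (A.toFun p).1.1.1 *ᵥ pbar.1 = p.1 := congrArg Subtype.val (A.map_base p)
  have hS0 : ∀ j k, (∀ q ∈ S j k, q ∈ cycle pbar → ((k : ℝ) + 1)⁻¹ / 2 ≤ mdot p.1 q) →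
      ∀ᵐ q ∂cycleMeasure pbar.1, q ∈ S j k → F p q = 0 := by
    intro j k hjk
    have hFm : MemLp ((S j k).indicator (F p)) 2 (cycleMeasure pbar.1) :=
      (Lp.memLp (F p)).indicator (hSm j k)
    have h0 : hFm.toLp _ = 0 := by
      refine (TopologicalSpace.denseRange_denseSeq (HLor pbar)).eq_zero_of_inner_left (𝕜 := ℂ) ?_
      intro i
      have h1 := hpae i j k (by
        refine lintegral_homExt_mulVec_lt_top pbar.forwardCausal α (A.toFun p).1
          (Lp.stronglyMeasurable _).measurable (Lp.memLp _) (R := k) (δ := ((k : ℝ) + 1)⁻¹ / 2)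
          (by positivity) ?_
        filter_upwards [(hmem i j k).coeFn_toLp, ae_mem_cycle pbar] with q h2 h3 h4
        rw [h2] at h4
        have h5 := Set.mem_of_indicator_ne_zero h4
        refine ⟨h5.1, ?_⟩
        rw [hbase]
        exact hjk q h5 h3)
      change inner ℂ _ (ϕ i) = 0
      rw [← inner_conj_symm, map_eq_zero, ← h1, L2.inner_def, L2.inner_def]
      refine integral_congr_ae ?_
      filter_upwards [(hmem i j k).coeFn_toLp, hFm.coeFn_toLp] with q h2 h3
      rw [h2, h3]
      by_cases hq : q ∈ S j k
      · rw [Set.indicator_of_mem hq, Set.indicator_of_mem hq]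
      · rw [Set.indicator_of_notMem hq, Set.indicator_of_notMem hq, inner_zero_left,
          inner_zero_right]
    have h1 := (Lp.eq_zero_iff_ae_eq_zero).1 h0
    filter_upwards [h1, hFm.coeFn_toLp] with q h2 h3 hq
    rw [h2, Set.indicator_of_mem hq] at h3
    exact h3.symm
  have hall : ∀ᵐ q ∂cycleMeasure pbar.1, ∀ j k,
      (∀ q ∈ S j k, q ∈ cycle pbar → ((k : ℝ) + 1)⁻¹ / 2 ≤ mdot p.1 q) →
        q ∈ S j k → F p q = 0 := by
    simp only [ae_all_iff]
    exact hS0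
  filter_upwards [hall, ae_cycleMeasure (v := pbar.1) p.forwardCausal, ae_mem_cycle pbar]
    with q h1 h2 h3
  obtain ⟨k, hk⟩ := exists_nat_ge (max (q 0) (2 * (mdot p.1 q)⁻¹))
  have hk1 : (q 0) ≤ k := (le_max_left _ _).trans hk
  have hk2 : ((k : ℝ) + 1)⁻¹ ≤ mdot p.1 q / 2 := by
    have h4 : 2 * (mdot p.1 q)⁻¹ ≤ (k : ℝ) + 1 := by
      have := (le_max_right _ _).trans hk
      linarith
    calc ((k : ℝ) + 1)⁻¹ ≤ (2 * (mdot p.1 q)⁻¹)⁻¹ := inv_anti₀ (by positivity) h4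
      _ = mdot p.1 q / 2 := by rw [mul_inv, inv_inv]; ring
  -- the components of a null vector are bounded by its energy
  have hb : ∀ w : Mink n, ∀ q ∈ cycle pbar, q 0 ≤ k →
      |mdot w q| ≤ (n + 2) * ‖w‖ * k := by
    intro w q hq hqk
    have hqi : ∀ i, |q i| ≤ k := by
      intro i
      refine (abs_le_of_sq_le_sq ?_ hq.2.1.le).trans hqk
      have h5 := hq.1
      simp only [mdot, ← pow_two] at h5
      refine Fin.cases le_rfl (fun i => ?_) i
      have := Finset.single_le_sum (fun j _ => sq_nonneg (q (Fin.succ j))) (Finset.mem_univ i)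
      linarith
    rw [mdot_eq_sum]
    refine (Finset.abs_sum_le_sum_abs _ _).trans ?_
    refine (Finset.sum_le_card_nsmul _ _ (‖w‖ * k) fun i _ => ?_).trans ?_
    · rw [abs_mul, abs_mul]
      have h6 : |signature n i| = 1 := by
        refine Fin.cases ?_ (fun j => ?_) i <;> simp [signature]
      rw [h6, one_mul]
      exact mul_le_mul (norm_le_pi_norm w i) (hqi i) (abs_nonneg _) (norm_nonneg _)
    · rw [Finset.card_univ, Fintype.card_fin, nsmul_eq_mul]
      push_cast
      rw [mul_assoc]
  have hε : 0 < ((k : ℝ) + 1)⁻¹ / 2 / ((n + 2) * (k + 1)) := by positivity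
  obtain ⟨j, hj⟩ := (TopologicalSpace.denseRange_denseSeq (MassShell n m)).exists_dist_lt p hε
  have hj' : ∀ q ∈ cycle pbar, q 0 ≤ k →
      |mdot p.1 q - mdot (P j).1 q| ≤ ((k : ℝ) + 1)⁻¹ / 2 := by
    intro q hq hqk
    rw [← mdot_sub_left]
    refine (hb _ q hq hqk).trans ?_
    have h5 : ‖p.1 - (P j).1‖ ≤ ((k : ℝ) + 1)⁻¹ / 2 / ((n + 2) * (k + 1)) := by
      rw [← dist_eq_norm]; exact hj.le
    calc ((n : ℝ) + 2) * ‖p.1 - (P j).1‖ * k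
        ≤ ((n : ℝ) + 2) * (((k : ℝ) + 1)⁻¹ / 2 / ((n + 2) * (k + 1))) * (k + 1) := by
          gcongr
          linarith
      _ = ((k : ℝ) + 1)⁻¹ / 2 := by field_simp
  refine h1 j k (fun q hq hqc => ?_) ⟨hk1, ?_⟩
  · have := (abs_le.1 (hj' q hqc hq.1)).1
    have h6 := hq.2
    linarith
  · have := (abs_le.1 (hj' q h3 hk1)).2
    linarith

end Density

/-! ### Zero mass: null rotations and the cycle as a paraboloid -/

/-- An isometric identification of a Euclidean space `V` with the space of the transverse
coordinates `x², …, x^{d-1}`. -/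
structure Transverse (n : ℕ) (V : Type*) [NormedAddCommGroup V] [InnerProductSpace ℝ V] where
  hat : V →ₗ[ℝ] Mink n
  coord : Mink n →ₗ[ℝ] V
  coord_hat : ∀ y, coord (hat y) = y
  hat_zero_one : ∀ y, hat y 0 = 0 ∧ hat y 1 = 0
  hat_coord : ∀ x : Mink n, ∀ i, i ≠ 0 → i ≠ 1 → hat (coord x) i = x i
  mdot_hat : ∀ y z, mdot (hat y) (hat z) = -inner ℝ y z

section Null
variable {n : ℕ} [NeZero n] {pbar : MassShell n 0}
  {V : Type*} [NormedAddCommGroup V] [InnerProductSpace ℝ V] (τ : Transverse n V)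

lemma mdot_base_self (pbar : MassShell n 0) : mdot pbar.1 pbar.1 = 0 := by
  rw [pbar.2.1]; norm_num

lemma mdot_of_transverse {x z : Mink n} (hx : ∀ i, i ≠ 0 → i ≠ 1 → x i = 0)
    (hz : z 0 = 0 ∧ z 1 = 0) : mdot x z = 0 := by
  have : ∀ i : Fin n, x i.succ.succ = 0 := fun i =>
    hx _ (Fin.succ_ne_zero _) (by
      rw [Ne, ← Fin.succ_zero_eq_one, Fin.succ_inj]; exact Fin.succ_ne_zero _)
  simp only [mdot_eq, hz.1, hz.2, this]
  simp

lemma mdot_base_hat (hp : (j0Down n).neg • pbar = pbar) (y : V) :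
    mdot pbar.1 (τ.hat y) = 0 :=
  mdot_of_transverse (fun i => base_apply hp i) (τ.hat_zero_one y)

lemma mdot_origin_hat (y : V) : mdot (origin pbar) (τ.hat y) = 0 :=
  mdot_of_transverse (fun i => origin_apply i) (τ.hat_zero_one y)

/-- The null rotation with parameter `y`, as a linear map. -/
def nullLin (pbar : MassShell n 0) (y : V) : Mink n →ₗ[ℝ] Mink n where
  toFun x := x + mdot pbar.1 x • τ.hat y +
    (-mdot (τ.hat y) x + ‖y‖ ^ 2 / 2 * mdot pbar.1 x) • pbar.1
  map_add' x z := by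
    simp only [mdot_add_right]
    module
  map_smul' t x := by
    simp only [mdot_smul, RingHom.id_apply]
    module

lemma nullLin_apply (y : V) (x : Mink n) : nullLin τ pbar y x = x + mdot pbar.1 x • τ.hat y +
    (-mdot (τ.hat y) x + ‖y‖ ^ 2 / 2 * mdot pbar.1 x) • pbar.1 := rfl

lemma mdot_hat_self (y : V) : mdot (τ.hat y) (τ.hat y) = -‖y‖ ^ 2 := by
  rw [τ.mdot_hat, real_inner_self_eq_norm_sq]

lemma mdot_nullLin (hp : (j0Down n).neg • pbar = pbar) (y : V) (x z : Mink n) :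
    mdot (nullLin τ pbar y x) (nullLin τ pbar y z) = mdot x z := by
  simp only [nullLin_apply, mdot_add_right, mdot_add_left, mdot_smul, mdot_smul_left,
    mdot_hat_self, mdot_base_self, mdot_base_hat τ hp, mdot_comm (τ.hat y) pbar.1,
    mdot_comm x pbar.1, mdot_comm x (τ.hat y)]
  ring

lemma nullLin_nullLin (hp : (j0Down n).neg • pbar = pbar) (y z : V) (x : Mink n) :
    nullLin τ pbar y (nullLin τ pbar z x) = nullLin τ pbar (y + z) x := by
  have h0 := mdot_base_hat τ hp
  simp only [nullLin_apply, mdot_smul,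
    mdot_base_self, h0, mdot_comm (τ.hat y) pbar.1, τ.mdot_hat, map_add,
    mdot_add_left, norm_add_sq_real]
  module

lemma nullLin_base (hp : (j0Down n).neg • pbar = pbar) (y : V) :
    nullLin τ pbar y pbar.1 = pbar.1 := by
  rw [nullLin_apply, mdot_base_self, mdot_comm, mdot_base_hat τ hp]
  simp

lemma det_nullLin (hp : (j0Down n).neg • pbar = pbar) (y : V) :
    (LinearMap.toMatrix' (nullLin τ pbar y)).det = 1 := by
  have h1 : LinearMap.toMatrix' (nullLin τ pbar y) =
      LinearMap.toMatrix' (nullLin τ pbar ((1 / 2 : ℝ) • y)) *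
        LinearMap.toMatrix' (nullLin τ pbar ((1 / 2 : ℝ) • y)) := by
    rw [← LinearMap.toMatrix'_comp]
    congr 1
    refine LinearMap.ext fun x => ?_
    rw [LinearMap.comp_apply, nullLin_nullLin τ hp, ← add_smul]
    norm_num
  have hN : ∀ x z, mdot (LinearMap.toMatrix' (nullLin τ pbar ((1 / 2 : ℝ) • y)) *ᵥ x)
      (LinearMap.toMatrix' (nullLin τ pbar ((1 / 2 : ℝ) • y)) *ᵥ z) = mdot x z := fun x z => by
    rw [LinearMap.toMatrix'_mulVec, LinearMap.toMatrix'_mulVec, mdot_nullLin τ hp]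
  have h2 := abs_det_eq_one (mem_orthochronous_of_fix (g := lorentzGL _ hN) pbar.forwardCausal hN
    (by
      change LinearMap.toMatrix' _ *ᵥ pbar.1 = pbar.1
      rw [LinearMap.toMatrix'_mulVec, nullLin_base τ hp]))
  change |(LinearMap.toMatrix' (nullLin τ pbar ((1 / 2 : ℝ) • y))).det| = 1 at h2
  rw [h1, det_mul, ← abs_mul_abs_self, h2, mul_one]

/-- The null rotations: the translations in the little group of a lightlike vector. -/
def nullRot (hp : (j0Down n).neg • pbar = pbar) (y : V) : LittleGroup pbar :=
  LittleGroup.ofMat (LinearMap.toMatrix' (nullLin τ pbar y))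
    (fun x z => by rw [LinearMap.toMatrix'_mulVec, LinearMap.toMatrix'_mulVec, mdot_nullLin τ hp])
    (det_nullLin τ hp y) (by rw [LinearMap.toMatrix'_mulVec, nullLin_base τ hp])

variable (hp : (j0Down n).neg • pbar = pbar)

lemma nullRot_mulVec (y : V) (x : Mink n) : lmat (nullRot τ hp y) *ᵥ x = nullLin τ pbar y x :=
  LinearMap.toMatrix'_mulVec _ _

lemma nullRot_add (y z : V) : nullRot τ hp (y + z) = nullRot τ hp y * nullRot τ hp z := by
  refine lmat_injective_mulVec fun x => ?_
  rw [lmat_mul, ← mulVec_mulVec]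
  simp only [nullRot_mulVec]
  rw [nullLin_nullLin τ hp]

lemma nullRot_zero : nullRot τ hp 0 = 1 := by
  refine lmat_injective_mulVec fun x => ?_
  rw [lmat_one, one_mulVec, nullRot_mulVec, nullLin_apply]
  have : mdot (0 : Mink n) x = 0 := by simp [mdot]
  simp [this]

lemma nullRot_neg (y : V) : nullRot τ hp (-y) = (nullRot τ hp y)⁻¹ :=
  eq_inv_of_mul_eq_one_left (by rw [← nullRot_add, neg_add_cancel, nullRot_zero])

lemma continuous_hat [FiniteDimensional ℝ V] : Continuous τ.hat :=
  LinearMap.continuous_of_finiteDimensional _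

lemma continuous_coord : Continuous τ.coord := LinearMap.continuous_of_finiteDimensional _

lemma continuous_nullRot [FiniteDimensional ℝ V] : Continuous (nullRot τ hp) := by
  refine isInducing_lmat.continuous_iff.2 ?_
  refine continuous_pi fun i => continuous_pi fun j => ?_
  have h1 : ∀ y, lmat (nullRot τ hp y) i j = nullLin τ pbar y (Pi.single j 1) i := fun y => by
    rw [← nullRot_mulVec τ hp]; simp
  simp only [Function.comp_def, h1, nullLin_apply, Pi.add_apply, Pi.smul_apply, smul_eq_mul]
  have h2 : Continuous fun y => τ.hat y i := (continuous_apply i).comp (continuous_hat τ)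
  have h3 : Continuous fun y => mdot (τ.hat y) (Pi.single j 1) :=
    (continuous_mdot (n := n)).comp ((continuous_hat τ).prodMk
      (continuous_const (y := (Pi.single j 1 : Mink n))))
  fun_prop

/-- The point of the cycle with transverse coordinates `y`. -/
def paraboloid (pbar : MassShell n 0) (y : V) : Mink n := nullLin τ pbar y (origin pbar)

lemma paraboloid_apply (y : V) : paraboloid τ pbar y =
    origin pbar + τ.hat y + (‖y‖ ^ 2 / 2) • pbar.1 := by
  rw [paraboloid, nullLin_apply, (origin_mem_cycle pbar).2.2, mdot_comm, mdot_origin_hat]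
  simp

lemma paraboloid_eq (y : V) : paraboloid τ pbar y = lmat (nullRot τ hp y) *ᵥ origin pbar :=
  (nullRot_mulVec τ hp y _).symm

lemma nullRot_paraboloid (y z : V) :
    lmat (nullRot τ hp y) *ᵥ paraboloid τ pbar z = paraboloid τ pbar (y + z) := by
  rw [nullRot_mulVec, paraboloid, nullLin_nullLin τ hp, ← paraboloid]

lemma coord_eq_zero {x : Mink n} (hx : ∀ i, i ≠ 0 → i ≠ 1 → x i = 0) : τ.coord x = 0 := by
  have h : τ.hat (τ.coord x) = 0 := by
    funext i
    by_cases h0 : i = 0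
    · rw [h0]; exact (τ.hat_zero_one _).1
    by_cases h1 : i = 1
    · rw [h1]; exact (τ.hat_zero_one _).2
    rw [τ.hat_coord x i h0 h1, hx i h0 h1, Pi.zero_apply]
  rw [← τ.coord_hat (τ.coord x), h, map_zero]

lemma coord_paraboloid (hp : (j0Down n).neg • pbar = pbar) (y : V) :
    τ.coord (paraboloid τ pbar y) = y := by
  rw [paraboloid_apply, map_add, map_add, map_smul, τ.coord_hat,
    coord_eq_zero τ (fun i => origin_apply i), coord_eq_zero τ (fun i => base_apply hp i)]
  simp

/-- A point of the cycle is determined by its transverse coordinates. -/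
lemma paraboloid_coord (hp : (j0Down n).neg • pbar = pbar) {q : Mink n} (hq : q ∈ cycle pbar) :
    paraboloid τ pbar (τ.coord q) = q := by
  set y := τ.coord q with hy
  -- The null rotation `-y` moves `q` to a point of the cycle without transverse components.
  have h1 : lmat (nullRot τ hp (-y)) *ᵥ q ∈ cycle pbar := lmat_mulVec_mem_cycle _ hq
  have h2 : lmat (nullRot τ hp (-y)) *ᵥ q = origin pbar := by
    refine eq_origin_of_mdot h1 ?_
    set r := lmat (nullRot τ hp (-y)) *ᵥ q with hr
    have ht : ∀ i, i ≠ 0 → i ≠ 1 → r i = 0 := fun i h0 h1 => by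
      rw [hr, nullRot_mulVec, nullLin_apply, hq.2.2, map_neg]
      simp only [Pi.add_apply, Pi.smul_apply, Pi.neg_apply, smul_eq_mul]
      rw [hy, τ.hat_coord q i h0 h1, base_apply hp i h0 h1]
      ring
    have hs : ∀ i : Fin n, r i.succ.succ = 0 := fun i =>
      ht _ (Fin.succ_ne_zero _) (by
        rw [Ne, ← Fin.succ_zero_eq_one, Fin.succ_inj]; exact Fin.succ_ne_zero _)
    have hb : ∀ i : Fin n, pbar.1 i.succ.succ = 0 := fun i =>
      base_apply hp _ (Fin.succ_ne_zero _) (by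
        rw [Ne, ← Fin.succ_zero_eq_one, Fin.succ_inj]; exact Fin.succ_ne_zero _)
    have e1 := h1.1
    have e2 := h1.2.2
    have e3 := base_mul_self hp
    rw [mdot_eq] at e1 e2
    simp only [hs, hb] at e1 e2
    simp only [mul_zero, Finset.sum_const_zero, sub_zero] at e1 e2
    rw [mdot_comm, mdot_origin]
    have h0 := h1.2.1
    have hb0 := pbar.2.2
    have hsg := baseSign_mul_self pbar
    have hsm := baseSign_mul pbar
    have habs : |pbar.1 1| = pbar.1 0 := by
      rw [← sq_eq_sq₀ (abs_nonneg _) hb0.le, sq_abs]; linarith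
    rw [habs] at hsm
    have hb1 : pbar.1 1 = pbar.1 0 * baseSign pbar := by
      linear_combination baseSign pbar * hsm - pbar.1 1 * hsg
    have e4 : pbar.1 0 * (r 0 - baseSign pbar * r 1) = 1 := by rw [hb1] at e2; linarith
    have e5 : (r 0 - baseSign pbar * r 1) * (r 0 + baseSign pbar * r 1) = 0 := by
      linear_combination e1 - r 1 ^ 2 * hsg
    have e6 : r 0 - baseSign pbar * r 1 ≠ 0 := fun h => by rw [h] at e4; norm_num at e4
    rw [(mul_eq_zero.1 e5).resolve_left e6, mul_zero]
  rw [paraboloid_eq τ hp, ← h2, nullRot_neg, lmat_mulVec_inv_mulVec]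

variable [FiniteDimensional ℝ V] [MeasurableSpace V] [BorelSpace V]

lemma continuous_paraboloid : Continuous (paraboloid τ pbar) := by
  have : paraboloid τ pbar = fun y => origin pbar + τ.hat y + (‖y‖ ^ 2 / 2) • pbar.1 :=
    funext (paraboloid_apply τ)
  rw [this]
  have := continuous_hat τ
  fun_prop

/-- The invariant measure of the cycle is a multiple of the Lebesgue measure of the transverse
coordinates, because the null rotations act on these coordinates by translations. -/
theorem exists_measurePreserving_paraboloid (hp : (j0Down n).neg • pbar = pbar) : ∃ c : ℝ, 0 < c ∧
    MeasurePreserving (paraboloid τ pbar) (ENNReal.ofReal c • volume) (cycleMeasure pbar.1) := by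
  have hcm : Measurable τ.coord := (continuous_coord τ).measurable
  have hpm : Measurable (paraboloid τ pbar) := (continuous_paraboloid τ).measurable
  set μ : Measure V := (cycleMeasure pbar.1).map τ.coord with hμ
  have hback : μ.map (paraboloid τ pbar) = cycleMeasure pbar.1 := by
    rw [hμ, Measure.map_map hpm hcm]
    conv_rhs => rw [← Measure.map_id (μ := cycleMeasure pbar.1)]
    refine Measure.map_congr ?_
    filter_upwards [ae_mem_cycle pbar] with q hq
    exact paraboloid_coord τ hp hq
  have hinv : μ.IsAddLeftInvariant := ⟨fun y => by
    conv_rhs => rw [hμ, ← (measurePreserving_lmat (nullRot τ hp y)).map_eq,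
      Measure.map_map hcm (measurable_mulVec _)]
    rw [hμ, Measure.map_map (measurable_const_add y) hcm]
    refine Measure.map_congr ?_
    filter_upwards [ae_mem_cycle pbar] with q hq
    simp only [Function.comp_apply]
    conv_rhs => rw [← paraboloid_coord τ hp hq, nullRot_paraboloid, coord_paraboloid τ hp]⟩
  have hfin : IsFiniteMeasureOnCompacts μ := ⟨fun K hK => by
    obtain ⟨R, hR⟩ := (hK.image (continuous_paraboloid (pbar := pbar) τ)).isBounded.exists_norm_le
    refine lt_of_le_of_lt ?_ (cycleMeasure_bounded_lt_top pbar.1 R)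
    rw [hμ, Measure.map_apply hcm hK.measurableSet]
    refine measure_mono_ae ?_
    filter_upwards [ae_mem_cycle pbar] with q hq hqK
    have h1 : ‖q‖ ≤ R := hR q ⟨τ.coord q, hqK, paraboloid_coord τ hp hq⟩
    exact (le_abs_self _).trans ((norm_le_pi_norm q 0).trans h1)⟩
  have hsmul := Measure.isAddLeftInvariant_eq_smul μ (volume : Measure V)
  set c := Measure.addHaarScalarFactor μ (volume : Measure V) with hc
  have hc0 : c ≠ 0 := fun h0 => by
    rw [h0, zero_smul] at hsmul
    rw [hsmul, Measure.map_zero] at hback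
    exact cycleMeasure_ne_zero pbar.forwardCausal hback.symm
  refine ⟨c, NNReal.coe_pos.2 (pos_iff_ne_zero.2 hc0), hpm, ?_⟩
  rw [ENNReal.ofReal_coe_nnreal, ← hback]
  conv_rhs => rw [hsmul]
  rfl

end Null

/-! ### The Fourier transform on the transverse space -/

section Fourier
open FourierTransform
open scoped Real RealInnerProductSpace SchwartzMap

variable {V : Type*} [NormedAddCommGroup V] [InnerProductSpace ℝ V] [FiniteDimensional ℝ V]
  [MeasurableSpace V] [BorelSpace V]

lemma continuous_fourier {ψ : V → ℂ} (hψ : Integrable ψ) : Continuous (𝓕 ψ) :=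
  VectorFourier.fourierIntegral_continuous Real.continuous_fourierChar
    (L := innerₗ V) (by simpa using! continuous_inner) hψ

lemma norm_fourier_le_integral (ψ : V → ℂ) (w : V) : ‖𝓕 ψ w‖ ≤ ∫ v, ‖ψ v‖ :=
  VectorFourier.norm_fourierIntegral_le_integral_norm _ _ _ _ _

/-- On integrable functions, the Fourier transform on `L²` is given by the Fourier integral. -/
lemma coeFn_fourier_Lp (ψ : Lp ℂ 2 (volume : Measure V)) (hψ : Integrable ψ) :
    (𝓕 ψ : Lp ℂ 2 (volume : Measure V)) =ᵐ[volume] 𝓕 (ψ : V → ℂ) := by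
  refine ae_eq_of_integral_contDiff_smul_eq ?_ ?_ fun g hg hgc => ?_
  · exact (Lp.memLp _).locallyIntegrable (by norm_num)
  · exact (continuous_fourier hψ).locallyIntegrable
  · have hgC : HasCompactSupport fun x => (g x : ℂ) := hgc.comp_left Complex.ofReal_zero
    let G : 𝓢(V, ℂ) := hgC.toSchwartzMap (Complex.ofRealCLM.contDiff.comp hg)
    have hG : ∀ x, G x = (g x : ℂ) := fun x => rfl
    have h1 : (𝓕 (Lp.toTemperedDistribution ψ)) G =
        Lp.toTemperedDistribution (𝓕 ψ : Lp ℂ 2 (volume : Measure V)) G := by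
      rw [Lp.fourier_toTemperedDistribution_eq]
    rw [TemperedDistribution.fourier_apply, Lp.toTemperedDistribution_apply,
      Lp.toTemperedDistribution_apply] at h1
    have h2 := VectorFourier.integral_fourierIntegral_smul_eq_flip (L := innerₗ V)
      Real.continuous_fourierChar (by simpa using! continuous_inner) (G.integrable (μ := volume)) hψ
    rw [flip_innerₗ] at h2
    change ∫ x, (𝓕 G) x • ψ x = ∫ x, G x • (𝓕 (ψ : V → ℂ)) x at h2
    rw [h2] at h1
    simp only [hG] at h1
    exact h1.symm

/-- Plancherel's theorem for integrable square integrable functions. -/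
lemma lintegral_fourier_sq {ψ : V → ℂ} (h1 : Integrable ψ) (h2 : MemLp ψ 2) :
    ∫⁻ w, ‖𝓕 ψ w‖ₑ ^ 2 = ∫⁻ v, ‖ψ v‖ₑ ^ 2 := by
  have h3 : Integrable (h2.toLp ψ) := h1.congr h2.coeFn_toLp.symm
  have h4 : ∀ w, 𝓕 (h2.toLp ψ : V → ℂ) w = 𝓕 ψ w := Real.fourier_congr_ae h2.coeFn_toLp
  have h5 : ∀ φ : Lp ℂ 2 (volume : Measure V), ∫⁻ v, ‖φ v‖ₑ ^ 2 = ‖φ‖ₑ ^ 2 := fun φ => by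
    rw [Lp.enorm_def, eLpNorm_eq_lintegral_rpow_enorm_toReal two_ne_zero ENNReal.ofNat_ne_top,
      ENNReal.toReal_ofNat, ← ENNReal.rpow_natCast, ← ENNReal.rpow_mul]
    norm_num
  calc ∫⁻ w, ‖𝓕 ψ w‖ₑ ^ 2
      = ∫⁻ w, ‖(𝓕 (h2.toLp ψ) : Lp ℂ 2 (volume : Measure V)) w‖ₑ ^ 2 := by
        refine lintegral_congr_ae ?_
        filter_upwards [coeFn_fourier_Lp _ h3] with w hw
        rw [hw, h4]
    _ = ∫⁻ v, ‖h2.toLp ψ v‖ₑ ^ 2 := by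
        have : ‖(𝓕 (h2.toLp ψ) : Lp ℂ 2 (volume : Measure V))‖ₑ = ‖h2.toLp ψ‖ₑ := by
          rw [← ofReal_norm, ← ofReal_norm, Lp.norm_fourier_eq]
        rw [h5, h5, this]
    _ = ∫⁻ v, ‖ψ v‖ₑ ^ 2 := by
        refine lintegral_congr_ae ?_
        filter_upwards [h2.coeFn_toLp] with v hv
        rw [hv]

variable {Ω : Type*} [MeasurableSpace Ω] {P : Measure Ω} [IsProbabilityMeasure P] {f : Ω → V}
  {H : Type*} [NormedAddCommGroup H] [InnerProductSpace ℂ H] {η : V → H}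

lemma norm_of_gram
    (hG : ∀ y z, inner ℂ (η y) (η z) = ∫ u, (𝐞 ⟪y - z, f u⟫ : ℂ) ∂P) (y : V) : ‖η y‖ = 1 := by
  have h1 := hG y y
  simp only [sub_self, inner_zero_left, AddChar.map_zero_eq_one, Circle.coe_one, integral_const,
    probReal_univ, one_smul] at h1
  have h2 := inner_self_eq_norm_sq (𝕜 := ℂ) (η y)
  rw [h1, RCLike.one_re] at h2
  exact (pow_eq_one_iff_of_nonneg (norm_nonneg _) two_ne_zero).1 h2.symm

lemma integrable_smul_of_norm_eq_one {ψ : V → ℂ} (hψ : Integrable ψ) (hη : Continuous η)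
    (h1 : ∀ y, ‖η y‖ = 1) : Integrable fun y => ψ y • η y := by
  refine hψ.norm.mono' (hψ.1.smul hη.aestronglyMeasurable)
    (Filter.Eventually.of_forall fun y => ?_)
  rw [norm_smul, h1, mul_one]

variable [CompleteSpace H]

/-- Vectors `η y` whose Gram matrix is an average of characters: the inner products with
`∫ ψ(z) η z dz` involve the values of the Fourier transform of `ψ` at the frequencies `f u`. -/
lemma inner_integral_of_gram (hf : Measurable f) (hη : Continuous η)
    (hG : ∀ y z, inner ℂ (η y) (η z) = ∫ u, (𝐞 ⟪y - z, f u⟫ : ℂ) ∂P)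
    {ψ : V → ℂ} (hψ : Integrable ψ) (y : V) :
    inner ℂ (η y) (∫ z, ψ z • η z) = ∫ u, (𝐞 ⟪y, f u⟫ : ℂ) * 𝓕 ψ (f u) ∂P := by
  rw [← integral_inner (integrable_smul_of_norm_eq_one hψ hη (norm_of_gram hG))]
  have h1 : ∀ z, inner ℂ (η y) (ψ z • η z) = ∫ u, ψ z * (𝐞 ⟪y - z, f u⟫ : ℂ) ∂P := fun z => by
    rw [inner_smul_right, hG, integral_const_mul]
  simp only [h1]
  rw [integral_integral_swap]
  · refine integral_congr_ae (Filter.Eventually.of_forall fun u => ?_)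
    simp only
    rw [Real.fourier_eq, ← integral_const_mul]
    refine integral_congr_ae (Filter.Eventually.of_forall fun z => ?_)
    have h2 : (𝐞 ⟪y - z, f u⟫ : ℂ) = 𝐞 ⟪y, f u⟫ * 𝐞 (-⟪z, f u⟫) := by
      rw [inner_sub_left, sub_eq_add_neg, AddChar.map_add_eq_mul, Circle.coe_mul]
    simp only [h2, Circle.smul_def, smul_eq_mul]
    ring
  · have hm : Measurable fun x : V × Ω => (𝐞 ⟪y - x.1, f x.2⟫ : ℂ) := by
      have hc : Continuous fun x : V × V => (𝐞 ⟪y - x.1, x.2⟫ : ℂ) :=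
        continuous_subtype_val.comp (Real.continuous_fourierChar.comp (by fun_prop))
      exact hc.measurable.comp (measurable_fst.prodMk (hf.comp measurable_snd))
    refine (hψ.comp_fst P).norm.mono' ((hψ.comp_fst P).1.mul hm.aestronglyMeasurable)
      (Filter.Eventually.of_forall fun x => ?_)
    rw [Function.uncurry, norm_mul, Circle.norm_coe, mul_one]

/-- Vectors `η y` whose Gram matrix is an average of characters: `∫ ψ(z) η z dz` has the norm of the
Fourier transform of `ψ`, restricted to the frequencies `f u`. -/
lemma norm_integral_of_gram (hf : Measurable f) (hη : Continuous η)
    (hG : ∀ y z, inner ℂ (η y) (η z) = ∫ u, (𝐞 ⟪y - z, f u⟫ : ℂ) ∂P)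
    {ψ : V → ℂ} (hψ : Integrable ψ) :
    ‖∫ z, ψ z • η z‖ₑ ^ 2 = ∫⁻ u, ‖𝓕 ψ (f u)‖ₑ ^ 2 ∂P := by
  set v := ∫ z, ψ z • η z with hv
  have hcont := continuous_fourier hψ
  have hFm : Measurable fun u => 𝓕 ψ (f u) := hcont.measurable.comp hf
  have hFb : ∀ u, ‖𝓕 ψ (f u)‖ ≤ ∫ v, ‖ψ v‖ := fun u => norm_fourier_le_integral ψ _
  have h1 : inner ℂ v v = ∫ u, 𝓕 ψ (f u) * conj (𝓕 ψ (f u)) ∂P := by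
    rw [← inner_conj_symm]
    nth_rewrite 2 [hv]
    rw [← integral_inner (integrable_smul_of_norm_eq_one hψ hη (norm_of_gram hG)),
      ← integral_conj]
    have h2 : ∀ y, conj (inner ℂ v (ψ y • η y)) =
        ∫ u, conj (ψ y) * ((𝐞 ⟪y, f u⟫ : ℂ) * 𝓕 ψ (f u)) ∂P := fun y => by
      rw [inner_conj_symm, inner_smul_left, hv, inner_integral_of_gram hf hη hG hψ,
        integral_const_mul]
    simp only [h2]
    rw [integral_integral_swap]
    · refine integral_congr_ae (Filter.Eventually.of_forall fun u => ?_)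
      simp only
      rw [Real.fourier_eq, ← integral_conj, ← integral_const_mul]
      refine integral_congr_ae (Filter.Eventually.of_forall fun z => ?_)
      simp only [AddChar.map_neg_eq_inv, Circle.smul_def, smul_eq_mul, map_mul,
        Circle.coe_inv_eq_conj, Complex.conj_conj]
      ring
    · have hm : Measurable fun x : V × Ω => (𝐞 ⟪x.1, f x.2⟫ : ℂ) := by
        have hc : Continuous fun x : V × V => (𝐞 ⟪x.1, x.2⟫ : ℂ) :=
          continuous_subtype_val.comp (Real.continuous_fourierChar.comp (by fun_prop))
        exact hc.measurable.comp (measurable_fst.prodMk (hf.comp measurable_snd))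
      have hc := (hψ.comp_fst P)
      refine (hc.norm.mul_const (∫ v, ‖ψ v‖)).mono'
        ((Complex.continuous_conj.comp_aestronglyMeasurable hc.1).mul
          (hm.mul (hFm.comp measurable_snd)).aestronglyMeasurable)
        (Filter.Eventually.of_forall fun x => ?_)
      simp only [Function.uncurry, norm_mul, RCLike.norm_conj, Circle.norm_coe, one_mul]
      gcongr
      exact hFb _
  have h3 : ‖v‖ ^ 2 = ∫ u, ‖𝓕 ψ (f u)‖ ^ 2 ∂P := by
    rw [inner_self_eq_norm_sq_to_K] at h1
    simp only [Complex.mul_conj'] at h1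
    have h4 : ((‖v‖ ^ 2 : ℝ) : ℂ) = ((∫ u, ‖𝓕 ψ (f u)‖ ^ 2 ∂P : ℝ) : ℂ) := by
      rw [← integral_complex_ofReal]
      simpa using h1
    exact_mod_cast h4
  have hint : Integrable (fun u => ‖𝓕 ψ (f u)‖ ^ 2) P :=
    Integrable.of_bound (hFm.norm.pow_const 2).aestronglyMeasurable ((∫ v, ‖ψ v‖) ^ 2)
      (Filter.Eventually.of_forall fun u => by
        rw [norm_pow, norm_norm]
        gcongr
        exact hFb u)
  rw [← ofReal_norm, ← ENNReal.ofReal_pow (norm_nonneg _), h3,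
    ofReal_integral_eq_lintegral_ofReal hint (Filter.Eventually.of_forall fun u => by positivity)]
  refine lintegral_congr fun u => ?_
  rw [ENNReal.ofReal_pow (norm_nonneg _), ofReal_norm]

end Fourier

/-! ### Direct integrals from fields of invariant vectors -/

lemma isOpen_labels (n : ℕ) : IsOpen (labels n) := by
  unfold labels; split_ifs
  exacts [isOpen_univ, isOpen_Ioi]

section Field
variable {n : ℕ} [NeZero n] {m : ℝ} {pbar : MassShell n m}
  (hp : (j0Down n).neg • pbar = pbar)
  {H : Type*} [NormedAddCommGroup H] [InnerProductSpace ℂ H]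

/-- A continuous field `k ↦ E k` of irreducible representations on one Hilbert space with a common
invariant vector `ξ`, and a density `ω`, such that `ψ ↦ (k ↦ ω(k) ∫ ψ(q) E_k(g_q) ξ dν(q))` is
isometric from `L²(Γ, ν_Γ)` to `L²(labels; H)` and the test functions `k ↦ h(k) ξ`
are in the range of `ψ ↦ (k ↦ ∫ ψ(q) E_k(g_q) ξ dν(q))`. -/
structure SphericalField (ξ : H) where
  E : ℝ → UnitaryRep (LittleGroup pbar) H
  ω : ℝ → ℂ
  irreducible : ∀ k ∈ labels n, (E k).Irreducible
  continuousOn_toHom : ∀ g x, ContinuousOn (fun k => (E k).toHom g x) (labels n)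
  fixed : ∀ k ∈ labels n, FixedVector (E k) ξ
  ne_zero : ξ ≠ 0
  continuousOn_ω : ContinuousOn ω (labels n)
  ω_ne_zero : ∀ k ∈ labels n, ω k ≠ 0
  isometry : ∀ ψ : integrableDomain pbar,
    ∫⁻ k in labels n, ‖ω k • orbitT hp (E k) ξ ψ‖ₑ ^ 2 = ∫⁻ q, ‖ψ.1 q‖ₑ ^ 2 ∂cycleMeasure pbar.1
  exists_eq : ∀ h : ℝ → ℝ, ContDiff ℝ ((⊤ : ℕ∞) : WithTop ℕ∞) h → HasCompactSupport h →
    tsupport h ⊆ labels n →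
    ∃ ψ : integrableDomain pbar, ∀ k ∈ labels n, orbitT hp (E k) ξ ψ = (h k : ℂ) • ξ

variable {hp} {ξ : H} (S : SphericalField hp ξ)

namespace SphericalField

/-- The value at the label `k` of the direct integral decomposition of `ψ`. -/
def value (ψ : integrableDomain pbar) (k : ℝ) : H := S.ω k • orbitT hp (S.E k) ξ ψ

lemma continuousOn_value (ψ : integrableDomain pbar) : ContinuousOn (S.value ψ) (labels n) := by
  refine S.continuousOn_ω.smul fun k hk => ?_
  change ContinuousWithinAt
    (fun k => ∫ q, ψ.1 q • orbitVec hp (S.E k) ξ q ∂cycleMeasure pbar.1) _ k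
  refine continuousWithinAt_of_dominated (bound := fun q => ‖ψ.1 q‖ * ‖ξ‖) ?_ ?_ ?_ ?_
  · exact Filter.Eventually.of_forall fun k =>
      (integrable_smul_orbitVec (hp := hp) (S.E k) ξ ψ.2).1
  · refine Filter.Eventually.of_forall fun k => Filter.Eventually.of_forall fun q => ?_
    rw [norm_smul, norm_orbitVec]
  · exact (Integrable.norm ψ.2).mul_const _
  · exact Filter.Eventually.of_forall fun q =>
      ((S.continuousOn_toHom (sec hp q) ξ).const_smul (ψ.1 q)) k hk

lemma lintegral_enorm_sq {X E : Type*} [MeasurableSpace X] {μ : Measure X} [NormedAddCommGroup E]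
    (f : X → E) : (∫⁻ x, ‖f x‖ₑ ^ 2 ∂μ) = eLpNorm f 2 μ ^ 2 := by
  rw [eLpNorm_eq_lintegral_rpow_enorm_toReal two_ne_zero ENNReal.ofNat_ne_top,
    ENNReal.toReal_ofNat, ← ENNReal.rpow_natCast, ← ENNReal.rpow_mul]
  norm_num

lemma eLpNorm_value (ψ : integrableDomain pbar) :
    eLpNorm (S.value ψ) 2 (volume.restrict (labels n)) = eLpNorm ψ.1 2 (cycleMeasure pbar.1) := by
  have h := S.isometry ψ
  rw [lintegral_enorm_sq (fun q => ψ.1 q)] at h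
  have h1 := lintegral_enorm_sq (μ := volume.restrict (labels n)) (S.value ψ)
  exact (ENNReal.pow_right_strictMono two_ne_zero).injective (h1.symm.trans h)

lemma memLp_value (ψ : integrableDomain pbar) :
    MemLp (S.value ψ) 2 (volume.restrict (labels n)) :=
  ⟨(S.continuousOn_value ψ).aestronglyMeasurable (isOpen_labels n).measurableSet, by
    rw [S.eLpNorm_value]; exact Lp.eLpNorm_lt_top _⟩

/-- The direct integral decomposition on the integrable functions. -/
def decompPre : integrableDomain pbar →ₗ[ℂ] Lp H 2 (volume.restrict (labels n)) where
  toFun ψ := (S.memLp_value ψ).toLp _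
  map_add' ψ ψ' := by
    rw [← MemLp.toLp_add]
    refine MemLp.toLp_congr _ _ (Filter.Eventually.of_forall fun k => ?_)
    have h := (orbitT hp (S.E k) ξ).map_add ψ ψ'
    exact (congrArg (S.ω k • ·) h).trans (smul_add _ _ _)
  map_smul' c ψ := by
    rw [RingHom.id_apply, ← MemLp.toLp_const_smul]
    refine MemLp.toLp_congr _ _ (Filter.Eventually.of_forall fun k => ?_)
    have h := (orbitT hp (S.E k) ξ).map_smul c ψ
    exact (congrArg (S.ω k • ·) h).trans (smul_comm _ _ _)

lemma coeFn_decompPre (ψ : integrableDomain pbar) :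
    S.decompPre ψ =ᵐ[volume.restrict (labels n)] S.value ψ := (S.memLp_value ψ).coeFn_toLp

lemma norm_decompPre (ψ : integrableDomain pbar) : ‖S.decompPre ψ‖ = ‖ψ.1‖ := by
  change ‖(S.memLp_value ψ).toLp _‖ = _
  rw [Lp.norm_toLp, Lp.norm_def, S.eLpNorm_value]

variable [CompleteSpace H]

lemma denseRange_subtype : DenseRange (integrableDomain pbar).subtype := by
  have := dense_integrableDomain (pbar := pbar)
  rw [DenseRange, Submodule.coe_subtype, Subtype.range_coe]
  exact this

/-- The direct integral decomposition as an isometry. -/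
def decomp : HLor pbar →ₗᵢ[ℂ] Lp H 2 (volume.restrict (labels n)) where
  toLinearMap := S.decompPre.extendOfNorm (integrableDomain pbar).subtype
  norm_map' ψ := by
    have he : ∀ ψ : integrableDomain pbar,
        S.decompPre.extendOfNorm (integrableDomain pbar).subtype ψ.1 = S.decompPre ψ := fun ψ =>
      LinearMap.extendOfNorm_eq denseRange_subtype
        ⟨1, fun x => by rw [one_mul]; exact (S.norm_decompPre x).le⟩ ψ
    refine dense_integrableDomain.induction (P := fun ψ =>
      ‖S.decompPre.extendOfNorm (integrableDomain pbar).subtype ψ‖ = ‖ψ‖) (fun ψ hψ => ?_)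
      (isClosed_eq (by fun_prop) continuous_norm) ψ
    have := he ⟨ψ, hψ⟩
    simp only at this ⊢
    rw [this]
    exact S.norm_decompPre _

lemma decomp_apply (ψ : integrableDomain pbar) : S.decomp ψ.1 = S.decompPre ψ :=
  LinearMap.extendOfNorm_eq denseRange_subtype
    ⟨1, fun x => by rw [one_mul]; exact (S.norm_decompPre x).le⟩ ψ

lemma coeFn_decomp (ψ : integrableDomain pbar) :
    S.decomp ψ.1 =ᵐ[volume.restrict (labels n)] S.value ψ := by
  rw [decomp_apply]; exact S.coeFn_decompPre ψ

lemma exists_value_ULor (α : PrincipalParam n) (g : LittleGroup pbar) (ψ : integrableDomain pbar) :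
    ∃ h : ULor α g.1 ψ.1 ∈ integrableDomain pbar, ∀ k ∈ labels n,
      S.value ⟨ULor α g.1 ψ.1, h⟩ k = (S.E k).toHom g (S.value ψ k) := by
  have hmem : ULor α g.1 ψ.1 ∈ integrableDomain pbar :=
    ((measurePreserving_lmat g⁻¹).integrable_comp_of_integrable ψ.2).congr
      (coeFn_ULor α g ψ.1).symm
  refine ⟨hmem, fun k hk => ?_⟩
  obtain ⟨h, e⟩ := (S.fixed k hk).orbitT_ULor hp α g ψ
  exact ((congrArg (S.ω k • ·) e).symm.trans (map_smul _ _ _).symm)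

/-- The decomposition intertwines `U^α` with the field of representations. -/
lemma decomp_ULor (α : PrincipalParam n) (g : LittleGroup pbar) (ψ : HLor pbar) :
    ∀ᵐ k ∂volume.restrict (labels n),
      S.decomp (ULor α g.1 ψ) k = (S.E k).toHom g (S.decomp ψ k) := by
  have hcl : ψ ∈ closure (integrableDomain pbar : Set (HLor pbar)) := dense_integrableDomain ψ
  obtain ⟨φ, hφ, hlim⟩ := mem_closure_iff_seq_limit.1 hcl
  have hl1 := tendstoInMeasure_of_tendsto_Lp ((S.decomp.continuous.tendsto ψ).comp hlim)
  obtain ⟨ns, hns, hae1⟩ := hl1.exists_seq_tendsto_ae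
  have hl2 := tendstoInMeasure_of_tendsto_Lp
    (((S.decomp.continuous.comp (ULor α g.1).continuous).tendsto ψ).comp
      (hlim.comp hns.tendsto_atTop))
  obtain ⟨ms, hms, hae2⟩ := hl2.exists_seq_tendsto_ae
  have hae3 : ∀ᵐ k ∂volume.restrict (labels n), ∀ i,
      S.decomp (ULor α g.1 (φ i)) k = (S.E k).toHom g (S.decomp (φ i) k) := by
    rw [ae_all_iff]
    intro i
    obtain ⟨h, hv⟩ := S.exists_value_ULor α g ⟨φ i, hφ i⟩
    filter_upwards [S.coeFn_decomp ⟨φ i, hφ i⟩, S.coeFn_decomp ⟨_, h⟩,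
      ae_restrict_mem (isOpen_labels n).measurableSet] with k h1 h2 hk
    rw [h1, h2, hv k hk]
  filter_upwards [hae1, hae2, hae3] with k h1 h2 h3
  have h4 := ((S.E k).toHom g).continuous.tendsto _ |>.comp (h1.comp hms.tendsto_atTop)
  refine tendsto_nhds_unique h2 (h4.congr fun i => ?_)
  simp only [Function.comp_apply]
  exact (h3 _).symm

/-- Translates of the functions `ψ` whose transform is a multiple `h(k) ω(k) ξ` of the invariant
vector, with arbitrary test functions `h`, show that `F k` is orthogonal to the orbit of `ξ` under
the representation with label `k`, for almost every `k`. By separability of the little group the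
exceptional set can be chosen independently of the group element. -/
lemma eq_zero_of_orthogonal (F : Lp H 2 (volume.restrict (labels n)))
    (hF : ∀ ψ : integrableDomain pbar, inner ℂ (S.decomp ψ.1) F = 0) : F = 0 := by
  let α : PrincipalParam n := ⟨-(n : ℂ) / 2, by
    rw [← Complex.ofReal_natCast, ← Complex.ofReal_neg]; simp⟩
  have hLm := (isOpen_labels n).measurableSet
  have key : ∀ g : LittleGroup pbar, ∀ᵐ k ∂volume.restrict (labels n),
      inner ℂ ((S.E k).toHom g ξ) (F k) = 0 := by
    intro g
    have hc : ContinuousOn (fun k => (S.E k).toHom g ξ) (labels n) := S.continuousOn_toHom g ξ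
    have hG2 : MemLp (fun k => inner ℂ ((S.E k).toHom g ξ) (F k)) 2
        (volume.restrict (labels n)) := by
      refine MemLp.of_le ((Lp.memLp F).norm.const_mul ‖ξ‖)
        ((hc.aestronglyMeasurable hLm).inner (Lp.aestronglyMeasurable F))
        (Filter.Eventually.of_forall fun k => ?_)
      refine (norm_inner_le_norm _ _).trans_eq ?_
      rw [LinearIsometryEquiv.norm_map, norm_mul, norm_norm, norm_norm]
    have hloc : LocallyIntegrableOn (fun k => conj (S.ω k) *
        inner ℂ ((S.E k).toHom g ξ) (F k)) (labels n) := by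
      have h1 : LocallyIntegrableOn (fun k => inner ℂ ((S.E k).toHom g ξ) (F k)) (labels n) :=
        (locallyIntegrableOn_of_locallyIntegrable_restrict
          (hG2.locallyIntegrable (by norm_num)))
      exact h1.continuousOn_mul
        (Complex.continuous_conj.comp_continuousOn S.continuousOn_ω)
        (isOpen_labels n).isLocallyClosed
    have h0 := (isOpen_labels n).ae_eq_zero_of_integral_contDiff_smul_eq_zero hloc
      fun h hh hhc hhs => by
        obtain ⟨ψ, hψ⟩ := S.exists_eq h hh hhc hhs
        obtain ⟨hmem, hv⟩ := S.exists_value_ULor α g ψ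
        have h1 := hF ⟨_, hmem⟩
        rw [L2.inner_def] at h1
        have h2 : ∫ k in labels n, h k • (conj (S.ω k) *
            inner ℂ ((S.E k).toHom g ξ) (F k)) = 0 := by
          rw [← h1]
          refine integral_congr_ae ?_
          filter_upwards [S.coeFn_decomp ⟨_, hmem⟩, ae_restrict_mem hLm] with k h3 hk
          rw [h3, hv k hk, value, hψ k hk, map_smul, map_smul, inner_smul_left, inner_smul_left,
            Complex.conj_ofReal, Complex.real_smul]
          ring
        rw [← h2]
        refine (setIntegral_eq_integral_of_forall_compl_eq_zero fun k hk => ?_).symm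
        rw [image_eq_zero_of_notMem_tsupport (fun h' => hk (hhs h')), zero_smul]
    rw [ae_restrict_iff' hLm]
    filter_upwards [h0] with k hk hkL
    exact (mul_eq_zero.1 (hk hkL)).resolve_left (by simpa using S.ω_ne_zero k hkL)
  have : SecondCountableTopology (Matrix (Fin (n + 2)) (Fin (n + 2)) ℝ) :=
    inferInstanceAs (SecondCountableTopology (Fin (n + 2) → Fin (n + 2) → ℝ))
  have : SecondCountableTopology (LittleGroup pbar) :=
    (isInducing_lmat (pbar := pbar)).secondCountableTopology
  have hall : ∀ᵐ k ∂volume.restrict (labels n), ∀ i : ℕ,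
      inner ℂ ((S.E k).toHom (TopologicalSpace.denseSeq (LittleGroup pbar) i) ξ) (F k) = 0 := by
    rw [ae_all_iff]
    exact fun i => key _
  rw [Lp.eq_zero_iff_ae_eq_zero]
  filter_upwards [hall, ae_restrict_mem hLm] with k h1 hk
  refine (S.irreducible k hk).eq_zero_of_inner_orbit S.ne_zero fun g => ?_
  exact (TopologicalSpace.denseRange_denseSeq (LittleGroup pbar)).induction_on
    (p := fun g => inner ℂ ((S.E k).toHom g ξ) (F k) = 0) g
    (isClosed_eq (((S.E k).continuous_apply ξ).inner continuous_const) continuous_const) h1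

lemma surjective_decomp : Function.Surjective S.decomp := by
  have hcl0 : IsClosed (Set.range S.decomp) :=
    S.decomp.isometry.isClosedEmbedding.isClosed_range
  have hcl : IsClosed (LinearMap.range S.decomp.toLinearMap :
      Set (Lp H 2 (volume.restrict (labels n)))) := by
    convert hcl0 using 1
    rfl
  have htop : LinearMap.range S.decomp.toLinearMap = ⊤ := by
    rw [← hcl.submodule_topologicalClosure_eq, Submodule.topologicalClosure_eq_top_iff,
      Submodule.eq_bot_iff]
    exact fun F hF => S.eq_zero_of_orthogonal F fun ψ =>
      (Submodule.mem_orthogonal _ _).1 hF _ ⟨ψ.1, rfl⟩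
  exact LinearMap.range_eq_top.1 htop

/-- The representations of the field are fibres of a direct integral decomposition of the principal
series. -/
theorem isDirectIntegralFibre {κ : ℝ} (hκ : κ ∈ labels n) :
    IsDirectIntegralFibre (S.E κ) (orbitT hp (S.E κ) (S.ω κ • ξ)) := by
  refine ⟨κ, S.E, LinearIsometryEquiv.ofSurjective S.decomp S.surjective_decomp, hκ, rfl,
    S.irreducible, S.continuousOn_toHom, fun α g ψ => S.decomp_ULor α g ψ, fun ψ =>
      ⟨S.value ψ, (S.coeFn_decomp ψ).symm,
        (S.continuousOn_value ψ).continuousAt ((isOpen_labels n).mem_nhds hκ), ?_⟩⟩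
  change S.ω κ • (∫ q, ψ.1 q • orbitVec hp (S.E κ) ξ q ∂cycleMeasure pbar.1) =
    ∫ q, ψ.1 q • orbitVec hp (S.E κ) (S.ω κ • ξ) q ∂cycleMeasure pbar.1
  rw [← integral_smul]
  refine integral_congr_ae (Filter.Eventually.of_forall fun q => ?_)
  simp only [orbitVec_smul]
  rw [smul_comm]

end SphericalField
end Field

/-! ### Zero mass: fields of representations with Bessel-type Gram functions -/

section Bessel
open FourierTransform
open scoped Real RealInnerProductSpace SchwartzMap

variable {n : ℕ} [NeZero n] {pbar : MassShell n 0}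
  {V : Type*} [NormedAddCommGroup V] [InnerProductSpace ℝ V] [FiniteDimensional ℝ V]
  [MeasurableSpace V] [BorelSpace V] (τ : Transverse n V)
  (hp : (j0Down n).neg • pbar = pbar)
  {H : Type*} [NormedAddCommGroup H] [InnerProductSpace ℂ H]

lemma FixedVector.toHom_nullRot {D : UnitaryRep (LittleGroup pbar) H} {ξ : H}
    (hK : FixedVector D ξ) (y : V) :
    D.toHom (nullRot τ hp y) ξ = orbitVec hp D ξ (paraboloid τ pbar y) := by
  rw [hK.toHom_eq hp, paraboloid_eq τ hp]

lemma FixedVector.toHom_eq_nullRot {D : UnitaryRep (LittleGroup pbar) H} {ξ : H}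
    (hK : FixedVector D ξ) (g : LittleGroup pbar) :
    D.toHom g ξ = D.toHom (nullRot τ hp (τ.coord (lmat g *ᵥ origin pbar))) ξ := by
  rw [hK.toHom_nullRot τ hp,
    paraboloid_coord τ hp (lmat_mulVec_mem_cycle g (origin_mem_cycle pbar)),
    hK.toHom_eq hp]

/-- The operator `T` in transverse coordinates. -/
lemma FixedVector.orbitT_eq_integral {c : ℝ} (hc : 0 < c)
    (hQ : MeasurePreserving (paraboloid τ pbar) (ENNReal.ofReal c • volume) (cycleMeasure pbar.1))
    {D : UnitaryRep (LittleGroup pbar) H} {ξ : H} (hK : FixedVector D ξ)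
    (ψ : integrableDomain pbar) :
    orbitT hp D ξ ψ =
      c • ∫ y, ψ.1 (paraboloid τ pbar y) • D.toHom (nullRot τ hp y) ξ := by
  change (∫ q, ψ.1 q • orbitVec hp D ξ q ∂cycleMeasure pbar.1) = _
  refine (integral_comp_of_measurePreserving hQ
    (integrable_smul_orbitVec hp D ξ ψ.2).1).symm.trans ?_
  rw [integral_smul_measure, ENNReal.toReal_ofReal hc.le]
  simp only [hK.toHom_nullRot τ hp]

variable [CompleteSpace H] {Ω : Type*} [MeasurableSpace Ω] {P : Measure Ω} [IsProbabilityMeasure P]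
  {e : Ω → V}

/-- A continuous field of irreducible representations with invariant vectors whose Gram functions
are the averages of the characters with frequencies in the sets `k • e(Ω)`, for `k` in the set of
labels, defines a direct integral decomposition, because of Plancherel's theorem on the transverse
space in the polar coordinates `(k, u) ↦ k • e u`. -/
theorem exists_sphericalField (he : Measurable e) {E : ℝ → UnitaryRep (LittleGroup pbar) H} {ξ : H}
    (hξ : ξ ≠ 0) (hirr : ∀ k ∈ labels n, (E k).Irreducible)
    (hcont : ∀ g x, ContinuousOn (fun k => (E k).toHom g x) (labels n))
    (hfix : ∀ k ∈ labels n, FixedVector (E k) ξ)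
    (hG : ∀ k ∈ labels n, ∀ y z, inner ℂ ((E k).toHom (nullRot τ hp y) ξ)
      ((E k).toHom (nullRot τ hp z) ξ) = ∫ u, (𝐞 ⟪y - z, k • e u⟫ : ℂ) ∂P)
    {w : ℝ → ℝ} (hw : ContinuousOn w (labels n)) (hw0 : ∀ k ∈ labels n, w k ≠ 0)
    (hpolar : ∀ F : V → ℝ≥0∞, Measurable F →
      ∫⁻ v, F v = ∫⁻ k in labels n, ENNReal.ofReal (w k ^ 2) * ∫⁻ u, F (k • e u) ∂P)
    (hbump : ∀ h : ℝ → ℝ, ContDiff ℝ ((⊤ : ℕ∞) : WithTop ℕ∞) h → HasCompactSupport h →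
      tsupport h ⊆ labels n → ∃ Φ : 𝓢(V, ℂ), ∀ k ∈ labels n, ∀ u, Φ (k • e u) = (h k : ℂ)) :
    ∃ S : SphericalField hp ξ, S.E = E := by
  obtain ⟨c, hc, hQ⟩ := exists_measurePreserving_paraboloid τ hp
  have hc0 : ENNReal.ofReal c ≠ 0 := by simpa using hc
  have hηc : ∀ k, Continuous fun y => (E k).toHom (nullRot τ hp y) ξ := fun k =>
    ((E k).continuous_apply ξ).comp (continuous_nullRot τ hp)
  refine ⟨{ E := E
            ω := fun k => ((w k * (Real.sqrt c)⁻¹ : ℝ) : ℂ)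
            irreducible := hirr
            continuousOn_toHom := hcont
            fixed := hfix
            ne_zero := hξ
            continuousOn_ω := Complex.continuous_ofReal.comp_continuousOn
              (hw.mul continuousOn_const)
            ω_ne_zero := fun k hk => by
              rw [Ne, Complex.ofReal_eq_zero]
              exact mul_ne_zero (hw0 k hk) (inv_ne_zero (Real.sqrt_pos.2 hc).ne')
            isometry := fun ψ => ?_
            exists_eq := fun h hh hhc hhs => ?_ }, rfl⟩
  · have h1 : Integrable fun y => ψ.1 (paraboloid τ pbar y) :=
      (integrable_smul_measure hc0 ENNReal.ofReal_ne_top).1 (hQ.integrable_comp_of_integrable ψ.2)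
    have h2 : MemLp (fun y => ψ.1 (paraboloid τ pbar y)) 2 := by
      have h3 := (Lp.memLp ψ.1).comp_measurePreserving hQ
      exact h3.of_measure_le_smul (c := (ENNReal.ofReal c)⁻¹) (ENNReal.inv_ne_top.2 hc0) (by
        rw [smul_smul, ENNReal.inv_mul_cancel hc0 ENNReal.ofReal_ne_top, one_smul])
    have hF := continuous_fourier h1
    have h4 : ∀ k ∈ labels n, ‖((w k * (Real.sqrt c)⁻¹ : ℝ) : ℂ) • orbitT hp (E k) ξ ψ‖ₑ ^ 2 =
        ENNReal.ofReal c * (ENNReal.ofReal (w k ^ 2) *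
          ∫⁻ u, ‖𝓕 (fun y => ψ.1 (paraboloid τ pbar y)) (k • e u)‖ₑ ^ 2 ∂P) := fun k hk => by
      rw [(hfix k hk).orbitT_eq_integral τ hp hc hQ, ← Complex.coe_smul, smul_smul, enorm_smul,
        mul_pow, norm_integral_of_gram (he.const_smul k) (hηc k) (hG k hk) h1, ← mul_assoc]
      congr 1
      rw [← Complex.ofReal_mul, ← ofReal_norm, Complex.norm_real,
        ← ENNReal.ofReal_pow (norm_nonneg _),
        ← ENNReal.ofReal_mul hc.le, Real.norm_eq_abs, sq_abs, mul_pow, mul_pow, inv_pow,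
        Real.sq_sqrt hc.le]
      congr 1
      field_simp
    rw [setLIntegral_congr_fun (isOpen_labels n).measurableSet h4,
      lintegral_const_mul' _ _ ENNReal.ofReal_ne_top,
      ← hpolar _ (hF.measurable.enorm.pow_const 2), lintegral_fourier_sq h1 h2]
    rw [← smul_eq_mul, ← lintegral_smul_measure]
    exact hQ.lintegral_comp ((Lp.stronglyMeasurable ψ.1).measurable.enorm.pow_const 2)
  · obtain ⟨Φ, hΦ⟩ := hbump h hh hhc hhs
    set φ : 𝓢(V, ℂ) := 𝓕⁻ Φ with hφ
    have hφF : 𝓕 (φ : V → ℂ) = Φ := by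
      rw [← SchwartzMap.fourier_coe, hφ, FourierTransform.fourier_fourierInv_eq]
    let ψ0 : Mink n → ℂ := fun q => (c : ℂ)⁻¹ * φ (τ.coord q)
    have hψc : Continuous ψ0 := continuous_const.mul (φ.continuous.comp (continuous_coord τ))
    have hψQ : ∀ y, ψ0 (paraboloid τ pbar y) = (c : ℂ)⁻¹ * φ y := fun y => by
      simp only [ψ0, coord_paraboloid τ hp]
    have hi : Integrable ψ0 (cycleMeasure pbar.1) := by
      rw [← hQ.map_eq, integrable_map_measure hψc.aestronglyMeasurable hQ.measurable.aemeasurable,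
        integrable_smul_measure hc0 ENNReal.ofReal_ne_top]
      simp only [Function.comp_def, hψQ]
      exact φ.integrable.const_mul _
    have h2 : MemLp ψ0 2 (cycleMeasure pbar.1) := by
      rw [← hQ.map_eq, memLp_map_measure_iff hψc.aestronglyMeasurable hQ.measurable.aemeasurable]
      simp only [Function.comp_def, hψQ]
      exact ((φ.memLp 2).const_mul _).smul_measure ENNReal.ofReal_ne_top
    have hmem : h2.toLp ψ0 ∈ integrableDomain pbar := hi.congr h2.coeFn_toLp.symm
    refine ⟨⟨h2.toLp ψ0, hmem⟩, fun k hk => ?_⟩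
    have h3 : orbitT hp (E k) ξ ⟨h2.toLp ψ0, hmem⟩ =
        ∫ y, φ y • (E k).toHom (nullRot τ hp y) ξ := by
      refine ((hfix k hk).orbitT_eq_integral τ hp hc hQ ⟨h2.toLp ψ0, hmem⟩).trans ?_
      rw [← integral_smul]
      have h4 : ∀ᵐ y, h2.toLp ψ0 (paraboloid τ pbar y) = ψ0 (paraboloid τ pbar y) := by
        have := hQ.quasiMeasurePreserving.ae h2.coeFn_toLp
        rwa [Measure.ae_ennreal_smul_measure_iff hc0] at this
      refine integral_congr_ae ?_
      filter_upwards [h4] with y hy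
      rw [hy, hψQ, ← Complex.coe_smul, smul_smul, mul_inv_cancel_left₀]
      exact_mod_cast hc.ne'
    refine h3.trans ?_
    rw [← sub_eq_zero]
    refine (hirr k hk).eq_zero_of_inner_orbit hξ fun g => ?_
    rw [(hfix k hk).toHom_eq_nullRot τ hp g, inner_sub_right, inner_smul_right,
      inner_integral_of_gram (he.const_smul k) (hηc k) (hG k hk) φ.integrable, sub_eq_zero]
    have h5 := hG k hk (τ.coord (lmat g *ᵥ origin pbar)) 0
    rw [nullRot_zero, UnitaryRep.toHom_one_apply, sub_zero] at h5
    rw [h5, ← integral_const_mul]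
    refine integral_congr_ae (Filter.Eventually.of_forall fun u => ?_)
    simp only [Pi.smul_apply]
    rw [hφF, hΦ k hk, mul_comm]

end Bessel

/-! ### Characters of Euclidean spaces -/

section Characters
open scoped Real RealInnerProductSpace

/-- Continuous characters of the real line are exponentials: as `c x ∫₀^δ c = ∫ₓ^{x+δ} c`, such a
character is differentiable. -/
lemma exists_eq_exp_of_continuous {c : ℝ → ℂ} (hc : Continuous c) (h0 : c 0 = 1)
    (hadd : ∀ x y, c (x + y) = c x * c y) : ∃ z : ℂ, ∀ x : ℝ, c x = Complex.exp (z * x) := by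
  have hF : ∀ x, HasDerivAt (fun x => ∫ t in (0 : ℝ)..x, c t) (c x) x := fun x =>
    hc.integral_hasStrictDerivAt 0 x |>.hasDerivAt
  obtain ⟨δ, hδ⟩ : ∃ δ : ℝ, ∫ t in (0 : ℝ)..δ, c t ≠ 0 := by
    by_contra! h
    have h1 := hF 0
    simp only [h, h0] at h1
    exact one_ne_zero (h1.unique (hasDerivAt_const 0 0))
  set I := ∫ t in (0 : ℝ)..δ, c t with hI
  have h1 : ∀ x, c x = I⁻¹ * ((∫ t in (0 : ℝ)..(x + δ), c t) -
      ∫ t in (0 : ℝ)..x, c t) := fun x => by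
    rw [intervalIntegral.integral_interval_sub_left (hc.intervalIntegrable _ _)
      (hc.intervalIntegrable _ _)]
    have h2 : ∫ t in x..(x + δ), c t = c x * I := by
      rw [hI, ← intervalIntegral.integral_const_mul]
      simp only [← hadd]
      rw [intervalIntegral.integral_comp_add_left, add_zero]
    rw [h2]
    field_simp
  set z := I⁻¹ * (c δ - 1) with hz
  have h3 : ∀ x, HasDerivAt c (z * c x) x := fun x => by
    have h4 := (((hF (x + δ)).comp_add_const x δ).sub (hF x)).const_mul I⁻¹
    rw [hadd] at h4
    have h5 : z * c x = I⁻¹ * (c x * c δ - c x) := by rw [hz]; ring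
    rw [h5]
    exact h4.congr_of_eventuallyEq (Filter.Eventually.of_forall h1)
  refine ⟨z, fun x => ?_⟩
  have h6 : ∀ x : ℝ, HasDerivAt (fun x : ℝ => c x * Complex.exp (-(z * x))) 0 x := fun x => by
    have h7 : HasDerivAt (fun x : ℝ => Complex.exp (-(z * x)))
        (Complex.exp (-(z * x)) * -(z * 1)) x :=
      ((Complex.ofRealCLM.hasDerivAt (x := x)).const_mul z).neg.cexp
    have h8 := (h3 x).mul h7
    have h9 : z * c x * Complex.exp (-(z * x)) + c x * (Complex.exp (-(z * x)) * -(z * 1)) = 0 := by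
      ring
    rwa [h9] at h8
  have h8 := is_const_of_deriv_eq_zero (fun x => (h6 x).differentiableAt)
    (fun x => (h6 x).deriv) x 0
  simp only [h0, Complex.ofReal_zero, mul_zero, neg_zero, Complex.exp_zero, mul_one] at h8
  rw [Complex.exp_neg] at h8
  exact (mul_inv_eq_one₀ (Complex.exp_ne_zero _)).1 h8

/-- Continuous unitary characters of a Euclidean space. -/
theorem exists_eq_fourierChar {V : Type*} [NormedAddCommGroup V] [InnerProductSpace ℝ V]
    [FiniteDimensional ℝ V] {c : V → ℂ} (hc : Continuous c) (hadd : ∀ x y, c (x + y) = c x * c y)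
    (hnorm : ∀ x, ‖c x‖ = 1) : ∃ a : V, ∀ x, c x = (Real.fourierChar ⟪a, x⟫ : ℂ) := by
  have h0 : c 0 = 1 := by
    have h1 := hadd 0 0
    rw [add_zero] at h1
    have h2 : c 0 ≠ 0 := norm_ne_zero_iff.1 (by rw [hnorm]; exact one_ne_zero)
    exact (mul_eq_left₀ h2).1 h1.symm
  have hline : ∀ v : V, ∃ r : ℝ, ∀ t : ℝ, c (t • v) = (Real.fourierChar (r * t) : ℂ) := fun v => by
    obtain ⟨z, hz⟩ := exists_eq_exp_of_continuous (c := fun t : ℝ => c (t • v)) (by fun_prop)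
      (by simp [h0]) (fun x y => by rw [add_smul, hadd])
    have h1 : z.re = 0 := by
      have h2 := hnorm ((1 : ℝ) • v)
      rw [hz, Complex.norm_exp, Real.exp_eq_one_iff] at h2
      simpa using h2
    refine ⟨z.im / (2 * π), fun t => ?_⟩
    have h3 : 2 * π * (z.im / (2 * π) * t) = z.im * t := by field_simp
    rw [hz, Real.fourierChar_apply, h3]
    congr 1
    apply Complex.ext
    · simp [h1]
    · simp
  choose r hr using hline
  set b := stdOrthonormalBasis ℝ V with hb
  have hsum : ∀ s : Finset (Fin (Module.finrank ℝ V)), ∀ f : Fin (Module.finrank ℝ V) → ℝ,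
      c (∑ i ∈ s, f i • b i) = (Real.fourierChar (∑ i ∈ s, r (b i) * f i) : ℂ) := fun s f => by
    induction s using Finset.induction_on with
    | empty => simp [h0]
    | insert i s hi ih =>
      rw [Finset.sum_insert hi, Finset.sum_insert hi, hadd, ih, hr, AddChar.map_add_eq_mul,
        Circle.coe_mul]
  refine ⟨∑ i, r (b i) • b i, fun x => ?_⟩
  rw [sum_inner]
  simp only [real_inner_smul_left]
  conv_lhs => rw [← b.sum_repr' x]
  exact hsum _ _

end Characters

/-! ### Zero mass in three dimensions -/

/-- The representation of a group by the multiples of the identity given by a unitary character. -/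
def scalarRep {G : Type*} [Group G] [TopologicalSpace G] (H : Type*) [NormedAddCommGroup H]
    [InnerProductSpace ℂ H] (χ : G →* Circle) (hχ : Continuous χ) : UnitaryRep G H where
  toHom :=
    { toFun := fun g =>
        { toFun := fun x => (χ g : ℂ) • x
          invFun := fun x => (χ g⁻¹ : ℂ) • x
          map_add' := smul_add _
          map_smul' := fun a x => smul_comm _ _ _
          left_inv := fun x => by
            change (χ g⁻¹ : ℂ) • (χ g : ℂ) • x = x
            rw [smul_smul, ← Circle.coe_mul, ← map_mul, inv_mul_cancel, map_one, Circle.coe_one,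
              one_smul]
          right_inv := fun x => by
            change (χ g : ℂ) • (χ g⁻¹ : ℂ) • x = x
            rw [smul_smul, ← Circle.coe_mul, ← map_mul, mul_inv_cancel, map_one, Circle.coe_one,
              one_smul]
          norm_map' := fun x => by
            change ‖(χ g : ℂ) • x‖ = ‖x‖
            rw [norm_smul, Circle.norm_coe, one_mul] }
      map_one' := LinearIsometryEquiv.ext fun x => by
        change (χ 1 : ℂ) • x = x
        rw [map_one, Circle.coe_one, one_smul]
      map_mul' := fun g h => LinearIsometryEquiv.ext fun x => by
        change (χ (g * h) : ℂ) • x = (χ g : ℂ) • (χ h : ℂ) • x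
        rw [map_mul, Circle.coe_mul, mul_smul] }
  continuous_apply := fun x => (continuous_subtype_val.comp hχ).smul continuous_const

lemma scalarRep_apply {G : Type*} [Group G] [TopologicalSpace G] {H : Type*} [NormedAddCommGroup H]
    [InnerProductSpace ℂ H] (χ : G →* Circle) (hχ : Continuous χ) (g : G) (x : H) :
    (scalarRep H χ hχ).toHom g x = (χ g : ℂ) • x := rfl

lemma UnitaryRep.toHom_ext {G : Type*} [Group G] [TopologicalSpace G] {H : Type*}
    [NormedAddCommGroup H] [InnerProductSpace ℂ H] {D D' : UnitaryRep G H}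
    (h : ∀ g x, D.toHom g x = D'.toHom g x) : D = D' := by
  obtain ⟨f, _⟩ := D
  obtain ⟨f', _⟩ := D'
  have : f = f' := MonoidHom.ext fun g => LinearIsometryEquiv.ext (h g)
  subst this
  rfl

/-- The transverse coordinate in three dimensions. -/
def transverseOne : Transverse 1 ℝ where
  hat :=
    { toFun := fun y => ![0, 0, y]
      map_add' := fun y z => by funext i; fin_cases i <;> simp
      map_smul' := fun t y => by funext i; fin_cases i <;> simp }
  coord := LinearMap.proj 2
  coord_hat := fun y => rfl
  hat_zero_one := fun y => ⟨rfl, rfl⟩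
  hat_coord := fun x i h0 h1 => by
    fin_cases i
    exacts [(h0 rfl).elim, (h1 rfl).elim, rfl]
  mdot_hat := fun y z => by
    simp [mdot_eq, mul_comm]

section One
open scoped Real RealInnerProductSpace SchwartzMap

variable {pbar : MassShell 1 0} (hp : (j0Down 1).neg • pbar = pbar)

/-- The parameter of an element of the little group, which consists of null rotations. -/
def nullCoord (g : LittleGroup pbar) : ℝ := transverseOne.coord (lmat g *ᵥ origin pbar)

lemma nullRot_nullCoord (g : LittleGroup pbar) : nullRot transverseOne hp (nullCoord g) = g := by
  have h1 : lmat ((nullRot transverseOne hp (nullCoord g))⁻¹ * g) *ᵥ origin pbar = origin pbar := by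
    rw [lmat_mul, ← mulVec_mulVec]
    have h2 : lmat (nullRot transverseOne hp (nullCoord g)) *ᵥ origin pbar =
        lmat g *ᵥ origin pbar := by
      rw [← paraboloid_eq transverseOne hp]
      exact paraboloid_coord transverseOne hp (lmat_mulVec_mem_cycle g (origin_mem_cycle pbar))
    rw [← h2, lmat_inv_mulVec_mulVec]
  exact inv_mul_eq_one.1 (eq_one_of_fix hp h1)

lemma nullCoord_nullRot (y : ℝ) : nullCoord (nullRot transverseOne hp y) = y := by
  rw [nullCoord, ← paraboloid_eq transverseOne hp, coord_paraboloid transverseOne hp]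

lemma nullCoord_mul (hp : (j0Down 1).neg • pbar = pbar) (g h : LittleGroup pbar) :
    nullCoord (g * h) = nullCoord g + nullCoord h := by
  conv_lhs => rw [← nullRot_nullCoord hp g, ← nullRot_nullCoord hp h, ← nullRot_add,
    nullCoord_nullRot]

lemma continuous_nullCoord : Continuous (nullCoord (pbar := pbar)) :=
  (continuous_coord transverseOne).comp
    (Continuous.matrix_mulVec (isInducing_lmat (pbar := pbar)).continuous continuous_const)

/-- The character of the little group with frequency `-k`. -/
def nullChar (k : ℝ) : LittleGroup pbar →* Circle where
  toFun g := Real.fourierChar (-k * nullCoord g)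
  map_one' := by
    have := nullCoord_nullRot hp 0
    rw [nullRot_zero] at this
    rw [this, mul_zero, AddChar.map_zero_eq_one]
  map_mul' g h := by rw [nullCoord_mul hp, mul_add, AddChar.map_add_eq_mul]

lemma continuous_nullChar (k : ℝ) : Continuous (nullChar hp k) :=
  Real.continuous_fourierChar.comp (continuous_const.mul continuous_nullCoord)

lemma labels_one : labels 1 = Set.univ := if_pos rfl

variable {H : Type*} [NormedAddCommGroup H] [InnerProductSpace ℂ H]
  {D : UnitaryRep (LittleGroup pbar) H}

/-- The little group is isomorphic to the additive group of real numbers, so it acts by scalars in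
an irreducible representation. -/
lemma exists_eq_scalarRep [CompleteSpace H] (hirr : D.Irreducible) :
    ∃ κ : ℝ, D = scalarRep H (nullChar hp κ) (continuous_nullChar hp κ) := by
  have hcomm : ∀ g h : LittleGroup pbar, g * h = h * g := fun g h => by
    rw [← nullRot_nullCoord hp g, ← nullRot_nullCoord hp h, ← nullRot_add, ← nullRot_add,
      add_comm (nullCoord g)]
  have hadj : ∀ g, (D.op g).adjoint = D.op g⁻¹ := fun g =>
    ((ContinuousLinearMap.eq_adjoint_iff _ _).2 fun x y => by
      rw [D.op_apply, D.op_apply, D.inner_toHom_left, inv_inv]).symm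
  have hsc : ∀ g, ∃ c : ℂ, ∀ x, D.toHom g x = c • x := fun g => by
    obtain ⟨c, hc⟩ := hirr.exists_eq_smul_one (D.op g) ⟨by
      rw [ContinuousLinearMap.star_eq_adjoint, hadj]
      ext x
      simp⟩ (fun h x => by
        rw [D.op_apply, D.op_apply, ← D.toHom_mul_apply, ← D.toHom_mul_apply, hcomm])
    exact ⟨c, fun x => by rw [← D.op_apply, hc]; rfl⟩
  choose c hc using hsc
  have := hirr.1
  obtain ⟨x, hx⟩ := exists_ne (0 : H)
  have hcc : ∀ g, c g = inner ℂ x (D.toHom g x) / inner ℂ x x := fun g => by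
    rw [hc, inner_smul_right, mul_div_cancel_right₀ _ (inner_self_ne_zero.2 hx)]
  obtain ⟨a, ha⟩ := exists_eq_fourierChar (V := ℝ)
    (c := fun y => c (nullRot transverseOne hp y))
    (by
      simp only [hcc]
      exact (continuous_const.inner ((D.continuous_apply x).comp
        (continuous_nullRot transverseOne hp))).div_const _)
    (fun y z => smul_left_injective ℂ hx (by
      simp only
      rw [nullRot_add, ← hc, D.toHom_mul_apply, hc _ x, map_smul, hc, smul_smul, mul_comm]))
    (fun y => by
      have h1 := (D.toHom (nullRot transverseOne hp y)).norm_map x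
      rw [hc, norm_smul] at h1
      exact (mul_eq_right₀ (norm_ne_zero_iff.2 hx)).1 h1)
  refine ⟨-a, UnitaryRep.toHom_ext fun g x => ?_⟩
  have h2 := ha (nullCoord g)
  simp only [nullRot_nullCoord] at h2
  have h3 : ⟪a, nullCoord g⟫ = - -a * nullCoord g := by simp [mul_comm]
  rw [hc, h2, h3]
  rfl

lemma fixedVector_one {m : ℝ} {pbar : MassShell 1 m} (hp : (j0Down 1).neg • pbar = pbar)
    (D : UnitaryRep (LittleGroup pbar) H) (ξ : H) : FixedVector D ξ := fun k hk => by
  rw [eq_one_of_fix hp hk, D.toHom_one_apply]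

lemma irreducible_scalarRep (hirr : D.Irreducible) {χ χ' : LittleGroup pbar →* Circle}
    {hχ : Continuous χ} {hχ' : Continuous χ'} (hD : D = scalarRep H χ hχ) :
    (scalarRep H χ' hχ').Irreducible := by
  refine ⟨hirr.1, fun K hK _ => hirr.2 K hK fun g x hx => ?_⟩
  rw [hD, scalarRep_apply]
  exact K.smul_mem _ hx

/-- In three dimensions, the principal series decomposes into the characters of the little group,
by the Fourier transform. -/
theorem exists_isDirectIntegralFibre_one [CompleteSpace H] (hirr : D.Irreducible) {ξ : H}
    (hξ : ‖ξ‖ = 1) :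
    ∃ c : ℂ, c ≠ 0 ∧ IsDirectIntegralFibre D (orbitT hp D (c • ξ)) := by
  obtain ⟨κ, hκ⟩ := exists_eq_scalarRep hp hirr
  have hξ0 : ξ ≠ 0 := norm_ne_zero_iff.1 (by rw [hξ]; exact one_ne_zero)
  obtain ⟨S, hS⟩ := exists_sphericalField transverseOne hp (P := Measure.dirac ()) (e := fun _ => 1)
    measurable_const
    (E := fun k => scalarRep H (nullChar hp k) (continuous_nullChar hp k)) hξ0
    (fun k _ => irreducible_scalarRep hirr hκ)
    (fun g x => by
      refine Continuous.continuousOn ?_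
      change Continuous fun k => ((Real.fourierChar (-k * nullCoord g) : ℂ)) • x
      exact (continuous_subtype_val.comp (Real.continuous_fourierChar.comp (by fun_prop))).smul
        continuous_const)
    (fun k _ => fixedVector_one hp _ ξ)
    (fun k _ y z => by
      rw [scalarRep_apply, scalarRep_apply, inner_smul_left, inner_smul_right,
        inner_self_eq_norm_sq_to_K, hξ, integral_dirac]
      change conj (Real.fourierChar (-k * _) : ℂ) * ((Real.fourierChar (-k * _) : ℂ) * _) = _
      rw [nullCoord_nullRot, nullCoord_nullRot, ← Circle.coe_inv_eq_conj, ← AddChar.map_neg_eq_inv,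
        ← mul_assoc, ← Circle.coe_mul, ← AddChar.map_add_eq_mul]
      have : - (-k * y) + -k * z = ⟪y - z, k • (1 : ℝ)⟫ := by
        simp; ring
      rw [this]
      simp)
    (w := fun _ => 1) continuousOn_const (fun _ _ => one_ne_zero)
    (fun F hF => by
      rw [labels_one, Measure.restrict_univ]
      simp)
    (fun h hh hhc _ => ⟨(hhc.comp_left (g := Complex.ofReal) Complex.ofReal_zero).toSchwartzMap
      (Complex.ofRealCLM.contDiff.comp hh), fun k _ u => by
        change ((h (k • 1) : ℝ) : ℂ) = _
        simp⟩)
  have hmem : κ ∈ labels 1 := by rw [labels_one]; trivial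
  have h1 := S.isDirectIntegralFibre hmem
  have hE : S.E κ = D := by rw [hS, hκ]
  rw [hE] at h1
  exact ⟨_, S.ω_ne_zero κ hmem, h1⟩

end One

/-! ### Averages of unitary operators -/

section Dense

/-- A continuous function on a compact space that is orthogonal to all functions in a family which
is closed under products and conjugation and separates points vanishes. -/
theorem eq_zero_of_integral_mul_eq_zero {X : Type*} [TopologicalSpace X] [CompactSpace X]
    [MeasurableSpace X] [BorelSpace X] {μ : Measure X} [IsFiniteMeasure μ]
    [μ.IsOpenPosMeasure] (M : Submonoid C(X, ℂ)) (hstar : ∀ f ∈ M, star f ∈ M)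
    (hsep : ∀ x y : X, x ≠ y → ∃ f ∈ M, f x ≠ f y) {g : X → ℂ} (hg : Continuous g)
    (h : ∀ f ∈ M, ∫ x, f x * g x ∂μ = 0) : g = 0 := by
  have hint : ∀ f : C(X, ℂ), Integrable (fun x => f x * g x) μ := fun f =>
    (f.continuous.mul hg).integrable_of_hasCompactSupport (HasCompactSupport.of_compactSpace _)
  have hspan : ∀ f ∈ Submodule.span ℂ (M : Set C(X, ℂ)), ∫ x, f x * g x ∂μ = 0 := fun f hf => by
    induction hf using Submodule.span_induction with
    | mem f hf => exact h f hf
    | zero => simp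
    | add f f' _ _ h1 h2 =>
      have h3 : ∀ x, (f + f') x * g x = f x * g x + f' x * g x := fun x => by
        rw [ContinuousMap.add_apply, add_mul]
      simp only [h3]
      rw [integral_add (hint f) (hint f'), h1, h2, add_zero]
    | smul c f _ h1 =>
      have h3 : ∀ x, (c • f) x * g x = c * (f x * g x) := fun x => by
        rw [ContinuousMap.smul_apply, smul_eq_mul, mul_assoc]
      simp only [h3]
      rw [integral_const_mul, h1, mul_zero]
  have hadj : Subalgebra.toSubmodule (Algebra.adjoin ℂ (M : Set C(X, ℂ))) =
      Submodule.span ℂ (M : Set C(X, ℂ)) := by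
    rw [Algebra.adjoin_eq_span, Submonoid.closure_eq]
  let A : StarSubalgebra ℂ C(X, ℂ) :=
    { Algebra.adjoin ℂ (M : Set C(X, ℂ)) with
      star_mem' := fun {f} hf => by
        change star f ∈ Subalgebra.toSubmodule (Algebra.adjoin ℂ (M : Set C(X, ℂ)))
        have hf' : f ∈ Subalgebra.toSubmodule (Algebra.adjoin ℂ (M : Set C(X, ℂ))) := hf
        rw [hadj] at hf' ⊢
        clear hf
        induction hf' using Submodule.span_induction with
        | mem f hf => exact Submodule.subset_span (hstar f hf)
        | zero => rw [star_zero]; exact zero_mem _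
        | add f f' _ _ h1 h2 => rw [star_add]; exact add_mem h1 h2
        | smul c f _ h1 => rw [star_smul]; exact Submodule.smul_mem _ _ h1 }
  have htop := ContinuousMap.starSubalgebra_topologicalClosure_eq_top_of_separatesPoints A
    fun x y hxy => by
      obtain ⟨f, hf, hne⟩ := hsep x y hxy
      exact ⟨f, ⟨f, Algebra.subset_adjoin hf, rfl⟩, hne⟩
  have hcl : IsClosed {f : C(X, ℂ) | ∫ x, f x * g x ∂μ = 0} := by
    let L : C(X, ℂ) →ₗ[ℂ] ℂ :=
      { toFun := fun f => ∫ x, f x * g x ∂μ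
        map_add' := fun f f' => by
          simp only [ContinuousMap.add_apply, add_mul]
          exact integral_add (hint f) (hint f')
        map_smul' := fun c f => by
          simp only [ContinuousMap.smul_apply, smul_eq_mul, mul_assoc, RingHom.id_apply]
          exact integral_const_mul _ _ }
    have hL : Continuous L := AddMonoidHomClass.continuous_of_bound L (∫ x, ‖g x‖ ∂μ) fun f => by
      refine (norm_integral_le_integral_norm _).trans ?_
      rw [← integral_mul_const]
      have hgi : Integrable g μ :=
        hg.integrable_of_hasCompactSupport (HasCompactSupport.of_compactSpace _)
      refine integral_mono (hint f).norm (hgi.norm.mul_const _) fun x => ?_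
      simp only
      rw [norm_mul, mul_comm]
      exact mul_le_mul_of_nonneg_left (f.norm_coe_le_norm x) (norm_nonneg _)
    exact isClosed_singleton.preimage hL
  have hall : ∀ f : C(X, ℂ), ∫ x, f x * g x ∂μ = 0 := fun f => by
    have hf : f ∈ closure (A : Set C(X, ℂ)) := by
      rw [← StarSubalgebra.topologicalClosure_coe, htop]; trivial
    refine hcl.closure_subset_iff.2 (fun f' hf' => ?_) hf
    refine hspan f' ?_
    rw [← hadj]
    exact hf'
  have h1 := hall ⟨fun x => conj (g x), Complex.continuous_conj.comp hg⟩
  simp only [ContinuousMap.coe_mk, Complex.conj_mul'] at h1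
  have h2 : ∫ x, ‖g x‖ ^ 2 ∂μ = 0 := by
    have h3 : ((∫ x, ‖g x‖ ^ 2 ∂μ : ℝ) : ℂ) = 0 := by
      rw [← integral_complex_ofReal, ← h1]
      simp
    exact_mod_cast h3
  have hc2 : Continuous fun x => ‖g x‖ ^ 2 := by fun_prop
  rw [integral_eq_zero_iff_of_nonneg (fun x => by positivity)
    (hc2.integrable_of_hasCompactSupport (HasCompactSupport.of_compactSpace _)),
    Continuous.ae_eq_iff_eq (μ := μ) hc2 continuous_zero] at h2
  funext x
  simpa using congrFun h2 x

end Dense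

section OpIntegral
variable {G : Type*} [Group G] [TopologicalSpace G] {H : Type*} [NormedAddCommGroup H]
  [InnerProductSpace ℂ H] [CompleteSpace H] (D : UnitaryRep G H)
  {X : Type*} [TopologicalSpace X] [MeasurableSpace X] [OpensMeasurableSpace X]
  [SecondCountableTopology X] {μ : Measure X} {φ ψ : X → ℂ} {γ : X → G}

lemma UnitaryRep.integrable_smul (hφ : Integrable φ μ) (hγ : Continuous γ) (x : H) :
    Integrable (fun t => φ t • D.toHom (γ t) x) μ := by
  refine (hφ.norm.mul_const ‖x‖).mono'
    (hφ.1.smul ((D.continuous_apply x).comp hγ).aestronglyMeasurable)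
    (Filter.Eventually.of_forall fun t => ?_)
  rw [norm_smul, LinearIsometryEquiv.norm_map]

/-- The average `∫ φ(t) D(γ(t)) dμ(t)`, as an integral in the strong sense. -/
def opIntegral (hφ : Integrable φ μ) (hγ : Continuous γ) : H →L[ℂ] H :=
  LinearMap.mkContinuous
    { toFun := fun x => ∫ t, φ t • D.toHom (γ t) x ∂μ
      map_add' := fun x y => by
        rw [← integral_add (D.integrable_smul hφ hγ x) (D.integrable_smul hφ hγ y)]
        simp only [map_add, smul_add]
      map_smul' := fun c x => by
        rw [RingHom.id_apply, ← integral_smul]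
        simp only [map_smul, smul_comm c] }
    (∫ t, ‖φ t‖ ∂μ) fun x => by
      refine (norm_integral_le_integral_norm _).trans_eq ?_
      simp only [norm_smul, LinearIsometryEquiv.norm_map]
      rw [integral_mul_const]

lemma opIntegral_apply (hφ : Integrable φ μ) (hγ : Continuous γ) (x : H) :
    opIntegral D hφ hγ x = ∫ t, φ t • D.toHom (γ t) x ∂μ := rfl

lemma toHom_opIntegral (hφ : Integrable φ μ) (hγ : Continuous γ) (g : G) (x : H) :
    D.toHom g (opIntegral D hφ hγ x) = ∫ t, φ t • D.toHom (g * γ t) x ∂μ := by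
  rw [opIntegral_apply, ← D.op_apply, ← ContinuousLinearMap.integral_comp_comm _
    (D.integrable_smul hφ hγ x)]
  simp only [map_smul, D.op_apply, D.toHom_mul_apply]

lemma inner_opIntegral_left (hφ : Integrable φ μ) (hγ : Continuous γ)
    (hφ' : Integrable (fun t => conj (φ t)) μ) (hγ' : Continuous fun t => (γ t)⁻¹) (x y : H) :
    inner ℂ (opIntegral D hφ hγ x) y = inner ℂ x (opIntegral D hφ' hγ' y) := by
  rw [← inner_conj_symm, opIntegral_apply, opIntegral_apply,
    ← integral_inner (D.integrable_smul hφ' hγ' y), ← integral_inner (D.integrable_smul hφ hγ x),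
    ← integral_conj]
  refine integral_congr_ae (Filter.Eventually.of_forall fun t => ?_)
  simp only
  rw [inner_smul_right, inner_smul_right, map_mul, inner_conj_symm, D.inner_toHom_left]

lemma adjoint_opIntegral (hφ : Integrable φ μ) (hγ : Continuous γ)
    (hφ' : Integrable (fun t => conj (φ t)) μ) (hγ' : Continuous fun t => (γ t)⁻¹) :
    (opIntegral D hφ hγ).adjoint = opIntegral D hφ' hγ' :=
  ((ContinuousLinearMap.eq_adjoint_iff _ _).2 fun x y => by
    rw [← inner_conj_symm, ← inner_opIntegral_left D hφ hγ hφ' hγ', inner_conj_symm]).symm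

lemma norm_opIntegral_sub_le (hφ : Integrable φ μ) (hψ : Integrable ψ μ) (hγ : Continuous γ) :
    ‖opIntegral D hφ hγ - opIntegral D hψ hγ‖ ≤ ∫ t, ‖φ t - ψ t‖ ∂μ := by
  refine ContinuousLinearMap.opNorm_le_bound _ (integral_nonneg fun t => norm_nonneg _) fun x => ?_
  rw [_root_.sub_apply, opIntegral_apply, opIntegral_apply,
    ← integral_sub (D.integrable_smul hφ hγ x) (D.integrable_smul hψ hγ x)]
  refine (norm_integral_le_integral_norm _).trans_eq ?_
  simp only [← sub_smul, norm_smul, LinearIsometryEquiv.norm_map]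
  rw [integral_mul_const]

end OpIntegral

section Circle

instance : MeasurableSpace Circle := borel Circle

instance : BorelSpace Circle := ⟨rfl⟩

/-- The Haar probability measure of a compact group. -/
def probHaar (G : Type*) [Group G] [TopologicalSpace G] [IsTopologicalGroup G] [CompactSpace G]
    [MeasurableSpace G] [BorelSpace G] : Measure G :=
  Measure.haarMeasure ⊤

variable {G : Type*} [Group G] [TopologicalSpace G] [IsTopologicalGroup G] [CompactSpace G]
    [MeasurableSpace G] [BorelSpace G]

instance : (probHaar G).IsHaarMeasure := by unfold probHaar; infer_instance

instance : IsProbabilityMeasure (probHaar G) := ⟨by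
  have := Measure.haarMeasure_self (K₀ := (⊤ : TopologicalSpace.PositiveCompacts G))
  simpa [probHaar] using this⟩

end Circle

/-! ### Irreducible representations of the Euclidean motion group of the plane -/

/-- The structure of the Euclidean motion group of the plane: translations `n z`, `z ∈ ℂ`, and
rotations `r u`, `|u| = 1`. -/
structure MotionGroup (G : Type*) [Group G] [TopologicalSpace G] where
  n : ℂ → G
  r : Circle → G
  continuous_n : Continuous n
  continuous_r : Continuous r
  n_add : ∀ y z, n (y + z) = n y * n z
  r_mul : ∀ u v, r (u * v) = r u * r v
  r_mul_n : ∀ u z, r u * n z = n (u * z) * r u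
  exists_eq : ∀ g, ∃ z u, g = n z * r u

namespace MotionGroup
open scoped Real RealInnerProductSpace

variable {G : Type*} [Group G] [TopologicalSpace G] (M : MotionGroup G)

lemma n_zero : M.n 0 = 1 := by
  have h := M.n_add 0 0
  rw [add_zero] at h
  exact left_eq_mul.1 h

lemma r_one : M.r 1 = 1 := by
  have h := M.r_mul 1 1
  rw [mul_one] at h
  exact left_eq_mul.1 h

lemma n_inv (z : ℂ) : (M.n z)⁻¹ = M.n (-z) :=
  inv_eq_of_mul_eq_one_right (by rw [← M.n_add, add_neg_cancel, n_zero])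

lemma n_comm (y z : ℂ) : M.n y * M.n z = M.n z * M.n y := by
  rw [← M.n_add, ← M.n_add, add_comm]

lemma continuous_n_circle (z : ℂ) : Continuous fun u : Circle => M.n (u * z) :=
  M.continuous_n.comp (continuous_subtype_val.mul continuous_const)

lemma continuous_n_circle_inv (z : ℂ) : Continuous fun u : Circle => (M.n (u * z))⁻¹ := by
  simp only [n_inv]
  exact M.continuous_n.comp (continuous_subtype_val.mul continuous_const).neg

lemma integrable_circle {φ : Circle → ℂ} (hφ : Continuous φ) : Integrable φ (probHaar Circle) :=
  hφ.integrable_of_hasCompactSupport (HasCompactSupport.of_compactSpace _)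

variable {H : Type*} [NormedAddCommGroup H] [InnerProductSpace ℂ H] [CompleteSpace H]
  (D : UnitaryRep G H)

/-- The average of the translations by `u z`, `|u| = 1`, with the weight `φ(u)`. -/
def avg {φ : Circle → ℂ} (hφ : Continuous φ) (z : ℂ) : H →L[ℂ] H :=
  opIntegral D (integrable_circle hφ) (M.continuous_n_circle z)

lemma avg_apply {φ : Circle → ℂ} (hφ : Continuous φ) (z : ℂ) (x : H) :
    M.avg D hφ z x = ∫ u, φ u • D.toHom (M.n (u * z)) x ∂probHaar Circle := rfl

lemma adjoint_avg {φ : Circle → ℂ} (hφ : Continuous φ) (z : ℂ) :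
    (M.avg D hφ z).adjoint = M.avg D (Complex.continuous_conj.comp hφ) (-z) := by
  rw [avg, adjoint_opIntegral D _ _ (integrable_circle (Complex.continuous_conj.comp hφ))
    (M.continuous_n_circle_inv z)]
  ext x
  rw [opIntegral_apply, avg_apply]
  simp only [n_inv, mul_neg, Function.comp_apply]

lemma toHom_n_avg {φ : Circle → ℂ} (hφ : Continuous φ) (z y : ℂ) (x : H) :
    D.toHom (M.n y) (M.avg D hφ z x) = M.avg D hφ z (D.toHom (M.n y) x) := by
  rw [avg, toHom_opIntegral, opIntegral_apply]
  simp only [M.n_comm y, D.toHom_mul_apply]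

/-- The rotations permute the averages of the translations. -/
lemma toHom_r_avg {φ : Circle → ℂ} (hφ : Continuous φ) (z : ℂ) (v : Circle) (x : H) :
    D.toHom (M.r v) (M.avg D hφ z x) =
      M.avg D (φ := fun u => φ (v⁻¹ * u)) (by fun_prop) z (D.toHom (M.r v) x) := by
  rw [avg, toHom_opIntegral, avg_apply]
  simp only [M.r_mul_n, D.toHom_mul_apply]
  rw [← integral_mul_left_eq_self (μ := probHaar Circle)
    (fun u : Circle => φ (v⁻¹ * u) • D.toHom (M.n (u * z)) (D.toHom (M.r v) x)) v]
  simp only [inv_mul_cancel_left, Circle.coe_mul, mul_assoc]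

lemma forall_of_n_r {p : G → Prop} (hn : ∀ z, p (M.n z)) (hr : ∀ u, p (M.r u))
    (hmul : ∀ g h, p g → p h → p (g * h)) (g : G) : p g := by
  obtain ⟨z, u, rfl⟩ := M.exists_eq g
  exact hmul _ _ (hn z) (hr u)

variable {D}

/-- A selfadjoint operator that commutes with the translations and the rotations is a scalar. -/
lemma exists_eq_smul (hirr : D.Irreducible) (S : H →L[ℂ] H) (hS : S.adjoint = S)
    (hn : ∀ z x, S (D.toHom (M.n z) x) = D.toHom (M.n z) (S x))
    (hr : ∀ u x, S (D.toHom (M.r u) x) = D.toHom (M.r u) (S x)) :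
    ∃ s : ℂ, ∀ x, S x = s • x := by
  obtain ⟨s, hs⟩ := hirr.exists_eq_smul_one S
    (by
      have : IsSelfAdjoint S := hS
      exact this.isStarNormal)
    (M.forall_of_n_r hn hr fun g h hg hh x => by
      rw [D.toHom_mul_apply, D.toHom_mul_apply, hg, hh])
  exact ⟨s, fun x => by rw [hs]; rfl⟩

/-- The spherical average of the translations is a scalar. -/
lemma exists_avg_one_eq_smul (hirr : D.Irreducible) (z : ℂ) :
    ∃ s : ℂ, ∀ x, M.avg D (φ := fun _ => 1) continuous_const z x = s • x := by
  refine M.exists_eq_smul hirr _ ?_ (fun y x => (M.toHom_n_avg D _ z y x).symm)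
    (fun u x => (M.toHom_r_avg D continuous_const z u x).symm)
  rw [adjoint_avg]
  ext x
  rw [avg_apply, avg_apply, ← integral_mul_left_eq_self (μ := probHaar Circle) _ (-1)]
  refine integral_congr_ae (Filter.Eventually.of_forall fun u => ?_)
  simp

lemma adjoint_self_toHom {T : H →L[ℂ] H} {g : G} {c : ℂ} (hc : ‖c‖ = 1)
    (h : ∀ x, T (D.toHom g x) = c • D.toHom g (T x)) (x : H) :
    T.adjoint (T (D.toHom g x)) = D.toHom g (T.adjoint (T x)) := by
  refine ext_inner_left ℂ fun w => ?_
  rw [← D.toHom_apply_inv_apply g w, ContinuousLinearMap.adjoint_inner_right, h, h, inner_smul_left,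
    inner_smul_right, ← mul_assoc, Complex.conj_mul', hc, LinearIsometryEquiv.inner_map_map,
    LinearIsometryEquiv.inner_map_map, ContinuousLinearMap.adjoint_inner_right]
  simp

lemma continuous_circle_zpow (m : ℤ) : Continuous fun u : Circle => ((u ^ m : Circle) : ℂ) :=
  continuous_subtype_val.comp (continuous_zpow m)

/-- The operator that raises the rotation weights by `m`. -/
def shift (m : ℤ) (z : ℂ) (D : UnitaryRep G H) : H →L[ℂ] H :=
  M.avg D (continuous_circle_zpow (-m)) z

lemma toHom_r_shift (m : ℤ) (z : ℂ) (v : Circle) (x : H) :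
    D.toHom (M.r v) (M.shift m z D x) =
      ((v ^ m : Circle) : ℂ) • M.shift m z D (D.toHom (M.r v) x) := by
  rw [shift, toHom_r_avg, avg_apply, avg_apply, ← integral_smul]
  refine integral_congr_ae (Filter.Eventually.of_forall fun u => ?_)
  simp only
  rw [smul_smul, _root_.mul_zpow, _root_.inv_zpow, _root_.zpow_neg, inv_inv, Circle.coe_mul]

/-- The shift commutes with the translations, and with the rotations up to a phase that the adjoint
compensates. -/
lemma exists_adjoint_shift_shift_eq_smul (hirr : D.Irreducible) (m : ℤ) (z : ℂ) :
    ∃ s : ℂ, ∀ x, (M.shift m z D).adjoint (M.shift m z D x) = s • x := by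
  have h1 : ∀ y x, M.shift m z D (D.toHom (M.n y) x) =
      (1 : ℂ) • D.toHom (M.n y) (M.shift m z D x) :=
    fun y x => by rw [one_smul, shift, M.toHom_n_avg]
  have h2 : ∀ u x, M.shift m z D (D.toHom (M.r u) x) =
      ((u ^ (-m) : Circle) : ℂ) • D.toHom (M.r u) (M.shift m z D x) := fun u x => by
    rw [toHom_r_shift, smul_smul, ← Circle.coe_mul, _root_.zpow_neg, inv_mul_cancel,
      Circle.coe_one, one_smul]
  generalize M.shift m z D = S at h1 h2 ⊢
  exact M.exists_eq_smul hirr (S.adjoint ∘L S)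
    (by rw [ContinuousLinearMap.adjoint_comp, ContinuousLinearMap.adjoint_adjoint])
    (fun y x => adjoint_self_toHom norm_one (h1 y) x)
    (fun u x => adjoint_self_toHom (Circle.norm_coe _) (h2 u) x)

/-- The translations are represented continuously in the operator norm: for a radial Lipschitz
function `f` of small support, `∫ f(z) D(n z) dz` is a nonzero multiple of the identity, and its
product with `D(n y)` is `∫ f(z - y) D(n z) dz`. -/
theorem continuous_op_n (hirr : D.Irreducible) : Continuous fun z => D.op (M.n z) := by
  have := hirr.1
  obtain ⟨x, hx⟩ := exists_ne (0 : H)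
  have hx0 : 0 < ‖x‖ := norm_pos_iff.2 hx
  obtain ⟨R, hR, hRx⟩ : ∃ R > 0, ∀ z : ℂ, ‖z‖ < R → ‖D.toHom (M.n z) x - x‖ < ‖x‖ / 2 := by
    have h1 : Continuous fun z => D.toHom (M.n z) x := (D.continuous_apply x).comp M.continuous_n
    obtain ⟨R, hR, h2⟩ := Metric.continuous_iff.1 h1 0 (‖x‖ / 2) (by positivity)
    refine ⟨R, hR, fun z hz => ?_⟩
    have h3 := h2 z (by rwa [dist_zero_right])
    rwa [M.n_zero, D.toHom_one_apply, dist_eq_norm] at h3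
  set f : ℂ → ℝ := fun z => max 0 (R - ‖z‖) with hf
  have hfc : Continuous f := by fun_prop
  have hf0 : ∀ z, R ≤ ‖z‖ → f z = 0 := fun z hz => max_eq_left (by linarith)
  have hfs : HasCompactSupport f := HasCompactSupport.of_support_subset_isCompact
    (isCompact_closedBall (0 : ℂ) R) fun z hz => by
      rw [mem_closedBall_zero_iff]
      by_contra! h
      exact hz (hf0 z h.le)
  have hFc : ∀ y, Continuous fun z => (f (z - y) : ℂ) := fun y =>
    Complex.continuous_ofReal.comp (hfc.comp (continuous_id.sub continuous_const))
  have hFi : ∀ y, Integrable fun z => (f (z - y) : ℂ) := fun y =>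
    (hFc y).integrable_of_hasCompactSupport
      ((hfs.comp_homeomorph (Homeomorph.subRight y)).comp_left (g := Complex.ofReal) rfl)
  set T : ℂ → H →L[ℂ] H := fun y => opIntegral D (hFi y) M.continuous_n with hT
  have hnT : ∀ y w x, D.toHom (M.n y) (T w x) = T (y + w) x := fun y w x => by
    rw [hT, toHom_opIntegral, opIntegral_apply, ← integral_sub_right_eq_self _ y]
    simp only [← M.n_add, add_sub_cancel]
    simp only [sub_sub]
  have hadj : (T 0).adjoint = T 0 := by
    have hc : ∀ z, conj (f (z - 0) : ℂ) = f (z - 0) := fun z => Complex.conj_ofReal _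
    rw [hT, adjoint_opIntegral D _ _ (by simpa only [hc] using hFi 0)
      (by simp only [n_inv]; exact M.continuous_n.comp continuous_neg)]
    ext x
    rw [opIntegral_apply, opIntegral_apply, ← integral_neg_eq_self]
    simp only [n_inv, neg_neg, hc]
    simp [hf]
  obtain ⟨s, hs⟩ := M.exists_eq_smul hirr (T 0) hadj
    (fun y x => by
      rw [hT, toHom_opIntegral, opIntegral_apply]
      simp only [M.n_comm y, D.toHom_mul_apply])
    (fun u x => by
      rw [hT, toHom_opIntegral, opIntegral_apply]
      simp only [M.r_mul_n, D.toHom_mul_apply]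
      have h1 := (rotation u).measurePreserving.integral_comp
        (rotation u).toHomeomorph.measurableEmbedding
        (fun z => (f (z - 0) : ℂ) • D.toHom (M.n z) (D.toHom (M.r u) x))
      rw [← h1]
      refine integral_congr_ae (Filter.Eventually.of_forall fun z => ?_)
      have h2 : f (rotation u z - 0) = f (z - 0) := by
        simp only [hf, sub_zero, LinearIsometryEquiv.norm_map]
      simp only [h2]
      rw [rotation_apply])
  have hs0 : s ≠ 0 := by
    rintro rfl
    have h1 := hs x
    rw [zero_smul, hT, opIntegral_apply] at h1
    have hi : Integrable f := hfc.integrable_of_hasCompactSupport hfs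
    have h2 : ∫ z, (f (z - 0) : ℂ) • (D.toHom (M.n z) x - x) = -((∫ z, f z : ℝ) : ℂ) • x := by
      simp only [smul_sub]
      rw [integral_sub (D.integrable_smul (hFi 0) M.continuous_n x) ((hFi 0).smul_const x), h1,
        zero_sub, integral_smul_const, neg_smul, integral_complex_ofReal]
      simp
    have h3 : 0 < ∫ z, f z := hfc.integral_pos_of_hasCompactSupport_nonneg_nonzero hfs
      (fun z => le_max_left _ _) (x := 0) (by simp [hf, hR])
    have h4 : ‖∫ z, (f (z - 0) : ℂ) • (D.toHom (M.n z) x - x)‖ ≤ (∫ z, f z) * (‖x‖ / 2) := by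
      rw [← integral_mul_const]
      refine norm_integral_le_of_norm_le (hi.mul_const _) (Filter.Eventually.of_forall fun z => ?_)
      rw [norm_smul, sub_zero, Complex.norm_real, Real.norm_of_nonneg (le_max_left _ _)]
      by_cases hz : ‖z‖ < R
      · exact mul_le_mul_of_nonneg_left (hRx z hz).le (le_max_left _ _)
      · have h5 : f z = 0 := hf0 z (not_lt.1 hz)
        change f z * _ ≤ f z * _
        rw [h5, zero_mul, zero_mul]
    rw [h2, norm_smul, norm_neg, Complex.norm_real, Real.norm_of_nonneg h3.le] at h4
    nlinarith [mul_pos h3 hx0]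
  have hlip : ∀ y w, ‖T y - T w‖ ≤ 2 * (volume (Metric.ball (0 : ℂ) R)).toReal * ‖y - w‖ := by
    intro y w
    refine (norm_opIntegral_sub_le D _ _ _).trans ?_
    have hi : ∀ v : ℂ, Integrable ((Metric.ball v R).indicator fun _ => ‖y - w‖) := fun v =>
      (integrable_indicator_iff measurableSet_ball).2
        (integrableOn_const measure_ball_lt_top.ne)
    have hv : ∀ v : ℂ, ∫ z, (Metric.ball v R).indicator (fun _ => ‖y - w‖) z =
        (volume (Metric.ball (0 : ℂ) R)).toReal * ‖y - w‖ := fun v => by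
      rw [integral_indicator measurableSet_ball, setIntegral_const, smul_eq_mul, Measure.real,
        Measure.addHaar_ball_center]
    calc ∫ z, ‖(f (z - y) : ℂ) - f (z - w)‖
        ≤ ∫ z, ((Metric.ball y R).indicator (fun _ => ‖y - w‖) z +
            (Metric.ball w R).indicator (fun _ => ‖y - w‖) z) := by
          refine integral_mono ((hFi y).sub (hFi w)).norm ((hi y).add (hi w)) fun z => ?_
          simp only
          rw [← Complex.ofReal_sub, Complex.norm_real, Real.norm_eq_abs]
          have h1 : |f (z - y) - f (z - w)| ≤ ‖y - w‖ := by
            change |max 0 (R - ‖z - y‖) - max 0 (R - ‖z - w‖)| ≤ _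
            rw [max_comm, max_comm 0]
            refine (abs_max_sub_max_le_abs _ _ _).trans ?_
            have h3 : R - ‖z - y‖ - (R - ‖z - w‖) = ‖z - w‖ - ‖z - y‖ := by ring
            rw [h3]
            refine (abs_norm_sub_norm_le _ _).trans_eq ?_
            have h4 : z - w - (z - y) = y - w := by ring
            rw [h4]
          have h2 : ∀ v, 0 ≤ (Metric.ball v R).indicator (fun _ => ‖y - w‖) z := fun v =>
            Set.indicator_nonneg (fun _ _ => norm_nonneg _) _
          by_cases hy : z ∈ Metric.ball y R
          · rw [Set.indicator_of_mem hy]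
            linarith [h2 w]
          by_cases hw : z ∈ Metric.ball w R
          · rw [Set.indicator_of_mem hw]
            linarith [h2 y]
          rw [Metric.mem_ball, dist_eq_norm, not_lt] at hy hw
          rw [hf0 _ hy, hf0 _ hw, sub_zero, abs_zero]
          linarith [h2 y, h2 w]
      _ = 2 * (volume (Metric.ball (0 : ℂ) R)).toReal * ‖y - w‖ := by
          rw [integral_add (hi y) (hi w), hv, hv]
          ring
  have hop : (fun z => D.op (M.n z)) = fun z => s⁻¹ • T z := by
    funext z
    ext x
    have h1 := hnT z 0 x
    rw [hs, add_zero, map_smul] at h1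
    rw [_root_.smul_apply, ← h1, smul_smul, inv_mul_cancel₀ hs0, one_smul]
    rfl
  rw [hop]
  refine Continuous.const_smul (g := T) ?_ s⁻¹
  refine LipschitzWith.continuous
    (K := ⟨2 * (volume (Metric.ball (0 : ℂ) R)).toReal, by positivity⟩)
    (LipschitzWith.of_dist_le_mul fun y w => ?_)
  rw [dist_eq_norm, dist_eq_norm]
  exact hlip y w

/-- A character of the closed commutative algebra generated by the translations: whenever the
product of two averages of translations is a scalar, this scalar is the product of the averages of
a unitary character of the plane. -/
theorem exists_character (hirr : D.Irreducible) : ∃ a : ℂ, ∀ {φ ψ : Circle → ℂ} (hφ : Continuous φ)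
    (hψ : Continuous ψ) (z w s : ℂ), (∀ x, M.avg D hψ w (M.avg D hφ z x) = s • x) →
      s = (∫ u, ψ u * (Real.fourierChar ⟪a, u * w⟫ : ℂ) ∂probHaar Circle) *
        ∫ u, φ u * (Real.fourierChar ⟪a, u * z⟫ : ℂ) ∂probHaar Circle := by
  have := hirr.1
  let A := (Algebra.adjoin ℂ (Set.range fun z => D.op (M.n z))).topologicalClosure
  have hcomm : ∀ S T : A, S * T = T * S := by
    have h1 : IsMulCommutative (Algebra.adjoin ℂ (Set.range fun z => D.op (M.n z))) := by
      refine Algebra.isMulCommutative_adjoin ℂ ?_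
      rintro _ ⟨y, rfl⟩ _ ⟨z, rfl⟩
      ext x
      change D.toHom (M.n y) (D.toHom (M.n z) x) = D.toHom (M.n z) (D.toHom (M.n y) x)
      rw [← D.toHom_mul_apply, ← D.toHom_mul_apply, M.n_comm]
    exact (Subalgebra.commRingTopologicalClosure _ mul_comm').mul_comm
  let _ : NormedCommRing A := { (inferInstance : NormedRing A) with mul_comm := hcomm }
  have : CompleteSpace A := (Subalgebra.isClosed_topologicalClosure _).completeSpace_coe
  have : Nontrivial A := inferInstance
  have : NormOneClass A := ⟨(norm_one : ‖(1 : H →L[ℂ] H)‖ = 1)⟩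
  obtain ⟨χ⟩ : Nonempty (WeakDual.characterSpace ℂ A) := inferInstance
  let n' : ℂ → A := fun z => ⟨D.op (M.n z),
    Subalgebra.le_topologicalClosure _ (Algebra.subset_adjoin ⟨z, rfl⟩)⟩
  have hn' : Continuous n' := (M.continuous_op_n hirr).subtype_mk _
  have hadd : ∀ y z, n' (y + z) = n' y * n' z := fun y z => Subtype.ext (by
    ext x
    change D.toHom (M.n (y + z)) x = D.toHom (M.n y) (D.toHom (M.n z) x)
    rw [M.n_add, D.toHom_mul_apply])
  have h0 : n' 0 = 1 := Subtype.ext (by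
    ext x
    change D.toHom (M.n 0) x = x
    rw [M.n_zero, D.toHom_one_apply])
  have hle : ∀ z, ‖χ (n' z)‖ ≤ 1 := fun z => by
    refine (AlgHom.norm_apply_le_self χ (n' z)).trans ?_
    exact ContinuousLinearMap.opNorm_le_bound _ zero_le_one fun x => by
      rw [one_mul]; exact (LinearIsometryEquiv.norm_map _ _).le
  obtain ⟨a, ha⟩ := exists_eq_fourierChar (c := fun z => χ (n' z))
    ((map_continuous χ).comp hn') (fun y z => by rw [hadd, map_mul]) (fun z => by
      refine le_antisymm (hle z) ?_
      have h1 : χ (n' z) * χ (n' (-z)) = 1 := by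
        rw [← map_mul, ← hadd, add_neg_cancel, h0, map_one]
      have h2 : ‖χ (n' z)‖ * ‖χ (n' (-z))‖ = 1 := by rw [← norm_mul, h1, norm_one]
      nlinarith [hle z, hle (-z), norm_nonneg (χ (n' z))])
  have hi : ∀ {φ : Circle → ℂ} (hφ : Continuous φ) (z : ℂ),
      Integrable (fun u : Circle => φ u • n' (u * z)) (probHaar Circle) := fun hφ z =>
    (hφ.smul (hn'.comp (continuous_subtype_val.mul continuous_const))
      ).integrable_of_hasCompactSupport (HasCompactSupport.of_compactSpace _)
  let avgA : (Circle → ℂ) → ℂ → A := fun φ z => ∫ u, φ u • n' (u * z) ∂probHaar Circle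
  have hval : ∀ {φ : Circle → ℂ} (hφ : Continuous φ) (z : ℂ), (avgA φ z).1 = M.avg D hφ z :=
      fun {φ} hφ z => by
    have h1 := (A.toSubmodule.subtypeL).integral_comp_comm (hi hφ z)
    have h2 : (avgA φ z).1 = ∫ u, φ u • D.op (M.n (u * z)) ∂probHaar Circle := h1.symm
    have h3 : Integrable (fun u : Circle => φ u • D.op (M.n (u * z))) (probHaar Circle) :=
      (A.toSubmodule.subtypeL).integrable_comp (hi hφ z)
    ext x
    rw [h2, ContinuousLinearMap.integral_apply h3]
    rfl
  have hχ : ∀ {φ : Circle → ℂ} (hφ : Continuous φ) (z : ℂ), χ (avgA φ z) =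
      ∫ u, φ u * (Real.fourierChar ⟪a, u * z⟫ : ℂ) ∂probHaar Circle := fun {φ} hφ z => by
    have h1 := (WeakDual.CharacterSpace.toCLM χ).integral_comp_comm (hi hφ z)
    refine h1.symm.trans (integral_congr_ae (Filter.Eventually.of_forall fun u => ?_))
    change χ (φ u • n' (u * z)) = _
    rw [map_smul, smul_eq_mul]
    exact congrArg (φ u * ·) (ha _)
  refine ⟨a, fun {φ ψ} hφ hψ z w s hs => ?_⟩
  have h1 : avgA ψ w * avgA φ z = s • 1 := Subtype.ext (by
    ext x
    change (avgA ψ w).1 ((avgA φ z).1 x) = s • x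
    rw [hval hφ, hval hψ, hs])
  rw [← hχ hφ, ← hχ hψ, ← map_mul, h1, map_smul, map_one, smul_eq_mul, mul_one]

end MotionGroup

namespace MotionGroup
open scoped Real RealInnerProductSpace

variable {G : Type*} [Group G] [TopologicalSpace G] (M : MotionGroup G)
  {H : Type*} [NormedAddCommGroup H] [InnerProductSpace ℂ H] [CompleteSpace H]
  {D : UnitaryRep G H}

lemma continuous_planeWave (a z : ℂ) :
    Continuous fun u : Circle => (Real.fourierChar ⟪a, u * z⟫ : ℂ) :=
  continuous_subtype_val.comp (Real.continuous_fourierChar.comp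
    (continuous_const.inner (continuous_subtype_val.mul continuous_const)))

/-- The plane waves with frequencies `z` on a circle of radius `|a|` are total: no weight `u ^ m`
is orthogonal to all of them. -/
lemma exists_integral_planeWave_ne_zero {a : ℂ} (ha : a ≠ 0) (m : ℤ) : ∃ z : ℂ,
    ∫ u : Circle, ((u ^ m : Circle) : ℂ) *
      (Real.fourierChar ⟪a, u * z⟫ : ℂ) ∂probHaar Circle ≠ 0 := by
  by_contra! h
  let W : ℂ → C(Circle, ℂ) := fun z => ⟨_, continuous_planeWave a z⟩
  let S : Submonoid C(Circle, ℂ) :=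
    { carrier := Set.range W
      one_mem' := ⟨0, ContinuousMap.ext fun u => by simp [W]⟩
      mul_mem' := by
        rintro _ _ ⟨y, rfl⟩ ⟨z, rfl⟩
        refine ⟨y + z, ContinuousMap.ext fun u => ?_⟩
        change (Real.fourierChar _ : ℂ) = (Real.fourierChar _ : ℂ) * (Real.fourierChar _ : ℂ)
        rw [mul_add, inner_add_right, AddChar.map_add_eq_mul, Circle.coe_mul] }
  have h1 := eq_zero_of_integral_mul_eq_zero (μ := probHaar Circle) S
    (by
      rintro _ ⟨z, rfl⟩
      refine ⟨-z, ContinuousMap.ext fun u => ?_⟩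
      change (Real.fourierChar _ : ℂ) = conj (Real.fourierChar _ : ℂ)
      rw [mul_neg, inner_neg_right, AddChar.map_neg_eq_inv, Circle.coe_inv_eq_conj])
    (fun u v huv => by
      have huv' : (u : ℂ) - v ≠ 0 := sub_ne_zero.2 fun h => huv (Circle.ext h)
      refine ⟨_, ⟨a / (2 * ‖a‖ ^ 2) / ((u : ℂ) - v), rfl⟩, fun h => ?_⟩
      change (Real.fourierChar _ : ℂ) = (Real.fourierChar _ : ℂ) at h
      set z := a / (2 * ‖a‖ ^ 2) / ((u : ℂ) - v) with hz
      have h2 : ⟪a, u * z⟫ = 1 / 2 + ⟪a, v * z⟫ := by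
        have h3 : (u : ℂ) * z = ((1 / (2 * ‖a‖ ^ 2) : ℝ) : ℂ) * a + v * z := by
          have h4 : ((u : ℂ) - v) * z = a / (2 * ‖a‖ ^ 2) := by rw [hz]; field_simp
          have h5 : ((1 / (2 * ‖a‖ ^ 2) : ℝ) : ℂ) * a = a / (2 * ‖a‖ ^ 2) := by
            push_cast; field_simp
          rw [h5, ← h4]; ring
        rw [h3, inner_add_right, ← Complex.real_smul, real_inner_smul_right,
          real_inner_self_eq_norm_sq]
        have := norm_ne_zero_iff.2 ha
        field_simp
      rw [h2, AddChar.map_add_eq_mul, Circle.coe_mul, mul_eq_right₀ (Circle.coe_ne_zero _),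
        Real.fourierChar_apply] at h
      have h6 : (2 * π * (1 / 2) : ℝ) = π := by ring
      rw [h6, Complex.exp_pi_mul_I] at h
      norm_num at h)
    (continuous_circle_zpow m)
    (by
      rintro _ ⟨z, rfl⟩
      rw [← h z]
      exact integral_congr_ae (Filter.Eventually.of_forall fun u => mul_comm _ _))
  have h2 := congrFun h1 1
  simp at h2

/-- Some weight occurs in every nonzero representation of the rotations. -/
lemma exists_weight_vector [Nontrivial H] : ∃ (m : ℤ) (x : H), x ≠ 0 ∧
    ∀ v, D.toHom (M.r v) x = ((v ^ m : Circle) : ℂ) • x := by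
  obtain ⟨x, hx⟩ := exists_ne (0 : H)
  let w : ℤ → H := fun m => opIntegral D (integrable_circle (continuous_circle_zpow (-m)))
    M.continuous_r x
  have hw : ∀ m v, D.toHom (M.r v) (w m) = ((v ^ m : Circle) : ℂ) • w m := fun m v => by
    simp only [w]
    rw [toHom_opIntegral, opIntegral_apply, ← integral_smul,
      ← integral_mul_left_eq_self (μ := probHaar Circle) (fun u : Circle => ((v ^ m : Circle) : ℂ) •
        ((u ^ (-m) : Circle) : ℂ) • D.toHom (M.r u) x) v]
    refine integral_congr_ae (Filter.Eventually.of_forall fun u => ?_)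
    simp only
    rw [M.r_mul, smul_smul, ← Circle.coe_mul, _root_.mul_zpow, ← mul_assoc, ← _root_.zpow_add,
      add_neg_cancel, zpow_zero, one_mul]
  by_contra! h
  have hw0 : ∀ m, w m = 0 := fun m => by
    by_contra h0
    obtain ⟨v, hv⟩ := h m (w m) h0
    exact hv (hw m v)
  let W : ℤ → C(Circle, ℂ) := fun m => ⟨_, continuous_circle_zpow m⟩
  let S : Submonoid C(Circle, ℂ) :=
    { carrier := Set.range W
      one_mem' := ⟨0, ContinuousMap.ext fun u => by simp [W]⟩
      mul_mem' := by
        rintro _ _ ⟨y, rfl⟩ ⟨z, rfl⟩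
        refine ⟨y + z, ContinuousMap.ext fun u => ?_⟩
        change ((u ^ (y + z) : Circle) : ℂ) = ((u ^ y : Circle) : ℂ) * ((u ^ z : Circle) : ℂ)
        rw [_root_.zpow_add, Circle.coe_mul] }
  have h1 := eq_zero_of_integral_mul_eq_zero (μ := probHaar Circle) S
    (by
      rintro _ ⟨z, rfl⟩
      refine ⟨-z, ContinuousMap.ext fun u => ?_⟩
      change ((u ^ (-z) : Circle) : ℂ) = conj ((u ^ z : Circle) : ℂ)
      rw [_root_.zpow_neg, Circle.coe_inv_eq_conj])
    (fun u v huv => ⟨_, ⟨1, rfl⟩, fun h => huv (Circle.ext (by simpa [W] using h))⟩)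
    (g := fun u => inner ℂ x (D.toHom (M.r u) x))
    (continuous_const.inner ((D.continuous_apply x).comp M.continuous_r))
    (by
      rintro _ ⟨m, rfl⟩
      have h2 : inner ℂ x (w (-m)) = 0 := by rw [hw0, inner_zero_right]
      simp only [w] at h2
      rw [opIntegral_apply, ← integral_inner (D.integrable_smul
        (integrable_circle (continuous_circle_zpow (- -m))) M.continuous_r x)] at h2
      rw [← h2]
      refine integral_congr_ae (Filter.Eventually.of_forall fun u => ?_)
      simp only
      rw [inner_smul_right, neg_neg]
      rfl)
  have h2 := congrFun h1 1
  simp only [M.r_one, D.toHom_one_apply, Pi.zero_apply] at h2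
  exact hx (inner_self_eq_zero.1 h2)

/-- The spherical function of an irreducible representation that is not trivial on the
translations, and a vector that is invariant under the rotations: from a vector of weight `m`, it is
obtained by the shift of the weights. -/
theorem exists_frequency (hirr : D.Irreducible) (hnt : ∃ z x, D.toHom (M.n z) x ≠ x) :
    ∃ a : ℂ, a ≠ 0 ∧ (∃ ξ : H, ξ ≠ 0 ∧ ∀ u, D.toHom (M.r u) ξ = ξ) ∧
      ∀ ξ : H, ‖ξ‖ = 1 → (∀ u, D.toHom (M.r u) ξ = ξ) → ∀ z,
        inner ℂ ξ (D.toHom (M.n z) ξ) =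
          ∫ u : Circle, (Real.fourierChar ⟪a, u * z⟫ : ℂ) ∂probHaar Circle := by
  have := hirr.1
  obtain ⟨a, ha⟩ := M.exists_character hirr
  have hM : ∀ z x, M.avg D (φ := fun _ => 1) continuous_const z x =
      (∫ u : Circle, (Real.fourierChar ⟪a, u * z⟫ : ℂ) ∂probHaar Circle) • x := fun z x => by
    obtain ⟨s, hs⟩ := M.exists_avg_one_eq_smul hirr z
    have h1 := ha (φ := fun _ => 1) (ψ := fun _ => 1) continuous_const continuous_const z 0 s
      fun x => by
        rw [hs, avg_apply]
        simp [M.n_zero]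
    rw [hs, h1]
    simp
  have ha0 : a ≠ 0 := by
    rintro rfl
    obtain ⟨z, x, hzx⟩ := hnt
    have h1 := hM z x
    simp only [inner_zero_left, AddChar.map_zero_eq_one, Circle.coe_one, integral_const,
      probReal_univ, one_smul] at h1
    have hc : Continuous fun u : Circle => D.toHom (M.n (u * z)) x :=
      (D.continuous_apply x).comp (M.continuous_n_circle z)
    have h2 : ∫ u : Circle, ‖D.toHom (M.n (u * z)) x - x‖ ^ 2 ∂probHaar Circle = 0 := by
      have h3 : ∀ u : Circle, ‖D.toHom (M.n (u * z)) x - x‖ ^ 2 =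
          2 * (‖x‖ ^ 2 - RCLike.re (inner ℂ x (D.toHom (M.n (u * z)) x))) := fun u => by
        rw [norm_sub_sq (𝕜 := ℂ), LinearIsometryEquiv.norm_map, inner_re_symm]
        ring
      have hi : Integrable (fun u : Circle => inner ℂ x (D.toHom (M.n (u * z)) x))
          (probHaar Circle) := integrable_circle (continuous_const.inner hc)
      have h4 : ∫ u : Circle, RCLike.re (inner ℂ x (D.toHom (M.n (u * z)) x)) ∂probHaar Circle =
          ‖x‖ ^ 2 := by
        rw [integral_re hi, integral_inner (hc.integrable_of_hasCompactSupport
          (HasCompactSupport.of_compactSpace _)), ← inner_self_eq_norm_sq (𝕜 := ℂ)]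
        congr 2
        refine Eq.trans ?_ h1
        rw [avg_apply]
        simp only [one_smul]
      simp only [h3]
      rw [integral_const_mul, integral_sub (integrable_const _) hi.re, h4]
      simp
    have hc2 : Continuous fun u : Circle => ‖D.toHom (M.n (u * z)) x - x‖ ^ 2 := by fun_prop
    rw [integral_eq_zero_iff_of_nonneg (fun u => by positivity)
      (hc2.integrable_of_hasCompactSupport (HasCompactSupport.of_compactSpace _)),
      Continuous.ae_eq_iff_eq (μ := probHaar Circle) hc2 continuous_zero] at h2
    have h5 := congrFun h2 1
    simp only [Circle.coe_one, one_mul, Pi.zero_apply, pow_eq_zero_iff two_ne_zero, norm_eq_zero,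
      sub_eq_zero] at h5
    exact hzx h5
  refine ⟨a, ha0, ?_, fun ξ hξ hfix z => ?_⟩
  · obtain ⟨m, x, hx, hxm⟩ := M.exists_weight_vector (D := D)
    obtain ⟨z, hz⟩ := exists_integral_planeWave_ne_zero ha0 m
    obtain ⟨s, hs⟩ := M.exists_adjoint_shift_shift_eq_smul hirr (-m) z
    have hc := continuous_circle_zpow (- -m)
    have h1 := ha hc (Complex.continuous_conj.comp hc) z (-z) s fun x => by
      rw [← adjoint_avg]
      exact hs x
    refine ⟨M.shift (-m) z D x, fun h0 => ?_, fun u => ?_⟩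
    · have h2 := hs x
      rw [h0, map_zero, eq_comm, smul_eq_zero] at h2
      rw [h2.resolve_right hx, zero_eq_mul] at h1
      simp only [neg_neg] at h1
      refine h1.elim (fun h3 => hz ?_) hz
      rw [← map_eq_zero (starRingEnd ℂ), ← integral_conj]
      rw [← h3]
      refine integral_congr_ae (Filter.Eventually.of_forall fun u => ?_)
      simp only [Function.comp_apply, map_mul, mul_neg, inner_neg_right]
      rw [AddChar.map_neg_eq_inv, Circle.coe_inv_eq_conj]
    · rw [toHom_r_shift, hxm, map_smul, smul_smul, ← Circle.coe_mul, _root_.zpow_neg,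
        inv_mul_cancel, Circle.coe_one, one_smul]
  · have h1 : ∀ u : Circle, inner ℂ ξ (D.toHom (M.n (u * z)) ξ) = inner ℂ ξ (D.toHom (M.n z) ξ) :=
      fun u => by
        calc inner ℂ ξ (D.toHom (M.n (u * z)) ξ)
            = inner ℂ ξ (D.toHom (M.n (u * z)) (D.toHom (M.r u) ξ)) := by rw [hfix u]
          _ = inner ℂ (D.toHom (M.r u) ξ) (D.toHom (M.r u) (D.toHom (M.n z) ξ)) := by
            rw [← D.toHom_mul_apply, ← M.r_mul_n, D.toHom_mul_apply, hfix u]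
          _ = inner ℂ ξ (D.toHom (M.n z) ξ) := LinearIsometryEquiv.inner_map_map _ _ _
    have hc : Continuous fun u : Circle => D.toHom (M.n (u * z)) ξ :=
      (D.continuous_apply ξ).comp (M.continuous_n_circle z)
    have h2 := congrArg (inner ℂ ξ) (hM z ξ)
    rw [inner_smul_right, inner_self_eq_norm_sq_to_K, hξ, avg_apply] at h2
    simp only [one_smul] at h2
    rw [← integral_inner (hc.integrable_of_hasCompactSupport
      (HasCompactSupport.of_compactSpace _))] at h2
    simp only [h1] at h2
    simpa using h2

end MotionGroup

/-! ### Zero mass in four dimensions: the little group -/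

/-- The transverse coordinates in four dimensions. -/
def transverseTwo : Transverse 2 ℂ where
  hat :=
    { toFun := fun y => ![0, 0, y.re, y.im]
      map_add' := fun y z => by funext i; fin_cases i <;> simp
      map_smul' := fun t y => by funext i; fin_cases i <;> simp }
  coord :=
    { toFun := fun x => ⟨x 2, x 3⟩
      map_add' := fun x z => by apply Complex.ext <;> simp
      map_smul' := fun t x => by apply Complex.ext <;> simp }
  coord_hat := fun y => rfl
  hat_zero_one := fun y => ⟨rfl, rfl⟩
  hat_coord := fun x i h0 h1 => by
    fin_cases i
    exacts [(h0 rfl).elim, (h1 rfl).elim, rfl, rfl]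
  mdot_hat := fun y z => by
    rw [mdot_two, Complex.inner]
    simp
    ring

lemma transverseTwo_hat (y : ℂ) : transverseTwo.hat y = ![0, 0, y.re, y.im] := rfl

section Two
variable {pbar : MassShell 2 0} (hp : (j0Down 2).neg • pbar = pbar)

lemma rot_hat (u : Circle) (y : ℂ) :
    lmat (rot hp u) *ᵥ transverseTwo.hat y = transverseTwo.hat (u * y) := by
  rw [rot_mulVec, transverseTwo_hat, transverseTwo_hat]
  funext i
  fin_cases i <;> simp; ring

lemma rot_mul_nullRot (u : Circle) (y : ℂ) :
    rot hp u * nullRot transverseTwo hp y = nullRot transverseTwo hp (u * y) * rot hp u := by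
  refine lmat_injective_mulVec fun x => ?_
  rw [lmat_mul, lmat_mul, ← mulVec_mulVec, ← mulVec_mulVec, nullRot_mulVec, nullRot_mulVec,
    nullLin_apply, nullLin_apply, mulVec_add, mulVec_add, mulVec_smul, mulVec_smul, rot_hat,
    lmat_mulVec_base, ← rot_hat hp, mdot_lmat, norm_mul, Circle.norm_coe, one_mul]
  have h : mdot pbar.1 (lmat (rot hp u) *ᵥ x) = mdot pbar.1 x := by
    conv_lhs => rw [← lmat_mulVec_base (rot hp u)]
    rw [mdot_lmat]
  rw [h]

/-- The little group of a lightlike vector in four dimensions is the Euclidean motion group. -/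
def motionGroup : MotionGroup (LittleGroup pbar) where
  n := nullRot transverseTwo hp
  r := rot hp
  continuous_n := continuous_nullRot transverseTwo hp
  continuous_r := continuous_rot hp
  n_add := nullRot_add transverseTwo hp
  r_mul := rot_mul hp
  r_mul_n := rot_mul_nullRot hp
  exists_eq g := by
    set y := transverseTwo.coord (lmat g *ᵥ origin pbar) with hy
    have h1 : lmat ((nullRot transverseTwo hp y)⁻¹ * g) *ᵥ origin pbar = origin pbar := by
      rw [lmat_mul, ← mulVec_mulVec]
      have h2 : lmat (nullRot transverseTwo hp y) *ᵥ origin pbar = lmat g *ᵥ origin pbar := by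
        rw [← paraboloid_eq transverseTwo hp]
        exact paraboloid_coord transverseTwo hp (lmat_mulVec_mem_cycle g (origin_mem_cycle pbar))
      rw [← h2, lmat_inv_mulVec_mulVec]
    obtain ⟨u, hu⟩ := exists_eq_rot hp h1
    exact ⟨y, u, by rw [← hu, mul_inv_cancel_left]⟩

/-- The boost with rapidity `η` in the plane spanned by the lightlike vectors `pbar` and
`origin pbar`. -/
def boostLin (pbar : MassShell 2 0) (η : ℝ) : Mink 2 →ₗ[ℝ] Mink 2 where
  toFun x := x + ((Real.exp η - 1) * mdot (origin pbar) x) • pbar.1 +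
    ((Real.exp (-η) - 1) * mdot pbar.1 x) • origin pbar
  map_add' x z := by
    simp only [mdot_add_right]
    module
  map_smul' t x := by
    simp only [mdot_smul, RingHom.id_apply]
    module

lemma boostLin_apply (η : ℝ) (x : Mink 2) : boostLin pbar η x =
    x + ((Real.exp η - 1) * mdot (origin pbar) x) • pbar.1 +
    ((Real.exp (-η) - 1) * mdot pbar.1 x) • origin pbar := rfl

lemma mdot_origin_self : mdot (origin pbar) (origin pbar) = 0 := (origin_mem_cycle pbar).1

lemma mdot_base_origin : mdot pbar.1 (origin pbar) = 1 := (origin_mem_cycle pbar).2.2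

lemma mdot_boostLin (η : ℝ) (x z : Mink 2) :
    mdot (boostLin pbar η x) (boostLin pbar η z) = mdot x z := by
  have h : Real.exp η * Real.exp (-η) = 1 := by rw [← Real.exp_add, add_neg_cancel, Real.exp_zero]
  simp only [boostLin_apply, mdot_add_right, mdot_add_left, mdot_smul, mdot_smul_left,
    mdot_base_self, mdot_origin_self, mdot_base_origin, mdot_comm (origin pbar) pbar.1,
    mdot_comm x pbar.1, mdot_comm x (origin pbar)]
  linear_combination (mdot (origin pbar) x * mdot pbar.1 z +
    mdot (origin pbar) z * mdot pbar.1 x) * h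

lemma boostLin_boostLin (η θ : ℝ) (x : Mink 2) :
    boostLin pbar η (boostLin pbar θ x) = boostLin pbar (η + θ) x := by
  simp only [boostLin_apply, mdot_add_right, mdot_smul,
    mdot_base_self, mdot_origin_self, mdot_base_origin, mdot_comm (origin pbar) pbar.1,
    neg_add, Real.exp_add]
  module

lemma boostLin_zero (x : Mink 2) : boostLin pbar 0 x = x := by
  simp [boostLin_apply]

lemma boostLin_base (η : ℝ) : boostLin pbar η pbar.1 = Real.exp η • pbar.1 := by
  rw [boostLin_apply, mdot_base_self, mdot_comm, mdot_base_origin]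
  module

/-- Conjugation by a boost, an automorphism of the little group. -/
def boostConjFun (η : ℝ) (g : LittleGroup pbar) : LittleGroup pbar :=
  LittleGroup.ofMat (LinearMap.toMatrix' (boostLin pbar η) * lmat g *
      LinearMap.toMatrix' (boostLin pbar (-η)))
    (fun x z => by
      simp only [← mulVec_mulVec, LinearMap.toMatrix'_mulVec, mdot_boostLin, mdot_lmat])
    (by
      rw [det_mul, det_mul, det_lmat, mul_one, ← det_mul, ← LinearMap.toMatrix'_comp]
      have : boostLin pbar η ∘ₗ boostLin pbar (-η) = LinearMap.id := LinearMap.ext fun x => by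
        rw [LinearMap.comp_apply, boostLin_boostLin, add_neg_cancel, boostLin_zero,
          LinearMap.id_apply]
      rw [this, LinearMap.toMatrix'_id, det_one])
    (by
      simp only [← mulVec_mulVec, LinearMap.toMatrix'_mulVec, boostLin_base, mulVec_smul,
        lmat_mulVec_base, smul_smul]
      rw [← Real.exp_add, neg_add_cancel, Real.exp_zero, one_smul])

lemma boostConjFun_mulVec (η : ℝ) (g : LittleGroup pbar) (x : Mink 2) :
    lmat (boostConjFun η g) *ᵥ x = boostLin pbar η (lmat g *ᵥ boostLin pbar (-η) x) := by
  change (LinearMap.toMatrix' (boostLin pbar η) * lmat g *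
      LinearMap.toMatrix' (boostLin pbar (-η))) *ᵥ x = _
  simp only [← mulVec_mulVec, LinearMap.toMatrix'_mulVec]

/-- Conjugation by a boost as a homomorphism. -/
def boostConj (pbar : MassShell 2 0) (η : ℝ) : LittleGroup pbar →* LittleGroup pbar where
  toFun := boostConjFun η
  map_one' := lmat_injective_mulVec fun x => by
    rw [boostConjFun_mulVec, lmat_one, one_mulVec, one_mulVec, boostLin_boostLin, add_neg_cancel,
      boostLin_zero]
  map_mul' g h := lmat_injective_mulVec fun x => by
    rw [boostConjFun_mulVec, lmat_mul, lmat_mul, ← mulVec_mulVec, ← mulVec_mulVec,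
      boostConjFun_mulVec, boostConjFun_mulVec, boostLin_boostLin, neg_add_cancel, boostLin_zero]

lemma boostConj_mulVec (η : ℝ) (g : LittleGroup pbar) (x : Mink 2) :
    lmat (boostConj pbar η g) *ᵥ x = boostLin pbar η (lmat g *ᵥ boostLin pbar (-η) x) :=
  boostConjFun_mulVec η g x

lemma boostConj_boostConj_neg (η : ℝ) (g : LittleGroup pbar) :
    boostConj pbar η (boostConj pbar (-η) g) = g := lmat_injective_mulVec fun x => by
  rw [boostConj_mulVec, boostConj_mulVec, boostLin_boostLin, boostLin_boostLin, neg_neg,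
    add_neg_cancel, boostLin_zero, boostLin_zero]

lemma boostConj_zero (g : LittleGroup pbar) : boostConj pbar 0 g = g :=
  lmat_injective_mulVec fun x => by
    rw [boostConj_mulVec, neg_zero, boostLin_zero, boostLin_zero]

lemma continuous_uncurry_boostConj :
    Continuous fun x : ℝ × LittleGroup pbar => boostConj pbar x.1 x.2 := by
  refine isInducing_lmat.continuous_iff.2 ?_
  have h1 : Continuous fun η : ℝ => LinearMap.toMatrix' (boostLin pbar η) := by
    refine continuous_pi fun i => continuous_pi fun j => ?_
    simp only [LinearMap.toMatrix'_apply, boostLin_apply, Pi.add_apply, Pi.smul_apply, smul_eq_mul]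
    fun_prop
  exact ((h1.comp continuous_fst).matrix_mul
    ((isInducing_lmat (pbar := pbar)).continuous.comp continuous_snd)).matrix_mul
      (h1.comp continuous_fst.neg)

lemma mdot_base_boostLin (η : ℝ) (x : Mink 2) :
    mdot pbar.1 (boostLin pbar η x) = Real.exp (-η) * mdot pbar.1 x := by
  rw [boostLin_apply, mdot_add_right, mdot_add_right, mdot_smul, mdot_smul, mdot_base_self,
    mdot_base_origin]
  ring

lemma mdot_hat_boostLin (hp : (j0Down 2).neg • pbar = pbar) (η : ℝ) (y : ℂ) (x : Mink 2) :
    mdot (transverseTwo.hat y) (boostLin pbar η x) = mdot (transverseTwo.hat y) x := by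
  rw [boostLin_apply, mdot_add_right, mdot_add_right, mdot_smul, mdot_smul, mdot_comm _ pbar.1,
    mdot_base_hat transverseTwo hp, mdot_comm _ (origin pbar), mdot_origin_hat]
  ring

lemma boostLin_hat (hp : (j0Down 2).neg • pbar = pbar) (η : ℝ) (y : ℂ) :
    boostLin pbar η (transverseTwo.hat y) = transverseTwo.hat y := by
  rw [boostLin_apply, mdot_base_hat transverseTwo hp, mdot_origin_hat]
  simp

/-- Boosts dilate the null rotations. -/
lemma boostConj_nullRot (η : ℝ) (y : ℂ) : boostConj pbar η (nullRot transverseTwo hp y) =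
    nullRot transverseTwo hp (Real.exp η • y) := lmat_injective_mulVec fun x => by
  have h : Real.exp η * Real.exp (-η) = 1 := by rw [← Real.exp_add, add_neg_cancel, Real.exp_zero]
  obtain ⟨z, rfl⟩ : ∃ z, x = boostLin pbar η z :=
    ⟨boostLin pbar (-η) x, by rw [boostLin_boostLin, add_neg_cancel, boostLin_zero]⟩
  rw [boostConj_mulVec, boostLin_boostLin, neg_add_cancel, boostLin_zero, nullRot_mulVec,
    nullRot_mulVec, nullLin_apply, nullLin_apply, map_add, map_add, map_smul, map_smul,
    boostLin_base, boostLin_hat hp, mdot_base_boostLin, map_smul, mdot_smul_left,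
    mdot_hat_boostLin hp, norm_smul, Real.norm_of_nonneg (Real.exp_pos η).le, smul_smul, smul_smul]
  congr 2
  · congr 1
    linear_combination -mdot pbar.1 z * h
  · linear_combination -(‖y‖ ^ 2 / 2 * mdot pbar.1 z * Real.exp η) * h

lemma boostConj_rot (η : ℝ) (u : Circle) : boostConj pbar η (rot hp u) = rot hp u := by
  refine lmat_injective_mulVec fun x => ?_
  obtain ⟨z, rfl⟩ : ∃ z, x = boostLin pbar η z :=
    ⟨boostLin pbar (-η) x, by rw [boostLin_boostLin, add_neg_cancel, boostLin_zero]⟩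
  have h1 : mdot pbar.1 (lmat (rot hp u) *ᵥ z) = mdot pbar.1 z := by
    conv_lhs => rw [← lmat_mulVec_base (rot hp u)]
    rw [mdot_lmat]
  have h2 : mdot (origin pbar) (lmat (rot hp u) *ᵥ z) = mdot (origin pbar) z := by
    conv_lhs => rw [← rot_mulVec_origin hp u]
    rw [mdot_lmat]
  rw [boostConj_mulVec, boostLin_boostLin, neg_add_cancel, boostLin_zero, boostLin_apply,
    boostLin_apply, mulVec_add, mulVec_add, mulVec_smul, mulVec_smul, lmat_mulVec_base,
    rot_mulVec_origin, h1, h2]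

variable {H : Type*} [NormedAddCommGroup H] [InnerProductSpace ℂ H]

lemma continuous_boostConj (η : ℝ) : Continuous (boostConj pbar η) :=
  Continuous.comp (g := fun x : ℝ × LittleGroup pbar => boostConj pbar x.1 x.2)
    (f := fun g => (η, g)) continuous_uncurry_boostConj (Continuous.prodMk_right η)

lemma continuous_boostConj_left (g : LittleGroup pbar) : Continuous fun η => boostConj pbar η g :=
  Continuous.comp (g := fun x : ℝ × LittleGroup pbar => boostConj pbar x.1 x.2)
    (f := fun η => (η, g)) continuous_uncurry_boostConj (Continuous.prodMk_left g)

/-- The representation obtained by precomposition with the conjugation by a boost. -/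
def boostRep (D : UnitaryRep (LittleGroup pbar) H) (η : ℝ) : UnitaryRep (LittleGroup pbar) H where
  toHom := D.toHom.comp (boostConj pbar η)
  continuous_apply x :=
    Continuous.comp (g := fun g => D.toHom g x) (D.continuous_apply x) (continuous_boostConj η)

lemma boostRep_apply (D : UnitaryRep (LittleGroup pbar) H) (η : ℝ) (g : LittleGroup pbar) (x : H) :
    (boostRep D η).toHom g x = D.toHom (boostConj pbar η g) x := rfl

lemma boostRep_zero (D : UnitaryRep (LittleGroup pbar) H) : boostRep D 0 = D :=
  UnitaryRep.toHom_ext fun g x => by rw [boostRep_apply, boostConj_zero]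

variable {D : UnitaryRep (LittleGroup pbar) H}

lemma irreducible_boostRep (hirr : D.Irreducible) (η : ℝ) : (boostRep D η).Irreducible :=
  ⟨hirr.1, fun K hK hinv => hirr.2 K hK fun g x hx => by
    have := hinv (boostConj pbar (-η) g) x hx
    rwa [boostRep_apply, boostConj_boostConj_neg] at this⟩

lemma fixedVector_iff {D : UnitaryRep (LittleGroup pbar) H} {ξ : H} :
    FixedVector D ξ ↔ ∀ u, D.toHom (rot hp u) ξ = ξ := by
  refine ⟨fun h u => h _ (rot_mulVec_origin hp u), fun h k hk => ?_⟩
  obtain ⟨u, rfl⟩ := exists_eq_rot hp hk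
  exact h u

lemma FixedVector.boostRep (hp : (j0Down 2).neg • pbar = pbar) {ξ : H} (hK : FixedVector D ξ)
    (η : ℝ) : FixedVector (boostRep D η) ξ := by
  rw [fixedVector_iff hp] at hK ⊢
  intro u
  rw [boostRep_apply, boostConj_rot, hK]

lemma nullRot_ne_trivial (hfaithful : D.Faithful) :
    ∃ z x, D.toHom ((motionGroup hp).n z) x ≠ x := by
  by_contra! h
  have h1 : nullRot transverseTwo hp 1 = 1 := hfaithful (LinearIsometryEquiv.ext fun x => by
    rw [D.toHom_one_apply]; exact h 1 x)
  have h2 := coord_paraboloid transverseTwo hp 1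
  rw [paraboloid_eq transverseTwo hp, h1, lmat_one, one_mulVec,
    coord_eq_zero transverseTwo fun i => origin_apply i] at h2
  exact zero_ne_one h2

/-- Integration over the plane in polar coordinates. -/
lemma lintegral_polar (b : Circle) {F : ℂ → ℝ≥0∞} (hF : Measurable F) :
    ∫⁻ v, F v = ∫⁻ k in Set.Ioi (0 : ℝ), ENNReal.ofReal (2 * Real.pi * k) *
      ∫⁻ u : Circle, F (k • ((u⁻¹ * b : Circle) : ℂ)) ∂probHaar Circle := by
  have hec : Continuous fun u : Circle => ((u⁻¹ * b : Circle) : ℂ) :=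
    continuous_subtype_val.comp (by fun_prop)
  have h1 : ∀ u : Circle, ∫⁻ v, F (((u⁻¹ * b : Circle) : ℂ) * v) = ∫⁻ v, F v := fun u =>
    (rotation (u⁻¹ * b)).measurePreserving.lintegral_comp hF
  calc ∫⁻ v, F v = ∫⁻ u : Circle, ∫⁻ v, F (((u⁻¹ * b : Circle) : ℂ) * v) ∂volume
          ∂probHaar Circle := by
        simp only [h1]
        rw [lintegral_const, measure_univ, mul_one]
    _ = ∫⁻ v, ∫⁻ u : Circle, F (((u⁻¹ * b : Circle) : ℂ) * v) ∂probHaar Circle := by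
        rw [lintegral_lintegral_swap]
        exact (hF.comp ((hec.comp continuous_fst).mul continuous_snd).measurable).aemeasurable
    _ = _ := by
        rw [← Complex.lintegral_comp_polarCoord_symm]
        have h2 : ∀ p ∈ polarCoord.target, ENNReal.ofReal p.1 •
            ∫⁻ u : Circle, F (((u⁻¹ * b : Circle) : ℂ) * Complex.polarCoord.symm p)
              ∂probHaar Circle =
            ENNReal.ofReal p.1 *
              ∫⁻ u : Circle, F (p.1 • ((u⁻¹ * b : Circle) : ℂ)) ∂probHaar Circle := fun p hp => by
          rw [smul_eq_mul]
          congr 1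
          rw [← lintegral_mul_left_eq_self (μ := probHaar Circle) _ (Circle.exp p.2)]
          refine lintegral_congr fun u => ?_
          congr 1
          have h3 : Complex.polarCoord.symm p = p.1 * ((Circle.exp p.2 : Circle) : ℂ) := by
            rw [Complex.polarCoord_symm_apply, Circle.coe_exp, Complex.exp_mul_I]
            push_cast
            rfl
          have h4 : ((Circle.exp p.2 : Circle) : ℂ) ≠ 0 := Circle.coe_ne_zero _
          have h5 : (u : ℂ) ≠ 0 := Circle.coe_ne_zero _
          rw [h3, Complex.real_smul]
          simp only [Circle.coe_mul, Circle.coe_inv]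
          field_simp
        have hm : Measurable fun k : ℝ => ENNReal.ofReal k *
            ∫⁻ u : Circle, F (k • ((u⁻¹ * b : Circle) : ℂ)) ∂probHaar Circle := by
          refine ENNReal.measurable_ofReal.mul ?_
          refine Measurable.lintegral_prod_right'
            (f := fun p : ℝ × Circle => F (p.1 • ((p.2⁻¹ * b : Circle) : ℂ))) ?_
          exact hF.comp (continuous_fst.smul (hec.comp continuous_snd)).measurable
        rw [setLIntegral_congr_fun polarCoord.open_target.measurableSet h2, polarCoord_target,
          Measure.volume_eq_prod, ← Measure.prod_restrict,
          lintegral_prod _ (show AEMeasurable (fun p : ℝ × ℝ => ENNReal.ofReal p.1 *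
            ∫⁻ u : Circle, F (p.1 • ((u⁻¹ * b : Circle) : ℂ)) ∂probHaar Circle) _ from
            (hm.comp measurable_fst).aemeasurable)]
        refine setLIntegral_congr_fun measurableSet_Ioi fun k hk => ?_
        simp only
        rw [lintegral_const, Measure.restrict_apply_univ, Real.volume_Ioo, mul_right_comm,
          ← ENNReal.ofReal_mul (le_of_lt hk)]
        congr 2
        ring

/-- Radial functions built from test functions on the half-line are test functions. -/
lemma contDiff_comp_norm {h : ℝ → ℝ} (hh : ContDiff ℝ ((⊤ : ℕ∞) : WithTop ℕ∞) h)
    (hs : tsupport h ⊆ Set.Ioi 0) :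
    ContDiff ℝ ((⊤ : ℕ∞) : WithTop ℕ∞) fun v : ℂ => (h ‖v‖ : ℂ) := by
  refine Complex.ofRealCLM.contDiff.comp (contDiff_iff_contDiffAt.2 fun v => ?_)
  by_cases hv : v = 0
  · have h0 : (0 : ℝ) ∉ tsupport h := fun h0 => lt_irrefl (0 : ℝ) (hs h0)
    have h1 : ∀ᶠ t in nhds (0 : ℝ), h t = 0 := by
      filter_upwards [(isClosed_tsupport h).isOpen_compl.mem_nhds h0] with t ht
      exact image_eq_zero_of_notMem_tsupport ht
    have h2 : (fun v : ℂ => h ‖v‖) =ᶠ[nhds v] fun _ => 0 := by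
      have h3 : Filter.Tendsto (fun v : ℂ => ‖v‖) (nhds v) (nhds 0) := by
        have := (continuous_norm (E := ℂ)).tendsto v
        rw [hv, norm_zero] at this
        rwa [hv]
      exact h3.eventually h1
    exact contDiffAt_const.congr_of_eventuallyEq h2
  · exact hh.contDiffAt.comp v (contDiffAt_norm ℝ hv)

lemma hasCompactSupport_comp_norm {h : ℝ → ℝ} (hc : HasCompactSupport h) :
    HasCompactSupport fun v : ℂ => (h ‖v‖ : ℂ) := by
  obtain ⟨R, hR⟩ := hc.isCompact.isBounded.subset_closedBall 0
  refine HasCompactSupport.of_support_subset_isCompact (isCompact_closedBall (0 : ℂ) R)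
    fun v hv => ?_
  have h1 : h ‖v‖ ≠ 0 := fun h0 => hv (by simp [h0])
  have h2 := hR (subset_tsupport h h1)
  rw [mem_closedBall_zero_iff] at h2 ⊢
  rwa [norm_norm] at h2

open scoped Real RealInnerProductSpace SchwartzMap in
/-- In four dimensions, the representations of the Euclidean motion group that are nontrivial on the
translations contain a rotation invariant vector, and the principal series decomposes into the
representations obtained by dilations. -/
theorem exists_isDirectIntegralFibre_two [CompleteSpace H] (hirr : D.Irreducible)
    (hfaithful : D.Faithful) : (∃ ξ : H, ξ ≠ 0 ∧ FixedVector D ξ) ∧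
      ∀ ξ : H, ‖ξ‖ = 1 → FixedVector D ξ →
        ∃ c : ℂ, c ≠ 0 ∧ IsDirectIntegralFibre D (orbitT hp D (c • ξ)) := by
  obtain ⟨a, ha, ⟨ξ0, hξ0, hfix0⟩, hG⟩ :=
    (motionGroup hp).exists_frequency hirr (nullRot_ne_trivial hp hfaithful)
  refine ⟨⟨ξ0, hξ0, (fixedVector_iff hp).2 hfix0⟩, fun ξ hξ hK => ?_⟩
  have hG' := hG ξ hξ ((fixedVector_iff hp).1 hK)
  change ∀ z, inner ℂ ξ (D.toHom (nullRot transverseTwo hp z) ξ) = _ at hG'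
  have hξ0 : ξ ≠ 0 := norm_ne_zero_iff.1 (by rw [hξ]; exact one_ne_zero)
  have hκ : 0 < ‖a‖ := norm_pos_iff.2 ha
  obtain ⟨b, hb⟩ : ∃ b : Circle, (b : ℂ) = -a / ‖a‖ :=
    ⟨⟨-a / ‖a‖, by
      simp [Submonoid.unitSphere, hκ.ne']⟩, rfl⟩
  have hL : labels 2 = Set.Ioi 0 := if_neg (by norm_num)
  obtain ⟨S, hS⟩ := exists_sphericalField transverseTwo hp (P := probHaar Circle)
    (e := fun u : Circle => ((u⁻¹ * b : Circle) : ℂ))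
    (continuous_subtype_val.comp (by fun_prop)).measurable
    (E := fun k => boostRep D (Real.log k - Real.log ‖a‖)) hξ0
    (fun k _ => irreducible_boostRep hirr _)
    (fun g x => by
      rw [hL]
      refine Continuous.comp_continuousOn (g := fun η => D.toHom (boostConj pbar η g) x)
        (f := fun k => Real.log k - Real.log ‖a‖)
        (Continuous.comp (g := fun g => D.toHom g x) (D.continuous_apply x)
          (continuous_boostConj_left g)) ?_
      exact (Real.continuousOn_log.mono fun k hk => (ne_of_gt hk)).sub continuousOn_const)
    (fun k _ => hK.boostRep hp _)
    (fun k hk y z => by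
      rw [hL] at hk
      have hexp : Real.exp (Real.log k - Real.log ‖a‖) = k / ‖a‖ := by
        rw [Real.exp_sub, Real.exp_log hk, Real.exp_log hκ]
      rw [UnitaryRep.inner_toHom_toHom, ← nullRot_neg, ← nullRot_add, boostRep_apply,
        boostConj_nullRot, hexp, hG']
      refine integral_congr_ae (Filter.Eventually.of_forall fun u => ?_)
      have h2 : ⟪a, (u : ℂ) * ((k / ‖a‖) • (-y + z))⟫ =
          ⟪y - z, k • ((u⁻¹ * b : Circle) : ℂ)⟫ := by
        rw [Complex.inner, Complex.inner, Circle.coe_mul, hb, Circle.coe_inv_eq_conj,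
          ← Complex.conj_re]
        congr 1
        simp only [map_mul, map_sub, map_add, map_neg, map_div₀, Complex.real_smul,
          Complex.conj_conj, Complex.conj_ofReal, Complex.ofReal_div]
        ring
      simp only [h2])
    (w := fun k => Real.sqrt (2 * π * k))
    (by fun_prop)
    (fun k hk => by
      rw [hL] at hk
      exact (Real.sqrt_pos.2 (mul_pos Real.two_pi_pos hk)).ne')
    (fun F hF => by
      rw [hL, lintegral_polar b hF]
      refine setLIntegral_congr_fun measurableSet_Ioi fun k hk => ?_
      rw [Real.sq_sqrt (mul_pos Real.two_pi_pos hk).le])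
    (fun h hh hhc hs => by
      rw [hL] at hs
      refine ⟨(hasCompactSupport_comp_norm hhc).toSchwartzMap (contDiff_comp_norm hh hs),
        fun k hk u => ?_⟩
      rw [hL] at hk
      change ((h ‖k • ((u⁻¹ * b : Circle) : ℂ)‖ : ℝ) : ℂ) = h k
      rw [norm_smul, Circle.norm_coe, mul_one, Real.norm_of_nonneg (le_of_lt hk)])
  have hmem : ‖a‖ ∈ labels 2 := by rw [hL]; exact hκ
  have h1 := S.isDirectIntegralFibre hmem
  have hE : S.E ‖a‖ = D := by rw [hS]; simp only [sub_self, boostRep_zero]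
  rw [hE] at h1
  exact ⟨_, S.ω_ne_zero _ hmem, h1⟩

end Two

/-! ### Vectors invariant under the rotations about an axis -/

section Polarization

variable {R : Type*} [NormedCommRing R] [NormedAlgebra ℝ R] {H : Type*} [NormedAddCommGroup H]
  [NormedSpace ℝ H]

/-- Polarization: if all determinants `ℓ(a, b) ℓ(a', b') - ℓ(a', b) ℓ(a, b')` are values of `ℓ`, and
`Λ` vanishes on all products of fewer than `N` values of `ℓ`, then on products of `N` values it is
symmetric in the first arguments, and thus determined by its values at equal first arguments. -/
theorem eq_zero_of_diagonal (Λ : R →L[ℝ] H) (ℓ : (Fin 3 → ℝ) → (Fin 3 → ℝ) → R)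
    (hadd : ∀ a a' b (t : ℝ), ℓ (a + t • a') b = ℓ a b + t • ℓ a' b)
    (hswap : ∀ a a' b b', ℓ a b * ℓ a' b' - ℓ a' b * ℓ a b' = ℓ (a ⨯₃ a') (b ⨯₃ b')) {N : ℕ}
    (hmin : ∀ L : Multiset ((Fin 3 → ℝ) × (Fin 3 → ℝ)), L.card < N →
      Λ (L.map fun p => ℓ p.1 p.2).prod = 0)
    (hdiag : ∀ a (b : Fin N → Fin 3 → ℝ), Λ (∏ i, ℓ a (b i)) = 0) (c b : Fin N → Fin 3 → ℝ) :
    Λ (∏ i, ℓ (c i) (b i)) = 0 := by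
  suffices h : ∀ s : Finset (Fin N), ∀ a, Λ ((∏ i ∈ sᶜ, ℓ a (b i)) * ∏ i ∈ s, ℓ (c i) (b i)) = 0 by
    simpa using h Finset.univ 0
  intro s
  induction s using Finset.induction_on with
  | empty => intro a; simpa using hdiag a b
  | insert j s hj ih =>
    intro a
    have hjs : j ∈ sᶜ := Finset.mem_compl.2 hj
    set Q := ∏ i ∈ s, ℓ (c i) (b i) with hQ
    set t : Fin N → R := fun k => (∏ i ∈ sᶜ.erase k, ℓ a (b i)) * ℓ (c j) (b k) * Q with ht
    -- The derivative at `0` of the vanishing function `r ↦ Λ (∏ ℓ(a + r c_j, b_i) Q)`.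
    have h1 : ∑ k ∈ sᶜ, Λ (t k) = 0 := by
      have hd : HasDerivAt (fun r : ℝ => ∏ i ∈ sᶜ, ℓ (a + r • c j) (b i))
          (∑ k ∈ sᶜ, (∏ i ∈ sᶜ.erase k, ℓ (a + (0 : ℝ) • c j) (b i)) • ℓ (c j) (b k)) 0 := by
        refine HasDerivAt.fun_finsetProd fun i _ => ?_
        simp only [hadd]
        have h2 := ((hasDerivAt_id (0 : ℝ)).smul_const (ℓ (c j) (b i))).const_add (ℓ a (b i))
        simpa using h2
      have h3 := (Λ.hasFDerivAt (x := (∏ i ∈ sᶜ, ℓ (a + (0 : ℝ) • c j) (b i)) * Q)).comp_hasDerivAt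
        (0 : ℝ) (hd.mul_const Q)
      have h4 : HasDerivAt (fun _ : ℝ => (0 : H)) (Λ ((∑ k ∈ sᶜ, (∏ i ∈ sᶜ.erase k,
          ℓ (a + (0 : ℝ) • c j) (b i)) • ℓ (c j) (b k)) * Q)) 0 :=
        h3.congr_of_eventuallyEq (Filter.Eventually.of_forall fun r => (ih (a + r • c j)).symm)
      have h5 := h4.unique (hasDerivAt_const 0 0)
      rw [Finset.sum_mul, map_sum] at h5
      simpa [ht] using h5
    -- All terms of the derivative agree, because `Λ` vanishes on products of `N - 1` factors.
    have h2 : ∀ k ∈ sᶜ, Λ (t k) = Λ (t j) := fun k hk => by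
      by_cases hkj : k = j
      · rw [hkj]
      rw [← sub_eq_zero, ← map_sub]
      have hk' : k ∈ sᶜ.erase j := Finset.mem_erase.2 ⟨hkj, hk⟩
      have hj' : j ∈ sᶜ.erase k := Finset.mem_erase.2 ⟨fun h => hkj h.symm, hjs⟩
      have h3 : t k - t j = ℓ (c j ⨯₃ a) (b k ⨯₃ b j) *
          (∏ i ∈ (sᶜ.erase k).erase j, ℓ a (b i)) * Q := by
        simp only [ht]
        rw [← Finset.mul_prod_erase _ _ hk', ← Finset.mul_prod_erase _ _ hj', ← hswap,
          Finset.erase_right_comm]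
        ring
      have h4 := hmin ((c j ⨯₃ a, b k ⨯₃ b j) ::ₘ
        (((sᶜ.erase k).erase j).val.map (fun i => (a, b i)) + s.val.map fun i => (c i, b i))) (by
          have e1 : (((sᶜ.erase k).erase j).card + 1 + 1) + s.card = N := by
            rw [Finset.card_erase_add_one hj', Finset.card_erase_add_one hk,
              Finset.card_compl_add_card,
              Fintype.card_fin]
          simp only [Multiset.card_cons, Multiset.card_add, Multiset.card_map, Finset.card_val]
          omega)
      simp only [Multiset.map_cons, Multiset.map_add, Multiset.map_map, Multiset.prod_cons,
        Multiset.prod_add, Function.comp_def] at h4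
      rw [h3, mul_assoc]
      exact h4
    rw [Finset.sum_congr rfl h2, Finset.sum_const, ← Nat.cast_smul_eq_nsmul ℝ, smul_eq_zero] at h1
    have h3 := h1.resolve_left (Nat.cast_ne_zero.2 (Finset.card_ne_zero_of_mem hjs))
    rw [Finset.compl_insert, Finset.prod_insert hj, ← h3]
    congr 1
    simp only [ht]
    ring

end Polarization

section Rotations

/-- Rotations preserve the vector product. -/
lemma mulVec_cross {A : Matrix (Fin 3) (Fin 3) ℝ} (hA : ∀ a b, (A *ᵥ a) ⬝ᵥ (A *ᵥ b) = a ⬝ᵥ b)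
    (hdet : A.det = 1) (b c : Fin 3 → ℝ) : (A *ᵥ b) ⨯₃ (A *ᵥ c) = A *ᵥ (b ⨯₃ c) := by
  have hu : IsUnit A := (Matrix.isUnit_iff_isUnit_det A).2 (by rw [hdet]; exact isUnit_one)
  have h1 : ∀ a, (A *ᵥ a) ⬝ᵥ ((A *ᵥ b) ⨯₃ (A *ᵥ c)) = (A *ᵥ a) ⬝ᵥ (A *ᵥ (b ⨯₃ c)) := fun a => by
    have h2 : (![A *ᵥ a, A *ᵥ b, A *ᵥ c] : Fin 3 → Fin 3 → ℝ) = of ![a, b, c] * Aᵀ := by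
      funext i j
      fin_cases i <;> simp [Matrix.mul_apply, mulVec, dotProduct, mul_comm]
    rw [hA, triple_product_eq_det, triple_product_eq_det, h2, det_mul, det_transpose, hdet, mul_one]
    rfl
  refine dotProduct_eq _ _ fun d => ?_
  obtain ⟨a, rfl⟩ := (Matrix.mulVec_surjective_iff_isUnit.2 hu) d
  rw [dotProduct_comm, h1, dotProduct_comm]

variable {G : Type*} [Group G] [TopologicalSpace G] [IsTopologicalGroup G] [CompactSpace G]
  [MeasurableSpace G] [BorelSpace G] [SecondCountableTopology G]
  {H : Type*} [NormedAddCommGroup H] [InnerProductSpace ℂ H] [CompleteSpace H]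

/-- The operator `f ↦ ∫ f(g) D(g) x dg` on the continuous functions of a compact group. -/
def orbitAverage (D : UnitaryRep G H) (x : H) : C(G, ℝ) →L[ℝ] H :=
  LinearMap.mkContinuous
    { toFun := fun f => ∫ g, f g • D.toHom g x ∂probHaar G
      map_add' := fun f f' => by
        simp only [ContinuousMap.add_apply, add_smul]
        exact integral_add
          ((f.continuous.smul (D.continuous_apply x)).integrable_of_hasCompactSupport
            (HasCompactSupport.of_compactSpace _))
          ((f'.continuous.smul (D.continuous_apply x)).integrable_of_hasCompactSupport
            (HasCompactSupport.of_compactSpace _))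
      map_smul' := fun c f => by
        simp only [ContinuousMap.smul_apply, smul_assoc, RingHom.id_apply]
        exact integral_smul _ _ }
    ‖x‖ fun f => by
      refine (norm_integral_le_of_norm_le_const (C := ‖x‖ * ‖f‖)
        (Filter.Eventually.of_forall fun g => ?_)).trans_eq (by simp)
      rw [norm_smul, LinearIsometryEquiv.norm_map, mul_comm]
      exact mul_le_mul_of_nonneg_left (f.norm_coe_le_norm g) (norm_nonneg _)

lemma orbitAverage_apply (D : UnitaryRep G H) (x : H) (f : C(G, ℝ)) :
    orbitAverage D x f = ∫ g, f g • D.toHom g x ∂probHaar G := rfl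

lemma toHom_orbitAverage (D : UnitaryRep G H) (x : H) (f : C(G, ℝ)) (h : G) :
    D.toHom h (orbitAverage D x f) = ∫ g, f (h⁻¹ * g) • D.toHom g x ∂probHaar G := by
  have hi : Integrable (fun g => f g • D.toHom g x) (probHaar G) :=
    (f.continuous.smul (D.continuous_apply x)).integrable_of_hasCompactSupport
      (HasCompactSupport.of_compactSpace _)
  rw [orbitAverage_apply, ← D.op_apply, ← ContinuousLinearMap.integral_comp_comm _ hi,
    ← integral_mul_left_eq_self (μ := probHaar G) (fun g => f (h⁻¹ * g) • D.toHom g x) h]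
  refine integral_congr_ae (Filter.Eventually.of_forall fun g => ?_)
  simp only
  rw [inv_mul_cancel_left, D.toHom_mul_apply, ← Complex.coe_smul, map_smul, Complex.coe_smul,
    D.op_apply]

/-- The function `g ↦ ⟪a, g b⟫`. -/
def entryFun {A : G →* Matrix (Fin 3) (Fin 3) ℝ} (hAc : Continuous A) (a b : Fin 3 → ℝ) : C(G, ℝ) :=
  ⟨fun g => a ⬝ᵥ (A g *ᵥ b), continuous_const.dotProduct (hAc.matrix_mulVec continuous_const)⟩

variable {A : G →* Matrix (Fin 3) (Fin 3) ℝ} (hAc : Continuous A)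

lemma entryFun_apply (a b : Fin 3 → ℝ) (g : G) : entryFun hAc a b g = a ⬝ᵥ (A g *ᵥ b) := rfl

/-- The products of matrix entries, as complex functions. -/
def entryMonoid : Submonoid C(G, ℂ) where
  carrier := Set.range fun L : Multiset ((Fin 3 → ℝ) × (Fin 3 → ℝ)) =>
    (⟨Complex.ofReal, Complex.continuous_ofReal⟩ : C(ℝ, ℂ)).comp
      (L.map fun p => entryFun hAc p.1 p.2).prod
  one_mem' := ⟨0, ContinuousMap.ext fun g => by simp⟩
  mul_mem' := by
    rintro _ _ ⟨L, rfl⟩ ⟨L', rfl⟩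
    exact ⟨L + L', ContinuousMap.ext fun g => by simp⟩

/-- The products of matrix entries are total, so some average of the orbit weighted by such a
product does not vanish. -/
lemma exists_orbitAverage_ne_zero (D : UnitaryRep G H) (hinj : Function.Injective A) {x : H}
    (hx : x ≠ 0) : ∃ L : Multiset ((Fin 3 → ℝ) × (Fin 3 → ℝ)),
      orbitAverage D x (L.map fun p => entryFun hAc p.1 p.2).prod ≠ 0 := by
  by_contra! h
  have h1 := eq_zero_of_integral_mul_eq_zero (μ := probHaar G) (entryMonoid hAc)
    (by
      rintro _ ⟨L, rfl⟩
      exact ⟨L, ContinuousMap.ext fun g => (Complex.conj_ofReal _).symm⟩)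
    (fun g g' hg => by
      by_contra! h2
      refine hg (hinj (Matrix.ext fun i j => ?_))
      have h3 := h2 _ ⟨{(Pi.single i 1, Pi.single j 1)}, rfl⟩
      have h4 : entryFun hAc (Pi.single i 1) (Pi.single j 1) g =
          entryFun hAc (Pi.single i 1) (Pi.single j 1) g' := by
        simpa using h3
      simpa [entryFun_apply] using h4)
    (g := fun g => inner ℂ x (D.toHom g x)) (continuous_const.inner (D.continuous_apply x))
    (by
      rintro _ ⟨L, rfl⟩
      set F := (L.map fun p => entryFun hAc p.1 p.2).prod with hF
      have h2 : inner ℂ x (orbitAverage D x F) = 0 := by rw [h, inner_zero_right]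
      have hi : Integrable (fun g => F g • D.toHom g x) (probHaar G) :=
        (F.continuous.smul (D.continuous_apply x)).integrable_of_hasCompactSupport
          (HasCompactSupport.of_compactSpace _)
      rw [orbitAverage_apply, ← integral_inner hi] at h2
      rw [← h2]
      refine integral_congr_ae (Filter.Eventually.of_forall fun g => ?_)
      simp only
      rw [← Complex.coe_smul, inner_smul_right]
      rfl)
  have h2 := congrFun h1 1
  simp only [D.toHom_one_apply, Pi.zero_apply] at h2
  exact hx (inner_self_eq_zero.1 h2)

/-- Among the products of matrix entries with nonvanishing weighted average there is one of the form
`∏ ⟪a, g b_i⟫`: otherwise polarization contradicts the choice of a nonvanishing product with the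
smallest number of factors. -/
lemma exists_orbitAverage_diagonal_ne_zero (D : UnitaryRep G H) (hinj : Function.Injective A)
    (horth : ∀ g a b, (A g *ᵥ a) ⬝ᵥ (A g *ᵥ b) = a ⬝ᵥ b) (hdet : ∀ g, (A g).det = 1) {x : H}
    (hx : x ≠ 0) : ∃ (N : ℕ) (a : Fin 3 → ℝ) (b : Fin N → Fin 3 → ℝ),
      orbitAverage D x (∏ i, entryFun hAc a (b i)) ≠ 0 := by
  classical
  obtain ⟨L, hL⟩ := exists_orbitAverage_ne_zero hAc D hinj hx
  have hex : ∃ N : ℕ, ∃ L : Multiset ((Fin 3 → ℝ) × (Fin 3 → ℝ)), L.card = N ∧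
      orbitAverage D x (L.map fun p => entryFun hAc p.1 p.2).prod ≠ 0 := ⟨_, L, rfl, hL⟩
  obtain ⟨L', hN, hL'⟩ := Nat.find_spec hex
  refine ⟨Nat.find hex, ?_⟩
  by_contra! hdiag
  have h1 := eq_zero_of_diagonal (orbitAverage D x) (entryFun hAc)
    (fun a a' b t => ContinuousMap.ext fun g => by
      rw [ContinuousMap.add_apply, ContinuousMap.smul_apply, entryFun_apply, entryFun_apply,
        entryFun_apply, add_dotProduct, smul_dotProduct])
    (fun a a' b b' => ContinuousMap.ext fun g => by
      rw [ContinuousMap.sub_apply, ContinuousMap.mul_apply, ContinuousMap.mul_apply]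
      simp only [entryFun_apply]
      rw [← mulVec_cross (horth g) (hdet g), cross_dot_cross]
      ring)
    (fun L hLN => by
      by_contra h
      exact Nat.find_min hex hLN ⟨L, rfl, h⟩) hdiag
  obtain ⟨l, rfl⟩ : ∃ l : List ((Fin 3 → ℝ) × (Fin 3 → ℝ)), L' = l := ⟨L'.toList, by simp⟩
  rw [Multiset.coe_card] at hN
  refine hL' ?_
  have h2 := h1 (fun i => (l[i.1]'(by omega)).1) (fun i => (l[i.1]'(by omega)).2)
  rw [Multiset.map_coe, Multiset.prod_coe, ← h2, ← Fin.prod_univ_fun_getElem]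
  congr 1
  exact Fintype.prod_equiv (finCongr hN) _ _ fun i => rfl

/-- A unitary representation of a compact group of rotations of space which is transitive on the
directions contains a nonzero vector invariant under the rotations about a given axis: the average
of an orbit weighted by `∏ ⟪a, g b_i⟫` is invariant under the rotations that fix `a`. -/
theorem exists_invariant_of_rotations [Nontrivial H] (D : UnitaryRep G H)
    (hAc : Continuous A) (hinj : Function.Injective A)
    (horth : ∀ g a b, (A g *ᵥ a) ⬝ᵥ (A g *ᵥ b) = a ⬝ᵥ b) (hdet : ∀ g, (A g).det = 1)
    (o : Fin 3 → ℝ) (htrans : ∀ a, ∃ h, ∃ t : ℝ, A h *ᵥ a = t • o) :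
    ∃ ξ : H, ξ ≠ 0 ∧ ∀ h, A h *ᵥ o = o → D.toHom h ξ = ξ := by
  obtain ⟨x, hx⟩ := exists_ne (0 : H)
  obtain ⟨N, a, b, hab⟩ := exists_orbitAverage_diagonal_ne_zero hAc D hinj horth hdet hx
  obtain ⟨h, t, hht⟩ := htrans a
  have key : ∀ g c, D.toHom g (orbitAverage D x (∏ i, entryFun hAc c (b i))) =
      orbitAverage D x (∏ i, entryFun hAc (A g *ᵥ c) (b i)) := fun g c => by
    rw [toHom_orbitAverage, orbitAverage_apply]
    refine integral_congr_ae (Filter.Eventually.of_forall fun g' => ?_)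
    simp only [ContinuousMap.prod_apply, entryFun_apply]
    congr 1
    refine Finset.prod_congr rfl fun i _ => ?_
    rw [← horth g, mulVec_mulVec, ← map_mul, mul_inv_cancel_left]
  refine ⟨orbitAverage D x (∏ i, entryFun hAc (t • o) (b i)), fun h0 => hab ?_, fun g hg => ?_⟩
  · rw [← hht, ← key] at h0
    exact (LinearIsometryEquiv.map_eq_zero_iff _).1 h0
  · rw [key, mulVec_smul, hg]

end Rotations

/-! ### Positive mass in four dimensions: the little group as a rotation group -/

section Massive

/-- The boost in the plane of `x⁰` and `x¹` with hyperbolic cosine `c` and hyperbolic sine `s`. -/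
def planeBoost (c s : ℝ) : Matrix (Fin (2 + 2)) (Fin (2 + 2)) ℝ :=
  !![c, s, 0, 0; s, c, 0, 0; 0, 0, 1, 0; 0, 0, 0, 1]

lemma planeBoost_mulVec (c s : ℝ) (x : Mink 2) :
    planeBoost c s *ᵥ x = ![c * x 0 + s * x 1, s * x 0 + c * x 1, x 2, x 3] := by
  funext i
  fin_cases i <;> simp [planeBoost, mulVec, dotProduct, Fin.sum_univ_succ]

lemma mdot_planeBoost {c s : ℝ} (h : c ^ 2 - s ^ 2 = 1) (x y : Mink 2) :
    mdot (planeBoost c s *ᵥ x) (planeBoost c s *ᵥ y) = mdot x y := by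
  rw [planeBoost_mulVec, planeBoost_mulVec, mdot_two, mdot_two]
  simp only [cons_val]
  linear_combination (x 0 * y 0 - x 1 * y 1) * h

lemma planeBoost_mul {c s : ℝ} (h : c ^ 2 - s ^ 2 = 1) :
    planeBoost c s * planeBoost c (-s) = 1 := by
  refine ext_of_mulVec_single fun j => ?_
  rw [← mulVec_mulVec, planeBoost_mulVec, planeBoost_mulVec, one_mulVec]
  funext i
  simp only [cons_val]
  fin_cases i
  · simp; linear_combination (Pi.single j 1 : Mink 2) 0 * h
  · simp; linear_combination (Pi.single j 1 : Mink 2) 1 * h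
  · simp
  · simp

variable {m : ℝ} {pbar : MassShell 2 m}

/-- The element of the little group in the rest frame of `pbar`. -/
def restMat (g : LittleGroup pbar) : Matrix (Fin (2 + 2)) (Fin (2 + 2)) ℝ :=
  planeBoost (pbar.1 0 / m) (-(pbar.1 1 / m)) * lmat g * planeBoost (pbar.1 0 / m) (pbar.1 1 / m)

/-- The rotation of space by which the little group acts in the rest frame of `pbar`. -/
def restRot (g : LittleGroup pbar) : Matrix (Fin 3) (Fin 3) ℝ :=
  (restMat g).submatrix Fin.succ Fin.succ

lemma rest_rel (hp : (j0Down 2).neg • pbar = pbar) (hm : 0 < m)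
    : (pbar.1 0 / m) ^ 2 - (pbar.1 1 / m) ^ 2 = 1 := by
  rw [div_pow, div_pow, ← sub_div, base_mul_self hp, div_self (pow_pos hm 2).ne']

lemma rest_rel_neg (hp : (j0Down 2).neg • pbar = pbar) (hm : 0 < m)
    : (pbar.1 0 / m) ^ 2 - (-(pbar.1 1 / m)) ^ 2 = 1 := by
  rw [neg_sq, rest_rel hp hm]

lemma planeBoost_neg_mul (hp : (j0Down 2).neg • pbar = pbar) (hm : 0 < m)
    : planeBoost (pbar.1 0 / m) (-(pbar.1 1 / m)) *
      planeBoost (pbar.1 0 / m) (pbar.1 1 / m) = 1 := by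
  have h := planeBoost_mul (rest_rel_neg hp hm)
  rwa [neg_neg] at h

lemma planeBoost_single (hp : (j0Down 2).neg • pbar = pbar)
    : planeBoost (pbar.1 0 / m) (pbar.1 1 / m) *ᵥ Pi.single 0 1 =
    m⁻¹ • pbar.1 := by
  rw [planeBoost_mulVec]
  funext i
  fin_cases i
  · simp [div_eq_inv_mul]
  · simp [div_eq_inv_mul]
  · simp [base_apply hp 2 (by decide) (by decide)]
  · simp [base_apply hp 3 (by decide) (by decide)]

lemma mdot_restMat (hp : (j0Down 2).neg • pbar = pbar) (hm : 0 < m)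
    (g : LittleGroup pbar) (x y : Mink 2) :
    mdot (restMat g *ᵥ x) (restMat g *ᵥ y) = mdot x y := by
  rw [restMat, ← mulVec_mulVec, ← mulVec_mulVec, ← mulVec_mulVec, ← mulVec_mulVec,
    mdot_planeBoost (rest_rel_neg hp hm), mdot_lmat, mdot_planeBoost (rest_rel hp hm)]

lemma restMat_mul (hp : (j0Down 2).neg • pbar = pbar) (hm : 0 < m)
    (g h : LittleGroup pbar) : restMat (g * h) = restMat g * restMat h := by
  have e := planeBoost_mul (rest_rel hp hm)
  rw [restMat, restMat, restMat, lmat_mul]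
  simp only [Matrix.mul_assoc]
  congr 2
  rw [← Matrix.mul_assoc (planeBoost _ (pbar.1 1 / m)), e, Matrix.one_mul]

lemma restMat_single (hp : (j0Down 2).neg • pbar = pbar) (hm : 0 < m) (g : LittleGroup pbar) :
    restMat g *ᵥ Pi.single 0 1 = (Pi.single 0 1 : Mink 2) := by
  rw [restMat, ← mulVec_mulVec, ← mulVec_mulVec, planeBoost_single hp, mulVec_smul,
    lmat_mulVec_base, ← planeBoost_single hp, mulVec_mulVec, planeBoost_neg_mul hp hm,
    one_mulVec]

lemma mdot_single_zero (x : Mink 2) : mdot (Pi.single 0 1) x = x 0 := by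
  simp [mdot_two]

lemma restMat_mulVec_zero (hp : (j0Down 2).neg • pbar = pbar) (hm : 0 < m)
    (g : LittleGroup pbar) (x : Mink 2) : (restMat g *ᵥ x) 0 = x 0 := by
  rw [← mdot_single_zero (restMat g *ᵥ x), ← restMat_single hp hm g, mdot_restMat hp hm,
    mdot_single_zero]

lemma restMat_apply_zero (hp : (j0Down 2).neg • pbar = pbar) (hm : 0 < m)
    (g : LittleGroup pbar) (j) :
    restMat g 0 j = (Pi.single 0 1 : Mink 2) j := by
  have h := restMat_mulVec_zero hp hm g (Pi.single j 1)
  rw [mulVec_single_one] at h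
  exact h.trans (Pi.single_comm _ _ _)

lemma restMat_zero_apply (hp : (j0Down 2).neg • pbar = pbar) (hm : 0 < m)
    (g : LittleGroup pbar) (i) :
    restMat g i 0 = (Pi.single 0 1 : Mink 2) i := by
  have h := congrFun (restMat_single hp hm g) i
  rwa [mulVec_single_one] at h

lemma restMat_cons (hp : (j0Down 2).neg • pbar = pbar) (hm : 0 < m)
    (g : LittleGroup pbar) (t : ℝ) (a : Fin 3 → ℝ) :
    restMat g *ᵥ vecCons t a = vecCons t (restRot g *ᵥ a) := by
  funext i
  refine Fin.cases ?_ (fun i => ?_) i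
  · exact restMat_mulVec_zero hp hm g _
  · rw [mulVec, dotProduct, Fin.sum_univ_succ, restMat_zero_apply hp hm]
    simp [restRot, mulVec, dotProduct]

lemma mdot_cons (t t' : ℝ) (a b : Fin 3 → ℝ) :
    mdot (vecCons t a : Mink 2) (vecCons t' b : Mink 2) = t * t' - a ⬝ᵥ b := by
  rw [mdot_two, vec3_dotProduct]
  change t * t' - a 0 * b 0 - a 1 * b 1 - a 2 * b 2 = _
  ring

lemma dotProduct_restRot (hp : (j0Down 2).neg • pbar = pbar) (hm : 0 < m)
    (g : LittleGroup pbar) (a b : Fin 3 → ℝ) :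
    (restRot g *ᵥ a) ⬝ᵥ (restRot g *ᵥ b) = a ⬝ᵥ b := by
  have h := mdot_restMat hp hm g (vecCons 0 a) (vecCons 0 b)
  rw [restMat_cons hp hm, restMat_cons hp hm, mdot_cons, mdot_cons] at h
  linarith

lemma det_restRot (hp : (j0Down 2).neg • pbar = pbar) (hm : 0 < m)
    (g : LittleGroup pbar) : (restRot g).det = 1 := by
  have h1 : (restMat g).det = 1 := by
    rw [restMat, det_mul, det_mul, det_lmat, mul_one, ← det_mul, planeBoost_neg_mul hp hm, det_one]
  rw [det_succ_row_zero, Finset.sum_eq_single_of_mem 0 (Finset.mem_univ _)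
    (fun j _ hj => by rw [restMat_apply_zero hp hm, Pi.single_eq_of_ne hj]; ring),
    restMat_apply_zero hp hm] at h1
  simpa [restRot, Fin.succAbove_zero] using h1

lemma lmat_eq_restMat (hp : (j0Down 2).neg • pbar = pbar) (hm : 0 < m) (g : LittleGroup pbar) :
    lmat g = planeBoost (pbar.1 0 / m) (pbar.1 1 / m) * restMat g *
      planeBoost (pbar.1 0 / m) (-(pbar.1 1 / m)) := by
  have e := planeBoost_mul (rest_rel hp hm)
  rw [restMat, ← Matrix.mul_assoc, ← Matrix.mul_assoc, e, Matrix.one_mul, Matrix.mul_assoc, e,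
    Matrix.mul_one]

/-- The action of the little group by rotations of the rest space of `pbar`. -/
def restRotHom (hp : (j0Down 2).neg • pbar = pbar) (hm : 0 < m) :
    LittleGroup pbar →* Matrix (Fin 3) (Fin 3) ℝ where
  toFun := restRot
  map_one' := by
    rw [restRot, restMat, lmat_one, Matrix.mul_one, planeBoost_neg_mul hp hm,
      submatrix_one _ (Fin.succ_injective _)]
  map_mul' g h := by
    refine ext_of_mulVec_single fun j => ?_
    have h1 := restMat_cons hp hm (g * h) 0 (Pi.single j 1)
    rw [restMat_mul hp hm, ← mulVec_mulVec, restMat_cons hp hm, restMat_cons hp hm] at h1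
    rw [← mulVec_mulVec]
    exact (vecCons_inj.1 h1).2.symm

lemma continuous_restRot : Continuous (restRot : LittleGroup pbar → _) :=
  ((continuous_const.matrix_mul continuous_lmat).matrix_mul continuous_const).matrix_submatrix _ _

lemma injective_restRot (hp : (j0Down 2).neg • pbar = pbar) (hm : 0 < m)
    : Function.Injective (restRot : LittleGroup pbar → _) := fun g h hgh => by
  refine lmat_ext ?_
  rw [lmat_eq_restMat hp hm g, lmat_eq_restMat hp hm h]
  congr 2
  refine ext_of_mulVec_single fun j => ?_
  have e : (Pi.single j 1 : Mink 2) = vecCons (vecHead (Pi.single j 1)) (vecTail (Pi.single j 1)) :=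
    (cons_head_tail _).symm
  rw [e, restMat_cons hp hm, restMat_cons hp hm, hgh]

lemma abs_restMat_le (hp : (j0Down 2).neg • pbar = pbar) (hm : 0 < m)
    (g : LittleGroup pbar) (i j) : restMat g i j ∈ Set.Icc (-1 : ℝ) 1 := by
  have h01 : ∀ i, (Pi.single 0 1 : Mink 2) i ∈ Set.Icc (-1 : ℝ) 1 := fun i => by
    rw [Pi.single_apply]; split_ifs <;> norm_num
  refine Fin.cases ?_ (fun i => ?_) i
  · rw [restMat_apply_zero hp hm]; exact h01 j
  refine Fin.cases ?_ (fun j => ?_) j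
  · rw [restMat_zero_apply hp hm]; exact h01 _
  have h := dotProduct_restRot hp hm g (Pi.single j 1) (Pi.single j 1)
  rw [single_one_dotProduct, Pi.single_eq_same, dotProduct] at h
  have h1 := Finset.single_le_sum (f := fun i => (restRot g *ᵥ Pi.single j 1) i *
    (restRot g *ᵥ Pi.single j 1) i) (fun i _ => mul_self_nonneg _) (Finset.mem_univ i)
  rw [h] at h1
  simp only [mulVec_single_one] at h1
  exact abs_le.1 (abs_le_one_iff_mul_self_le_one.2 h1)

/-- The matrices of the little group form a closed set, and they are bounded because those in the
rest frame have entries in `[-1, 1]`. -/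
lemma compactSpace_littleGroup (hp : (j0Down 2).neg • pbar = pbar) (hm : 0 < m)
    : CompactSpace (LittleGroup pbar) := by
  refine ⟨isInducing_lmat.isCompact_iff.2 ?_⟩
  rw [Set.image_univ]
  have hr : Set.range (lmat : LittleGroup pbar → _) =
      {M | (∀ x y, mdot (M *ᵥ x) (M *ᵥ y) = mdot x y) ∧ M.det = 1 ∧ M *ᵥ pbar.1 = pbar.1} := by
    ext M
    exact ⟨by rintro ⟨g, rfl⟩; exact ⟨mdot_lmat g, det_lmat g, lmat_mulVec_base g⟩,
      fun h => ⟨LittleGroup.ofMat M h.1 h.2.1 h.2.2, rfl⟩⟩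
  have hv : ∀ x : Mink 2, Continuous fun M : Matrix (Fin (2 + 2)) (Fin (2 + 2)) ℝ => M *ᵥ x :=
    fun x => continuous_id.matrix_mulVec continuous_const
  have hcl : IsClosed (Set.range (lmat : LittleGroup pbar → _)) := by
    rw [hr]
    have h : {M : Matrix (Fin (2 + 2)) (Fin (2 + 2)) ℝ |
        ∀ x y, mdot (M *ᵥ x) (M *ᵥ y) = mdot x y} =
        ⋂ x, ⋂ y, {M | mdot (M *ᵥ x) (M *ᵥ y) = mdot x y} := by
      ext M
      simp
    have h1 : IsClosed {M : Matrix (Fin (2 + 2)) (Fin (2 + 2)) ℝ |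
        ∀ x y, mdot (M *ᵥ x) (M *ᵥ y) = mdot x y} := by
      rw [h]
      exact isClosed_iInter fun x => isClosed_iInter fun y =>
        isClosed_eq (continuous_mdot.comp ((hv x).prodMk (hv y))) continuous_const
    exact h1.inter ((isClosed_eq continuous_id.matrix_det continuous_const).inter
      (isClosed_eq (hv _) continuous_const))
  have hK : IsCompact (Set.univ.pi fun _ => Set.univ.pi fun _ => Set.Icc (-1) 1 :
      Set (Fin (2 + 2) → Fin (2 + 2) → ℝ)) :=
    isCompact_univ_pi fun _ => isCompact_univ_pi fun _ => isCompact_Icc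
  have hf : Continuous fun M : Matrix (Fin (2 + 2)) (Fin (2 + 2)) ℝ =>
      planeBoost (pbar.1 0 / m) (pbar.1 1 / m) * M * planeBoost (pbar.1 0 / m) (-(pbar.1 1 / m)) :=
    (continuous_const.matrix_mul continuous_id).matrix_mul continuous_const
  refine (hK.image hf).of_isClosed_subset hcl ?_
  rintro _ ⟨g, rfl⟩
  exact ⟨restMat g, fun i _ j _ => abs_restMat_le hp hm g i j, (lmat_eq_restMat hp hm g).symm⟩

/-- The direction of `origin pbar` in the rest frame of `pbar`. -/
def restOrigin (pbar : MassShell 2 m) : Fin 3 → ℝ :=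
  vecTail (planeBoost (pbar.1 0 / m) (-(pbar.1 1 / m)) *ᵥ origin pbar)

lemma vecHead_planeBoost (hp : (j0Down 2).neg • pbar = pbar) (hm : 0 < m)
    {q : Mink 2} (hq : q ∈ cycle pbar) :
    (planeBoost (pbar.1 0 / m) (-(pbar.1 1 / m)) *ᵥ q) 0 = m⁻¹ := by
  rw [← mdot_single_zero (_ *ᵥ q), ← mdot_planeBoost (rest_rel hp hm), planeBoost_single hp,
    mulVec_mulVec, planeBoost_mul (rest_rel hp hm), one_mulVec, mdot_smul_left, hq.2.2, mul_one]

lemma planeBoost_origin (hp : (j0Down 2).neg • pbar = pbar) (hm : 0 < m)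
    : planeBoost (pbar.1 0 / m) (-(pbar.1 1 / m)) *ᵥ origin pbar =
    vecCons m⁻¹ (restOrigin pbar) := by
  rw [← vecHead_planeBoost hp hm (origin_mem_cycle pbar)]
  exact (cons_head_tail _).symm

lemma restRot_restOrigin (hp : (j0Down 2).neg • pbar = pbar) (hm : 0 < m)
    {k : LittleGroup pbar} (hk : lmat k *ᵥ origin pbar = origin pbar) :
    restRot k *ᵥ restOrigin pbar = restOrigin pbar := by
  have h1 := restMat_cons hp hm k m⁻¹ (restOrigin pbar)
  rw [← planeBoost_origin hp hm, restMat, ← mulVec_mulVec, ← mulVec_mulVec, mulVec_mulVec _ _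
    (planeBoost _ (-(pbar.1 1 / m))), planeBoost_mul (rest_rel hp hm), one_mulVec, hk,
    planeBoost_origin hp hm] at h1
  exact (vecCons_inj.1 h1).2.symm

/-- The little group rotates every vector of the rest space into the axis through `origin pbar`:
the directions of the rest space are those of the points of the cycle. -/
lemma exists_restRot_eq_smul (hp : (j0Down 2).neg • pbar = pbar) (hm : 0 < m) (a : Fin 3 → ℝ) :
    ∃ (h : LittleGroup pbar) (t : ℝ), restRot h *ᵥ a = t • restOrigin pbar := by
  by_cases ha : a = 0
  · exact ⟨1, 0, by rw [ha, mulVec_zero, zero_smul]⟩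
  set s := Real.sqrt (a ⬝ᵥ a) with hs
  have hpos : 0 < a ⬝ᵥ a := (Finset.sum_nonneg fun i _ => mul_self_nonneg (a i)).lt_of_ne'
    fun h => ha (dotProduct_self_eq_zero.1 h)
  have hs0 : 0 < s := Real.sqrt_pos.2 hpos
  have hss : s * s = a ⬝ᵥ a := Real.mul_self_sqrt hpos.le
  set x : Mink 2 := vecCons m⁻¹ ((m * s)⁻¹ • a) with hx
  set q := planeBoost (pbar.1 0 / m) (pbar.1 1 / m) *ᵥ x with hq
  have hqq : mdot q q = 0 := by
    rw [hq, mdot_planeBoost (rest_rel hp hm), hx, mdot_cons, smul_dotProduct, dotProduct_smul,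
      ← hss, smul_eq_mul, smul_eq_mul]
    field_simp
    ring
  have hpq : mdot pbar.1 q = 1 := by
    have h1 : mdot (m⁻¹ • pbar.1) q = m⁻¹ := by
      rw [← planeBoost_single hp, hq, mdot_planeBoost (rest_rel hp hm), mdot_single_zero]
      rfl
    rw [mdot_smul_left] at h1
    exact mul_left_cancel₀ (inv_ne_zero hm.ne') (h1.trans (mul_one _).symm)
  have hq0 : 0 < q 0 := by
    by_contra! h0
    have h1 : 0 ≤ mdot pbar.1 (-q) := mdot_nonneg pbar.forwardCausal.1 pbar.forwardCausal.2.le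
      (by rw [mdot_neg_right, mdot_comm, mdot_neg_right, hqq]; norm_num) (by simpa using h0)
    rw [mdot_neg_right, hpq] at h1
    linarith
  have hc : q ∈ cycle pbar := ⟨hqq, hq0, hpq⟩
  refine ⟨(sec hp q)⁻¹, m * s, ?_⟩
  have h1 : restMat (sec hp q)⁻¹ *ᵥ x = vecCons m⁻¹ (restOrigin pbar) := by
    rw [restMat, ← mulVec_mulVec, ← mulVec_mulVec, ← hq]
    nth_rewrite 2 [← sec_mulVec_origin hp hc]
    rw [lmat_inv_mulVec_mulVec, planeBoost_origin hp hm]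
  rw [hx, restMat_cons hp hm, mulVec_smul] at h1
  rw [← (vecCons_inj.1 h1).2, smul_inv_smul₀ (mul_pos hm hs0).ne']

/-- For positive mass in four dimensions every representation of the little group contains a
nonzero vector that is invariant under the stabilizer of `origin pbar`. -/
lemma exists_fixedVector_of_pos (hp : (j0Down 2).neg • pbar = pbar) (hm : 0 < m)
    {H : Type*} [NormedAddCommGroup H] [InnerProductSpace ℂ H]
    [CompleteSpace H] [Nontrivial H] (D : UnitaryRep (LittleGroup pbar) H) :
    ∃ ξ : H, ξ ≠ 0 ∧ FixedVector D ξ := by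
  have := compactSpace_littleGroup hp hm
  have : SecondCountableTopology (Matrix (Fin (2 + 2)) (Fin (2 + 2)) ℝ) :=
    inferInstanceAs (SecondCountableTopology (Fin (2 + 2) → Fin (2 + 2) → ℝ))
  have : SecondCountableTopology (LittleGroup pbar) :=
    (isInducing_lmat (pbar := pbar)).secondCountableTopology
  let _ : MeasurableSpace (LittleGroup pbar) := borel _
  have : BorelSpace (LittleGroup pbar) := ⟨rfl⟩
  obtain ⟨ξ, hξ, h⟩ := exists_invariant_of_rotations (A := restRotHom hp hm) D continuous_restRot
    (injective_restRot hp hm) (dotProduct_restRot hp hm) (det_restRot hp hm) (restOrigin pbar)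
    (exists_restRot_eq_smul hp hm)
  exact ⟨ξ, hξ, fun k hk => h k (restRot_restOrigin hp hm hk)⟩

end Massive

/-! ### Existence of invariant vectors and the direct integral -/

section Final

variable {n : ℕ} [NeZero n] {m : ℝ} {pbar : MassShell n m}
  {H : Type*} [NormedAddCommGroup H] [InnerProductSpace ℂ H] [CompleteSpace H]
  {D : UnitaryRep (LittleGroup pbar) H}

/-- An irreducible representation of the little group contains a nonzero vector that is invariant
under the stabilizer of `origin pbar`. In three dimensions this stabilizer is trivial, in four
dimensions it consists of the rotations in the transverse plane. -/
theorem exists_fixedVector (hn : n = 1 ∨ n = 2) (hm : 0 ≤ m)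
    (hp : (j0Down n).neg • pbar = pbar)
    (hirr : D.Irreducible) (hfaithful : m = 0 → n = 2 → D.Faithful) :
    ∃ ξ : H, ξ ≠ 0 ∧ FixedVector D ξ := by
  have := hirr.1
  obtain ⟨x, hx⟩ := exists_ne (0 : H)
  rcases hn with rfl | rfl
  · exact ⟨x, hx, fixedVector_one hp D x⟩
  rcases hm.lt_or_eq with hm | rfl
  · exact exists_fixedVector_of_pos hp hm D
  · exact (exists_isDirectIntegralFibre_two hp hirr (hfaithful rfl rfl)).1

/-- For zero mass every nonzero invariant vector has a multiple for which `T` is the fibre at `D` of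
a direct integral decomposition of the principal series. -/
theorem FixedVector.isDirectIntegralFibre (hn : n = 1 ∨ n = 2) (hm : m = 0)
    (hp : (j0Down n).neg • pbar = pbar)
    (hirr : D.Irreducible) (hfaithful : n = 2 → D.Faithful) {ξ : H} (hξ : ξ ≠ 0)
    (hK : FixedVector D ξ) :
    ∃ c : ℂ, c ≠ 0 ∧ IsDirectIntegralFibre D (orbitT hp D (c • ξ)) := by
  subst hm
  have h0 : ((‖ξ‖⁻¹ : ℝ) : ℂ) ≠ 0 := Complex.ofReal_ne_zero.2 (inv_ne_zero (norm_ne_zero_iff.2 hξ))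
  have h1 : ‖((‖ξ‖⁻¹ : ℝ) : ℂ) • ξ‖ = 1 := by
    rw [norm_smul, Complex.norm_real, norm_inv, norm_norm, inv_mul_cancel₀ (norm_ne_zero_iff.2 hξ)]
  obtain ⟨c, hc, h⟩ : ∃ c : ℂ, c ≠ 0 ∧
      IsDirectIntegralFibre D (orbitT hp D (c • ((‖ξ‖⁻¹ : ℝ) : ℂ) • ξ)) := by
    rcases hn with rfl | rfl
    · exact exists_isDirectIntegralFibre_one hp hirr h1
    · exact (exists_isDirectIntegralFibre_two hp hirr (hfaithful rfl)).2 _ h1 (hK.smul _)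
  exact ⟨c * ((‖ξ‖⁻¹ : ℝ) : ℂ), mul_ne_zero hc h0, by rwa [mul_smul]⟩

end Final

end Wigner

end

theorem mainTheorem3 {n : ℕ} [NeZero n] (hn : n = 1 ∨ n = 2) {m : ℝ} (hm : 0 ≤ m)
    (pbar : MassShell n m) (hpbar : (j0Down n).neg • pbar = pbar)
    {H : Type*} [NormedAddCommGroup H] [InnerProductSpace ℂ H] [CompleteSpace H]
    (D : UnitaryRep (LittleGroup pbar) H) (hirr : D.Irreducible)
    (hfaithful : m = 0 → n = 2 → D.Faithful) :
    ∃ (T : HLor pbar →ₗ.[ℂ] H) (J : H ≃ₗᵢ⋆[ℂ] H),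
      -- the densely defined map `T` with dense range
      Dense (T.domain : Set (HLor pbar)) ∧
      DenseRange T ∧
      -- `T` intertwines the restriction of `U^α` to the little group with `D`
      (∀ (α : PrincipalParam n) (g : LittleGroup pbar) (ψ : T.domain),
        ∃ h : ULor α g.1 ψ.1 ∈ T.domain, D.toHom g (T ψ) = T ⟨ULor α g.1 ψ.1, h⟩) ∧
      (0 < m → IsSubrepProjection D T) ∧
      (m = 0 → IsDirectIntegralFibre D T) ∧
      -- `J = D(j₀)` extends `D`, and `T` intertwines it with `U^α(j₀)`
      (∀ x, J (J x) = x) ∧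
      (∀ (g : LittleGroup pbar) (x : H),
        J (D.toHom g (J x)) = D.toHom (conjJ0Little hpbar g) x) ∧
      (∀ (α : PrincipalParam n) (ψ : T.domain),
        ∃ h : ULorDown α (j0Down n) ψ.1 ∈ T.domain,
          J (T ψ) = T ⟨ULorDown α (j0Down n) ψ.1, h⟩) ∧
      -- the intertwiner `R^α`
      ∀ (A : BoostSection pbar) (α : PrincipalParam n),
        Dense (Submodule.span ℂ {Φ : L2Shell n m (HLor pbar) |
          Φ ∈ (intertwiner T α A).domain ∧
            ∃ (φ : L2Shell n m ℂ) (ϕ : HLor pbar), Φ = tensor φ ϕ} :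
              Set (L2Shell n m (HLor pbar))) ∧
        (∀ (a : Mink n) (L : restrictedLorentz n) (Φ : (intertwiner T α A).domain),
          ∃ h : U0tensor α a L Φ.1 ∈ (intertwiner T α A).domain,
            Uirr D A a L (intertwiner T α A Φ) = intertwiner T α A ⟨U0tensor α a L Φ.1, h⟩) ∧
        (∀ (j : LorentzDown n) (Φ : (intertwiner T α A).domain),
          ∃ h : U0tensorDown α j Φ.1 ∈ (intertwiner T α.conj A).domain,
            UirrDown D J A j (intertwiner T α A Φ) =
              intertwiner T α.conj A ⟨U0tensorDown α j Φ.1, h⟩) := by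
  -- `T` is built from a multiple of an invariant vector, normalised for the decomposition at hand.
  obtain ⟨ξ₀, hξ₀, hK₀⟩ := exists_fixedVector hn hm hpbar hirr hfaithful
  obtain ⟨c, hc, hsub, hfib⟩ : ∃ c : ℂ, c ≠ 0 ∧
      (0 < m → IsSubrepProjection D (orbitT hpbar D (c • ξ₀))) ∧
      (m = 0 → IsDirectIntegralFibre D (orbitT hpbar D (c • ξ₀))) := by
    rcases hm.lt_or_eq with h | h
    · obtain ⟨c, hc, hs⟩ := hK₀.isSubrepProjection hpbar h hirr hξ₀
      exact ⟨c, hc, fun _ => hs, fun h' => absurd h' h.ne'⟩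
    · obtain ⟨c, hc, hs⟩ :=
        FixedVector.isDirectIntegralFibre hn h.symm hpbar hirr (hfaithful h.symm) hξ₀ hK₀
      exact ⟨c, hc, fun h' => absurd h h'.ne, fun _ => hs⟩
  have hK := hK₀.smul c
  have hξ : c • ξ₀ ≠ 0 := smul_ne_zero hc hξ₀
  obtain ⟨J, hJJ, hJD, hJo⟩ := hK.exists_conjugation hpbar hn hirr hξ
  have hT := fun α g ψ => hK.orbitT_ULor hpbar α g ψ
  have hTJ := fun α ψ => orbitT_ULorDown hpbar hJo α ψ
  exact ⟨orbitT hpbar D (c • ξ₀), J, dense_integrableDomain, hK.denseRange_orbitT hpbar hirr hξ,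
    hT, hsub, hfib, hJJ, hJD, hTJ, fun A α => ⟨dense_tensor_intertwiner hpbar D (c • ξ₀) A α,
      fun a L Φ => intertwiner_U0tensor hT a L Φ,
      fun j Φ => intertwiner_U0tensorDown hT hTJ j Φ⟩⟩
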